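/- Let $R$ be a commutative ring with identity and a fixed invertible element $q^{1/2}$; put $\overline{q}=q^{-1}$ and $\alpha=q+\overline{q}$. Let $\Sigma=\Sigma_{0,5}$ be the $5$-punctured sphere, viewed as the oriented plane with four punctures $\mathsf{p}_1,\mathsf{p}_2,\mathsf{p}_3,\mathsf{p}_4$ placed in convex position, in this clockwise order (the fifth puncture is at infinity). Let $\mathcal{S}_4=\mathcal{S}(\Sigma_{0,5};R)$ be its Kauffman bracket skein algebra: the $R$-module generated by isotopy classes of framed links (possibly empty) in $\Sigma\times[0,1]$, modulo the relations $L=q^{1/2}L_A+q^{-1/2}L_B$ and $L\sqcup\bigcirc=-\alpha L$. Here $L,L_A,L_B$ are identical outside a ball in which $L$ is a crossing with vertical framing and $L_A$ (resp. $L_B$) is the smoothing that joins the two regions swept by the over-strand when it is turned counterclockwise (resp. clockwise) onto the under-strand, and $\bigcirc$ is a trivial loop in a ball disjoint from $L$. The product $L_1L_2$ is defined by stacking $L_1$ over $L_2$. For $\emptyset\neq\{i_1,\dots,i_r\}\subseteq\{1,2,3,4\}$ let $t_{i_1\cdots i_r}\in\mathcal{S}_4$ be the class of a convex simple closed curve,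 with vertical framing, that encircles exactly the punctures $\mathsf{p}_{i_1},\dots,\mathsf{p}_{i_r}$ (the order of the indices is immaterial), and put $t_0=t_{1234}$. Then in $\mathcal{S}_4$ we have \begin{align*} qt_{23}t_{12}-\overline{q}t_{12}t_{23}&=(q^2-\overline{q}^2)t_{13}+(q-\overline{q})(t_1t_3+t_2t_{123}),\\ t_{24}t_{13}-t_{13}t_{24}&=(\overline{q}^2-q^2)(t_{12}t_{34}-t_{14}t_{23})+(\overline{q}-q)(t_3t_4t_{12}-t_1t_4t_{23}+t_1t_2t_{34}-t_2t_3t_{14}),\\ \overline{q}t_{234}t_{14}-qt_{14}t_{234}&=(\overline{q}^2-q^2)t_{123}+(\overline{q}-q)(t_4t_0+t_1t_{23}),\\ qt_{124}t_{34}-\overline{q}t_{34}t_{124}&=(q^2-\overline{q}^2)t_{123}+(q-\overline{q})(t_4t_0+t_3t_{12}),\\ t_{134}t_{24}-t_{24}t_{134}&=(q-\overline{q})(\overline{q}t_{34}t_{124}-qt_{14}t_{234}+qt_1t_{23}-\overline{q}t_3t_{12})+(q-\overline{q})^2(t_4t_0+\alpha t_{123}). \end{align*} Moreover, the identities obtained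 from these five by acting on the indices $1,2,3,4$ with the cyclic permutations $(1234)^k$, $k=1,2,3$ (with $t_0$ fixed), hold in $\mathcal{S}_4$ as well; those obtained from the first two identities (resp. the last three) are the commuting relations of type $[2,2]$ (resp. $[2,3]$). -/

import Mathlib

open scoped ContDiff Real

namespace Skein

/-! ### Framed links in `X × [0,1]`, for a planar surface `X ⊆ ℂ` -/

/-- `c i`, `i : ι`, are smooth, regular, simple and pairwise disjoint closed curves in `X × [0,1]`
(of period `2π`), and `v i` is a smooth framing along `c i`: a vector field that is nowhere tangent
to the curve. -/
structure IsFramedLink (X : Set ℂ) {ι : Type} (c v : ι → ℝ → ℂ × ℝ) : Prop where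
  smooth_curve : ∀ i, ContDiff ℝ ∞ (c i)
  smooth_framing : ∀ i, ContDiff ℝ ∞ (v i)
  periodic_curve : ∀ i, Function.Periodic (c i) (2 * π)
  periodic_framing : ∀ i, Function.Periodic (v i) (2 * π)
  mem : ∀ i θ, c i θ ∈ X ×ˢ Set.Icc (0 : ℝ) 1
  simple : ∀ i j θ φ, c i θ = c j φ → i = j ∧ ∃ m : ℤ, φ = θ + m * (2 * π)
  independent : ∀ i θ, LinearIndependent ℝ ![deriv (c i) θ, v i θ]

/-- The set of pairs (point, framing vector) of a parametrized framed link. -/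
def trace {ι : Type} (c v : ι → ℝ → ℂ × ℝ) : Set ((ℂ × ℝ) × (ℂ × ℝ)) :=
  {x | ∃ i θ, x = (c i θ, v i θ)}

/-- A framed link (unoriented, unparametrized, possibly empty) in `X × [0,1]`, as the set of its
points together with their framing vectors. -/
@[ext]
structure FramedLink (X : Set ℂ) where
  carrier : Set ((ℂ × ℝ) × (ℂ × ℝ))
  exists_param : ∃ (ι : Type) (_ : Finite ι) (c v : ι → ℝ → ℂ × ℝ),
    IsFramedLink X c v ∧ trace c v = carrier

/-- Smooth isotopy of framed links in `X × [0,1]`. -/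
def Isotopic {X : Set ℂ} (L L' : FramedLink X) : Prop :=
  ∃ (ι : Type) (_ : Finite ι) (C V : ℝ → ι → ℝ → ℂ × ℝ),
    (∀ i, ContDiff ℝ ∞ fun p : ℝ × ℝ => C p.1 i p.2) ∧
    (∀ i, ContDiff ℝ ∞ fun p : ℝ × ℝ => V p.1 i p.2) ∧
    (∀ s ∈ Set.Icc (0 : ℝ) 1, IsFramedLink X (C s) (V s)) ∧
    trace (C 0) (V 0) = L.carrier ∧ trace (C 1) (V 1) = L'.carrier

/-! ### Stacking -/

/-- The vertical affine map `(z, h) ↦ (z, a h + b)`. -/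
def vmap (a b : ℝ) (p : ℂ × ℝ) : ℂ × ℝ := (p.1, a * p.2 + b)

/-- The vertical affine map `(z, h) ↦ (z, a h + b)`, acting on framed points. -/
def fmap (a b : ℝ) (x : (ℂ × ℝ) × (ℂ × ℝ)) : (ℂ × ℝ) × (ℂ × ℝ) :=
  (vmap a b x.1, vmap a 0 x.2)

theorem fmap_one_zero : fmap 1 0 = id := by
  funext x
  simp [fmap, vmap]

theorem trace_fmap {ι : Type} (c v : ι → ℝ → ℂ × ℝ) (a b : ℝ) :
    trace (fun i θ => vmap a b (c i θ)) (fun i θ => vmap a 0 (v i θ)) = fmap a b '' trace c v := by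
  ext x
  constructor
  · rintro ⟨i, θ, rfl⟩
    exact ⟨_, ⟨i, θ, rfl⟩, rfl⟩
  · rintro ⟨_, ⟨i, θ, rfl⟩, rfl⟩
    exact ⟨i, θ, rfl⟩

theorem trace_sum {ι κ : Type} (c v : ι → ℝ → ℂ × ℝ) (c' v' : κ → ℝ → ℂ × ℝ) :
    trace (Sum.elim c c') (Sum.elim v v') = trace c v ∪ trace c' v' := by
  ext x
  simp [trace]

theorem contDiff_vmap {E : Type*} [NormedAddCommGroup E] [NormedSpace ℝ E] {a b : E → ℝ}
    {f : E → ℂ × ℝ} (ha : ContDiff ℝ ∞ a) (hb : ContDiff ℝ ∞ b) (hf : ContDiff ℝ ∞ f) :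
    ContDiff ℝ ∞ fun x => vmap (a x) (b x) (f x) := by
  unfold vmap
  exact (contDiff_fst.comp hf).prodMk ((ha.mul (contDiff_snd.comp hf)).add hb)

theorem IsFramedLink.vmap {X : Set ℂ} {ι : Type} {c v : ι → ℝ → ℂ × ℝ} (h : IsFramedLink X c v)
    {a b : ℝ} (ha : 0 < a) (hb : 0 ≤ b) (hab : a + b ≤ 1) :
    IsFramedLink X (fun i θ => vmap a b (c i θ)) (fun i θ => Skein.vmap a 0 (v i θ)) where
  smooth_curve i := contDiff_vmap contDiff_const contDiff_const (h.smooth_curve i)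
  smooth_framing i := contDiff_vmap contDiff_const contDiff_const (h.smooth_framing i)
  periodic_curve i θ := by simp only [h.periodic_curve i θ]
  periodic_framing i θ := by simp only [h.periodic_framing i θ]
  mem i θ := by
    obtain ⟨h1, h2, h3⟩ := h.mem i θ
    refine ⟨h1, ?_, ?_⟩ <;> simp only [Skein.vmap] <;> nlinarith
  simple i j θ φ e := by
    apply h.simple
    simp only [Skein.vmap, Prod.mk.injEq] at e
    refine Prod.ext e.1 ?_
    have := e.2
    have h2 : a * (c i θ).2 = a * (c j φ).2 := by linarith
    exact mul_left_cancel₀ ha.ne' h2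
  independent i θ := by
    have hd : HasDerivAt (c i) (deriv (c i) θ) θ :=
      ((h.smooth_curve i).differentiable (by simp)).differentiableAt.hasDerivAt
    have hd' : HasDerivAt (fun θ => Skein.vmap a b (c i θ)) (Skein.vmap a 0 (deriv (c i) θ)) θ := by
      unfold Skein.vmap
      have h1 : HasDerivAt (fun θ => (c i θ).1) (deriv (c i) θ).1 θ := hd.fst
      have h2 : HasDerivAt (fun θ => (c i θ).2) (deriv (c i) θ).2 θ := hd.snd
      rw [add_zero]
      exact h1.prodMk ((h2.const_mul a).add_const b)
    rw [hd'.deriv]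
    have hl := h.independent i θ
    rw [LinearIndependent.pair_iff] at hl ⊢
    intro x y hxy
    apply hl
    simp only [Skein.vmap, Prod.smul_mk, Prod.mk_add_mk, Prod.mk_eq_zero, smul_eq_mul] at hxy
    refine Prod.ext hxy.1 ?_
    have h2 : a * (x * (deriv (c i) θ).2 + y * (v i θ).2) = 0 := by linarith [hxy.2]
    simpa using (mul_eq_zero.1 h2).resolve_left ha.ne'

theorem IsFramedLink.sum {X : Set ℂ} {ι κ : Type} {c v : ι → ℝ → ℂ × ℝ} {c' v' : κ → ℝ → ℂ × ℝ}
    (h : IsFramedLink X c v) (h' : IsFramedLink X c' v')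
    (hd : ∀ i j θ φ, (c' j φ).2 < (c i θ).2) :
    IsFramedLink X (Sum.elim c c') (Sum.elim v v') where
  smooth_curve := by rintro (i | i); exacts [h.smooth_curve i, h'.smooth_curve i]
  smooth_framing := by rintro (i | i); exacts [h.smooth_framing i, h'.smooth_framing i]
  periodic_curve := by rintro (i | i); exacts [h.periodic_curve i, h'.periodic_curve i]
  periodic_framing := by rintro (i | i); exacts [h.periodic_framing i, h'.periodic_framing i]
  mem := by rintro (i | i); exacts [h.mem i, h'.mem i]
  simple := by
    rintro (i | i) (j | j) θ φ e
    · obtain ⟨rfl, h⟩ := h.simple i j θ φ e; exact ⟨rfl, h⟩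
    · exact absurd (congrArg Prod.snd e) (hd i j θ φ).ne'
    · exact absurd (congrArg Prod.snd e) (hd j i φ θ).ne
    · obtain ⟨rfl, h⟩ := h'.simple i j θ φ e; exact ⟨rfl, h⟩
  independent := by rintro (i | i); exacts [h.independent i, h'.independent i]

/-- The empty link. -/
def FramedLink.empty (X : Set ℂ) : FramedLink X where
  carrier := ∅
  exists_param := ⟨Empty, inferInstance, Empty.elim, Empty.elim,
    ⟨nofun, nofun, nofun, nofun, nofun, nofun, nofun⟩, by ext x; simp [trace]⟩

/-- `L` stacked over `L'`: `L` is squeezed into the upper third of `X × [0,1]` and `L'` into the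
lower third. -/
def FramedLink.stack {X : Set ℂ} (L L' : FramedLink X) : FramedLink X where
  carrier := fmap (1 / 3) (2 / 3) '' L.carrier ∪ fmap (1 / 3) 0 '' L'.carrier
  exists_param := by
    obtain ⟨ι, _, c, v, h, e⟩ := L.exists_param
    obtain ⟨κ, _, c', v', h', e'⟩ := L'.exists_param
    refine ⟨ι ⊕ κ, inferInstance, _, _,
      (h.vmap (a := 1 / 3) (b := 2 / 3) (by norm_num) (by norm_num) (by norm_num)).sum
      (h'.vmap (a := 1 / 3) (b := 0) (by norm_num) (by norm_num) (by norm_num)) ?_, ?_⟩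
    · intro i j θ φ
      have h1 := (h.mem i θ).2.1
      have h2 := (h'.mem j φ).2.2
      simp only [Skein.vmap]
      linarith
    · rw [trace_sum, trace_fmap, trace_fmap, e, e']

/-! ### The skein relations -/

/-- A box `D × [lo, hi]` in `X × [0,1]`, where `D` is an embedded disk in `X`, parametrized by the
closed unit disk of `ℂ` through an orientation-preserving smooth embedding. -/
structure Box (X : Set ℂ) where
  chart : ℂ → ℂ
  lo : ℝ
  hi : ℝ
  smooth : ContDiff ℝ ∞ chart
  injOn : Set.InjOn chart (Metric.closedBall 0 1)
  orientation : ∀ z ∈ Metric.closedBall (0 : ℂ) 1, 0 < (fderiv ℝ chart z).det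
  mapsTo : Set.MapsTo chart (Metric.closedBall 0 1) X
  lo_nonneg : 0 ≤ lo
  hi_le_one : hi ≤ 1

/-- The set of points of the box. -/
def Box.region {X : Set ℂ} (B : Box X) : Set (ℂ × ℝ) :=
  (B.chart '' Metric.closedBall 0 1) ×ˢ Set.Icc B.lo B.hi

/-- The part of the planar picture `A` in the unit disk, drawn in the box at the heights given by
the function `h`. -/
def Box.draw {X : Set ℂ} (B : Box X) (h : ℂ → ℝ) (A : Set ℂ) : Set (ℂ × ℝ) :=
  (fun z => (B.chart z, h z)) '' (A ∩ Metric.closedBall 0 1)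

/-- Inside the box `B`, the link `L` consists of the points `K`, and its framing points vertically
upward there. -/
def FramedLink.LooksLike {X : Set ℂ} (L : FramedLink X) (B : Box X) (K : Set (ℂ × ℝ)) : Prop :=
  (Prod.fst '' L.carrier) ∩ B.region = K ∧
    ∀ x ∈ L.carrier, x.1 ∈ B.region → x.2.1 = 0 ∧ 0 < x.2.2

/-- `L` and `L'` are identical outside the box `B`. -/
def FramedLink.AgreeOutside {X : Set ℂ} (B : Box X) (L L' : FramedLink X) : Prop :=
  L.carrier \ (Prod.fst ⁻¹' B.region) = L'.carrier \ (Prod.fst ⁻¹' B.region)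

/-- A smooth positive function `g` that rounds off the corner of `|x|`. The curves `y = ± g x` and
`x = ± g y` are the two smoothings of the crossing of the lines `y = x` and `y = -x`. -/
structure IsRounding (g : ℝ → ℝ) : Prop where
  smooth : ContDiff ℝ ∞ g
  pos : ∀ x, 0 < g x
  eq_abs : ∀ x, 1 / 2 ≤ |x| → g x = |x|
  lt_half : ∀ x, |x| < 1 / 2 → g x < 1 / 2

/-- `L`, `LA`, `LB` are identical outside a box. Inside the box, `L` is a crossing, with the strand
`y = x` over the strand `y = -x`; `LA` is the smoothing `)(`, which connects the top and the bottom
region (those swept by the over-strand when it turns counterclockwise); `LB` is the other smoothing,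
which connects the left and the right region. -/
def IsSkeinTriple {X : Set ℂ} (L LA LB : FramedLink X) : Prop :=
  ∃ (B : Box X) (g : ℝ → ℝ) (h₁ h₂ hA hB : ℂ → ℝ), IsRounding g ∧
    Continuous h₁ ∧ Continuous h₂ ∧ Continuous hA ∧ Continuous hB ∧ h₂ 0 < h₁ 0 ∧
    L.LooksLike B (B.draw h₁ {z | z.im = z.re} ∪ B.draw h₂ {z | z.im = -z.re}) ∧
    LA.LooksLike B (B.draw hA {z | |z.re| = g z.im}) ∧
    LB.LooksLike B (B.draw hB {z | |z.im| = g z.re}) ∧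
    L.AgreeOutside B LA ∧ L.AgreeOutside B LB

/-- `L'` is `L` together with a trivial loop that lies in a box disjoint from `L`. -/
def IsLoopPair {X : Set ℂ} (L' L : FramedLink X) : Prop :=
  ∃ (B : Box X) (h : ℂ → ℝ), Continuous h ∧
    L'.LooksLike B (B.draw h (Metric.sphere 0 (1 / 2))) ∧ L.LooksLike B ∅ ∧ L'.AgreeOutside B L

/-! ### The skein algebra -/

/-- The relators of the skein module: differences of isotopic framed links,
`L - q^{1/2} LA - q^{-1/2} LB`, and `(L ⊔ ○) + (q + q⁻¹) L`. The unit `s` is `q^{1/2}`. -/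
def relators (X : Set ℂ) {R : Type*} [CommRing R] (s : Rˣ) : Set (FramedLink X →₀ R) :=
  {x | ∃ L L', Isotopic L L' ∧ x = Finsupp.single L 1 - Finsupp.single L' 1} ∪
  {x | ∃ L LA LB, IsSkeinTriple L LA LB ∧ x = Finsupp.single L 1 -
    (s : R) • Finsupp.single LA 1 - ((s⁻¹ : Rˣ) : R) • Finsupp.single LB 1} ∪
  {x | ∃ L' L, IsLoopPair L' L ∧ x = Finsupp.single L' 1 +
    (((s ^ 2 : Rˣ) : R) + (((s ^ 2)⁻¹ : Rˣ) : R)) • Finsupp.single L 1}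

/-- The Kauffman bracket skein algebra of the planar surface `X` over `R`, with `q^{1/2} = s`: the
`R`-module generated by framed links in `X × [0,1]`, modulo isotopy and the skein relations. -/
def SkeinAlgebra (X : Set ℂ) {R : Type*} [CommRing R] (s : Rˣ) : Type _ :=
  (FramedLink X →₀ R) ⧸ Submodule.span R (relators X s)

section Algebra

variable {X : Set ℂ} {R : Type*} [CommRing R] (s : Rˣ)

noncomputable instance : AddCommGroup (SkeinAlgebra X s) :=
  inferInstanceAs (AddCommGroup ((FramedLink X →₀ R) ⧸ Submodule.span R (relators X s)))

noncomputable instance : Module R (SkeinAlgebra X s) :=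
  inferInstanceAs (Module R ((FramedLink X →₀ R) ⧸ Submodule.span R (relators X s)))

/-- The class of a formal linear combination of framed links. -/
noncomputable def mkₗ : (FramedLink X →₀ R) →ₗ[R] SkeinAlgebra X s :=
  Submodule.mkQ (Submodule.span R (relators X s))

/-- The class of a framed link in the skein algebra. -/
noncomputable def FramedLink.toSkein (L : FramedLink X) : SkeinAlgebra X s :=
  mkₗ s (Finsupp.single L 1)

theorem mkₗ_relator {x : FramedLink X →₀ R} (hx : x ∈ relators X s) : mkₗ s x = 0 :=
  (Submodule.Quotient.mk_eq_zero _).2 (Submodule.subset_span hx)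

variable {s} in
theorem toSkein_eq_of_isotopic {L L' : FramedLink X} (h : Isotopic L L') :
    L.toSkein s = L'.toSkein s := by
  have := mkₗ_relator s (Or.inl (Or.inl ⟨L, L', h, rfl⟩))
  rwa [map_sub, sub_eq_zero] at this

theorem Isotopic.stack {L₁ L₁' L₂ L₂' : FramedLink X} (h₁ : Isotopic L₁ L₁')
    (h₂ : Isotopic L₂ L₂') : Isotopic (L₁.stack L₂) (L₁'.stack L₂') := by
  obtain ⟨ι, _, C, V, hC, hV, hL, h0, h1⟩ := h₁
  obtain ⟨κ, _, C', V', hC', hV', hL', h0', h1'⟩ := h₂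
  refine ⟨ι ⊕ κ, inferInstance,
    fun s => Sum.elim (fun i θ => vmap (1 / 3) (2 / 3) (C s i θ))
      (fun i θ => vmap (1 / 3) 0 (C' s i θ)),
    fun s => Sum.elim (fun i θ => vmap (1 / 3) 0 (V s i θ))
      (fun i θ => vmap (1 / 3) 0 (V' s i θ)), ?_, ?_, ?_, ?_, ?_⟩
  · rintro (i | i)
    · exact contDiff_vmap contDiff_const contDiff_const (hC i)
    · exact contDiff_vmap contDiff_const contDiff_const (hC' i)
  · rintro (i | i)
    · exact contDiff_vmap contDiff_const contDiff_const (hV i)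
    · exact contDiff_vmap contDiff_const contDiff_const (hV' i)
  · intro t ht
    refine ((hL t ht).vmap (by norm_num) (by norm_num) (by norm_num)).sum
      ((hL' t ht).vmap (by norm_num) (by norm_num) (by norm_num)) ?_
    intro i j θ φ
    have h1 := ((hL t ht).mem i θ).2.1
    have h2 := ((hL' t ht).mem j φ).2.2
    simp only [Skein.vmap]
    linarith
  · rw [trace_sum, trace_fmap, trace_fmap, h0, h0']; rfl
  · rw [trace_sum, trace_fmap, trace_fmap, h1, h1']; rfl

theorem Isotopic.refl (L : FramedLink X) : Isotopic L L := by
  obtain ⟨ι, _, c, v, h, e⟩ := L.exists_param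
  exact ⟨ι, inferInstance, fun _ => c, fun _ => v, fun i => (h.smooth_curve i).comp contDiff_snd,
    fun i => (h.smooth_framing i).comp contDiff_snd, fun _ _ => h, e, e⟩

/-- Linear interpolation of `x` and `y`. -/
def lerp (x y t : ℝ) : ℝ := (1 - t) * x + t * y

theorem contDiff_lerp (x y : ℝ) : ContDiff ℝ ∞ fun p : ℝ × ℝ => lerp x y p.1 := by
  unfold lerp
  fun_prop

theorem Isotopic.one_stack (L : FramedLink X) : Isotopic ((FramedLink.empty X).stack L) L := by
  obtain ⟨ι, _, c, v, h, e⟩ := L.exists_param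
  refine ⟨ι, inferInstance, fun t i θ => vmap (lerp (1 / 3) 1 t) 0 (c i θ),
    fun t i θ => vmap (lerp (1 / 3) 1 t) 0 (v i θ), fun i => contDiff_vmap (contDiff_lerp _ _)
      contDiff_const ((h.smooth_curve i).comp contDiff_snd), fun i => contDiff_vmap
      (contDiff_lerp _ _) contDiff_const ((h.smooth_framing i).comp contDiff_snd), ?_, ?_, ?_⟩
  · rintro t ⟨ht, ht'⟩
    apply h.vmap <;> (try unfold lerp) <;> linarith
  · rw [trace_fmap, e]
    simp [FramedLink.stack, FramedLink.empty, lerp]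
  · rw [trace_fmap, e]
    simp [lerp, fmap_one_zero]

theorem Isotopic.stack_one (L : FramedLink X) : Isotopic (L.stack (FramedLink.empty X)) L := by
  obtain ⟨ι, _, c, v, h, e⟩ := L.exists_param
  refine ⟨ι, inferInstance, fun t i θ => vmap (lerp (1 / 3) 1 t) (lerp (2 / 3) 0 t) (c i θ),
    fun t i θ => vmap (lerp (1 / 3) 1 t) 0 (v i θ), fun i => contDiff_vmap (contDiff_lerp _ _)
      (contDiff_lerp _ _) ((h.smooth_curve i).comp contDiff_snd), fun i => contDiff_vmap
      (contDiff_lerp _ _) contDiff_const ((h.smooth_framing i).comp contDiff_snd), ?_, ?_, ?_⟩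
  · rintro t ⟨ht, ht'⟩
    apply h.vmap <;> (try unfold lerp) <;> linarith
  · rw [trace_fmap, e]
    simp [FramedLink.stack, FramedLink.empty, lerp]
  · rw [trace_fmap, e]
    simp [lerp, fmap_one_zero]

theorem fmap_image_image (a b a' b' : ℝ) (S : Set ((ℂ × ℝ) × (ℂ × ℝ))) :
    fmap a b '' (fmap a' b' '' S) = fmap (a * a') (a * b' + b) '' S := by
  rw [Set.image_image]
  congr 1
  ext x <;> simp [fmap, vmap] <;> ring

theorem Isotopic.assoc (L₁ L₂ L₃ : FramedLink X) :
    Isotopic ((L₁.stack L₂).stack L₃) (L₁.stack (L₂.stack L₃)) := by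
  obtain ⟨ι₁, _, c₁, v₁, H₁, e₁⟩ := L₁.exists_param
  obtain ⟨ι₂, _, c₂, v₂, H₂, e₂⟩ := L₂.exists_param
  obtain ⟨ι₃, _, c₃, v₃, H₃, e₃⟩ := L₃.exists_param
  refine ⟨(ι₁ ⊕ ι₂) ⊕ ι₃, inferInstance,
    fun t => Sum.elim (Sum.elim
      (fun i θ => vmap (lerp (1 / 9) (1 / 3) t) (lerp (8 / 9) (2 / 3) t) (c₁ i θ))
      (fun i θ => vmap (lerp (1 / 9) (1 / 9) t) (lerp (2 / 3) (2 / 9) t) (c₂ i θ)))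
      (fun i θ => vmap (lerp (1 / 3) (1 / 9) t) 0 (c₃ i θ)),
    fun t => Sum.elim (Sum.elim
      (fun i θ => vmap (lerp (1 / 9) (1 / 3) t) 0 (v₁ i θ))
      (fun i θ => vmap (lerp (1 / 9) (1 / 9) t) 0 (v₂ i θ)))
      (fun i θ => vmap (lerp (1 / 3) (1 / 9) t) 0 (v₃ i θ)), ?_, ?_, ?_, ?_, ?_⟩
  · rintro ((i | i) | i)
    · exact contDiff_vmap (contDiff_lerp _ _) (contDiff_lerp _ _)
        ((H₁.smooth_curve i).comp contDiff_snd)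
    · exact contDiff_vmap (contDiff_lerp _ _) (contDiff_lerp _ _)
        ((H₂.smooth_curve i).comp contDiff_snd)
    · exact contDiff_vmap (contDiff_lerp _ _) contDiff_const
        ((H₃.smooth_curve i).comp contDiff_snd)
  · rintro ((i | i) | i)
    · exact contDiff_vmap (contDiff_lerp _ _) contDiff_const
        ((H₁.smooth_framing i).comp contDiff_snd)
    · exact contDiff_vmap (contDiff_lerp _ _) contDiff_const
        ((H₂.smooth_framing i).comp contDiff_snd)
    · exact contDiff_vmap (contDiff_lerp _ _) contDiff_const
        ((H₃.smooth_framing i).comp contDiff_snd)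
  · rintro t ⟨ht, ht'⟩
    refine ((H₁.vmap ?_ ?_ ?_).sum (H₂.vmap ?_ ?_ ?_) ?_).sum (H₃.vmap ?_ ?_ ?_) ?_
    any_goals first | exact le_rfl | (unfold lerp; linarith)
    · intro i j θ φ
      have h1 := (H₁.mem i θ).2.1
      have h2 := (H₂.mem j φ).2.2
      simp only [Skein.vmap, lerp]
      nlinarith
    · rintro (i | i) j θ φ
      · have h1 := (H₁.mem i θ).2.1
        have h2 := (H₃.mem j φ).2.2
        simp only [Skein.vmap, lerp, Sum.elim_inl]
        nlinarith
      · have h1 := (H₂.mem i θ).2.1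
        have h2 := (H₃.mem j φ).2.2
        simp only [Skein.vmap, lerp, Sum.elim_inr]
        nlinarith
  · rw [trace_sum, trace_sum, trace_fmap, trace_fmap, trace_fmap, e₁, e₂, e₃]
    simp only [FramedLink.stack, Set.image_union, fmap_image_image]
    norm_num [lerp]
  · rw [trace_sum, trace_sum, trace_fmap, trace_fmap, trace_fmap, e₁, e₂, e₃]
    simp only [FramedLink.stack, Set.image_union, fmap_image_image]
    norm_num [lerp, Set.union_assoc]

/-- The image of a box under the vertical map `h ↦ h / 3 + b`. -/
noncomputable def Box.squeeze (B : Box X) (b : ℝ) (hb : 0 ≤ b) (hb' : b ≤ 2 / 3) : Box X where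
  chart := B.chart
  lo := 1 / 3 * B.lo + b
  hi := 1 / 3 * B.hi + b
  smooth := B.smooth
  injOn := B.injOn
  orientation := B.orientation
  mapsTo := B.mapsTo
  lo_nonneg := by linarith [B.lo_nonneg]
  hi_le_one := by linarith [B.hi_le_one]

theorem Box.mem_squeeze (B : Box X) (b : ℝ) (hb : 0 ≤ b) (hb' : b ≤ 2 / 3) (p : ℂ × ℝ) :
    vmap (1 / 3) b p ∈ (B.squeeze b hb hb').region ↔ p ∈ B.region := by
  simp only [Box.region, Box.squeeze, vmap, Set.mem_prod, Set.mem_Icc]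
  refine and_congr Iff.rfl (and_congr ?_ ?_) <;> constructor <;> intro h <;> linarith

theorem Box.squeeze_draw (B : Box X) (b : ℝ) (hb : 0 ≤ b) (hb' : b ≤ 2 / 3) (h : ℂ → ℝ)
    (A : Set ℂ) :
    (B.squeeze b hb hb').draw (fun z => 1 / 3 * h z + b) A = vmap (1 / 3) b '' B.draw h A := by
  rw [Box.draw, Box.draw, Set.image_image]
  rfl

/-- `M` is the union of a squeezed copy of `L` and a part `Q` outside the squeezed box. -/
theorem looksLike_squeeze {L M : FramedLink X} {B : Box X} {b : ℝ} (hb : 0 ≤ b) (hb' : b ≤ 2 / 3)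
    {Q : Set ((ℂ × ℝ) × (ℂ × ℝ))} (hM : M.carrier = fmap (1 / 3) b '' L.carrier ∪ Q)
    (hQ : ∀ x ∈ Q, x.1 ∉ (B.squeeze b hb hb').region) {K : Set (ℂ × ℝ)} (h : L.LooksLike B K) :
    M.LooksLike (B.squeeze b hb hb') (vmap (1 / 3) b '' K) := by
  constructor
  · rw [← h.1, hM]
    ext p
    constructor
    · rintro ⟨⟨x, ⟨y, hy, rfl⟩ | hx, rfl⟩, hp⟩
      · exact ⟨y.1, ⟨⟨y, hy, rfl⟩, (B.mem_squeeze b hb hb' _).1 hp⟩, rfl⟩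
      · exact absurd hp (hQ x hx)
    · rintro ⟨_, ⟨⟨y, hy, rfl⟩, hp⟩, rfl⟩
      exact ⟨⟨_, Or.inl ⟨y, hy, rfl⟩, rfl⟩, (B.mem_squeeze b hb hb' _).2 hp⟩
  · rw [hM]
    rintro x (⟨y, hy, rfl⟩ | hx) hp
    · have := h.2 y hy ((B.mem_squeeze b hb hb' _).1 hp)
      refine ⟨this.1, ?_⟩
      simp only [fmap, vmap]
      linarith [this.2]
    · exact absurd hp (hQ x hx)

theorem agreeOutside_squeeze {L L' M M' : FramedLink X} {B : Box X} {b : ℝ} (hb : 0 ≤ b)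
    (hb' : b ≤ 2 / 3) {Q : Set ((ℂ × ℝ) × (ℂ × ℝ))}
    (hM : M.carrier = fmap (1 / 3) b '' L.carrier ∪ Q)
    (hM' : M'.carrier = fmap (1 / 3) b '' L'.carrier ∪ Q) (h : L.AgreeOutside B L') :
    M.AgreeOutside (B.squeeze b hb hb') M' := by
  have key : ∀ {L L' : FramedLink X}, L.AgreeOutside B L' →
      (fmap (1 / 3) b '' L.carrier ∪ Q) \ (Prod.fst ⁻¹' (B.squeeze b hb hb').region) ⊆
      (fmap (1 / 3) b '' L'.carrier ∪ Q) \ (Prod.fst ⁻¹' (B.squeeze b hb hb').region) := by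
    rintro L L' h x ⟨⟨y, hy, rfl⟩ | hx, hp⟩
    · have hy' : y ∈ L.carrier \ (Prod.fst ⁻¹' B.region) :=
        ⟨hy, fun hr => hp ((B.mem_squeeze b hb hb' _).2 hr)⟩
      rw [h] at hy'
      exact ⟨Or.inl ⟨y, hy'.1, rfl⟩, hp⟩
    · exact ⟨Or.inr hx, hp⟩
  unfold FramedLink.AgreeOutside
  rw [hM, hM']
  exact (key h).antisymm (key h.symm)

theorem IsSkeinTriple.squeeze {L LA LB M MA MB : FramedLink X} {b : ℝ} (hb : 0 ≤ b)
    (hb' : b ≤ 2 / 3) {Q : Set ((ℂ × ℝ) × (ℂ × ℝ))}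
    (hQ : ∀ (B : Box X), ∀ x ∈ Q, x.1 ∉ (B.squeeze b hb hb').region)
    (hM : M.carrier = fmap (1 / 3) b '' L.carrier ∪ Q)
    (hMA : MA.carrier = fmap (1 / 3) b '' LA.carrier ∪ Q)
    (hMB : MB.carrier = fmap (1 / 3) b '' LB.carrier ∪ Q) (h : IsSkeinTriple L LA LB) :
    IsSkeinTriple M MA MB := by
  obtain ⟨B, g, h₁, h₂, hA, hB, hg, c₁, c₂, cA, cB, hlt, l, lA, lB, a, a'⟩ := h
  refine ⟨B.squeeze b hb hb', g, fun z => 1 / 3 * h₁ z + b, fun z => 1 / 3 * h₂ z + b,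
    fun z => 1 / 3 * hA z + b, fun z => 1 / 3 * hB z + b, hg, by fun_prop, by fun_prop,
    by fun_prop, by fun_prop, by linarith, ?_, ?_, ?_, agreeOutside_squeeze hb hb' hM hMA a,
    agreeOutside_squeeze hb hb' hM hMB a'⟩
  · rw [Box.squeeze_draw, Box.squeeze_draw, ← Set.image_union]
    exact looksLike_squeeze hb hb' hM (hQ B) l
  · rw [Box.squeeze_draw]
    exact looksLike_squeeze hb hb' hMA (hQ B) lA
  · rw [Box.squeeze_draw]
    exact looksLike_squeeze hb hb' hMB (hQ B) lB

theorem IsLoopPair.squeeze {L' L M' M : FramedLink X} {b : ℝ} (hb : 0 ≤ b)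
    (hb' : b ≤ 2 / 3) {Q : Set ((ℂ × ℝ) × (ℂ × ℝ))}
    (hQ : ∀ (B : Box X), ∀ x ∈ Q, x.1 ∉ (B.squeeze b hb hb').region)
    (hM' : M'.carrier = fmap (1 / 3) b '' L'.carrier ∪ Q)
    (hM : M.carrier = fmap (1 / 3) b '' L.carrier ∪ Q) (h : IsLoopPair L' L) :
    IsLoopPair M' M := by
  obtain ⟨B, h, c, l', l, a⟩ := h
  refine ⟨B.squeeze b hb hb', fun z => 1 / 3 * h z + b, by fun_prop, ?_, ?_,
    agreeOutside_squeeze hb hb' hM' hM a⟩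
  · rw [Box.squeeze_draw]
    exact looksLike_squeeze hb hb' hM' (hQ B) l'
  · rw [← Set.image_empty (vmap (1 / 3) b)]
    exact looksLike_squeeze hb hb' hM (hQ B) l

theorem FramedLink.height_mem (L : FramedLink X) {x} (hx : x ∈ L.carrier) :
    x.1.2 ∈ Set.Icc (0 : ℝ) 1 := by
  obtain ⟨ι, _, c, v, h, e⟩ := L.exists_param
  rw [← e] at hx
  obtain ⟨i, θ, rfl⟩ := hx
  exact (h.mem i θ).2

theorem upper_notMem (N : FramedLink X) (B : Box X) :
    ∀ x ∈ fmap (1 / 3) (2 / 3) '' N.carrier,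
      x.1 ∉ (B.squeeze 0 le_rfl (by norm_num)).region := by
  rintro _ ⟨y, hy, rfl⟩ ⟨-, -, h⟩
  have h1 := (N.height_mem hy).1
  have h2 := B.hi_le_one
  simp only [fmap, vmap, Box.squeeze] at h
  linarith

theorem lower_notMem (N : FramedLink X) (B : Box X) :
    ∀ x ∈ fmap (1 / 3) 0 '' N.carrier,
      x.1 ∉ (B.squeeze (2 / 3) (by norm_num) le_rfl).region := by
  rintro _ ⟨y, hy, rfl⟩ ⟨-, h, -⟩
  have h1 := (N.height_mem hy).2
  have h2 := B.lo_nonneg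
  simp only [fmap, vmap, Box.squeeze] at h
  linarith

theorem lmapDomain_one (f : FramedLink X → FramedLink X) (L : FramedLink X) (r : R) :
    Finsupp.lmapDomain R R f (Finsupp.single L r) = Finsupp.single (f L) r := by
  simp

theorem mapDomain_stack_left (N : FramedLink X) {x : FramedLink X →₀ R} (hx : x ∈ relators X s) :
    Finsupp.lmapDomain R R N.stack x ∈ relators X s := by
  obtain (⟨L, L', h, rfl⟩ | ⟨L, LA, LB, h, rfl⟩) | ⟨L', L, h, rfl⟩ := hx
  · refine Or.inl (Or.inl ⟨N.stack L, N.stack L', (Isotopic.refl N).stack h, ?_⟩)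
    simp only [map_sub, lmapDomain_one]
  · refine Or.inl (Or.inr ⟨N.stack L, N.stack LA, N.stack LB, h.squeeze le_rfl (by norm_num)
      (upper_notMem N) (Set.union_comm _ _) (Set.union_comm _ _) (Set.union_comm _ _), ?_⟩)
    simp only [map_sub, map_smul, lmapDomain_one]
  · refine Or.inr ⟨N.stack L', N.stack L, h.squeeze le_rfl (by norm_num)
      (upper_notMem N) (Set.union_comm _ _) (Set.union_comm _ _), ?_⟩
    simp only [map_add, map_smul, lmapDomain_one]

theorem mapDomain_stack_right (N : FramedLink X) {x : FramedLink X →₀ R} (hx : x ∈ relators X s) :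
    Finsupp.lmapDomain R R (fun L => L.stack N) x ∈ relators X s := by
  obtain (⟨L, L', h, rfl⟩ | ⟨L, LA, LB, h, rfl⟩) | ⟨L', L, h, rfl⟩ := hx
  · refine Or.inl (Or.inl ⟨L.stack N, L'.stack N, h.stack (Isotopic.refl N), ?_⟩)
    simp only [map_sub, lmapDomain_one]
  · refine Or.inl (Or.inr ⟨L.stack N, LA.stack N, LB.stack N, h.squeeze (by norm_num) le_rfl
      (lower_notMem N) rfl rfl rfl, ?_⟩)
    simp only [map_sub, map_smul, lmapDomain_one]
  · refine Or.inr ⟨L'.stack N, L.stack N, h.squeeze (by norm_num) le_rfl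
      (lower_notMem N) rfl rfl, ?_⟩
    simp only [map_add, map_smul, lmapDomain_one]

/-- Stacking the link `N` over the elements of the skein algebra. -/
noncomputable def stackLeft (N : FramedLink X) : SkeinAlgebra X s →ₗ[R] SkeinAlgebra X s :=
  Submodule.mapQ _ _ (Finsupp.lmapDomain R R N.stack) (by
    rw [Submodule.span_le]
    intro x hx
    exact Submodule.subset_span (mapDomain_stack_left s N hx))

theorem stackLeft_toSkein (N L : FramedLink X) :
    stackLeft s N (L.toSkein s) = (N.stack L).toSkein s := by
  change mkₗ s (Finsupp.lmapDomain R R N.stack (Finsupp.single L 1)) = _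
  simp [FramedLink.toSkein]

theorem hom_ext {M : Type*} [AddCommGroup M] [Module R M] {f g : SkeinAlgebra X s →ₗ[R] M}
    (h : ∀ L : FramedLink X, f (L.toSkein s) = g (L.toSkein s)) : f = g := by
  apply Submodule.linearMap_qext
  apply Finsupp.lhom_ext'
  intro L
  apply LinearMap.ext_ring
  exact h L

/-- The product of the skein algebra as a bilinear map: the bilinear extension of stacking. -/
noncomputable def mulₗ : SkeinAlgebra X s →ₗ[R] SkeinAlgebra X s →ₗ[R] SkeinAlgebra X s :=
  Submodule.liftQ _ (Finsupp.linearCombination R (stackLeft s)) (by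
    rw [Submodule.span_le]
    intro x hx
    rw [SetLike.mem_coe, LinearMap.mem_ker]
    apply hom_ext
    intro L
    have h1 : ∀ x : FramedLink X →₀ R, Finsupp.linearCombination R (stackLeft s) x (L.toSkein s) =
        mkₗ s (Finsupp.lmapDomain R R (fun N => N.stack L) x) := by
      intro x
      induction x using Finsupp.induction_linear with
      | zero => simp
      | add f g hf hg => rw [map_add, LinearMap.add_apply, hf, hg, map_add, map_add]
      | single N r =>
        rw [Finsupp.linearCombination_single, LinearMap.smul_apply, stackLeft_toSkein,
          FramedLink.toSkein, ← map_smul]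
        simp
    rw [h1, mkₗ_relator s (mapDomain_stack_right s L hx)]
    rfl)

theorem mulₗ_toSkein (L L' : FramedLink X) :
    mulₗ s (L.toSkein s) (L'.toSkein s) = (L.stack L').toSkein s := by
  have : mulₗ s (L.toSkein s) = stackLeft s L := by
    change Finsupp.linearCombination R (stackLeft s) (Finsupp.single L 1) = _
    simp
  rw [this, stackLeft_toSkein]

noncomputable instance : Mul (SkeinAlgebra X s) := ⟨fun x y => mulₗ s x y⟩

noncomputable instance : One (SkeinAlgebra X s) := ⟨(FramedLink.empty X).toSkein s⟩

theorem toSkein_mul (L L' : FramedLink X) :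
    L.toSkein s * L'.toSkein s = (L.stack L').toSkein s := mulₗ_toSkein s L L'

theorem one_def : (1 : SkeinAlgebra X s) = (FramedLink.empty X).toSkein s := rfl

protected theorem mul_assoc (x y z : SkeinAlgebra X s) : x * y * z = x * (y * z) := by
  have h3 : ∀ L₁ L₂ : FramedLink X, mulₗ s (mulₗ s (L₁.toSkein s) (L₂.toSkein s)) =
      (mulₗ s (L₁.toSkein s)).comp (mulₗ s (L₂.toSkein s)) := by
    intro L₁ L₂
    apply hom_ext
    intro L₃
    simp only [LinearMap.comp_apply, mulₗ_toSkein]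
    exact toSkein_eq_of_isotopic (Isotopic.assoc _ _ _)
  have h2 : ∀ L₁ : FramedLink X, ((mulₗ s).flip z).comp (mulₗ s (L₁.toSkein s)) =
      (mulₗ s (L₁.toSkein s)).comp ((mulₗ s).flip z) := by
    intro L₁
    apply hom_ext
    intro L₂
    exact congrArg (fun f => f z) (h3 L₁ L₂)
  have h1 : ((mulₗ s).flip z).comp ((mulₗ s).flip y) = (mulₗ s).flip (mulₗ s y z) := by
    apply hom_ext
    intro L₁
    exact congrArg (fun f => f y) (h2 L₁)
  exact congrArg (fun f => f x) h1

protected theorem one_mul (x : SkeinAlgebra X s) : 1 * x = x := by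
  have h : mulₗ s (1 : SkeinAlgebra X s) = LinearMap.id := by
    apply hom_ext
    intro L
    rw [one_def, mulₗ_toSkein]
    exact toSkein_eq_of_isotopic (Isotopic.one_stack L)
  exact congrArg (fun f => f x) h

protected theorem mul_one (x : SkeinAlgebra X s) : x * 1 = x := by
  have h : (mulₗ s).flip (1 : SkeinAlgebra X s) = LinearMap.id := by
    apply hom_ext
    intro L
    rw [LinearMap.flip_apply, one_def, mulₗ_toSkein]
    exact toSkein_eq_of_isotopic (Isotopic.stack_one L)
  exact congrArg (fun f => f x) h

noncomputable instance : Ring (SkeinAlgebra X s) :=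
  { (inferInstance : AddCommGroup (SkeinAlgebra X s)) with
    mul := (· * ·)
    one := 1
    mul_assoc := Skein.mul_assoc s
    one_mul := Skein.one_mul s
    mul_one := Skein.mul_one s
    left_distrib := fun x y z => map_add (mulₗ s x) y z
    right_distrib := fun x y z => LinearMap.map_add₂ (mulₗ s) x y z
    zero_mul := fun x => LinearMap.map_zero₂ (mulₗ s) x
    mul_zero := fun x => map_zero (mulₗ s x) }

noncomputable instance : Algebra R (SkeinAlgebra X s) :=
  Algebra.ofModule (fun r x y => LinearMap.map_smul₂ (mulₗ s) r x y)
    (fun r x y => map_smul (mulₗ s x) r y)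

end Algebra

/-! ### The five-punctured sphere and the curves encircling its punctures -/

/-- The punctures `p₁, p₂, p₃, p₄ = p₀`: the points `-i, -1, i, 1`, which follow each other
clockwise on the unit circle. -/
noncomputable def puncture (i : ZMod 4) : ℂ := (-Complex.I) ^ i.val

/-- The sphere with five punctures: the plane without the four points `puncture i` (the fifth
puncture is at infinity). -/
def Sigma05 : Set ℂ := (Set.range puncture)ᶜ

/-- The ellipse with centre `c` and half-axes `u`, `w`. -/
noncomputable def ellipse (c u w : ℂ) (θ : ℝ) : ℂ := c + Real.cos θ * u + Real.sin θ * w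

/-- The framed link formed by an ellipse in `X × {1/2}`, with the framing that points vertically
upward. -/
noncomputable def ellipseLink {X : Set ℂ} (c u w : ℂ) (hdet : u.re * w.im - u.im * w.re ≠ 0)
    (hX : ∀ θ, ellipse c u w θ ∈ X) : FramedLink X where
  carrier := trace (fun (_ : Unit) θ => (ellipse c u w θ, 1 / 2)) (fun _ _ => (0, 1))
  exists_param := by
    have key : ∀ x y : ℝ, x * u + y * w = 0 → x = 0 ∧ y = 0 := by
      intro x y h
      have h1 := congrArg Complex.re h
      have h2 := congrArg Complex.im h
      simp at h1 h2
      constructor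
      · refine (mul_eq_zero.1 (?_ : x * (u.re * w.im - u.im * w.re) = 0)).resolve_right hdet
        linear_combination w.im * h1 - w.re * h2
      · refine (mul_eq_zero.1 (?_ : y * (u.re * w.im - u.im * w.re) = 0)).resolve_right hdet
        linear_combination u.re * h2 - u.im * h1
    have hd : ∀ θ : ℝ, HasDerivAt (ellipse c u w)
        (((-Real.sin θ : ℝ) : ℂ) * u + (Real.cos θ : ℂ) * w) θ := by
      intro θ
      unfold ellipse
      exact (((Real.hasDerivAt_cos θ).ofReal_comp.mul_const u).const_add c).add
        ((Real.hasDerivAt_sin θ).ofReal_comp.mul_const w)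
    refine ⟨Unit, inferInstance, _, _, ⟨?_, ?_, ?_, ?_, ?_, ?_, ?_⟩, rfl⟩
    · intro _
      unfold ellipse
      have h1 : ContDiff ℝ ∞ fun θ : ℝ => ((Real.cos θ : ℝ) : ℂ) :=
        Complex.ofRealCLM.contDiff.comp Real.contDiff_cos
      have h2 : ContDiff ℝ ∞ fun θ : ℝ => ((Real.sin θ : ℝ) : ℂ) :=
        Complex.ofRealCLM.contDiff.comp Real.contDiff_sin
      exact ((contDiff_const.add (h1.mul contDiff_const)).add (h2.mul contDiff_const)).prodMk
        contDiff_const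
    · intro _
      exact contDiff_const
    · intro _ θ
      simp [ellipse]
    · intro _ θ
      rfl
    · intro _ θ
      exact ⟨hX θ, by norm_num⟩
    · intro _ _ θ φ e
      refine ⟨rfl, ?_⟩
      have e1 := congrArg Prod.fst e
      simp only [ellipse] at e1
      have := key (Real.cos φ - Real.cos θ) (Real.sin φ - Real.sin θ) (by
        push_cast at e1 ⊢
        linear_combination -e1)
      have hang : (φ : Real.Angle) = θ :=
        Real.Angle.cos_sin_inj (sub_eq_zero.1 this.1) (sub_eq_zero.1 this.2)
      obtain ⟨m, hm⟩ := Real.Angle.angle_eq_iff_two_pi_dvd_sub.1 hang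
      exact ⟨m, by linarith⟩
    · intro _ θ
      rw [((hd θ).prodMk (hasDerivAt_const θ (1 / 2 : ℝ))).deriv, LinearIndependent.pair_iff]
      intro x y hxy
      simp only [Prod.smul_mk, Prod.mk_add_mk, Prod.mk_eq_zero, smul_zero, add_zero, smul_eq_mul,
        mul_zero, mul_one, zero_add, Complex.real_smul] at hxy
      refine ⟨?_, hxy.2⟩
      have h3 := key (x * -Real.sin θ) (x * Real.cos θ) (by
        have := hxy.1
        push_cast at this ⊢
        linear_combination this)
      have h4 := Real.sin_sq_add_cos_sq θ
      have h5 : x ^ 2 = 0 := by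
        linear_combination (-x ^ 2) * h4 - (x * Real.sin θ) * h3.1 + (x * Real.cos θ) * h3.2
      exact pow_eq_zero_iff (two_ne_zero) |>.1 h5

theorem puncture_zero : puncture 0 = 1 := by simp [puncture]

theorem puncture_one : puncture 1 = -Complex.I := by
  have : (1 : ZMod 4).val = 1 := rfl
  simp [puncture, this]

theorem puncture_two : puncture 2 = -1 := by
  have : (2 : ZMod 4).val = 2 := rfl
  simp [puncture, this]

theorem puncture_three : puncture 3 = Complex.I := by
  have : (3 : ZMod 4).val = 3 := rfl
  simp [puncture, this, pow_succ]

theorem forall_zmod4 {p : ZMod 4 → Prop} (h0 : p 0) (h1 : p 1) (h2 : p 2) (h3 : p 3) :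
    ∀ i, p i := by
  intro i
  fin_cases i
  exacts [h0, h1, h2, h3]

theorem puncture_add_one (i : ZMod 4) : puncture (i + 1) = -Complex.I * puncture i := by
  revert i
  have h12 : (1 : ZMod 4) + 1 = 2 := rfl
  have h23 : (2 : ZMod 4) + 1 = 3 := rfl
  have h30 : (3 : ZMod 4) + 1 = 0 := rfl
  apply forall_zmod4 <;>
    simp [h12, h23, h30, puncture_zero, puncture_one, puncture_two, puncture_three]

theorem mem_Sigma05 {z : ℂ} (h0 : z ≠ 1) (h1 : z ≠ -Complex.I) (h2 : z ≠ -1)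
    (h3 : z ≠ Complex.I) : z ∈ Sigma05 := by
  rintro ⟨j, rfl⟩
  revert h0 h1 h2 h3 j
  apply forall_zmod4 <;>
    simp [puncture_zero, puncture_one, puncture_two, puncture_three]

theorem mul_puncture_mem (i : ZMod 4) {z : ℂ} (hz : z ∈ Sigma05) : z * puncture i ∈ Sigma05 := by
  have h0 : z ≠ 1 := fun h => hz ⟨0, by rw [h, puncture_zero]⟩
  have h1 : z ≠ -Complex.I := fun h => hz ⟨1, by rw [h, puncture_one]⟩
  have h2 : z ≠ -1 := fun h => hz ⟨2, by rw [h, puncture_two]⟩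
  have h3 : z ≠ Complex.I := fun h => hz ⟨3, by rw [h, puncture_three]⟩
  simp only [ne_eq, Complex.ext_iff, Complex.one_re, Complex.one_im, Complex.neg_re, Complex.neg_im,
    Complex.I_re, Complex.I_im] at h0 h1 h2 h3
  revert i
  apply forall_zmod4 <;> apply mem_Sigma05 <;>
    simp [puncture_zero, puncture_one, puncture_two, puncture_three, Complex.ext_iff] <;>
    grind

theorem avoid_unit {c u w : ℂ} (h : ∀ x y : ℝ, x ^ 2 + y ^ 2 = 1 → c + x * u + y * w ∈ Sigma05)
    (i : ZMod 4) (θ : ℝ) :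
    ellipse (c * puncture i) (u * puncture i) (w * puncture i) θ ∈ Sigma05 := by
  have := mul_puncture_mem i (h _ _ (Real.cos_sq_add_sin_sq θ))
  convert this using 1
  rw [ellipse]
  ring

theorem puncture_det (i : ZMod 4) (u w : ℂ) :
    (u * puncture i).re * (w * puncture i).im - (u * puncture i).im * (w * puncture i).re =
      u.re * w.im - u.im * w.re := by
  revert i
  apply forall_zmod4 <;>
    simp [puncture_zero, puncture_one, puncture_two, puncture_three] <;> ring

/-- The curve `θ ↦ (c + cos θ u + sin θ w) pᵢ`: an ellipse in coordinates rotated by `pᵢ`. -/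
noncomputable def rotatedEllipseLink (i : ZMod 4) (c u w : ℂ)
    (hdet : u.re * w.im - u.im * w.re ≠ 0)
    (h : ∀ x y : ℝ, x ^ 2 + y ^ 2 = 1 → c + x * u + y * w ∈ Sigma05) : FramedLink Sigma05 :=
  ellipseLink (c * puncture i) (u * puncture i) (w * puncture i)
    (by rwa [puncture_det]) (avoid_unit h i)

/-- The curve encircling the puncture `pᵢ`: the circle with centre `pᵢ` and radius `1/10`. -/
noncomputable def loop₁ (i : ZMod 4) : FramedLink Sigma05 :=
  rotatedEllipseLink i 1 (1 / 10) (Complex.I / 10) (by norm_num) (by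
    intro x y h
    apply mem_Sigma05 <;> simp [Complex.ext_iff] <;> intros <;> nlinarith)

/-- The curve encircling the neighbouring punctures `pᵢ` and `pᵢ₊₁ = -i pᵢ`: the ellipse with centre
`(pᵢ + pᵢ₊₁) / 2` and half-axes `3/5 (pᵢ₊₁ - pᵢ)` and `9/20 i (pᵢ₊₁ - pᵢ)`. -/
noncomputable def loop₂ (i : ZMod 4) : FramedLink Sigma05 :=
  rotatedEllipseLink i ((1 - Complex.I) / 2) (3 / 5 * (-Complex.I - 1))
    (9 / 20 * Complex.I * (-Complex.I - 1)) (by norm_num) (by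
    intro x y h
    apply mem_Sigma05 <;> simp [Complex.ext_iff] <;> norm_num <;> intros <;> nlinarith)

/-- The curve encircling the opposite punctures `pᵢ` and `pᵢ₊₂ = -pᵢ`: the ellipse with centre `0`
and half-axes `3/2 pᵢ` and `1/2 i pᵢ`. -/
noncomputable def loopOpp (i : ZMod 4) : FramedLink Sigma05 :=
  rotatedEllipseLink i 0 (3 / 2) (Complex.I / 2) (by norm_num) (by
    intro x y h
    apply mem_Sigma05 <;> simp [Complex.ext_iff] <;> norm_num <;> intros <;> nlinarith)

/-- The curve encircling the punctures `pᵢ`, `pᵢ₊₁`, `pᵢ₊₂`: the circle with centre `pᵢ₊₁ = -i pᵢ`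
and radius `17/10`. -/
noncomputable def loop₃ (i : ZMod 4) : FramedLink Sigma05 :=
  rotatedEllipseLink i (-Complex.I) (17 / 10) (17 / 10 * Complex.I) (by norm_num) (by
    intro x y h
    apply mem_Sigma05 <;> simp [Complex.ext_iff] <;> norm_num <;> intros <;> nlinarith)

/-- The curve encircling all four punctures: the circle with centre `0` and radius `2`. -/
noncomputable def loop₄ : FramedLink Sigma05 :=
  rotatedEllipseLink 0 0 2 (2 * Complex.I) (by norm_num) (by
    intro x y h
    apply mem_Sigma05 <;> simp [Complex.ext_iff] <;> intros <;> nlinarith)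

end Skein

open scoped ContDiff Real
namespace Skein

/-! ### Links with vertical framing -/

/-- The curves `(γ i, η i)`, of period `T i`, form a link in `X × [0,1]` whose components have
regular projections to `X`, so that the vertical vector field is a framing. -/
structure IsVLink (X : Set ℂ) {ι : Type} (T : ι → ℝ) (γ : ι → ℝ → ℂ) (η : ι → ℝ → ℝ) : Prop where
  pos : ∀ i, 0 < T i
  smooth : ∀ i, ContDiff ℝ ∞ (γ i)
  smooth_height : ∀ i, ContDiff ℝ ∞ (η i)
  periodic : ∀ i, Function.Periodic (γ i) (T i)
  periodic_height : ∀ i, Function.Periodic (η i) (T i)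
  mem : ∀ i t, γ i t ∈ X
  height_mem : ∀ i t, η i t ∈ Set.Icc (0 : ℝ) 1
  deriv_ne : ∀ i t, deriv (γ i) t ≠ 0
  simple : ∀ i j t t', γ i t = γ j t' → η i t = η j t' → i = j ∧ ∃ m : ℤ, t' = t + m * T i

/-- The framed points of the link with components `(γ i, η i)` and vertical framing. -/
def vset {ι : Type} (γ : ι → ℝ → ℂ) (η : ι → ℝ → ℝ) : Set ((ℂ × ℝ) × (ℂ × ℝ)) :=
  {x | ∃ i t, x = ((γ i t, η i t), (0, 1))}

theorem IsVLink.isFramedLink {X : Set ℂ} {ι : Type} {T : ι → ℝ} {γ : ι → ℝ → ℂ} {η : ι → ℝ → ℝ}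
    (h : IsVLink X T γ η) {a : ℝ} (ha : 0 < a) :
    IsFramedLink X (fun i θ => (γ i (T i / (2 * π) * θ), η i (T i / (2 * π) * θ)))
      (fun _ _ => ((0 : ℂ), a)) where
  smooth_curve i := by
    have := h.smooth i
    have := h.smooth_height i
    fun_prop
  smooth_framing i := contDiff_const
  periodic_curve i θ := by
    have e : T i / (2 * π) * (θ + 2 * π) = T i / (2 * π) * θ + T i := by
      field_simp [Real.pi_ne_zero]
    simp only [e, h.periodic i _, h.periodic_height i _]
  periodic_framing i θ := rfl
  mem i θ := ⟨h.mem _ _, h.height_mem _ _⟩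
  simple i j θ φ e := by
    obtain ⟨rfl, m, hm⟩ := h.simple i j _ _ (congrArg Prod.fst e) (congrArg Prod.snd e)
    refine ⟨rfl, m, ?_⟩
    have := (h.pos i).ne'
    have := Real.pi_ne_zero
    field_simp at hm
    linarith
  independent i θ := by
    have hne : T i / (2 * π) ≠ 0 := (div_pos (h.pos i) Real.two_pi_pos).ne'
    have h1 : HasDerivAt (fun θ => γ i (T i / (2 * π) * θ))
        ((T i / (2 * π)) • deriv (γ i) (T i / (2 * π) * θ)) θ := by
      have := (((h.smooth i).differentiable (by simp)).differentiableAt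
        (x := T i / (2 * π) * θ)).hasDerivAt
      have h2 : HasDerivAt (fun θ => T i / (2 * π) * θ) (T i / (2 * π)) θ := by
        simpa using (hasDerivAt_id θ).const_mul (T i / (2 * π))
      exact this.scomp θ h2
    have h3 : HasDerivAt (fun θ => η i (T i / (2 * π) * θ))
        (deriv (fun θ => η i (T i / (2 * π) * θ)) θ) θ := by
      have := h.smooth_height i
      have : ContDiff ℝ ∞ (fun θ => η i (T i / (2 * π) * θ)) := by fun_prop
      exact (this.differentiable (by simp)).differentiableAt.hasDerivAt
    rw [(h1.prodMk h3).deriv, LinearIndependent.pair_iff]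
    intro x y hxy
    simp only [Prod.smul_mk, Prod.mk_add_mk, Prod.mk_eq_zero, smul_zero, add_zero,
      smul_eq_zero, hne, h.deriv_ne, or_false] at hxy
    refine ⟨hxy.1, ?_⟩
    simpa [hxy.1, ha.ne'] using hxy.2

theorem IsVLink.trace_eq {X : Set ℂ} {ι : Type} {T : ι → ℝ} {γ : ι → ℝ → ℂ} {η : ι → ℝ → ℝ}
    (h : IsVLink X T γ η) :
    trace (fun i θ => (γ i (T i / (2 * π) * θ), η i (T i / (2 * π) * θ)))
      (fun _ _ => ((0 : ℂ), (1 : ℝ))) = vset γ η := by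
  ext x
  constructor
  · rintro ⟨i, θ, rfl⟩
    exact ⟨i, _, rfl⟩
  · rintro ⟨i, t, rfl⟩
    refine ⟨i, 2 * π / T i * t, ?_⟩
    have := (h.pos i).ne'
    have := Real.pi_ne_zero
    have e : T i / (2 * π) * (2 * π / T i * t) = t := by field_simp
    simp only [e]

/-- The link with components `(γ i, η i)` and vertical framing. -/
def IsVLink.link {X : Set ℂ} {ι : Type} [Finite ι] {T : ι → ℝ} {γ : ι → ℝ → ℂ} {η : ι → ℝ → ℝ}
    (h : IsVLink X T γ η) : FramedLink X where
  carrier := vset γ η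
  exists_param := ⟨ι, inferInstance, _, _, h.isFramedLink one_pos, h.trace_eq⟩

theorem toSkein_eq_of_family {X : Set ℂ} {R : Type*} [CommRing R] {s : Rˣ} {ι : Type} [Finite ι]
    {T : ι → ℝ} {Γ : ℝ → ι → ℝ → ℂ} {N : ℝ → ι → ℝ → ℝ}
    (hΓ : ∀ i, ContDiff ℝ ∞ fun p : ℝ × ℝ => Γ p.1 i p.2)
    (hN : ∀ i, ContDiff ℝ ∞ fun p : ℝ × ℝ => N p.1 i p.2)
    (h : ∀ x ∈ Set.Icc (0 : ℝ) 1, IsVLink X T (Γ x) (N x)) {L L' : FramedLink X}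
    (hL : L.carrier = vset (Γ 0) (N 0)) (hL' : L'.carrier = vset (Γ 1) (N 1)) :
    L.toSkein s = L'.toSkein s := by
  apply toSkein_eq_of_isotopic
  refine ⟨ι, inferInstance, fun x i θ => (Γ x i (T i / (2 * π) * θ), N x i (T i / (2 * π) * θ)),
    fun _ _ _ => (0, 1), ?_, ?_, ?_, ?_, ?_⟩
  · intro i
    have e : ContDiff ℝ ∞ fun p : ℝ × ℝ => (p.1, T i / (2 * π) * p.2) := by fun_prop
    exact ((hΓ i).comp e).prodMk ((hN i).comp e)
  · exact fun i => contDiff_const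
  · exact fun x hx => (h x hx).isFramedLink one_pos
  · rw [hL]; exact (h 0 (by simp)).trace_eq
  · rw [hL']; exact (h 1 (by simp)).trace_eq

/-! ### Simple loops -/

/-- `γ` is a regular simple closed curve in `X` of period `T`. -/
structure IsLoop (X : Set ℂ) (T : ℝ) (γ : ℝ → ℂ) : Prop where
  pos : 0 < T
  smooth : ContDiff ℝ ∞ γ
  periodic : Function.Periodic γ T
  mem : ∀ t, γ t ∈ X
  deriv_ne : ∀ t, deriv γ t ≠ 0
  simple : ∀ t t', γ t = γ t' → ∃ m : ℤ, t' = t + m * T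

/-- The framed points of a planar curve at height `1/2` with vertical framing. -/
def loopSet (γ : ℝ → ℂ) : Set ((ℂ × ℝ) × (ℂ × ℝ)) :=
  {x | ∃ t, x = ((γ t, 1 / 2), (0, 1))}

theorem loopSet_eq_of_range {γ γ' : ℝ → ℂ} (h : Set.range γ = Set.range γ') :
    loopSet γ = loopSet γ' := by
  have key : ∀ {γ γ' : ℝ → ℂ}, Set.range γ = Set.range γ' → loopSet γ ⊆ loopSet γ' := by
    rintro γ γ' h x ⟨t, rfl⟩
    obtain ⟨t', ht'⟩ : γ t ∈ Set.range γ' := h ▸ ⟨t, rfl⟩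
    exact ⟨t', by rw [ht']⟩
  exact (key h).antisymm (key h.symm)

theorem IsLoop.isVLink {X : Set ℂ} {T : ℝ} {γ : ℝ → ℂ} (h : IsLoop X T γ) :
    IsVLink X (fun _ : Unit => T) (fun _ => γ) (fun _ _ => 1 / 2) where
  pos _ := h.pos
  smooth _ := h.smooth
  smooth_height _ := contDiff_const
  periodic _ := h.periodic
  periodic_height _ _ := rfl
  mem _ := h.mem
  height_mem _ _ := by norm_num
  deriv_ne _ := h.deriv_ne
  simple _ _ t t' e _ := ⟨rfl, h.simple t t' e⟩

theorem vset_unit (γ : ℝ → ℂ) : vset (fun _ : Unit => γ) (fun _ _ => 1 / 2) = loopSet γ := by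
  ext x
  simp [vset, loopSet]

/-- The link formed by a simple loop at height `1/2`. -/
def IsLoop.link {X : Set ℂ} {T : ℝ} {γ : ℝ → ℂ} (h : IsLoop X T γ) : FramedLink X where
  carrier := loopSet γ
  exists_param := by
    obtain ⟨ι, i, c, v, hcv, e⟩ := h.isVLink.link.exists_param
    exact ⟨ι, i, c, v, hcv, e.trans (vset_unit γ)⟩

theorem loop_toSkein_eq_of_family {X : Set ℂ} {R : Type*} [CommRing R] {s : Rˣ} {T : ℝ}
    {Γ : ℝ → ℝ → ℂ} (hΓ : ContDiff ℝ ∞ fun p : ℝ × ℝ => Γ p.1 p.2)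
    (h : ∀ x ∈ Set.Icc (0 : ℝ) 1, IsLoop X T (Γ x)) {L L' : FramedLink X}
    (hL : L.carrier = loopSet (Γ 0)) (hL' : L'.carrier = loopSet (Γ 1)) :
    L.toSkein s = L'.toSkein s :=
  toSkein_eq_of_family (Γ := fun x _ => Γ x) (N := fun _ _ _ => 1 / 2) (fun _ => hΓ)
    (fun _ => contDiff_const) (fun x hx => (h x hx).isVLink) (by rw [hL, vset_unit])
    (by rw [hL', vset_unit])

/-! ### Products -/

theorem isVLink_pair {X : Set ℂ} {T T' : ℝ} {γ γ' : ℝ → ℂ} {η η' : ℝ → ℝ} (h : IsLoop X T γ)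
    (h' : IsLoop X T' γ') (hη : ContDiff ℝ ∞ η) (hη' : ContDiff ℝ ∞ η')
    (hp : Function.Periodic η T) (hp' : Function.Periodic η' T')
    (hm : ∀ t, η t ∈ Set.Icc (0 : ℝ) 1) (hm' : ∀ t, η' t ∈ Set.Icc (0 : ℝ) 1)
    (hd : ∀ t t', γ t = γ' t' → η t ≠ η' t') :
    IsVLink X (fun b : Bool => cond b T T') (fun b => cond b γ γ') (fun b => cond b η η') where
  pos := by rintro (_ | _); exacts [h'.pos, h.pos]
  smooth := by rintro (_ | _); exacts [h'.smooth, h.smooth]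
  smooth_height := by rintro (_ | _); exacts [hη', hη]
  periodic := by rintro (_ | _); exacts [h'.periodic, h.periodic]
  periodic_height := by rintro (_ | _); exacts [hp', hp]
  mem := by rintro (_ | _); exacts [h'.mem, h.mem]
  height_mem := by rintro (_ | _); exacts [hm', hm]
  deriv_ne := by rintro (_ | _); exacts [h'.deriv_ne, h.deriv_ne]
  simple := by
    rintro (_ | _) (_ | _) t t' e e'
    · exact ⟨rfl, h'.simple t t' e⟩
    · exact absurd e'.symm (hd t' t e.symm)
    · exact absurd e' (hd t t' e)
    · exact ⟨rfl, h.simple t t' e⟩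

/-- The product of two loops is the class of every link with these two components, if the first
loop is above the second one at their common points. -/
theorem toSkein_mul_eq {X : Set ℂ} {R : Type*} [CommRing R] {s : Rˣ} {T T' : ℝ} {γ γ' : ℝ → ℂ}
    {η η' : ℝ → ℝ} (h : IsLoop X T γ)
    (h' : IsLoop X T' γ') (hη : ContDiff ℝ ∞ η) (hη' : ContDiff ℝ ∞ η')
    (hp : Function.Periodic η T) (hp' : Function.Periodic η' T')
    (hm : ∀ t, η t ∈ Set.Icc (0 : ℝ) 1) (hm' : ∀ t, η' t ∈ Set.Icc (0 : ℝ) 1)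
    (hd : ∀ t t', γ t = γ' t' → η' t' < η t) {L L' M : FramedLink X} (hL : L.carrier = loopSet γ)
    (hL' : L'.carrier = loopSet γ') (hM : M.carrier = vset (fun b => cond b γ γ')
      (fun b : Bool => cond b η η')) :
    L.toSkein s * L'.toSkein s = M.toSkein s := by
  rw [toSkein_mul]
  apply toSkein_eq_of_isotopic
  have hV : ∀ x ∈ Set.Icc (0 : ℝ) 1, IsVLink X (fun b : Bool => cond b T T')
      (fun b => cond b γ γ') (fun b => cond b (fun t => (1 - x) * (5 / 6) + x * η t)
        (fun t => (1 - x) * (1 / 6) + x * η' t)) := by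
    rintro x ⟨hx, hx'⟩
    refine isVLink_pair h h' (by fun_prop) (by fun_prop) (fun t => by simp only [hp t])
      (fun t => by simp only [hp' t]) (fun t => ?_) (fun t => ?_) ?_
    · obtain ⟨h1, h2⟩ := hm t
      constructor <;> nlinarith
    · obtain ⟨h1, h2⟩ := hm' t
      constructor <;> nlinarith
    · intro t t' e
      have := hd t t' e
      apply ne_of_gt
      rcases hx.eq_or_lt with rfl | hx
      · norm_num
      · nlinarith
  refine ⟨Bool, inferInstance, fun x b θ => (cond b γ γ' (cond b T T' / (2 * π) * θ),
    cond b (fun t => (1 - x) * (5 / 6) + x * η t) (fun t => (1 - x) * (1 / 6) + x * η' t)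
      (cond b T T' / (2 * π) * θ)), fun x _ _ => (0, lerp (1 / 3) 1 x), ?_, ?_, ?_, ?_, ?_⟩
  · have := h.smooth
    have := h'.smooth
    rintro (_ | _) <;> simp only [cond_true, cond_false] <;> fun_prop
  · intro b
    exact contDiff_const.prodMk (contDiff_lerp _ _)
  · rintro x ⟨hx, hx'⟩
    exact (hV x ⟨hx, hx'⟩).isFramedLink (by unfold lerp; nlinarith)
  · change _ = fmap (1 / 3) (2 / 3) '' L.carrier ∪ fmap (1 / 3) 0 '' L'.carrier
    rw [hL, hL']
    ext y
    have e1 := h.pos.ne'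
    have e2 := h'.pos.ne'
    have e3 := Real.pi_ne_zero
    constructor
    · rintro ⟨_ | _, θ, rfl⟩
      · refine Or.inr ⟨_, ⟨T' / (2 * π) * θ, rfl⟩, ?_⟩
        simp [fmap, vmap, lerp]
        norm_num
      · refine Or.inl ⟨_, ⟨T / (2 * π) * θ, rfl⟩, ?_⟩
        simp [fmap, vmap, lerp]
        norm_num
    · rintro (⟨_, ⟨t, rfl⟩, rfl⟩ | ⟨_, ⟨t, rfl⟩, rfl⟩)
      · have e : T / (2 * π) * (2 * π / T * t) = t := by field_simp
        refine ⟨true, 2 * π / T * t, ?_⟩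
        simp [fmap, vmap, lerp, e]
        norm_num
      · have e : T' / (2 * π) * (2 * π / T' * t) = t := by field_simp
        refine ⟨false, 2 * π / T' * t, ?_⟩
        simp [fmap, vmap, lerp, e]
        norm_num
  · rw [hM]
    have : lerp (1 / 3) 1 1 = 1 := by norm_num [lerp]
    beta_reduce
    rw [this, (hV 1 (by simp)).trace_eq]
    simp only [sub_self, zero_mul, zero_add, one_mul]

/-- Links with disjoint projections to the surface commute. -/
theorem toSkein_mul_comm {X : Set ℂ} {R : Type*} [CommRing R] {s : Rˣ} {L L' : FramedLink X}
    (hd : ∀ x ∈ L.carrier, ∀ y ∈ L'.carrier, x.1.1 ≠ y.1.1) :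
    L.toSkein s * L'.toSkein s = L'.toSkein s * L.toSkein s := by
  rw [toSkein_mul, toSkein_mul]
  apply toSkein_eq_of_isotopic
  obtain ⟨ι, _, c, v, h, e⟩ := L.exists_param
  obtain ⟨κ, _, c', v', h', e'⟩ := L'.exists_param
  refine ⟨ι ⊕ κ, inferInstance,
    fun t => Sum.elim (fun i θ => vmap (1 / 3) (lerp (2 / 3) 0 t) (c i θ))
      (fun i θ => vmap (1 / 3) (lerp 0 (2 / 3) t) (c' i θ)),
    fun t => Sum.elim (fun i θ => vmap (1 / 3) 0 (v i θ))
      (fun i θ => vmap (1 / 3) 0 (v' i θ)), ?_, ?_, ?_, ?_, ?_⟩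
  · rintro (i | i)
    · exact contDiff_vmap contDiff_const (contDiff_lerp _ _) ((h.smooth_curve i).comp contDiff_snd)
    · exact contDiff_vmap contDiff_const (contDiff_lerp _ _) ((h'.smooth_curve i).comp contDiff_snd)
  · rintro (i | i)
    · exact contDiff_vmap contDiff_const contDiff_const ((h.smooth_framing i).comp contDiff_snd)
    · exact contDiff_vmap contDiff_const contDiff_const ((h'.smooth_framing i).comp contDiff_snd)
  · rintro t ⟨ht, ht'⟩
    have h1 := h.vmap (a := 1 / 3) (b := lerp (2 / 3) 0 t) (by norm_num)
      (by unfold lerp; linarith) (by unfold lerp; linarith)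
    have h2 := h'.vmap (a := 1 / 3) (b := lerp 0 (2 / 3) t) (by norm_num)
      (by unfold lerp; linarith) (by unfold lerp; linarith)
    have key : ∀ i j θ φ, (c i θ).1 ≠ (c' j φ).1 := fun i j θ φ =>
      hd (c i θ, v i θ) (e ▸ ⟨i, θ, rfl⟩) (c' j φ, v' j φ) (e' ▸ ⟨j, φ, rfl⟩)
    exact
    { smooth_curve := by rintro (i | i); exacts [h1.smooth_curve i, h2.smooth_curve i]
      smooth_framing := by rintro (i | i); exacts [h1.smooth_framing i, h2.smooth_framing i]
      periodic_curve := by rintro (i | i); exacts [h1.periodic_curve i, h2.periodic_curve i]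
      periodic_framing := by rintro (i | i); exacts [h1.periodic_framing i, h2.periodic_framing i]
      mem := by rintro (i | i); exacts [h1.mem i, h2.mem i]
      simple := by
        rintro (i | i) (j | j) θ φ e
        · obtain ⟨rfl, h⟩ := h1.simple i j θ φ e; exact ⟨rfl, h⟩
        · exact absurd (congrArg Prod.fst e) (key i j θ φ)
        · exact absurd (congrArg Prod.fst e).symm (key j i φ θ)
        · obtain ⟨rfl, h⟩ := h2.simple i j θ φ e; exact ⟨rfl, h⟩
      independent := by rintro (i | i); exacts [h1.independent i, h2.independent i] }
  · rw [trace_sum, trace_fmap, trace_fmap, e, e']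
    simp [FramedLink.stack, lerp]
  · rw [trace_sum, trace_fmap, trace_fmap, e, e']
    simp [FramedLink.stack, lerp, Set.union_comm]

end Skein

namespace Skein

/-! ### A rounding of the absolute value -/

/-- A smooth bump function on `ℝ`, supported in `[-1/4, 1/4]`. -/
noncomputable def bump : ContDiffBump (0 : ℝ) := ⟨1 / 8, 1 / 4, by norm_num, by norm_num⟩

theorem contDiff_bump : ContDiff ℝ ∞ (bump : ℝ → ℝ) := bump.contDiff

theorem bump_zero : bump 0 = 1 :=
  bump.one_of_mem_closedBall (by simp [bump])

theorem bump_eq_zero {x : ℝ} (h : 1 / 4 ≤ |x|) : bump x = 0 :=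
  bump.zero_of_le_dist (by simpa [bump, Real.dist_eq] using h)

/-- A smooth even positive function that agrees with `|x|` for `|x| ≥ 1/4`. -/
noncomputable def rnd (x : ℝ) : ℝ := √(x ^ 2 + 1 / 16 * bump x)

theorem rnd_arg_pos (x : ℝ) : 0 < x ^ 2 + 1 / 16 * bump x := by
  rcases eq_or_ne x 0 with rfl | hx
  · rw [bump_zero]; norm_num
  · have := bump.nonneg (x := x)
    positivity

theorem contDiff_rnd : ContDiff ℝ ∞ rnd := by
  unfold rnd
  apply ContDiff.sqrt
  · have := contDiff_bump
    fun_prop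
  · exact fun x => (rnd_arg_pos x).ne'

theorem rnd_pos (x : ℝ) : 0 < rnd x := Real.sqrt_pos.2 (rnd_arg_pos x)

theorem rnd_neg (x : ℝ) : rnd (-x) = rnd x := by
  simp [rnd, bump.neg]

theorem rnd_eq_abs {x : ℝ} (h : 1 / 4 ≤ |x|) : rnd x = |x| := by
  rw [rnd, bump_eq_zero h, mul_zero, add_zero, Real.sqrt_sq_eq_abs]

theorem rnd_eq_self {x : ℝ} (h : 1 / 4 ≤ x) : rnd x = x := by
  rw [rnd_eq_abs (h.trans (le_abs_self x)), abs_of_nonneg (by linarith)]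

theorem rnd_lt_half {x : ℝ} (h : |x| < 1 / 2) : rnd x < 1 / 2 := by
  rcases le_or_gt (1 / 4) |x| with h' | h'
  · rwa [rnd_eq_abs h']
  · rw [rnd, Real.sqrt_lt' (by norm_num)]
    have h1 := bump.le_one (x := x)
    have h2 : x ^ 2 < (1 / 4) ^ 2 := sq_lt_sq' (by linarith [(abs_lt.1 h').1]) (abs_lt.1 h').2
    norm_num at h2 ⊢
    linarith

theorem abs_le_rnd (x : ℝ) : |x| ≤ rnd x := by
  rw [rnd, ← Real.sqrt_sq_eq_abs]
  apply Real.sqrt_le_sqrt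
  linarith [bump.nonneg (x := x)]

theorem rnd_le (x : ℝ) : rnd x ≤ |x| + 1 / 2 := by
  rcases le_or_gt (1 / 2) |x| with h | h
  · rw [rnd_eq_abs (by linarith)]; linarith
  · linarith [rnd_lt_half h, abs_nonneg x]

theorem rnd_lt_half_iff {x : ℝ} : rnd x < 1 / 2 ↔ |x| < 1 / 2 :=
  ⟨fun h => (abs_le_rnd x).trans_lt h, rnd_lt_half⟩

theorem isRounding_rnd : IsRounding rnd where
  smooth := contDiff_rnd
  pos := rnd_pos
  eq_abs x h := rnd_eq_abs (by linarith)
  lt_half x h := rnd_lt_half h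

/-! ### Even and odd periodic extensions -/

/-- The representative of `t` modulo `2 w` in `[-w, w)`. -/
noncomputable def cmod (w t : ℝ) : ℝ := t - 2 * w * round (t / (2 * w))

theorem cmod_eq_self {w t : ℝ} (h : -w ≤ t) (h' : t < w) : cmod w t = t := by
  have hw : 0 < 2 * w := by linarith
  have : round (t / (2 * w)) = 0 := by
    rw [round_eq_zero_iff]
    constructor
    · rw [le_div_iff₀ hw]; linarith
    · rw [div_lt_iff₀ hw]; linarith
  simp [cmod, this]

theorem cmod_add {w : ℝ} (hw : 0 < w) (t : ℝ) (n : ℤ) : cmod w (t + 2 * w * n) = cmod w t := by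
  have : (t + 2 * w * n) / (2 * w) = t / (2 * w) + n := by field_simp
  rw [cmod, cmod, this, round_add_intCast]
  push_cast
  ring

theorem exists_eq_add {w : ℝ} (hw : 0 < w) (t : ℝ) :
    ∃ (x : ℝ) (n : ℤ), -w ≤ x ∧ x < w ∧ t = x + 2 * w * n := by
  refine ⟨t - 2 * w * ⌊(t + w) / (2 * w)⌋, ⌊(t + w) / (2 * w)⌋, ?_, ?_, by ring⟩
  · have := Int.floor_le ((t + w) / (2 * w))
    rw [le_div_iff₀ (by linarith)] at this
    linarith
  · have := Int.lt_floor_add_one ((t + w) / (2 * w))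
    rw [div_lt_iff₀ (by linarith)] at this
    linarith

/-- The even `2 w`-periodic function that agrees with `k` on `[0, w]`. -/
noncomputable def evenExt (w : ℝ) (k : ℝ → ℝ) (t : ℝ) : ℝ := k |cmod w t|

/-- The odd `2 w`-periodic function that agrees with `b` on `[0, w]`. -/
noncomputable def oddExt (w : ℝ) (b : ℝ → ℝ) (t : ℝ) : ℝ :=
  if 0 ≤ cmod w t then b (cmod w t) else -b (-cmod w t)

section Ext

variable {w : ℝ} {k b : ℝ → ℝ}

theorem evenExt_periodic (hw : 0 < w) : Function.Periodic (evenExt w k) (2 * w) := fun t => by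
  have := cmod_add hw t 1
  rw [Int.cast_one, mul_one] at this
  rw [evenExt, evenExt, this]

theorem oddExt_periodic (hw : 0 < w) : Function.Periodic (oddExt w b) (2 * w) := fun t => by
  have := cmod_add hw t 1
  rw [Int.cast_one, mul_one] at this
  rw [oddExt, oddExt, this]

theorem evenExt_apply (hw : 1 / 2 < w) (h0 : ∀ x, |x| < 1 / 2 → k (-x) = k x)
    (h1 : ∀ x, |x| < 1 / 2 → k (w + x) = k (w - x)) {x : ℝ} (hx : -(1 / 2) < x)
    (hx' : x < w + 1 / 2) (n : ℤ) : evenExt w k (x + 2 * w * n) = k x := by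
  rw [evenExt, cmod_add (by linarith)]
  rcases lt_or_ge x 0 with h | h
  · rw [cmod_eq_self (by linarith) (by linarith), abs_of_neg h, h0 x (abs_lt.2 ⟨by linarith,
      by linarith⟩)]
  rcases lt_or_ge x w with h' | h'
  · rw [cmod_eq_self (by linarith) h', abs_of_nonneg h]
  · have : cmod w x = x - 2 * w := by
      rw [← cmod_add (by linarith) x (-1), cmod_eq_self] <;> push_cast <;> linarith
    have e := h1 (x - w) (abs_lt.2 ⟨by linarith, by linarith⟩)
    rw [this, abs_of_neg (by linarith)]
    convert e.symm using 2 <;> ring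

theorem oddExt_apply (hw : 1 / 2 < w) (h0 : ∀ x, |x| < 1 / 2 → b (-x) = -b x)
    (h1 : ∀ x, |x| < 1 / 2 → b (w + x) = -b (w - x)) {x : ℝ} (hx : -(1 / 2) < x)
    (hx' : x < w + 1 / 2) (n : ℤ) : oddExt w b (x + 2 * w * n) = b x := by
  rw [oddExt, cmod_add (by linarith)]
  rcases lt_or_ge x 0 with h | h
  · rw [cmod_eq_self (by linarith) (by linarith), if_neg (by linarith), h0 x (abs_lt.2
      ⟨by linarith, by linarith⟩), neg_neg]
  rcases lt_or_ge x w with h' | h'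
  · rw [cmod_eq_self (by linarith) h', if_pos h]
  · have : cmod w x = x - 2 * w := by
      rw [← cmod_add (by linarith) x (-1), cmod_eq_self] <;> push_cast <;> linarith
    have e := h1 (x - w) (abs_lt.2 ⟨by linarith, by linarith⟩)
    rw [this, if_neg (by linarith)]
    rw [show w + (x - w) = x by ring, show w - (x - w) = -(x - 2 * w) by ring] at e
    exact e.symm

theorem evenExt_neg (hw : 1 / 2 < w) (h0 : ∀ x, |x| < 1 / 2 → k (-x) = k x)
    (h1 : ∀ x, |x| < 1 / 2 → k (w + x) = k (w - x)) (t : ℝ) :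
    evenExt w k (-t) = evenExt w k t := by
  have key : ∀ (x : ℝ) (n : ℤ), 0 ≤ x → x ≤ w →
      evenExt w k (-(x + 2 * w * n)) = evenExt w k (x + 2 * w * n) := by
    intro x n hx hx'
    rw [evenExt_apply hw h0 h1 (by linarith) (by linarith), evenExt]
    rw [show -(x + 2 * w * n) = -x + 2 * w * (-n : ℤ) by push_cast; ring,
      cmod_add (by linarith)]
    rcases hx'.eq_or_lt with rfl | h
    · rw [cmod_eq_self le_rfl (by linarith), abs_neg, abs_of_nonneg hx]
    · rw [cmod_eq_self (by linarith) (by linarith), abs_neg, abs_of_nonneg hx]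
  obtain ⟨x, n, hx, hx', rfl⟩ := exists_eq_add (w := w) (by linarith) t
  rcases le_or_gt 0 x with h | h
  · exact key x n h hx'.le
  · have := key (-x) (-n) (by linarith) (by linarith)
    push_cast at this
    rw [show -(-x + 2 * w * -(n : ℝ)) = x + 2 * w * n by ring] at this
    rw [this]
    congr 1
    ring

theorem oddExt_neg (hw : 1 / 2 < w) (h0 : ∀ x, |x| < 1 / 2 → b (-x) = -b x)
    (h1 : ∀ x, |x| < 1 / 2 → b (w + x) = -b (w - x)) (t : ℝ) :
    oddExt w b (-t) = -oddExt w b t := by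
  have b0 : b 0 = 0 := by have := h0 0 (by norm_num); rw [neg_zero] at this; linarith
  have bw : b w = 0 := by have := h1 0 (by norm_num); rw [add_zero, sub_zero] at this; linarith
  have key : ∀ (x : ℝ) (n : ℤ), 0 ≤ x → x ≤ w →
      oddExt w b (-(x + 2 * w * n)) = -oddExt w b (x + 2 * w * n) := by
    intro x n hx hx'
    rw [oddExt_apply hw h0 h1 (by linarith) (by linarith), oddExt]
    rw [show -(x + 2 * w * n) = -x + 2 * w * (-n : ℤ) by push_cast; ring,
      cmod_add (by linarith), cmod_eq_self (by linarith) (by linarith)]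
    rcases hx.eq_or_lt with rfl | h
    · simp [b0]
    · rw [if_neg (by linarith), neg_neg]
  obtain ⟨x, n, hx, hx', rfl⟩ := exists_eq_add (w := w) (by linarith) t
  rcases le_or_gt 0 x with h | h
  · exact key x n h hx'.le
  · have := key (-x) (-n) (by linarith) (by linarith)
    push_cast at this
    rw [show -(-x + 2 * w * -(n : ℝ)) = x + 2 * w * n by ring] at this
    rw [this, neg_neg]
    congr 1
    ring

theorem contDiff_of_local {f : ℝ → ℝ} {c : ℝ} (hw : 0 < w) (hk : ContDiff ℝ ∞ k)
    (hneg : ∀ t, f (-t) = c * f t)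
    (h : ∀ x : ℝ, -(1 / 2) < x → x < w + 1 / 2 → ∀ n : ℤ, f (x + 2 * w * n) = k x) :
    ContDiff ℝ ∞ f := by
  have key : ∀ (x : ℝ) (n : ℤ), 0 ≤ x → x ≤ w → ContDiffAt ℝ ∞ f (x + 2 * w * n) := by
    intro x n hx hx'
    have h1 : ContDiff ℝ ∞ fun t => k (t - 2 * w * n) := by fun_prop
    refine h1.contDiffAt.congr_of_eventuallyEq ?_
    have h2 : Set.Ioo (-(1 / 2) + 2 * w * n) (w + 1 / 2 + 2 * w * n) ∈ nhds (x + 2 * w * n) :=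
      Ioo_mem_nhds (by linarith) (by linarith)
    filter_upwards [h2] with t ht
    have := h (t - 2 * w * n) (by linarith [ht.1]) (by linarith [ht.2]) n
    rwa [sub_add_cancel] at this
  rw [contDiff_iff_contDiffAt]
  intro t
  obtain ⟨x, n, hx, hx', rfl⟩ := exists_eq_add (w := w) hw t
  rcases le_or_gt 0 x with h' | h'
  · exact key x n h' hx'.le
  · have h1 := key (-x) (-n) (by linarith) (by linarith)
    push_cast at h1
    rw [show -x + 2 * w * -(n : ℝ) = -(x + 2 * w * n) by ring] at h1
    have h2 : ContDiffAt ℝ ∞ (fun t => f (-t)) (x + 2 * w * n) :=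
      ContDiffAt.comp (x + 2 * w * n) h1 contDiff_neg.contDiffAt
    have h3 : f = fun t => c * f (-t) := by
      funext t
      have := hneg (-t)
      rwa [neg_neg] at this
    rw [h3]
    exact contDiffAt_const.mul h2

theorem contDiff_evenExt (hw : 1 / 2 < w) (hk : ContDiff ℝ ∞ k)
    (h0 : ∀ x, |x| < 1 / 2 → k (-x) = k x)
    (h1 : ∀ x, |x| < 1 / 2 → k (w + x) = k (w - x)) : ContDiff ℝ ∞ (evenExt w k) :=
  contDiff_of_local (c := 1) (by linarith) hk (fun t => by rw [evenExt_neg hw h0 h1, one_mul])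
    fun _ hx hx' n => evenExt_apply hw h0 h1 hx hx' n

theorem contDiff_oddExt (hw : 1 / 2 < w) (hk : ContDiff ℝ ∞ b)
    (h0 : ∀ x, |x| < 1 / 2 → b (-x) = -b x)
    (h1 : ∀ x, |x| < 1 / 2 → b (w + x) = -b (w - x)) : ContDiff ℝ ∞ (oddExt w b) :=
  contDiff_of_local (c := -1) (by linarith) hk
    (fun t => by rw [oddExt_neg hw h0 h1, neg_one_mul])
    fun _ hx hx' n => oddExt_apply hw h0 h1 hx hx' n

end Ext

/-! ### The rounded triangle wave -/

/-- The function `x`, bent near `0` and near `w` so as to be even at `0` and at `w`. -/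
noncomputable def bend (w x : ℝ) : ℝ := rnd x + (w - x) - rnd (w - x)

/-- The rounded triangle wave: a smooth even function of period `2 w` that agrees with `t` for
`1/4 ≤ t ≤ w - 1/4`. -/
noncomputable def wave (w : ℝ) : ℝ → ℝ := evenExt w (bend w)

section Wave

variable {w : ℝ}

theorem bend_of_le {x : ℝ} (h : x ≤ w - 1 / 4) : bend w x = rnd x := by
  rw [bend, rnd_eq_self (x := w - x) (by linarith)]
  ring

theorem bend_of_ge {x : ℝ} (h : 1 / 4 ≤ x) : bend w x = w - rnd (w - x) := by
  rw [bend, rnd_eq_self (x := x) h]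
  ring

theorem bend_eq_self {x : ℝ} (h : 1 / 4 ≤ x) (h' : x ≤ w - 1 / 4) : bend w x = x := by
  rw [bend_of_le h', rnd_eq_self h]

theorem bend_sub (x : ℝ) : bend w (w - x) = w - bend w x := by
  simp only [bend, sub_sub_cancel]
  ring

theorem contDiff_bend : ContDiff ℝ ∞ (bend w) := by
  unfold bend
  have := contDiff_rnd
  fun_prop

theorem bend_neg (hw : 1 ≤ w) (x : ℝ) (hx : |x| < 1 / 2) : bend w (-x) = bend w x := by
  rw [abs_lt] at hx
  rw [bend_of_le (by linarith), bend_of_le (by linarith), rnd_neg]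

theorem bend_add (hw : 1 ≤ w) (x : ℝ) (hx : |x| < 1 / 2) : bend w (w + x) = bend w (w - x) := by
  have h := bend_sub (w := w) (-x)
  rw [sub_neg_eq_add] at h
  rw [h, bend_sub, bend_neg hw x hx]

theorem wave_apply (hw : 1 ≤ w) {x : ℝ} (hx : -(1 / 2) < x) (hx' : x < w + 1 / 2) (n : ℤ) :
    wave w (x + 2 * w * n) = bend w x :=
  evenExt_apply (by linarith) (bend_neg hw) (bend_add hw) hx hx' n

theorem wave_eq_bend (hw : 1 ≤ w) {x : ℝ} (hx : -(1 / 2) < x) (hx' : x < w + 1 / 2) :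
    wave w x = bend w x := by
  simpa using wave_apply hw hx hx' 0

theorem wave_neg (hw : 1 ≤ w) (t : ℝ) : wave w (-t) = wave w t :=
  evenExt_neg (by linarith) (bend_neg hw) (bend_add hw) t

theorem wave_periodic (hw : 1 ≤ w) : Function.Periodic (wave w) (2 * w) :=
  evenExt_periodic (by linarith)

theorem wave_add_int (hw : 1 ≤ w) (t : ℝ) (n : ℤ) : wave w (t + 2 * w * n) = wave w t := by
  have := (wave_periodic hw).int_mul n t
  rwa [mul_comm (n : ℝ)] at this

theorem contDiff_wave (hw : 1 ≤ w) : ContDiff ℝ ∞ (wave w) :=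
  contDiff_evenExt (by linarith) contDiff_bend (bend_neg hw) (bend_add hw)

theorem wave_eq_self (hw : 1 ≤ w) {x : ℝ} (h : 1 / 4 ≤ x) (h' : x ≤ w - 1 / 4) :
    wave w x = x := by
  rw [wave_eq_bend hw (by linarith) (by linarith), bend_eq_self h h']

theorem wave_of_le (hw : 1 ≤ w) {x : ℝ} (h : -(1 / 2) < x) (h' : x ≤ w - 1 / 4) :
    wave w x = rnd x := by
  rw [wave_eq_bend hw h (by linarith), bend_of_le h']

theorem wave_of_ge (hw : 1 ≤ w) {x : ℝ} (h : 1 / 4 ≤ x) (h' : x < w + 1 / 2) :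
    wave w x = w - rnd (w - x) := by
  rw [wave_eq_bend hw (by linarith) h', bend_of_ge h]

theorem bend_near (hw : 1 ≤ w) {x : ℝ} (h : 0 ≤ x) (h' : x ≤ w) : |bend w x - x| ≤ 1 / 2 := by
  have h1 := rnd_le x
  have h2 := abs_le_rnd x
  have h3 := rnd_le (w - x)
  have h4 := abs_le_rnd (w - x)
  rw [abs_of_nonneg (by linarith)] at h1 h2 h3 h4
  rw [abs_le]
  rcases le_or_gt x (w - 1 / 4) with h5 | h5
  · rw [bend_of_le h5]; constructor <;> linarith
  · rw [bend_of_ge (by linarith)]; constructor <;> linarith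

theorem bend_pos (hw : 1 ≤ w) {x : ℝ} (h : 0 ≤ x) (h' : x ≤ w) : 0 < bend w x := by
  rcases le_or_gt x (w - 1 / 4) with h5 | h5
  · rw [bend_of_le h5]; exact rnd_pos x
  · have := (abs_le.1 (bend_near hw h h')).1
    linarith

theorem bend_lt (hw : 1 ≤ w) {x : ℝ} (h : 0 ≤ x) (h' : x ≤ w) : bend w x < w := by
  have := bend_pos hw (x := w - x) (by linarith) (by linarith)
  rw [bend_sub] at this
  linarith

theorem wave_cases (hw : 1 ≤ w) (t : ℝ) : ∃ (x : ℝ) (n : ℤ), 0 ≤ x ∧ x ≤ w ∧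
    (t = x + 2 * w * n ∨ t = -x + 2 * w * n) ∧ wave w t = bend w x := by
  obtain ⟨x, n, hx, hx', rfl⟩ := exists_eq_add (w := w) (by linarith) t
  rcases le_or_gt 0 x with h | h
  · exact ⟨x, n, h, hx'.le, Or.inl rfl, wave_apply hw (by linarith) (by linarith) n⟩
  · refine ⟨-x, n, by linarith, by linarith, Or.inr (by ring), ?_⟩
    rw [← wave_neg hw, ← wave_apply hw (by linarith) (by linarith) (-n)]
    congr 1
    push_cast
    ring

theorem wave_pos (hw : 1 ≤ w) (t : ℝ) : 0 < wave w t := by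
  obtain ⟨x, n, hx, hx', -, e⟩ := wave_cases hw t
  rw [e]
  exact bend_pos hw hx hx'

theorem wave_lt (hw : 1 ≤ w) (t : ℝ) : wave w t < w := by
  obtain ⟨x, n, hx, hx', -, e⟩ := wave_cases hw t
  rw [e]
  exact bend_lt hw hx hx'

end Wave

end Skein

namespace Skein

/-! ### Logarithmic polar coordinates -/

/-- The logarithmic polar coordinates `u`, `θ` with centre `a`, where `θ` has period `2 P`. -/
noncomputable def pol (P : ℝ) (a b : ℂ) (u θ : ℝ) : ℂ :=
  a + b * Complex.exp ((π / P : ℝ) * (u + θ * Complex.I))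

section Pol

variable {P : ℝ} {a b : ℂ}

theorem pol_eq_iff (hP : 0 < P) (hb : b ≠ 0) {u u' θ θ' : ℝ} :
    pol P a b u θ = pol P a b u' θ' ↔ u' = u ∧ ∃ n : ℤ, θ' = θ + 2 * P * n := by
  have hr : π / P ≠ 0 := (div_pos Real.pi_pos hP).ne'
  have hπ := Real.pi_ne_zero
  rw [pol, pol, add_right_inj, mul_right_inj' hb, eq_comm, Complex.exp_eq_exp_iff_exists_int]
  constructor
  · rintro ⟨n, hn⟩
    have h1 := congrArg Complex.re hn
    have h2 := congrArg Complex.im hn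
    simp only [Complex.mul_re, Complex.mul_im, Complex.add_re, Complex.add_im, Complex.ofReal_re,
      Complex.ofReal_im, Complex.I_re, Complex.I_im, Complex.intCast_re, Complex.intCast_im,
      Complex.re_ofNat, Complex.im_ofNat, mul_zero, zero_mul, sub_zero, add_zero, mul_one,
      zero_add] at h1 h2
    refine ⟨mul_left_cancel₀ hr h1, n, mul_left_cancel₀ hr ?_⟩
    rw [h2]
    field_simp
  · rintro ⟨rfl, n, rfl⟩
    refine ⟨n, ?_⟩
    have : (P : ℂ) ≠ 0 := Complex.ofReal_ne_zero.2 hP.ne'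
    push_cast
    field_simp
    ring

theorem pol_add_int (hP : 0 < P) (u θ : ℝ) (n : ℤ) :
    pol P a b u (θ + 2 * P * n) = pol P a b u θ := by
  rcases eq_or_ne b 0 with rfl | hb
  · simp [pol]
  · exact ((pol_eq_iff hP hb).2 ⟨rfl, n, rfl⟩).symm

theorem contDiff_pol {E : Type*} [NormedAddCommGroup E] [NormedSpace ℝ E] {f ϑ : E → ℝ}
    (hf : ContDiff ℝ ∞ f) (hϑ : ContDiff ℝ ∞ ϑ) :
    ContDiff ℝ ∞ fun t => pol P a b (f t) (ϑ t) := by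
  have h1 : ContDiff ℝ ∞ fun t => ((f t : ℝ) : ℂ) := Complex.ofRealCLM.contDiff.comp hf
  have h2 : ContDiff ℝ ∞ fun t => ((ϑ t : ℝ) : ℂ) := Complex.ofRealCLM.contDiff.comp hϑ
  unfold pol
  fun_prop

theorem deriv_pol_ne (hP : 0 < P) (hb : b ≠ 0) {f ϑ : ℝ → ℝ} {t : ℝ} (hf : DifferentiableAt ℝ f t)
    (hϑ : DifferentiableAt ℝ ϑ t) (h : deriv f t ≠ 0 ∨ deriv ϑ t ≠ 0) :
    deriv (fun t => pol P a b (f t) (ϑ t)) t ≠ 0 := by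
  have h1 : HasDerivAt (fun t => ((π / P : ℝ) : ℂ) * (f t + ϑ t * Complex.I))
      ((π / P : ℝ) * ((deriv f t : ℝ) + (deriv ϑ t : ℝ) * Complex.I)) t :=
    ((hf.hasDerivAt.ofReal_comp).add ((hϑ.hasDerivAt.ofReal_comp).mul_const _)).const_mul _
  have h2 := ((h1.cexp).const_mul b).const_add a
  have hr : ((π / P : ℝ) : ℂ) ≠ 0 := Complex.ofReal_ne_zero.2 (div_pos Real.pi_pos hP).ne'
  unfold pol
  rw [h2.deriv]
  refine mul_ne_zero hb (mul_ne_zero (Complex.exp_ne_zero _) (mul_ne_zero hr ?_))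
  intro h0
  have e1 := congrArg Complex.re h0
  have e2 := congrArg Complex.im h0
  simp at e1 e2
  tauto

/-- A closed curve in logarithmic polar coordinates. -/
theorem isLoop_pol {X : Set ℂ} {T : ℝ} (hP : 0 < P) (hb : b ≠ 0) {f ϑ : ℝ → ℝ} (hT : 0 < T)
    (hf : ContDiff ℝ ∞ f) (hϑ : ContDiff ℝ ∞ ϑ) (hfT : Function.Periodic f T)
    (hϑT : ∀ t, ∃ n : ℤ, ϑ (t + T) = ϑ t + 2 * P * n)
    (hm : ∀ t, pol P a b (f t) (ϑ t) ∈ X) (hd : ∀ t, deriv f t ≠ 0 ∨ deriv ϑ t ≠ 0)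
    (hs : ∀ t t' : ℝ, ∀ n : ℤ, f t' = f t → ϑ t' = ϑ t + 2 * P * n → ∃ m : ℤ, t' = t + m * T) :
    IsLoop X T fun t => pol P a b (f t) (ϑ t) where
  pos := hT
  smooth := contDiff_pol hf hϑ
  periodic t := by
    obtain ⟨n, hn⟩ := hϑT t
    simp only [hn, hfT t, pol_add_int hP]
  mem := hm
  deriv_ne t := deriv_pol_ne hP hb (hf.differentiable (by simp)).differentiableAt
    (hϑ.differentiable (by simp)).differentiableAt (hd t)
  simple t t' e := by
    obtain ⟨h1, n, h2⟩ := (pol_eq_iff hP hb).1 e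
    exact hs t t' n h1 h2

/-- A curve that winds once around the centre. -/
theorem isLoop_graph {X : Set ℂ} (hP : 0 < P) (hb : b ≠ 0) {φ : ℝ → ℝ}
    (hφ : ContDiff ℝ ∞ φ) (hφP : Function.Periodic φ (2 * P))
    (hm : ∀ t, pol P a b (φ t) t ∈ X) : IsLoop X (2 * P) fun t => pol P a b (φ t) t :=
  isLoop_pol hP hb (by linarith) hφ contDiff_id hφP (fun t => ⟨1, by simp⟩) hm
    (fun t => Or.inr (by simp)) fun t t' n _ h => ⟨n, by rw [h]; ring⟩

end Pol

/-! ### The local pictures at a crossing -/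

/-- The curves `u = v` and `u = - v`, with the first one at a height of `δ` above the middle level
at their intersection and the second one below it. -/
def crossT (δ u v η : ℝ) : Prop :=
  (u = v ∧ η = 1 / 2 + δ * bump v) ∨ (u = -v ∧ η = 1 / 2 - δ * bump v)

/-- The smoothing `|u| = rnd v` of the crossing of the curves `u = v` and `u = - v`. -/
def pinchT (u v η : ℝ) : Prop := |u| = rnd v ∧ η = 1 / 2

/-- The smoothing `|v| = rnd u` of the crossing of the curves `u = v` and `u = - v`. -/
def openT (u v η : ℝ) : Prop := |v| = rnd u ∧ η = 1 / 2

/-- The local pictures agree where `|v| ≥ 1/2`, and lie in a square where `|v| < 1/2`. -/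
structure IsLocalPicture (τ : ℝ → ℝ → ℝ → Prop) : Prop where
  far : ∀ {u v η}, 1 / 2 ≤ |v| → (τ u v η ↔ |u| = |v| ∧ η = 1 / 2)
  near : ∀ {u v η}, |v| < 1 / 2 → τ u v η → |u| < 1 / 2

theorem isLocalPicture_crossT (δ : ℝ) : IsLocalPicture (crossT δ) where
  far {u v η} h := by
    rw [crossT, bump_eq_zero (by linarith), abs_eq_abs]
    simp
    tauto
  near {u v η} h := by
    rintro (⟨rfl, -⟩ | ⟨rfl, -⟩)
    · exact h
    · rwa [abs_neg]

theorem isLocalPicture_pinchT : IsLocalPicture pinchT where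
  far {u v η} h := by rw [pinchT, rnd_eq_abs (by linarith)]
  near {u v η} h := by
    rintro ⟨e, -⟩
    rw [e]
    exact rnd_lt_half h

theorem isLocalPicture_openT : IsLocalPicture openT where
  far {u v η} h := by
    rw [openT, and_congr_left_iff]
    rintro -
    constructor
    · intro e
      have h1 : ¬ rnd u < 1 / 2 := by rw [← e]; linarith
      rw [rnd_lt_half_iff, not_lt] at h1
      rw [e, rnd_eq_abs (by linarith)]
    · intro e
      rw [rnd_eq_abs (by rw [e]; linarith), e]
  near {u v η} h := by
    rintro ⟨e, -⟩
    rw [← rnd_lt_half_iff, ← e]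
    exact h

/-- The box with centre at `u = 0`, `θ = θ₀`, whose chart is rotated by the unit number `e`. -/
noncomputable def polBox {X : Set ℂ} {P : ℝ} {a b : ℂ} (hP : 2 ≤ P) (hb : b ≠ 0) (θ₀ : ℝ) (e : ℂ)
    (he : ‖e‖ = 1) (hX : ∀ u y : ℝ, |u| ≤ 1 → |y| ≤ 1 → pol P a b u (θ₀ + y) ∈ X) : Box X where
  chart z := a + b * Complex.exp ((π / P : ℝ) * (θ₀ * Complex.I + e * z))
  lo := 0
  hi := 1
  smooth := by fun_prop
  injOn := by
    have hr : ((π / P : ℝ) : ℂ) ≠ 0 :=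
      Complex.ofReal_ne_zero.2 (div_pos Real.pi_pos (by linarith)).ne'
    have hr' : 0 < π / P := div_pos Real.pi_pos (by linarith)
    have he0 : e ≠ 0 := by rintro rfl; simp at he
    intro z hz z' hz' h
    simp only [Metric.mem_closedBall, dist_zero_right] at hz hz'
    simp only [add_right_inj, mul_right_inj' hb] at h
    rw [Complex.exp_eq_exp_iff_exists_int] at h
    obtain ⟨n, hn⟩ := h
    have h1 : ((π / P : ℝ) : ℂ) * (e * (z - z')) = n * (2 * π * Complex.I) := by
      linear_combination hn
    have h2 := congrArg norm h1
    have h3 : ‖z - z'‖ ≤ 2 := (norm_sub_le z z').trans (by linarith)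
    rw [norm_mul, norm_mul, he, Complex.norm_real, Real.norm_of_nonneg hr'.le] at h2
    simp only [norm_mul, Complex.norm_intCast, Complex.norm_ofNat, Complex.norm_real,
      Real.norm_of_nonneg Real.pi_pos.le, Complex.norm_I, mul_one, one_mul] at h2
    have h4 : |(n : ℝ)| * (2 * P) = ‖z - z'‖ := by
      have := Real.pi_ne_zero
      have : P ≠ 0 := by linarith
      field_simp at h2
      linarith
    have h5 : |(n : ℝ)| < 1 := by nlinarith [abs_nonneg (n : ℝ)]
    have h6 : n = 0 := by
      rw [← Int.abs_lt_one_iff]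
      exact_mod_cast h5
    rw [h6, Int.cast_zero, zero_mul] at h1
    simpa [hr, he0, sub_eq_zero, -Complex.ofReal_div] using h1
  orientation := by
    intro z _
    have hr : ((π / P : ℝ) : ℂ) ≠ 0 :=
      Complex.ofReal_ne_zero.2 (div_pos Real.pi_pos (by linarith)).ne'
    have he0 : e ≠ 0 := by rintro rfl; simp at he
    have h1 : HasDerivAt (fun z : ℂ => a + b * Complex.exp ((π / P : ℝ) * (θ₀ * Complex.I + e * z)))
        (b * (Complex.exp ((π / P : ℝ) * (θ₀ * Complex.I + e * z)) * ((π / P : ℝ) * e))) z := by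
      have := ((((hasDerivAt_id z).const_mul e).const_add (θ₀ * Complex.I)).const_mul
        ((π / P : ℝ) : ℂ)).cexp.const_mul b |>.const_add a
      simpa using this
    have h2 := (h1.hasFDerivAt.restrictScalars ℝ).fderiv
    set d := b * (Complex.exp ((π / P : ℝ) * (θ₀ * Complex.I + e * z)) * ((π / P : ℝ) * e)) with hd
    have hd0 : d ≠ 0 := mul_ne_zero hb (mul_ne_zero (Complex.exp_ne_zero _) (mul_ne_zero hr he0))
    rw [h2]
    have h3 : (((ContinuousLinearMap.toSpanSingleton ℂ d).restrictScalars ℝ : ℂ →L[ℝ] ℂ) :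
        ℂ →ₗ[ℝ] ℂ) = Algebra.lmul ℝ ℂ d := by
      ext z
      simp [mul_comm]
    rw [ContinuousLinearMap.det, h3]
    change 0 < Algebra.norm ℝ d
    rw [Algebra.norm_complex_apply]
    exact Complex.normSq_pos.2 hd0
  mapsTo := by
    intro z hz
    simp only [Metric.mem_closedBall, dist_zero_right] at hz
    have h1 : ‖e * z‖ ≤ 1 := by rwa [norm_mul, he, one_mul]
    have := hX (e * z).re (e * z).im ((Complex.abs_re_le_norm _).trans h1)
      ((Complex.abs_im_le_norm _).trans h1)
    change a + b * Complex.exp ((π / P : ℝ) * (θ₀ * Complex.I + e * z)) ∈ X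
    convert this using 1
    rw [pol]
    congr 4
    conv_lhs => rw [← Complex.re_add_im (e * z)]
    push_cast
    ring
  lo_nonneg := le_rfl
  hi_le_one := le_rfl

section Box

variable {X : Set ℂ} {P : ℝ} {a b : ℂ} (hP : 2 ≤ P) (hb : b ≠ 0) (θ₀ : ℝ) (e : ℂ)
    (he : ‖e‖ = 1) (hX : ∀ u y : ℝ, |u| ≤ 1 → |y| ≤ 1 → pol P a b u (θ₀ + y) ∈ X)

theorem polBox_chart (z : ℂ) :
    (polBox hP hb θ₀ e he hX).chart z = pol P a b (e * z).re (θ₀ + (e * z).im) := by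
  change a + b * Complex.exp ((π / P : ℝ) * (θ₀ * Complex.I + e * z)) = _
  rw [pol]
  congr 4
  conv_lhs => rw [← Complex.re_add_im (e * z)]
  push_cast
  ring

theorem mem_polBox_region {p : ℂ × ℝ} : p ∈ (polBox hP hb θ₀ e he hX).region ↔
    (∃ u y : ℝ, u ^ 2 + y ^ 2 ≤ 1 ∧ p.1 = pol P a b u (θ₀ + y)) ∧ p.2 ∈ Set.Icc (0 : ℝ) 1 := by
  rw [Box.region, Set.mem_prod]
  refine and_congr ?_ Iff.rfl
  have he0 : e ≠ 0 := by rintro rfl; simp at he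
  constructor
  · rintro ⟨z, hz, h⟩
    rw [polBox_chart] at h
    simp only [Metric.mem_closedBall, dist_zero_right] at hz
    refine ⟨_, _, ?_, h.symm⟩
    have h1 : ‖e * z‖ ^ 2 ≤ 1 := by rw [norm_mul, he, one_mul]; nlinarith [norm_nonneg z]
    rw [← Complex.normSq_eq_norm_sq, Complex.normSq_apply] at h1
    linarith
  · rintro ⟨u, y, h, h'⟩
    have e1 : e * (e⁻¹ * (u + y * Complex.I)) = u + y * Complex.I := by field_simp
    refine ⟨e⁻¹ * (u + y * Complex.I), ?_, ?_⟩
    · rw [Metric.mem_closedBall, dist_zero_right, norm_mul, norm_inv, he, inv_one, one_mul,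
        ← sq_le_one_iff₀ (norm_nonneg _), ← Complex.normSq_eq_norm_sq, Complex.normSq_add_mul_I]
      exact h
    · rw [polBox_chart, e1, h']
      simp

/-- In the box, the vertically framed link `L` is given by the local picture `τ`. -/
def FramedLink.IsDrawn (P : ℝ) (a b : ℂ) (θ₀ : ℝ) (L : FramedLink X) (τ : ℝ → ℝ → ℝ → Prop) :
    Prop :=
  (∀ x ∈ L.carrier, x.2 = (0, 1)) ∧ ∀ u y η : ℝ, u ^ 2 + y ^ 2 ≤ 1 →
    (((pol P a b u (θ₀ + y), η), ((0 : ℂ), (1 : ℝ))) ∈ L.carrier ↔ τ u y η)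

theorem looksLike_of_isDrawn {L : FramedLink X} {τ : ℝ → ℝ → ℝ → Prop}
    (h : L.IsDrawn P a b θ₀ τ) (A A' : Set ℂ) (k k' : ℂ → ℝ)
    (hτ : ∀ z η, ‖z‖ ≤ 1 → (τ (e * z).re (e * z).im η ↔ (z ∈ A ∧ η = k z) ∨ (z ∈ A' ∧ η = k' z))) :
    L.LooksLike (polBox hP hb θ₀ e he hX)
      ((polBox hP hb θ₀ e he hX).draw k A ∪ (polBox hP hb θ₀ e he hX).draw k' A') := by
  have hball : ∀ z : ℂ, ‖z‖ ≤ 1 → (e * z).re ^ 2 + (e * z).im ^ 2 ≤ 1 := by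
    intro z hz
    have h1 : ‖e * z‖ ^ 2 ≤ 1 := by rw [norm_mul, he, one_mul]; nlinarith [norm_nonneg z]
    rw [← Complex.normSq_eq_norm_sq, Complex.normSq_apply] at h1
    linarith
  constructor
  · ext p
    constructor
    · rintro ⟨⟨x, hx, rfl⟩, ⟨z, hz, hzx⟩, hη⟩
      simp only [Metric.mem_closedBall, dist_zero_right] at hz
      have hx' : x = ((pol P a b (e * z).re (θ₀ + (e * z).im), x.1.2), ((0 : ℂ), (1 : ℝ))) := by
        rw [← polBox_chart hP hb θ₀ e he hX, hzx]
        exact Prod.ext rfl (h.1 x hx)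
      have h1 := (h.2 _ _ x.1.2 (hball z hz)).1 (hx' ▸ hx)
      rcases (hτ z _ hz).1 h1 with ⟨h2, h3⟩ | ⟨h2, h3⟩
      · exact Or.inl ⟨z, ⟨h2, by simpa using hz⟩, Prod.ext hzx h3.symm⟩
      · exact Or.inr ⟨z, ⟨h2, by simpa using hz⟩, Prod.ext hzx h3.symm⟩
    · have key : ∀ z η, ‖z‖ ≤ 1 → τ (e * z).re (e * z).im η →
          ((polBox hP hb θ₀ e he hX).chart z, η) ∈
            Prod.fst '' L.carrier ∩ (polBox hP hb θ₀ e he hX).region := by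
        intro z η hz hη
        have h1 := (h.2 _ _ η (hball z hz)).2 hη
        rw [polBox_chart]
        refine ⟨⟨_, h1, rfl⟩, ?_⟩
        rw [mem_polBox_region]
        exact ⟨⟨_, _, hball z hz, rfl⟩, L.height_mem h1⟩
      rintro (⟨z, ⟨hz, hz'⟩, rfl⟩ | ⟨z, ⟨hz, hz'⟩, rfl⟩)
      · rw [Metric.mem_closedBall, dist_zero_right] at hz'
        exact key z _ hz' ((hτ z _ hz').2 (Or.inl ⟨hz, rfl⟩))
      · rw [Metric.mem_closedBall, dist_zero_right] at hz'
        exact key z _ hz' ((hτ z _ hz').2 (Or.inr ⟨hz, rfl⟩))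
  · intro x hx _
    rw [h.1 x hx]
    simp

theorem isSkeinTriple_of_isDrawn {θ₀ : ℝ} (hP : 2 ≤ P) (hb : b ≠ 0) {L LI LO : FramedLink X} {δ : ℝ}
    (hX : ∀ u y : ℝ, |u| ≤ 1 → |y| ≤ 1 → pol P a b u (θ₀ + y) ∈ X)
    (h : L.IsDrawn P a b θ₀ (crossT δ)) (hI : LI.IsDrawn P a b θ₀ pinchT)
    (hO : LO.IsDrawn P a b θ₀ openT)
    (haI : ∀ x : (ℂ × ℝ) × (ℂ × ℝ),
      (¬ ∃ u y : ℝ, u ^ 2 + y ^ 2 ≤ 1 ∧ x.1.1 = pol P a b u (θ₀ + y)) →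
      (x ∈ L.carrier ↔ x ∈ LI.carrier))
    (haO : ∀ x : (ℂ × ℝ) × (ℂ × ℝ),
      (¬ ∃ u y : ℝ, u ^ 2 + y ^ 2 ≤ 1 ∧ x.1.1 = pol P a b u (θ₀ + y)) →
      (x ∈ L.carrier ↔ x ∈ LO.carrier)) :
    (0 < δ → IsSkeinTriple L LI LO) ∧ (δ < 0 → IsSkeinTriple L LO LI) := by
  have agree : ∀ {M : FramedLink X} (e : ℂ) (he : ‖e‖ = 1), (∀ x : (ℂ × ℝ) × (ℂ × ℝ),
      (¬ ∃ u y : ℝ, u ^ 2 + y ^ 2 ≤ 1 ∧ x.1.1 = pol P a b u (θ₀ + y)) →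
      (x ∈ L.carrier ↔ x ∈ M.carrier)) → L.AgreeOutside (polBox hP hb θ₀ e he hX) M := by
    intro M e he ha
    have key : ∀ {N : FramedLink X} {x}, x ∈ N.carrier → x.1 ∉ (polBox hP hb θ₀ e he hX).region →
        ¬ ∃ u y : ℝ, u ^ 2 + y ^ 2 ≤ 1 ∧ x.1.1 = pol P a b u (θ₀ + y) := by
      intro N x hx hr hu
      exact hr ((mem_polBox_region hP hb θ₀ e he hX).2 ⟨hu, N.height_mem hx⟩)
    ext x
    exact ⟨fun hx => ⟨(ha x (key hx.1 hx.2)).1 hx.1, hx.2⟩,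
      fun hx => ⟨(ha x (key hx.1 hx.2)).2 hx.1, hx.2⟩⟩
  have hb' := bump.continuous
  constructor
  · intro hδ'
    refine ⟨polBox hP hb θ₀ 1 (by simp) hX, rnd, fun z => 1 / 2 + δ * bump z.im,
      fun z => 1 / 2 - δ * bump z.im, fun _ => 1 / 2, fun _ => 1 / 2, isRounding_rnd, ?_, ?_,
      continuous_const, continuous_const, ?_, ?_, ?_, ?_, agree 1 (by simp) haI,
      agree 1 (by simp) haO⟩
    · have := Complex.continuous_im; fun_prop
    · have := Complex.continuous_im; fun_prop
    · simp only [Complex.zero_im, bump_zero]; linarith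
    · apply looksLike_of_isDrawn (h := h)
      intro z η _
      simp only [one_mul, crossT, Set.mem_ofPred_eq]
      refine or_congr (and_congr_left fun _ => eq_comm) (and_congr_left fun _ => ?_)
      constructor <;> intro <;> linarith
    · rw [← Set.union_self (Box.draw _ _ _)]
      apply looksLike_of_isDrawn (h := hI)
      intro z η _
      simp only [one_mul, pinchT, Set.mem_ofPred_eq, or_self]
    · rw [← Set.union_self (Box.draw _ _ _)]
      apply looksLike_of_isDrawn (h := hO)
      intro z η _
      simp only [one_mul, openT, Set.mem_ofPred_eq, or_self]
  · intro hδ'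
    refine ⟨polBox hP hb θ₀ Complex.I (by simp) hX, rnd, fun z => 1 / 2 - δ * bump z.re,
      fun z => 1 / 2 + δ * bump z.re, fun _ => 1 / 2, fun _ => 1 / 2, isRounding_rnd, ?_, ?_,
      continuous_const, continuous_const, ?_, ?_, ?_, ?_, agree _ (by simp) haO,
      agree _ (by simp) haI⟩
    · have := Complex.continuous_re; fun_prop
    · have := Complex.continuous_re; fun_prop
    · simp only [Complex.zero_re, bump_zero]; linarith
    · apply looksLike_of_isDrawn (h := h)
      intro z η _
      simp only [Complex.I_mul_re, Complex.I_mul_im, crossT, Set.mem_ofPred_eq]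
      rw [or_comm]
      refine or_congr (and_congr_left fun _ => ?_) (and_congr_left fun _ => ?_)
      · constructor <;> intro <;> linarith
      · constructor <;> intro <;> linarith
    · rw [← Set.union_self (Box.draw _ _ _)]
      apply looksLike_of_isDrawn (h := hO)
      intro z η _
      simp only [Complex.I_mul_re, Complex.I_mul_im, openT, Set.mem_ofPred_eq, or_self, rnd_neg]
    · rw [← Set.union_self (Box.draw _ _ _)]
      apply looksLike_of_isDrawn (h := hI)
      intro z η _
      simp only [Complex.I_mul_re, Complex.I_mul_im, pinchT, Set.mem_ofPred_eq, or_self, abs_neg]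

end Box

end Skein

namespace Skein

/-! ### Folded curves -/

/-- The odd functions `f` of period `2 w` for which the curve `(f t, wave w t)` is simple. -/
structure IsFold (w : ℝ) (f : ℝ → ℝ) : Prop where
  smooth : ContDiff ℝ ∞ f
  odd : ∀ t, f (-t) = -f t
  periodic : Function.Periodic f (2 * w)
  pos : ∀ t, 0 < t → t < w → 0 < f t
  deriv_pos : ∀ t, |t| < 1 / 2 → 0 < deriv f t
  deriv_neg : ∀ t, |t - w| < 1 / 2 → deriv f t < 0

theorem deriv_wave {w : ℝ} (hw : 1 ≤ w) {x : ℝ} (h : 1 / 4 < x) (h' : x < w - 1 / 4) :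
    deriv (wave w) x = 1 := by
  have : wave w =ᶠ[nhds x] id := by
    filter_upwards [Ioo_mem_nhds h h'] with y hy
    exact wave_eq_self hw hy.1.le hy.2.le
  rw [this.deriv_eq, deriv_id]

theorem deriv_add_two_mul {f : ℝ → ℝ} {w : ℝ} (hf : Function.Periodic f (2 * w)) (t : ℝ) (n : ℤ) :
    deriv f (t + 2 * w * n) = deriv f t := by
  have h : (fun t => f (t + 2 * w * n)) = f := by
    funext t
    have := hf.int_mul n t
    rwa [mul_comm (n : ℝ)] at this
  conv_rhs => rw [← h]
  rw [deriv_comp_add_const]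

theorem deriv_neg_of_odd {f : ℝ → ℝ} (hf : ∀ t, f (-t) = -f t) (t : ℝ) :
    deriv f (-t) = deriv f t := by
  have h : (fun t => f (-t)) = fun t => -f t := funext hf
  have h1 := congrArg (fun g => deriv g t) h
  simp only [deriv_comp_neg, deriv.fun_neg, neg_inj] at h1
  exact h1

theorem deriv_neg_of_even {f : ℝ → ℝ} (hf : ∀ t, f (-t) = f t) (t : ℝ) :
    deriv f (-t) = -deriv f t := by
  have h : (fun t => f (-t)) = f := funext hf
  have h1 := congrArg (fun g => deriv g t) h
  simp only [deriv_comp_neg] at h1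
  linarith

theorem bend_inj {w x x' : ℝ} (hw : 1 ≤ w) (hx : 0 ≤ x) (hxw : x ≤ w) (hx' : 0 ≤ x')
    (hxw' : x' ≤ w) (h : bend w x = bend w x') :
    x = x' ∨ (x < 1 / 2 ∧ x' < 1 / 2) ∨ (w - x < 1 / 2 ∧ w - x' < 1 / 2) := by
  have key : ∀ y, 0 ≤ y → y ≤ w → (y < 1 / 2 ∧ bend w y < 1 / 2) ∨
      (w - y < 1 / 2 ∧ w - bend w y < 1 / 2) ∨ (1 / 2 ≤ y ∧ 1 / 2 ≤ w - y ∧ bend w y = y) := by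
    intro y hy hyw
    rcases lt_or_ge y (1 / 2) with h1 | h1
    · left
      rw [bend_of_le (by linarith)]
      exact ⟨h1, rnd_lt_half (abs_lt.2 ⟨by linarith, h1⟩)⟩
    rcases lt_or_ge (w - y) (1 / 2) with h2 | h2
    · right; left
      rw [bend_of_ge (by linarith)]
      refine ⟨h2, ?_⟩
      have := rnd_lt_half (x := w - y) (abs_lt.2 ⟨by linarith, h2⟩)
      linarith
    · right; right
      exact ⟨h1, h2, bend_eq_self (by linarith) (by linarith)⟩
  rcases key x hx hxw with ⟨h1, h2⟩ | ⟨h1, h2⟩ | ⟨h1, h2, h3⟩ <;>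
  rcases key x' hx' hxw' with ⟨h1', h2'⟩ | ⟨h1', h2'⟩ | ⟨h1', h2', h3'⟩
  · exact Or.inr (Or.inl ⟨h1, h1'⟩)
  · linarith
  · linarith
  · linarith
  · exact Or.inr (Or.inr ⟨h1, h1'⟩)
  · linarith
  · linarith
  · linarith
  · left; linarith

/-- A function with `f (-t) = - f t` and period `2 w`, in terms of its values on `[0, w]`. -/
theorem odd_cases {w : ℝ} (hw : 1 ≤ w) {f : ℝ → ℝ} (hf : ∀ t, f (-t) = -f t)
    (hp : Function.Periodic f (2 * w)) (t : ℝ) : ∃ (x σ : ℝ) (n : ℤ), 0 ≤ x ∧ x ≤ w ∧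
      (σ = 1 ∨ σ = -1) ∧ t = σ * x + 2 * w * n ∧ wave w t = bend w x ∧ f t = σ * f x := by
  obtain ⟨x, n, hx, hxw, ht, e⟩ := wave_cases hw t
  have hp' : ∀ t, f (t + 2 * w * n) = f t := fun t => by
    have := hp.int_mul n t
    rwa [mul_comm (n : ℝ)] at this
  rcases ht with rfl | rfl
  · exact ⟨x, 1, n, hx, hxw, Or.inl rfl, by ring, e, by rw [hp', one_mul]⟩
  · exact ⟨x, -1, n, hx, hxw, Or.inr rfl, by ring, e, by rw [hp', hf, neg_one_mul]⟩

theorem IsFold.zero {w : ℝ} {f : ℝ → ℝ} (hf : IsFold w f) : f 0 = 0 := by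
  have := hf.odd 0
  rw [neg_zero] at this
  linarith

theorem IsFold.end {w : ℝ} {f : ℝ → ℝ} (hf : IsFold w f) : f w = 0 := by
  have h1 := hf.odd w
  have h2 := hf.periodic (-w)
  rw [show -w + 2 * w = w by ring] at h2
  linarith

theorem IsFold.nonneg {w : ℝ} {f : ℝ → ℝ} (hf : IsFold w f) {x : ℝ} (hx : 0 ≤ x) (hxw : x ≤ w) :
    0 ≤ f x := by
  rcases hx.eq_or_lt with rfl | hx
  · rw [hf.zero]
  rcases hxw.eq_or_lt with rfl | hxw
  · rw [hf.end]
  exact (hf.pos x hx hxw).le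

theorem IsFold.injOn {w : ℝ} {f : ℝ → ℝ} (hf : IsFold w f) (hw : 1 ≤ w) {x x' : ℝ} (hx : 0 ≤ x)
    (hxw : x ≤ w) (hx' : 0 ≤ x') (hxw' : x' ≤ w) (h : bend w x = bend w x') (h' : f x = f x') :
    x = x' := by
  rcases bend_inj hw hx hxw hx' hxw' h with h1 | ⟨h1, h2⟩ | ⟨h1, h2⟩
  · exact h1
  · have : StrictMonoOn f (Set.Ioo (-(1 / 2)) (1 / 2)) := by
      apply strictMonoOn_of_deriv_pos (convex_Ioo _ _) hf.smooth.continuous.continuousOn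
      rw [interior_Ioo]
      exact fun t ht => hf.deriv_pos t (abs_lt.2 ht)
    exact this.injOn ⟨by linarith, h1⟩ ⟨by linarith, h2⟩ h'
  · have : StrictAntiOn f (Set.Ioo (w - 1 / 2) (w + 1 / 2)) := by
      apply strictAntiOn_of_deriv_neg (convex_Ioo _ _) hf.smooth.continuous.continuousOn
      rw [interior_Ioo]
      exact fun t ht => hf.deriv_neg t (abs_lt.2 ⟨by linarith [ht.1], by linarith [ht.2]⟩)
    exact this.injOn ⟨by linarith, by linarith⟩ ⟨by linarith, by linarith⟩ h'

theorem fold_deriv_ne {w : ℝ} {f : ℝ → ℝ} (hw : 1 ≤ w) (hodd : ∀ t, f (-t) = -f t)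
    (hp : Function.Periodic f (2 * w)) (h0 : ∀ t, |t| < 1 / 2 → deriv f t ≠ 0)
    (h1 : ∀ t, |t - w| < 1 / 2 → deriv f t ≠ 0) (θ₁ t : ℝ) :
    deriv f t ≠ 0 ∨ deriv (fun t => θ₁ + wave w t) t ≠ 0 := by
  obtain ⟨x, σ, n, hx, hxw, hσ, rfl, -, -⟩ := odd_cases hw hodd hp t
  have e1 : deriv f (σ * x + 2 * w * n) = deriv f x := by
    rw [deriv_add_two_mul hp]
    rcases hσ with rfl | rfl
    · rw [one_mul]
    · rw [neg_one_mul, deriv_neg_of_odd hodd]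
  have e2 : deriv (wave w) (σ * x + 2 * w * n) = σ * deriv (wave w) x := by
    rw [deriv_add_two_mul (wave_periodic hw)]
    rcases hσ with rfl | rfl
    · rw [one_mul, one_mul]
    · rw [neg_one_mul, deriv_neg_of_even (wave_neg hw), neg_one_mul]
  rw [deriv_const_add, e1, e2]
  by_cases h2 : x < 1 / 2
  · exact Or.inl (h0 x (abs_lt.2 ⟨by linarith, h2⟩))
  by_cases h3 : w - 1 / 2 < x
  · exact Or.inl (h1 x (abs_lt.2 ⟨by linarith, by linarith⟩))
  · right
    rw [deriv_wave hw (by linarith) (by linarith), mul_one]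
    rcases hσ with rfl | rfl <;> norm_num

/-- The closed curve `(f t, θ₁ + wave w t)` in logarithmic polar coordinates. -/
theorem isLoop_fold {X : Set ℂ} {P : ℝ} {a b : ℂ} (hP : 0 < P) (hb : b ≠ 0) {w : ℝ} {f : ℝ → ℝ}
    (hw : 1 ≤ w) (hwP : w ≤ 2 * P) (hf : IsFold w f) (θ₁ : ℝ)
    (hm : ∀ t, pol P a b (f t) (θ₁ + wave w t) ∈ X) :
    IsLoop X (2 * w) fun t => pol P a b (f t) (θ₁ + wave w t) := by
  refine isLoop_pol hP hb (by linarith) hf.smooth (contDiff_const.add (contDiff_wave hw))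
    hf.periodic (fun t => ⟨0, by rw [wave_periodic hw]; simp⟩) hm
    (fold_deriv_ne hw hf.odd hf.periodic (fun t ht => (hf.deriv_pos t ht).ne')
      (fun t ht => (hf.deriv_neg t ht).ne) θ₁) ?_
  intro t t' n h1 h2
  have hn : n = 0 := by
    have b1 := wave_pos hw t
    have b2 := wave_pos hw t'
    have b3 := wave_lt hw t
    have b4 := wave_lt hw t'
    by_contra hn
    rcases lt_or_gt_of_ne hn with h | h
    · have : (n : ℝ) ≤ -1 := by exact_mod_cast (by omega : n ≤ -1)
      nlinarith
    · have : (1 : ℝ) ≤ n := by exact_mod_cast (by omega : 1 ≤ n)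
      nlinarith
  subst hn
  obtain ⟨x, σ, n, hx, hxw, hσ, rfl, e1, e2⟩ := odd_cases hw hf.odd hf.periodic t
  obtain ⟨x', σ', n', hx', hxw', hσ', rfl, e1', e2'⟩ := odd_cases hw hf.odd hf.periodic t'
  rw [e1, e1', Int.cast_zero, mul_zero, add_zero, add_right_inj] at h2
  rw [e2, e2'] at h1
  have p1 := hf.nonneg hx hxw
  have p2 := hf.nonneg hx' hxw'
  have h3 : f x' = f x := by
    rcases hσ with rfl | rfl <;> rcases hσ' with rfl | rfl <;> linarith
  have h4 := hf.injOn hw hx' hxw' hx hxw h2 h3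
  subst h4
  by_cases hσσ : σ = σ'
  · subst hσσ
    exact ⟨n' - n, by push_cast; ring⟩
  · have h5 : f x' = 0 := by
      rcases hσ with rfl | rfl <;> rcases hσ' with rfl | rfl <;>
        first | exact absurd rfl hσσ | linarith
    rcases hx.eq_or_lt with h6 | h6
    · subst h6
      exact ⟨n' - n, by push_cast; ring⟩
    rcases hxw.eq_or_lt with h7 | h7
    · subst h7
      rcases hσ with rfl | rfl <;> rcases hσ' with rfl | rfl
      · exact absurd rfl hσσ
      · exact ⟨n' - n - 1, by push_cast; ring⟩
      · exact ⟨n' - n + 1, by push_cast; ring⟩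
      · exact absurd rfl hσσ
    · exact absurd h5 (hf.pos x' h6 h7).ne'

theorem odd_of_eq_self {b : ℝ → ℝ} (h0 : ∀ x, |x| ≤ 1 → b x = x) (x : ℝ) (hx : |x| < 1 / 2) :
    b (-x) = -b x := by
  rw [h0 x (by linarith), h0 (-x) (by rw [abs_neg]; linarith)]

theorem odd_of_eq_mul {w c : ℝ} {b : ℝ → ℝ} (h1 : ∀ x, |x| ≤ 1 → b (w + x) = c * x) (x : ℝ)
    (hx : |x| < 1 / 2) : b (w + x) = -b (w - x) := by
  rw [h1 x (by linarith), sub_eq_add_neg, h1 (-x) (by rw [abs_neg]; linarith)]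
  ring

theorem isFold_oddExt {w : ℝ} (hw : 2 ≤ w) {b : ℝ → ℝ} (hb : ContDiff ℝ ∞ b)
    (h0 : ∀ x, |x| ≤ 1 → b x = x) (h1 : ∀ x, |x| ≤ 1 → b (w + x) = -1 * x)
    (hpos : ∀ x, 0 < x → x < w → 0 < b x) : IsFold w (oddExt w b) := by
  have o0 := odd_of_eq_self h0
  have o1 := odd_of_eq_mul h1
  have key : ∀ x, -(1 / 2) < x → x < w + 1 / 2 → oddExt w b x = b x := fun x hx hx' => by
    simpa using oddExt_apply (by linarith) o0 o1 hx hx' 0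
  refine ⟨contDiff_oddExt (by linarith) hb o0 o1, oddExt_neg (by linarith) o0 o1,
    oddExt_periodic (by linarith), ?_, ?_, ?_⟩
  · intro t ht ht'
    rw [key t (by linarith) (by linarith)]
    exact hpos t ht ht'
  · intro t ht
    rw [abs_lt] at ht
    have : oddExt w b =ᶠ[nhds t] id := by
      filter_upwards [Ioo_mem_nhds ht.1 ht.2] with y hy
      rw [key y hy.1 (by linarith [hy.2]), h0 y (abs_le.2 ⟨by linarith [hy.1], by linarith [hy.2]⟩)]
      rfl
    rw [this.deriv_eq, deriv_id]
    norm_num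
  · intro t ht
    rw [abs_lt] at ht
    have : oddExt w b =ᶠ[nhds t] fun y => w - y := by
      filter_upwards [Ioo_mem_nhds (show w - 1 / 2 < t by linarith)
        (show t < w + 1 / 2 by linarith)] with y hy
      have := h1 (y - w) (abs_le.2 ⟨by linarith [hy.1], by linarith [hy.2]⟩)
      rw [key y (by linarith [hy.1]) hy.2]
      rw [add_sub_cancel] at this
      rw [this]
      ring
    rw [this.deriv_eq]
    simp

theorem IsFold.flip {w : ℝ} {f : ℝ → ℝ} (hf : IsFold w f) : IsFold w fun t => f (w - t) := by
  have hp : ∀ t, f (t + 2 * w) = f t := hf.periodic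
  refine ⟨?_, ?_, ?_, ?_, ?_, ?_⟩
  · have := hf.smooth
    fun_prop
  · intro t
    have h1 := hf.odd (w - t)
    have h2 := hp (-(w - t))
    rw [show -(w - t) + 2 * w = w - -t by ring] at h2
    linarith
  · intro t
    have := hp (w - (t + 2 * w))
    rw [show w - (t + 2 * w) + 2 * w = w - t by ring] at this
    exact this.symm
  · exact fun t ht ht' => hf.pos _ (by linarith) (by linarith)
  · intro t ht
    rw [deriv_comp_const_sub]
    have := hf.deriv_neg (w - t) (by rw [show w - t - w = -t by ring, abs_neg]; exact ht)
    linarith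
  · intro t ht
    rw [deriv_comp_const_sub]
    have := hf.deriv_pos (w - t) (by rw [abs_sub_comm]; exact ht)
    linarith

/-! ### Antiperiodic extensions -/

/-- The extension of `b` from `[0, w]` by `f (t + w) = - f t`. -/
noncomputable def antiExt (w : ℝ) (b : ℝ → ℝ) (t : ℝ) : ℝ :=
  (-1) ^ ⌊t / w⌋ * b (t - w * ⌊t / w⌋)

section Anti

variable {w : ℝ} {b : ℝ → ℝ}

theorem antiExt_apply (hw : 1 / 2 < w) (h : ∀ x, |x| < 1 / 2 → b (w + x) = -b x) {x : ℝ}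
    (hx : -(1 / 2) < x) (hx' : x < w + 1 / 2) (n : ℤ) :
    antiExt w b (x + w * n) = (-1) ^ n * b x := by
  have hw0 : 0 < w := by linarith
  have hf : ∀ m : ℤ, w * m ≤ x → x < w * m + w → ⌊(x + w * n) / w⌋ = n + m := by
    intro m h1 h2
    rw [Int.floor_eq_iff]
    push_cast
    constructor
    · rw [le_div_iff₀ hw0]; linarith
    · rw [div_lt_iff₀ hw0]; linarith
  have hne : (-1 : ℝ) ≠ 0 := by norm_num
  rcases lt_or_ge x 0 with h0 | h0
  · have e := hf (-1) (by push_cast; linarith) (by push_cast; linarith)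
    have e2 := h x (abs_lt.2 ⟨hx, by linarith⟩)
    rw [antiExt, e, zpow_add₀ hne]
    push_cast
    rw [show x + w * n - w * (n + -1) = w + x by ring, e2]
    norm_num
  rcases lt_or_ge x w with h1 | h1
  · have e := hf 0 (by push_cast; linarith) (by push_cast; linarith)
    rw [antiExt, e, add_zero, add_sub_cancel_right]
  · have e := hf 1 (by push_cast; linarith) (by push_cast; linarith)
    have e2 := h (x - w) (abs_lt.2 ⟨by linarith, by linarith⟩)
    rw [add_sub_cancel] at e2
    rw [antiExt, e, zpow_add₀ hne]
    push_cast
    rw [show x + w * n - w * (n + 1) = x - w by ring, e2]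
    norm_num

theorem exists_eq_add_mul (hw : 0 < w) (t : ℝ) :
    ∃ (x : ℝ) (n : ℤ), 0 ≤ x ∧ x < w ∧ t = x + w * n := by
  refine ⟨t - w * ⌊t / w⌋, ⌊t / w⌋, ?_, ?_, by ring⟩
  · have := Int.floor_le (t / w)
    rw [le_div_iff₀ hw] at this
    linarith
  · have := Int.lt_floor_add_one (t / w)
    rw [div_lt_iff₀ hw] at this
    linarith

theorem contDiff_antiExt (hw : 1 / 2 < w) (hb : ContDiff ℝ ∞ b)
    (h : ∀ x, |x| < 1 / 2 → b (w + x) = -b x) : ContDiff ℝ ∞ (antiExt w b) := by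
  rw [contDiff_iff_contDiffAt]
  intro t
  obtain ⟨x, n, hx, hx', rfl⟩ := exists_eq_add_mul (w := w) (by linarith) t
  have h1 : ContDiff ℝ ∞ fun t => (-1) ^ n * b (t - w * n) := by fun_prop
  refine h1.contDiffAt.congr_of_eventuallyEq ?_
  have h2 : Set.Ioo (-(1 / 2) + w * n) (w + 1 / 2 + w * n) ∈ nhds (x + w * n) :=
    Ioo_mem_nhds (by linarith) (by linarith)
  filter_upwards [h2] with t ht
  have := antiExt_apply hw h (x := t - w * n) (by linarith [ht.1]) (by linarith [ht.2]) n
  rwa [sub_add_cancel] at this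

theorem antiExt_add (hw : 1 / 2 < w) (h : ∀ x, |x| < 1 / 2 → b (w + x) = -b x) (t : ℝ) (n : ℤ) :
    antiExt w b (t + w * n) = (-1) ^ n * antiExt w b t := by
  obtain ⟨x, m, hx, hx', rfl⟩ := exists_eq_add_mul (w := w) (by linarith) t
  rw [show x + w * m + w * n = x + w * (m + n : ℤ) by push_cast; ring,
    antiExt_apply hw h (by linarith) (by linarith), antiExt_apply hw h (by linarith) (by linarith),
    zpow_add₀ (by norm_num)]
  ring

end Anti

end Skein

namespace Skein

/-! ### Two curves with two crossings: the pictures -/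

/-- The profile of the two crossing curves `u = prof θ` and `u = - prof θ`. -/
noncomputable def prof (P H θ : ℝ) : ℝ := wave P θ - H

section Prof

variable {P H : ℝ}

theorem contDiff_prof (hP : 1 ≤ P) : ContDiff ℝ ∞ (prof P H) :=
  (contDiff_wave hP).sub contDiff_const

theorem prof_neg (hP : 1 ≤ P) (θ : ℝ) : prof P H (-θ) = prof P H θ := by
  rw [prof, prof, wave_neg hP]

theorem prof_add_int (hP : 1 ≤ P) (θ : ℝ) (n : ℤ) : prof P H (θ + 2 * P * n) = prof P H θ := by
  rw [prof, prof, wave_add_int hP]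

theorem prof_periodic (hP : 1 ≤ P) : Function.Periodic (prof P H) (2 * P) := fun θ => by
  rw [prof, prof, wave_periodic hP]

theorem prof_near (hH : 4 ≤ H) (hP : H + 4 ≤ P) {θ : ℝ} (h : |θ - H| ≤ 3) :
    prof P H θ = θ - H := by
  rw [abs_le] at h
  rw [prof, wave_eq_self (by linarith) (by linarith) (by linarith)]

theorem prof_near_neg (hH : 4 ≤ H) (hP : H + 4 ≤ P) {y : ℝ} (h : |y| ≤ 3) :
    prof P H (-H + y) = -y := by
  have h1 : |-(-H + y) - H| ≤ 3 := by
    rw [show -(-H + y) - H = -y by ring, abs_neg]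
    exact h
  rw [← prof_neg (by linarith), prof_near hH hP h1]
  ring

theorem prof_ge (hH : 4 ≤ H) (hP : H + 4 ≤ P) {θ : ℝ} (h : H + 1 / 4 ≤ θ) (h' : θ ≤ P) :
    1 / 4 ≤ prof P H θ := by
  have h1 := abs_le.1 (bend_near (w := P) (by linarith) (x := θ) (by linarith) h')
  rcases le_or_gt θ (H + 1) with h2 | h2
  · rw [prof_near hH hP (abs_le.2 ⟨by linarith, by linarith⟩)]; linarith
  · rw [prof, wave_eq_bend (by linarith) (by linarith) (by linarith)]
    linarith [h1.1]

theorem prof_le (hH : 4 ≤ H) (hP : H + 4 ≤ P) {θ : ℝ} (h : θ ≤ H - 1 / 4) (h' : 0 ≤ θ) :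
    prof P H θ ≤ -(1 / 4) := by
  have h1 := abs_le.1 (bend_near (w := P) (by linarith) (x := θ) (by linarith) (by linarith))
  rcases le_or_gt (H - 1) θ with h2 | h2
  · rw [prof_near hH hP (abs_le.2 ⟨by linarith, by linarith⟩)]; linarith
  · rw [prof, wave_eq_bend (by linarith) (by linarith) (by linarith)]
    linarith [h1.2]

theorem prof_small (hH : 4 ≤ H) (hP : H + 4 ≤ P) {θ : ℝ} (h0 : 0 ≤ θ) (h' : θ ≤ P)
    (h : |prof P H θ| < 1 / 2) : prof P H θ = θ - H ∧ |θ - H| < 1 / 2 := by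
  have h1 := abs_le.1 (bend_near (w := P) (by linarith) (x := θ) (by linarith) (by linarith))
  rw [← wave_eq_bend (by linarith) (by linarith) (by linarith)] at h1
  have h2 : |θ - H| ≤ 3 := by
    rw [prof, abs_lt] at h
    rw [abs_le]
    constructor <;> linarith
  have h3 := prof_near hH hP h2
  exact ⟨h3, h3 ▸ h⟩

theorem prof_small_neg (hH : 4 ≤ H) (hP : H + 4 ≤ P) {θ : ℝ} (h0 : θ ≤ 0) (h' : -P ≤ θ)
    (h : |prof P H θ| < 1 / 2) : prof P H θ = -(θ + H) ∧ |θ + H| < 1 / 2 := by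
  rw [← prof_neg (by linarith)] at h ⊢
  obtain ⟨h1, h2⟩ := prof_small hH hP (by linarith) (by linarith) h
  refine ⟨by rw [h1]; ring, ?_⟩
  rwa [show -θ - H = -(θ + H) by ring, abs_neg] at h2

end Prof

/-- The points `(u, θ, η)` of the picture that is given by `τ` for `0 ≤ θ ≤ P` and by `τ'` for
`-P ≤ θ ≤ 0`. -/
def mset (P H : ℝ) (τ τ' : ℝ → ℝ → ℝ → Prop) : Set (ℝ × ℝ × ℝ) :=
  {x | |x.2.1| ≤ P ∧ (0 ≤ x.2.1 → τ x.1 (prof P H x.2.1) x.2.2) ∧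
    (x.2.1 ≤ 0 → τ' x.1 (prof P H x.2.1) x.2.2)}

/-- The vertically framed points of the picture `mset`. -/
def mcar (P H : ℝ) (a b : ℂ) (τ τ' : ℝ → ℝ → ℝ → Prop) : Set ((ℂ × ℝ) × (ℂ × ℝ)) :=
  {x | ∃ u θ η, (u, θ, η) ∈ mset P H τ τ' ∧ x = ((pol P a b u θ, η), (0, 1))}

/-- The curves `(f i, ϑ i, η i)` trace the set `S` of triples, modulo the period of `θ`. -/
structure Sweeps (P : ℝ) {ι : Type} (f ϑ η : ι → ℝ → ℝ) (S : Set (ℝ × ℝ × ℝ)) : Prop where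
  mem : ∀ i t, ∃ n : ℤ, (f i t, ϑ i t + 2 * P * n, η i t) ∈ S
  surj : ∀ u θ h, (u, θ, h) ∈ S → ∃ i t, ∃ n : ℤ, f i t = u ∧ θ = ϑ i t + 2 * P * n ∧ η i t = h

section Model

variable {P H : ℝ} {a b : ℂ}

theorem Sweeps.vset_eq (hP : 0 < P) {ι : Type} {f ϑ η : ι → ℝ → ℝ} {τ τ' : ℝ → ℝ → ℝ → Prop}
    (h : Sweeps P f ϑ η (mset P H τ τ')) :
    vset (fun i t => pol P a b (f i t) (ϑ i t)) η = mcar P H a b τ τ' := by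
  ext x
  constructor
  · rintro ⟨i, t, rfl⟩
    obtain ⟨n, hn⟩ := h.mem i t
    exact ⟨_, _, _, hn, by rw [pol_add_int hP]⟩
  · rintro ⟨u, θ, η', hx, rfl⟩
    obtain ⟨i, t, n, rfl, rfl, rfl⟩ := h.surj _ _ _ hx
    exact ⟨i, t, by rw [pol_add_int hP]⟩

theorem mset_near {τ τ' : ℝ → ℝ → ℝ → Prop} (hτ : IsLocalPicture τ) (hτ' : IsLocalPicture τ')
    {u θ η : ℝ} (h : (u, θ, η) ∈ mset P H τ τ') : |(|u| - |prof P H θ|)| ≤ 1 := by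
  have key : ∀ {τ : ℝ → ℝ → ℝ → Prop}, IsLocalPicture τ → τ u (prof P H θ) η →
      |(|u| - |prof P H θ|)| ≤ 1 := by
    intro τ hτ h
    rcases le_or_gt (1 / 2) |prof P H θ| with h1 | h1
    · rw [((hτ.far h1).1 h).1]; simp
    · have := hτ.near h1 h
      rw [abs_le]
      constructor <;> linarith [abs_nonneg u, abs_nonneg (prof P H θ)]
  rcases le_total 0 θ with h0 | h0
  · exact key hτ (h.2.1 h0)
  · exact key hτ' (h.2.2 h0)

theorem Sweeps.mem_of_near {X : Set ℂ} (hP : 1 ≤ P) {ι : Type} {f ϑ η : ι → ℝ → ℝ}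
    {τ τ' : ℝ → ℝ → ℝ → Prop} (h : Sweeps P f ϑ η (mset P H τ τ')) (hτ : IsLocalPicture τ)
    (hτ' : IsLocalPicture τ')
    (hX : ∀ u θ : ℝ, |(|u| - |prof P H θ|)| ≤ 1 → pol P a b u θ ∈ X) (i : ι) (t : ℝ) :
    pol P a b (f i t) (ϑ i t) ∈ X := by
  obtain ⟨n, hn⟩ := h.mem i t
  rw [← pol_add_int (by linarith) (f i t) (ϑ i t) n]
  exact hX _ _ (mset_near hτ hτ' hn)

theorem mem_mset_neg (hP : 1 ≤ P) {τ τ' : ℝ → ℝ → ℝ → Prop} {u θ η : ℝ} :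
    (u, -θ, η) ∈ mset P H τ τ' ↔ (u, θ, η) ∈ mset P H τ' τ := by
  change (|-θ| ≤ P ∧ (0 ≤ -θ → τ u (prof P H (-θ)) η) ∧ (-θ ≤ 0 → τ' u (prof P H (-θ)) η)) ↔
    (|θ| ≤ P ∧ (0 ≤ θ → τ' u (prof P H θ) η) ∧ (θ ≤ 0 → τ u (prof P H θ) η))
  rw [prof_neg hP, abs_neg, Left.nonneg_neg_iff, Left.neg_nonpos_iff]
  tauto

theorem isDrawn_of_carrier {X : Set ℂ} (hH : 4 ≤ H) (hP : H + 4 ≤ P) (hb : b ≠ 0)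
    {τ τ' : ℝ → ℝ → ℝ → Prop} {L : FramedLink X} (hL : L.carrier = mcar P H a b τ τ') :
    L.IsDrawn P a b H τ := by
  constructor
  · intro x hx
    rw [hL] at hx
    obtain ⟨u, θ, η, -, rfl⟩ := hx
    rfl
  · intro u y η h
    have hy : |y| ≤ 1 := abs_le_one_iff_mul_self_le_one.2 (by nlinarith [sq_nonneg u])
    have hv : prof P H (H + y) = y := by
      rw [prof_near hH hP (by rw [add_sub_cancel_left]; linarith), add_sub_cancel_left]
    rw [abs_le] at hy
    rw [hL]
    constructor
    · rintro ⟨u', θ', η', hm, e⟩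
      simp only [Prod.mk.injEq, and_true] at e
      obtain ⟨e, rfl⟩ := e
      obtain ⟨rfl, n, rfl⟩ := (pol_eq_iff (by linarith) hb).1 e
      have h1 := abs_le.1 hm.1
      simp only at h1
      have hn : n = 0 := by
        by_contra hn
        rcases lt_or_gt_of_ne hn with h | h
        · have : (n : ℝ) ≤ -1 := by exact_mod_cast (by omega : n ≤ -1)
          nlinarith
        · have : (1 : ℝ) ≤ n := by exact_mod_cast (by omega : 1 ≤ n)
          nlinarith
      have h2 := hm.2.1
      simp only [hn, Int.cast_zero, mul_zero, add_zero, hv] at h2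
      exact h2 (by linarith)
    · intro hτ
      refine ⟨u, H + y, η, ⟨abs_le.2 ⟨?_, ?_⟩, ?_, ?_⟩, rfl⟩
      · simp only; linarith
      · simp only; linarith
      · simp only [hv]; exact fun _ => hτ
      · simp only; intro; linarith

theorem isDrawn_of_carrier_neg {X : Set ℂ} (hH : 4 ≤ H) (hP : H + 4 ≤ P) (hb : b ≠ 0)
    {τ τ' σ : ℝ → ℝ → ℝ → Prop} {L : FramedLink X} (hL : L.carrier = mcar P H a b τ τ')
    (hσ : ∀ u y η, τ' u (-y) η ↔ σ u y η) :
    L.IsDrawn P a b (-H) σ := by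
  constructor
  · intro x hx
    rw [hL] at hx
    obtain ⟨u, θ, η, -, rfl⟩ := hx
    rfl
  · intro u y η h
    have hy : |y| ≤ 1 := abs_le_one_iff_mul_self_le_one.2 (by nlinarith [sq_nonneg u])
    have hv : prof P H (-H + y) = -y := prof_near_neg hH hP (by linarith)
    rw [abs_le] at hy
    rw [hL]
    constructor
    · rintro ⟨u', θ', η', hm, e⟩
      simp only [Prod.mk.injEq, and_true] at e
      obtain ⟨e, rfl⟩ := e
      obtain ⟨rfl, n, rfl⟩ := (pol_eq_iff (by linarith) hb).1 e
      have h1 := abs_le.1 hm.1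
      simp only at h1
      have hn : n = 0 := by
        by_contra hn
        rcases lt_or_gt_of_ne hn with h | h
        · have : (n : ℝ) ≤ -1 := by exact_mod_cast (by omega : n ≤ -1)
          nlinarith
        · have : (1 : ℝ) ≤ n := by exact_mod_cast (by omega : 1 ≤ n)
          nlinarith
      have h2 := hm.2.2
      simp only [hn, Int.cast_zero, mul_zero, add_zero, hv] at h2
      exact (hσ _ _ _).1 (h2 (by linarith))
    · intro hτ
      refine ⟨u, -H + y, η, ⟨abs_le.2 ⟨?_, ?_⟩, ?_, ?_⟩, rfl⟩
      · simp only; linarith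
      · simp only; linarith
      · simp only; intro; linarith
      · simp only [hv]; exact fun _ => (hσ _ _ _).2 hτ

theorem mcar_agree (hH : 4 ≤ H) (hP : H + 4 ≤ P) {τ τ' σ : ℝ → ℝ → ℝ → Prop}
    (hτ : IsLocalPicture τ) (hσ : IsLocalPicture σ) {x : (ℂ × ℝ) × (ℂ × ℝ)}
    (hx : ¬ ∃ u y : ℝ, u ^ 2 + y ^ 2 ≤ 1 ∧ x.1.1 = pol P a b u (H + y))
    (h : x ∈ mcar P H a b τ τ') : x ∈ mcar P H a b σ τ' := by
  obtain ⟨u, θ, η, hm, rfl⟩ := h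
  refine ⟨u, θ, η, ⟨hm.1, fun h0 => ?_, hm.2.2⟩, rfl⟩
  have h1 := hm.2.1 h0
  simp only at h0 h1 ⊢
  rcases le_or_gt (1 / 2) |prof P H θ| with h2 | h2
  · exact (hσ.far h2).2 ((hτ.far h2).1 h1)
  · exfalso
    have h3 := hτ.near h2 h1
    have h4 := (prof_small hH hP h0 (abs_le.1 hm.1).2 h2).2
    rw [abs_lt] at h3 h4
    refine hx ⟨u, θ - H, by nlinarith, ?_⟩
    rw [add_sub_cancel]

theorem mcar_agree_neg (hH : 4 ≤ H) (hP : H + 4 ≤ P) {τ τ' σ : ℝ → ℝ → ℝ → Prop}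
    (hτ : IsLocalPicture τ') (hσ : IsLocalPicture σ) {x : (ℂ × ℝ) × (ℂ × ℝ)}
    (hx : ¬ ∃ u y : ℝ, u ^ 2 + y ^ 2 ≤ 1 ∧ x.1.1 = pol P a b u (-H + y))
    (h : x ∈ mcar P H a b τ τ') : x ∈ mcar P H a b τ σ := by
  obtain ⟨u, θ, η, hm, rfl⟩ := h
  refine ⟨u, θ, η, ⟨hm.1, hm.2.1, fun h0 => ?_⟩, rfl⟩
  have h1 := hm.2.2 h0
  simp only at h0 h1 ⊢
  rcases le_or_gt (1 / 2) |prof P H θ| with h2 | h2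
  · exact (hσ.far h2).2 ((hτ.far h2).1 h1)
  · exfalso
    have h3 := hτ.near h2 h1
    have h4 := (prof_small_neg hH hP h0 (abs_le.1 hm.1).1 h2).2
    rw [abs_lt] at h3 h4
    refine hx ⟨u, θ + H, by nlinarith, ?_⟩
    rw [show -H + (θ + H) = θ by ring]

/-- Resolving the crossing at `θ = H`. -/
theorem isSkeinTriple_mcar {X : Set ℂ} (hH : 4 ≤ H) (hP : H + 4 ≤ P) (hb : b ≠ 0)
    (hX : ∀ u θ : ℝ, |(|u| - |prof P H θ|)| ≤ 1 → pol P a b u θ ∈ X) {δ : ℝ}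
    {τ' : ℝ → ℝ → ℝ → Prop} {L LI LO : FramedLink X}
    (h : L.carrier = mcar P H a b (crossT δ) τ') (hI : LI.carrier = mcar P H a b pinchT τ')
    (hO : LO.carrier = mcar P H a b openT τ') :
    (0 < δ → IsSkeinTriple L LI LO) ∧ (δ < 0 → IsSkeinTriple L LO LI) := by
  apply isSkeinTriple_of_isDrawn (by linarith) hb _ (isDrawn_of_carrier hH hP hb h)
    (isDrawn_of_carrier hH hP hb hI) (isDrawn_of_carrier hH hP hb hO)
  · intro x hx
    rw [h, hI]
    exact ⟨mcar_agree hH hP (isLocalPicture_crossT δ) isLocalPicture_pinchT hx,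
      mcar_agree hH hP isLocalPicture_pinchT (isLocalPicture_crossT δ) hx⟩
  · intro x hx
    rw [h, hO]
    exact ⟨mcar_agree hH hP (isLocalPicture_crossT δ) isLocalPicture_openT hx,
      mcar_agree hH hP isLocalPicture_openT (isLocalPicture_crossT δ) hx⟩
  · intro u y hu hy
    apply hX
    rw [prof_near hH hP (by rw [add_sub_cancel_left]; linarith), add_sub_cancel_left, abs_le]
    constructor <;> linarith [abs_nonneg u, abs_nonneg y]

/-- Resolving the crossing at `θ = - H`. -/
theorem isSkeinTriple_mcar_neg {X : Set ℂ} (hH : 4 ≤ H) (hP : H + 4 ≤ P) (hb : b ≠ 0)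
    (hX : ∀ u θ : ℝ, |(|u| - |prof P H θ|)| ≤ 1 → pol P a b u θ ∈ X) {δ : ℝ}
    {τ : ℝ → ℝ → ℝ → Prop} {L LI LO : FramedLink X}
    (h : L.carrier = mcar P H a b τ (crossT δ)) (hI : LI.carrier = mcar P H a b τ pinchT)
    (hO : LO.carrier = mcar P H a b τ openT) :
    (0 < δ → IsSkeinTriple L LO LI) ∧ (δ < 0 → IsSkeinTriple L LI LO) := by
  have key : (0 < -δ → IsSkeinTriple L LI LO) ∧ (-δ < 0 → IsSkeinTriple L LO LI) := by
    apply isSkeinTriple_of_isDrawn (δ := -δ) (by linarith) hb _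
      (isDrawn_of_carrier_neg hH hP hb h (σ := crossT (-δ)) ?_)
      (isDrawn_of_carrier_neg hH hP hb hI (σ := pinchT) ?_)
      (isDrawn_of_carrier_neg hH hP hb hO (σ := openT) ?_)
    · intro x hx
      rw [h, hI]
      exact ⟨mcar_agree_neg hH hP (isLocalPicture_crossT δ) isLocalPicture_pinchT hx,
        mcar_agree_neg hH hP isLocalPicture_pinchT (isLocalPicture_crossT δ) hx⟩
    · intro x hx
      rw [h, hO]
      exact ⟨mcar_agree_neg hH hP (isLocalPicture_crossT δ) isLocalPicture_openT hx,
        mcar_agree_neg hH hP isLocalPicture_openT (isLocalPicture_crossT δ) hx⟩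
    · intro u y hu hy
      apply hX
      rw [prof_near_neg hH hP (by linarith), abs_neg, abs_le]
      constructor <;> linarith [abs_nonneg u, abs_nonneg y]
    · intro u y η
      simp only [crossT, neg_neg, bump.neg, neg_mul, sub_neg_eq_add, ← sub_eq_add_neg]
      tauto
    · intro u y η
      simp only [pinchT, rnd_neg]
    · intro u y η
      simp only [openT, abs_neg]
  exact ⟨fun h => key.2 (by linarith), fun h => key.1 (by linarith)⟩

end Model

end Skein

namespace Skein

/-! ### Two curves with two crossings: parametrizations of the pictures -/

theorem fold_cases {w : ℝ} (hw : 1 ≤ w) (t : ℝ) : ∃ (y σ : ℝ) (n : ℤ), (σ = 1 ∨ σ = -1) ∧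
    ((|y| < 1 / 2 ∧ t = y + 2 * w * n) ∨ (|y| < 1 / 2 ∧ t = w + y + 2 * w * n) ∨
      (1 / 4 ≤ y ∧ y ≤ w - 1 / 4 ∧ t = σ * y + 2 * w * n)) := by
  obtain ⟨x, n, hx, hx', rfl⟩ := exists_eq_add (w := w) (by linarith) t
  rcases lt_or_ge |x| (1 / 4) with h | h
  · exact ⟨x, 1, n, Or.inl rfl, Or.inl ⟨by linarith, rfl⟩⟩
  rcases le_or_gt 0 x with h0 | h0
  · rw [abs_of_nonneg h0] at h
    rcases le_or_gt x (w - 1 / 4) with h1 | h1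
    · exact ⟨x, 1, n, Or.inl rfl, Or.inr (Or.inr ⟨h, h1, by ring⟩)⟩
    · exact ⟨x - w, 1, n, Or.inl rfl, Or.inr (Or.inl ⟨by rw [abs_lt]; constructor <;> linarith,
        by ring⟩)⟩
  · rw [abs_of_neg h0] at h
    rcases le_or_gt (-x) (w - 1 / 4) with h1 | h1
    · exact ⟨-x, -1, n, Or.inr rfl, Or.inr (Or.inr ⟨h, h1, by ring⟩)⟩
    · exact ⟨x + w, 1, n - 1, Or.inl rfl, Or.inr (Or.inl
        ⟨by rw [abs_lt]; constructor <;> linarith, by push_cast; ring⟩)⟩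

section WaveEval

variable {w : ℝ}

theorem wave_near_zero (hw : 1 ≤ w) {y : ℝ} (h : |y| < 1 / 2) (n : ℤ) :
    wave w (y + 2 * w * n) = rnd y := by
  rw [abs_lt] at h
  rw [wave_add_int hw, wave_of_le hw (by linarith) (by linarith)]

theorem wave_near_end (hw : 1 ≤ w) {y : ℝ} (h : |y| < 1 / 2) (n : ℤ) :
    wave w (w + y + 2 * w * n) = w - rnd y := by
  rw [abs_lt] at h
  rw [wave_add_int hw, wave_of_ge hw (by linarith) (by linarith), ← rnd_neg y]
  congr 2
  ring

theorem wave_mid (hw : 1 ≤ w) {y σ : ℝ} (hσ : σ = 1 ∨ σ = -1) (h : 1 / 4 ≤ y) (h' : y ≤ w - 1 / 4)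
    (n : ℤ) : wave w (σ * y + 2 * w * n) = y := by
  rw [wave_add_int hw]
  rcases hσ with rfl | rfl
  · rw [one_mul, wave_eq_self hw h h']
  · rw [neg_one_mul, wave_neg hw, wave_eq_self hw h h']

end WaveEval

/-- The odd `2 w`-periodic extension `f` of a function `b` that is equal to `y` near `0` and to
`c (y - w)` near `w`. -/
structure IsOddExt (w c : ℝ) (b f : ℝ → ℝ) : Prop where
  smooth : ContDiff ℝ ∞ f
  odd : ∀ t, f (-t) = -f t
  periodic : Function.Periodic f (2 * w)
  near_zero : ∀ {y : ℝ} (n : ℤ), |y| < 1 / 2 → f (y + 2 * w * n) = y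
  near_end : ∀ {y : ℝ} (n : ℤ), |y| < 1 / 2 → f (w + y + 2 * w * n) = c * y
  mid : ∀ {y σ : ℝ} (n : ℤ), σ = 1 ∨ σ = -1 → 0 ≤ y → y ≤ w → f (σ * y + 2 * w * n) = σ * b y

theorem odd_add_int {w : ℝ} {f : ℝ → ℝ} (hp : Function.Periodic f (2 * w)) (t : ℝ) (n : ℤ) :
    f (t + 2 * w * n) = f t := by
  have := hp.int_mul n t
  rwa [mul_comm (n : ℝ)] at this

theorem isOddExt_oddExt {w c : ℝ} (hw : 1 ≤ w) {b : ℝ → ℝ} (hb : ContDiff ℝ ∞ b)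
    (h0 : ∀ x, |x| ≤ 1 → b x = x) (h1 : ∀ x, |x| ≤ 1 → b (w + x) = c * x) :
    IsOddExt w c b (oddExt w b) := by
  have o0 := odd_of_eq_self h0
  have o1 := odd_of_eq_mul h1
  refine ⟨contDiff_oddExt (by linarith) hb o0 o1, oddExt_neg (by linarith) o0 o1,
    oddExt_periodic (by linarith), ?_, ?_, ?_⟩
  · intro y n h
    have h' := abs_lt.1 h
    rw [oddExt_apply (by linarith) o0 o1 (by linarith) (by linarith), h0 y (by linarith)]
  · intro y n h
    have h' := abs_lt.1 h
    rw [oddExt_apply (by linarith) o0 o1 (by linarith) (by linarith), h1 y (by linarith)]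
  · rintro y σ n (rfl | rfl) h h'
    · rw [one_mul, one_mul, oddExt_apply (by linarith) o0 o1 (by linarith) (by linarith)]
    · rw [odd_add_int (oddExt_periodic (by linarith)), neg_one_mul, neg_one_mul,
        oddExt_neg (by linarith) o0 o1]
      congr 1
      simpa using oddExt_apply (by linarith) o0 o1 (x := y) (by linarith) (by linarith) 0

/-- The half `0 ≤ t ≤ 2 P` of the curve `u = prof θ`, `θ = t - H`, that is smoothed at `θ = H`
by `rnd`, to be continued by a symmetry. -/
noncomputable def joinFn (P H x : ℝ) : ℝ :=
  rnd (prof P H (x - H)) + x - rnd x + (2 * P - x) - rnd (2 * P - x)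

section Join

variable {P H : ℝ}

theorem contDiff_joinFn (hP : 1 ≤ P) : ContDiff ℝ ∞ (joinFn P H) := by
  have h1 := contDiff_rnd
  have h2 := contDiff_prof (H := H) hP
  unfold joinFn
  fun_prop

theorem prof_shift (hP : 1 ≤ P) (θ : ℝ) : prof P H (θ - 2 * P) = prof P H θ := by
  have := prof_add_int (H := H) hP (θ - 2 * P) 1
  rw [← this]
  congr 1
  simp

theorem join_of_le {x : ℝ} (h : x ≤ 2 * P - 1 / 4) :
    joinFn P H x = rnd (prof P H (x - H)) + x - rnd x := by
  rw [joinFn, rnd_eq_self (x := 2 * P - x) (by linarith)]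
  ring

theorem join_of_ge {x : ℝ} (h : 1 / 4 ≤ x) :
    joinFn P H x = rnd (prof P H (x - H)) + (2 * P - x) - rnd (2 * P - x) := by
  rw [joinFn, rnd_eq_self (x := x) (by linarith)]
  ring

theorem join_zero (hH : 4 ≤ H) (hP : H + 4 ≤ P) {x : ℝ} (h : |x| ≤ 1) : joinFn P H x = x := by
  rw [join_of_le (by linarith [(abs_le.1 h).2]), show x - H = -H + x by ring,
    prof_near_neg hH hP (by linarith), rnd_neg]
  ring

theorem join_end (hH : 4 ≤ H) (hP : H + 4 ≤ P) {x : ℝ} (h : |x| ≤ 1) :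
    joinFn P H (2 * P + x) = -1 * x := by
  have h' := abs_le.1 h
  rw [join_of_ge (by linarith), ← prof_shift (by linarith),
    show 2 * P + x - H - 2 * P = -H + x by ring,
    prof_near_neg hH hP (by linarith), show 2 * P - (2 * P + x) = -x by ring]
  ring

theorem join_lo (hH : 4 ≤ H) (hP : H + 4 ≤ P) {x : ℝ} (h : 0 ≤ x) (h' : x ≤ H) :
    joinFn P H x = -prof P H (x - H) := by
  rcases le_or_gt x 1 with h1 | h1
  · rw [join_zero hH hP (abs_le.2 ⟨by linarith, h1⟩), show x - H = -H + x by ring,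
      prof_near_neg hH hP (abs_le.2 ⟨by linarith, by linarith⟩), neg_neg]
  · have h2 := prof_le hH hP (θ := -(x - H)) (by linarith) (by linarith)
    rw [prof_neg (by linarith)] at h2
    rw [join_of_le (by linarith), rnd_eq_self (x := x) (by linarith), ← rnd_neg,
      rnd_eq_self (by linarith)]
    ring

theorem join_mid {x : ℝ} (h : 1 / 4 ≤ x) (h' : x ≤ 2 * P - 1 / 4) :
    joinFn P H x = rnd (prof P H (x - H)) := by
  rw [join_of_le h', rnd_eq_self h]
  ring

theorem join_hi (hH : 4 ≤ H) (hP : H + 4 ≤ P) {x : ℝ} (h : P + H ≤ x) (h' : x ≤ 2 * P) :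
    joinFn P H x = prof P H (x - H) := by
  rcases lt_or_ge x (2 * P - 1) with h1 | h1
  · have h2 := prof_ge hH hP (θ := -(x - H - 2 * P)) (by linarith) (by linarith)
    rw [prof_neg (by linarith), prof_shift (by linarith)] at h2
    rw [join_mid (by linarith) (by linarith), rnd_eq_self h2]
  · have := join_end hH hP (x := x - 2 * P) (abs_le.2 ⟨by linarith, by linarith⟩)
    rw [add_sub_cancel] at this
    rw [this, ← prof_shift (by linarith), show x - H - 2 * P = -H + (x - 2 * P) by ring,
      prof_near_neg hH hP (abs_le.2 ⟨by linarith, by linarith⟩)]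
    ring

theorem join_pos (hH : 4 ≤ H) (hP : H + 4 ≤ P) {x : ℝ} (h : 0 < x) (h' : x < 2 * P) :
    0 < joinFn P H x := by
  rcases lt_or_ge x (1 / 4) with h1 | h1
  · rwa [join_zero hH hP (abs_le.2 ⟨by linarith, by linarith⟩)]
  rcases lt_or_ge (2 * P - 1 / 4) x with h2 | h2
  · have := join_end hH hP (x := x - 2 * P) (abs_le.2 ⟨by linarith, by linarith⟩)
    rw [add_sub_cancel] at this
    rw [this]
    linarith
  · rw [join_mid h1 h2]
    exact rnd_pos _

end Join

section Params

variable {P H : ℝ}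

theorem mem_mset {τ τ' : ℝ → ℝ → ℝ → Prop} {u θ η : ℝ} : (u, θ, η) ∈ mset P H τ τ' ↔
    |θ| ≤ P ∧ (0 ≤ θ → τ u (prof P H θ) η) ∧ (θ ≤ 0 → τ' u (prof P H θ) η) := Iff.rfl

theorem mem_mset_of_pos {τ τ' : ℝ → ℝ → ℝ → Prop} {u θ η : ℝ} (h : 0 < θ) (h' : θ ≤ P)
    (ht : τ u (prof P H θ) η) : (u, θ, η) ∈ mset P H τ τ' :=
  ⟨abs_le.2 ⟨by simp only; linarith, h'⟩, fun _ => ht, fun h0 => absurd h0 (not_le.2 h)⟩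

theorem mem_mset_of_neg {τ τ' : ℝ → ℝ → ℝ → Prop} {u θ η : ℝ} (h : θ < 0) (h' : -P ≤ θ)
    (ht : τ' u (prof P H θ) η) : (u, θ, η) ∈ mset P H τ τ' :=
  ⟨abs_le.2 ⟨h', by simp only; linarith⟩, fun h0 => absurd h0 (not_le.2 h), fun _ => ht⟩

theorem mem_mset_self {τ : ℝ → ℝ → ℝ → Prop} {u θ η : ℝ} (h : |θ| ≤ P)
    (ht : τ u (prof P H θ) η) : (u, θ, η) ∈ mset P H τ τ :=
  ⟨h, fun _ => ht, fun _ => ht⟩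

/-- The picture near one of the points `θ = 0`, `θ = P` between the crossings. -/
theorem mem_mset_far {τ τ' : ℝ → ℝ → ℝ → Prop} (hτ : IsLocalPicture τ) (hτ' : IsLocalPicture τ')
    {u θ : ℝ} (h : |θ| ≤ P) (h' : 1 / 2 ≤ |prof P H θ|) (hu : |u| = |prof P H θ|) :
    (u, θ, 1 / 2) ∈ mset P H τ τ' :=
  ⟨h, fun _ => (hτ.far h').2 ⟨hu, rfl⟩, fun _ => (hτ'.far h').2 ⟨hu, rfl⟩⟩

theorem sweeps_cross (hP : 1 ≤ P) (δ : ℝ) :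
    Sweeps P (fun (c : Bool) t => cond c (prof P H t) (-prof P H t)) (fun _ t => t)
      (fun c t => cond c (1 / 2 + δ * bump (prof P H t)) (1 / 2 - δ * bump (prof P H t)))
      (mset P H (crossT δ) (crossT δ)) where
  mem c t := by
    obtain ⟨x, n, hx, hx', rfl⟩ := exists_eq_add (w := P) (by linarith) t
    refine ⟨-n, ?_⟩
    rw [show x + 2 * P * n + 2 * P * (-n : ℤ) = x by push_cast; ring, prof_add_int hP]
    apply mem_mset_self (abs_le.2 ⟨hx, hx'.le⟩)
    cases c
    · exact Or.inr ⟨rfl, rfl⟩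
    · exact Or.inl ⟨rfl, rfl⟩
  surj u θ h hm := by
    have key : crossT δ u (prof P H θ) h := by
      rcases le_total 0 θ with h0 | h0
      exacts [hm.2.1 h0, hm.2.2 h0]
    rcases key with ⟨h1, h2⟩ | ⟨h1, h2⟩
    · exact ⟨true, θ, 0, h1.symm, by simp, h2.symm⟩
    · exact ⟨false, θ, 0, h1.symm, by simp, h2.symm⟩

theorem sweeps_pinch (hP : 1 ≤ P) :
    Sweeps P (fun (c : Bool) t => cond c (-rnd (prof P H t)) (rnd (prof P H t))) (fun _ t => t)
      (fun _ _ => 1 / 2) (mset P H pinchT pinchT) where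
  mem c t := by
    obtain ⟨x, n, hx, hx', rfl⟩ := exists_eq_add (w := P) (by linarith) t
    refine ⟨-n, ?_⟩
    rw [show x + 2 * P * n + 2 * P * (-n : ℤ) = x by push_cast; ring, prof_add_int hP]
    apply mem_mset_self (abs_le.2 ⟨hx, hx'.le⟩)
    refine ⟨?_, rfl⟩
    cases c
    · exact abs_of_pos (rnd_pos _)
    · simp only [cond_true, abs_neg, abs_of_pos (rnd_pos _)]
  surj u θ h hm := by
    obtain ⟨h1, h2⟩ : pinchT u (prof P H θ) h := by
      rcases le_total 0 θ with h0 | h0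
      exacts [hm.2.1 h0, hm.2.2 h0]
    rcases (abs_eq (rnd_pos _).le).1 h1 with h3 | h3
    · exact ⟨false, θ, 0, h3.symm, by simp, h2.symm⟩
    · exact ⟨true, θ, 0, h3.symm, by simp, h2.symm⟩

theorem exists_sign {u v : ℝ} (h : |u| = |v|) : ∃ σ : ℝ, (σ = 1 ∨ σ = -1) ∧ u = σ * v := by
  rcases abs_eq_abs.1 h with h | h
  · exact ⟨1, Or.inl rfl, by rw [h, one_mul]⟩
  · exact ⟨-1, Or.inr rfl, by rw [h, neg_one_mul]⟩

theorem abs_sign_mul {σ v : ℝ} (h : σ = 1 ∨ σ = -1) : |σ * v| = |v| := by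
  rcases h with rfl | rfl <;> simp

theorem openT_of_abs {u v : ℝ} (h : |u| = |v|) (h' : 1 / 4 ≤ |v|) : openT u v (1 / 2) :=
  ⟨by rw [rnd_eq_abs (by rw [h]; exact h'), h], rfl⟩

theorem openT_rnd (u : ℝ) : openT u (rnd u) (1 / 2) := ⟨abs_of_pos (rnd_pos u), rfl⟩

theorem openT_neg_rnd (u : ℝ) : openT u (-rnd u) (1 / 2) :=
  ⟨by rw [abs_neg]; exact abs_of_pos (rnd_pos u), rfl⟩

theorem rnd_le_three {y : ℝ} (h : |y| < 1 / 2) : |rnd y| ≤ 3 := by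
  rw [abs_of_pos (rnd_pos y)]
  linarith [rnd_lt_half h]

/-- The curve that is joined at `θ = H` and open at `θ = - H`. -/
theorem sweeps_pinch_open (hH : 4 ≤ H) (hP : H + 4 ≤ P) {f : ℝ → ℝ}
    (hf : IsOddExt (2 * P) (-1) (joinFn P H) f) :
    Sweeps P (fun (_ : Unit) t => f t) (fun _ t => -H + wave (2 * P) t) (fun _ _ => 1 / 2)
      (mset P H pinchT openT) where
  mem _ t := by
    have hw : 1 ≤ 2 * P := by linarith
    obtain ⟨y, σ, n, hσ, ⟨h, rfl⟩ | ⟨h, rfl⟩ | ⟨h, h', rfl⟩⟩ := fold_cases hw t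
    · have := rnd_lt_half h
      have := rnd_pos y
      refine ⟨0, ?_⟩
      rw [hf.near_zero n h, wave_near_zero hw h, Int.cast_zero, mul_zero, add_zero]
      apply mem_mset_of_neg (by linarith) (by linarith)
      rw [prof_near_neg hH hP (rnd_le_three h)]
      exact openT_neg_rnd y
    · have := rnd_lt_half h
      have := rnd_pos y
      refine ⟨-1, ?_⟩
      rw [hf.near_end n h, wave_near_end hw h,
        show -H + (2 * P - rnd y) + 2 * P * ((-1 : ℤ) : ℝ) = -H + -rnd y by push_cast; ring]
      apply mem_mset_of_neg (by linarith) (by linarith)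
      rw [prof_near_neg hH hP (by rw [abs_neg]; exact rnd_le_three h), neg_neg]
      refine ⟨?_, rfl⟩
      rw [neg_one_mul, rnd_neg, abs_of_pos (rnd_pos y)]
    · rw [hf.mid n hσ (by linarith) (by linarith), wave_mid hw hσ h h']
      rcases lt_or_ge y H with h1 | h1
      · refine ⟨0, ?_⟩
        have h2 := prof_le hH hP (θ := -(y - H)) (by linarith) (by linarith)
        rw [prof_neg (by linarith)] at h2
        rw [join_lo hH hP (by linarith) h1.le, Int.cast_zero, mul_zero, add_zero,
          show -H + y = y - H by ring]
        apply mem_mset_of_neg (by linarith) (by linarith)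
        apply openT_of_abs
        · rw [abs_sign_mul hσ, abs_neg]
        · rw [abs_of_neg (by linarith)]; linarith
      rcases lt_or_ge (P + H) y with h3 | h3
      · refine ⟨-1, ?_⟩
        have h2 := prof_ge hH hP (θ := -(y - H - 2 * P)) (by linarith) (by linarith)
        rw [prof_neg (by linarith)] at h2
        rw [join_hi hH hP h3.le (by linarith),
          show -H + y + 2 * P * ((-1 : ℤ) : ℝ) = y - H - 2 * P by push_cast; ring]
        apply mem_mset_of_neg (by linarith) (by linarith)
        apply openT_of_abs
        · rw [abs_sign_mul hσ, prof_shift (by linarith)]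
        · rw [abs_of_pos (by linarith)]; linarith
      · refine ⟨0, ?_⟩
        rw [join_mid h h', Int.cast_zero, mul_zero, add_zero, show -H + y = y - H by ring]
        refine ⟨abs_le.2 ⟨?_, ?_⟩, fun _ => ⟨?_, rfl⟩, fun h0 => ?_⟩
        · simp only; linarith
        · simp only; linarith
        · rw [abs_sign_mul hσ, abs_of_pos (rnd_pos _)]
        · simp only at h0 ⊢
          have h4 : y - H = 0 := by linarith
          rw [h4]
          have h2 := prof_le hH hP (θ := 0) (by linarith) le_rfl
          apply openT_of_abs
          · rw [abs_sign_mul hσ, abs_of_pos (rnd_pos _), rnd_eq_abs]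
            rw [abs_of_neg (by linarith)]; linarith
          · rw [abs_of_neg (by linarith)]; linarith
  surj u θ h hm := by
    have hw : 1 ≤ 2 * P := by linarith
    obtain ⟨h1, h2, h3⟩ := mem_mset.1 hm
    rw [abs_le] at h1
    rcases lt_or_ge 0 θ with h0 | h0
    · obtain ⟨h4, rfl⟩ := h2 h0.le
      obtain ⟨σ, hσ, rfl⟩ := exists_sign (h4.trans (abs_of_pos (rnd_pos _)).symm)
      refine ⟨(), σ * (θ + H) + 2 * (2 * P) * (0 : ℤ), 0, ?_, ?_, rfl⟩
      · rw [hf.mid 0 hσ (by linarith) (by linarith), join_mid (by linarith) (by linarith),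
          add_sub_cancel_right]
      · rw [wave_mid hw hσ (by linarith) (by linarith)]
        simp
    · obtain ⟨h4, rfl⟩ := h3 h0
      rcases le_or_gt (1 / 2) |prof P H θ| with h5 | h5
      · have h6 := ((isLocalPicture_openT.far h5).1 ⟨h4, rfl⟩).1
        obtain ⟨σ, hσ, rfl⟩ := exists_sign h6
        have hσ' : -σ = 1 ∨ -σ = -1 := by rcases hσ with rfl | rfl <;> simp
        rcases lt_or_ge θ (-H) with h7 | h7
        · have h8 : θ ≤ -H - 1 / 4 := by
            by_contra h8
            have : prof P H (-H + (θ + H)) = -(θ + H) :=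
              prof_near_neg hH hP (abs_le.2 ⟨by linarith, by linarith⟩)
            rw [show -H + (θ + H) = θ by ring] at this
            rw [this, abs_of_pos (by linarith)] at h5
            linarith
          refine ⟨(), σ * (θ + H + 2 * P) + 2 * (2 * P) * (0 : ℤ), -1, ?_, ?_, rfl⟩
          · rw [hf.mid 0 hσ (by linarith) (by linarith), join_hi hH hP (by linarith) (by linarith),
              ← prof_shift (by linarith)]
            congr 2
            ring
          · rw [wave_mid hw hσ (by linarith) (by linarith)]
            push_cast
            ring
        · have h8 : -H + 1 / 4 ≤ θ := by
            by_contra h8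
            have : prof P H (-H + (θ + H)) = -(θ + H) :=
              prof_near_neg hH hP (abs_le.2 ⟨by linarith, by linarith⟩)
            rw [show -H + (θ + H) = θ by ring] at this
            rw [this, abs_neg, abs_of_nonneg (by linarith)] at h5
            linarith
          refine ⟨(), -σ * (θ + H) + 2 * (2 * P) * (0 : ℤ), 0, ?_, ?_, rfl⟩
          · rw [hf.mid 0 hσ' (by linarith) (by linarith), join_lo hH hP (by linarith) (by linarith),
              add_sub_cancel_right]
            ring
          · rw [wave_mid hw hσ' (by linarith) (by linarith)]
            simp
      · obtain ⟨h6, h7⟩ := prof_small_neg hH hP h0 h1.1 h5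
        have h8 := isLocalPicture_openT.near h5 ⟨h4, rfl⟩
        rw [h6, abs_neg] at h4
        rcases le_or_gt 0 (θ + H) with h9 | h9
        · rw [abs_of_nonneg h9] at h4
          refine ⟨(), u + 2 * (2 * P) * (0 : ℤ), 0, hf.near_zero 0 h8, ?_, rfl⟩
          rw [wave_near_zero hw h8, ← h4]
          simp
        · rw [abs_of_neg h9] at h4
          have h8' : |-u| < 1 / 2 := by rwa [abs_neg]
          refine ⟨(), 2 * P + -u + 2 * (2 * P) * (0 : ℤ), -1, ?_, ?_, rfl⟩
          · rw [hf.near_end 0 h8']; ring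
          · rw [wave_near_end hw h8', rnd_neg, ← h4]
            push_cast
            ring

/-- The curve that is open at `θ = H` and joined at `θ = - H`. -/
theorem sweeps_open_pinch (hH : 4 ≤ H) (hP : H + 4 ≤ P) {f : ℝ → ℝ}
    (hf : IsOddExt (2 * P) (-1) (joinFn P H) f) :
    Sweeps P (fun (_ : Unit) t => f (2 * P - t)) (fun _ t => H + wave (2 * P) t)
      (fun _ _ => 1 / 2) (mset P H openT pinchT) := by
  have h := sweeps_pinch_open hH hP hf
  have e : ∀ t, wave (2 * P) (2 * P - t) = 2 * P - wave (2 * P) t := by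
    intro t
    have hw : 1 ≤ 2 * P := by linarith
    obtain ⟨y, σ, n, hσ, ⟨h, rfl⟩ | ⟨h, rfl⟩ | ⟨h, h', rfl⟩⟩ := fold_cases hw t
    · rw [wave_near_zero hw h, show 2 * P - (y + 2 * (2 * P) * n) =
        2 * P + -y + 2 * (2 * P) * (-n : ℤ) by push_cast; ring,
        wave_near_end hw (by rwa [abs_neg]), rnd_neg]
    · rw [wave_near_end hw h, show 2 * P - (2 * P + y + 2 * (2 * P) * n) =
        -y + 2 * (2 * P) * (-n : ℤ) by push_cast; ring,
        wave_near_zero hw (by rwa [abs_neg]), rnd_neg]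
      ring
    · rw [wave_mid hw hσ h h']
      rcases hσ with rfl | rfl
      · rw [show 2 * P - (1 * y + 2 * (2 * P) * n) =
          1 * (2 * P - y) + 2 * (2 * P) * (-n : ℤ) by push_cast; ring,
          wave_mid hw (Or.inl rfl) (by linarith) (by linarith)]
      · rw [show 2 * P - (-1 * y + 2 * (2 * P) * n) =
          -1 * (2 * P - y) + 2 * (2 * P) * (-n + 1 : ℤ) by push_cast; ring,
          wave_mid hw (Or.inr rfl) (by linarith) (by linarith)]
  constructor
  · intro i t
    obtain ⟨n, hn⟩ := h.mem i (2 * P - t)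
    refine ⟨-n - 1, ?_⟩
    rw [e] at hn
    rw [← mem_mset_neg (by linarith)]
    convert hn using 3
    push_cast
    ring
  · intro u θ k hm
    rw [← mem_mset_neg (by linarith)] at hm
    obtain ⟨i, t, n, h1, h2, h3⟩ := h.surj _ _ _ hm
    refine ⟨i, 2 * P - t, -n - 1, ?_, ?_, h3⟩
    · rw [sub_sub_cancel, h1]
    · rw [e]
      push_cast
      linarith

end Params

end Skein

namespace Skein

section Params

variable {P H : ℝ}

theorem bump_prof_neg (hH : 4 ≤ H) (hP : H + 4 ≤ P) {θ : ℝ} (h0 : θ ≤ 0) (h' : -P ≤ θ) :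
    bump (prof P H θ) = bump (θ + H) := by
  rcases lt_or_ge |prof P H θ| (1 / 2) with h | h
  · rw [(prof_small_neg hH hP h0 h' h).1, bump.neg]
  · rw [bump_eq_zero (by linarith), bump_eq_zero]
    by_contra h1
    have : prof P H (-H + (θ + H)) = -(θ + H) := prof_near_neg hH hP (by linarith)
    rw [show -H + (θ + H) = θ by ring] at this
    rw [this, abs_neg] at h
    linarith

theorem prof_zero_le (hH : 4 ≤ H) (hP : H + 4 ≤ P) : prof P H 0 ≤ -3 := by
  have := rnd_lt_half (x := 0) (by norm_num)
  rw [prof, wave_of_le (by linarith) (by linarith) (by linarith)]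
  linarith

theorem far_of_half_le (hH : 4 ≤ H) (hP : H + 4 ≤ P) {θ : ℝ} (h : 1 / 2 ≤ |prof P H θ|) :
    1 / 4 ≤ |θ - H| := by
  by_contra h8
  rw [not_le] at h8
  rw [prof_near hH hP (by linarith)] at h
  linarith

theorem far_of_half_le_neg (hH : 4 ≤ H) (hP : H + 4 ≤ P) {θ : ℝ} (h : 1 / 2 ≤ |prof P H θ|) :
    1 / 4 ≤ |θ + H| := by
  rw [← prof_neg (by linarith)] at h
  have := far_of_half_le hH hP h
  rwa [show -θ - H = -(θ + H) by ring, abs_neg] at this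

/-- The pair of curves that are open at both crossings. -/
theorem sweeps_open (hH : 4 ≤ H) (hP : H + 4 ≤ P) {f g : ℝ → ℝ}
    (hf : IsOddExt (2 * H) (-1) (fun x => -prof P H (x - H)) f)
    (hg : IsOddExt (2 * P - 2 * H) (-1) (fun x => prof P H (x + H)) g) :
    Sweeps P (fun (c : Bool) t => cond c (f t) (g t))
      (fun c t => cond c (-H + wave (2 * H) t) (H + wave (2 * P - 2 * H) t)) (fun _ _ => 1 / 2)
      (mset P H openT openT) where
  mem c t := by
    cases c
    · simp only [cond_false]
      have hw : 1 ≤ 2 * P - 2 * H := by linarith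
      obtain ⟨y, σ, n, hσ, ⟨h, rfl⟩ | ⟨h, rfl⟩ | ⟨h, h', rfl⟩⟩ := fold_cases hw t
      · have := rnd_lt_half h
        have := rnd_pos y
        refine ⟨0, ?_⟩
        rw [hg.near_zero n h, wave_near_zero hw h, Int.cast_zero, mul_zero, add_zero]
        apply mem_mset_of_pos (by linarith) (by linarith)
        rw [prof_near hH hP (by rw [add_sub_cancel_left]; exact rnd_le_three h),
          add_sub_cancel_left]
        exact openT_rnd y
      · have := rnd_lt_half h
        have := rnd_pos y
        refine ⟨-1, ?_⟩
        rw [hg.near_end n h, wave_near_end hw h, show H + (2 * P - 2 * H - rnd y) +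
          2 * P * ((-1 : ℤ) : ℝ) = -H + -rnd y by push_cast; ring]
        apply mem_mset_of_neg (by linarith) (by linarith)
        rw [prof_near_neg hH hP (by rw [abs_neg]; exact rnd_le_three h), neg_neg, neg_one_mul,
          ← rnd_neg]
        exact openT_rnd _
      · rw [hg.mid n hσ (by linarith) (by linarith), wave_mid hw hσ h h', add_comm y H]
        rcases le_or_gt (H + y) P with h1 | h1
        · refine ⟨0, ?_⟩
          have h2 := prof_ge hH hP (θ := H + y) (by linarith) h1
          rw [Int.cast_zero, mul_zero, add_zero]
          apply mem_mset_of_pos (by linarith) (by linarith)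
          apply openT_of_abs (abs_sign_mul hσ)
          rwa [abs_of_pos (by linarith)]
        · refine ⟨-1, ?_⟩
          have h2 := prof_ge hH hP (θ := -(H + y - 2 * P)) (by linarith) (by linarith)
          rw [prof_neg (by linarith), prof_shift (by linarith)] at h2
          rw [show H + y + 2 * P * ((-1 : ℤ) : ℝ) = H + y - 2 * P by push_cast; ring]
          apply mem_mset_of_neg (by linarith) (by linarith)
          rw [prof_shift (by linarith)]
          apply openT_of_abs (abs_sign_mul hσ)
          rwa [abs_of_pos (by linarith)]
    · simp only [cond_true]
      have hw : 1 ≤ 2 * H := by linarith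
      obtain ⟨y, σ, n, hσ, ⟨h, rfl⟩ | ⟨h, rfl⟩ | ⟨h, h', rfl⟩⟩ := fold_cases hw t
      · have := rnd_lt_half h
        have := rnd_pos y
        refine ⟨0, ?_⟩
        rw [hf.near_zero n h, wave_near_zero hw h, Int.cast_zero, mul_zero, add_zero]
        apply mem_mset_of_neg (by linarith) (by linarith)
        rw [prof_near_neg hH hP (rnd_le_three h)]
        exact openT_neg_rnd y
      · have := rnd_lt_half h
        have := rnd_pos y
        refine ⟨0, ?_⟩
        rw [hf.near_end n h, wave_near_end hw h, show -H + (2 * H - rnd y) +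
          2 * P * ((0 : ℤ) : ℝ) = H - rnd y by push_cast; ring]
        apply mem_mset_of_pos (by linarith) (by linarith)
        rw [prof_near hH hP (by rw [sub_sub_cancel_left, abs_neg]; exact rnd_le_three h),
          neg_one_mul, ← rnd_neg, sub_sub_cancel_left]
        exact openT_neg_rnd _
      · rw [hf.mid n hσ (by linarith) (by linarith), wave_mid hw hσ h h']
        refine ⟨0, ?_⟩
        rw [Int.cast_zero, mul_zero, add_zero, show -H + y = y - H by ring]
        apply mem_mset_self (abs_le.2 ⟨by linarith, by linarith⟩)
        apply openT_of_abs
        · rw [abs_sign_mul hσ, abs_neg]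
        · have h2 : prof P H (y - H) ≤ -(1 / 4) := by
            rcases le_or_gt 0 (y - H) with h1 | h1
            · exact prof_le hH hP (by linarith) h1
            · rw [← prof_neg (by linarith)]
              exact prof_le hH hP (by linarith) (by linarith)
          rw [abs_of_neg (by linarith)]
          linarith
  surj u θ h hm := by
    have hw : 1 ≤ 2 * H := by linarith
    have hw' : 1 ≤ 2 * P - 2 * H := by linarith
    have h1 := abs_le.1 (mem_mset.1 hm).1
    obtain ⟨h4, rfl⟩ : openT u (prof P H θ) h := by
      rcases le_total 0 θ with h0 | h0
      exacts [hm.2.1 h0, hm.2.2 h0]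
    rcases le_or_gt (1 / 2) |prof P H θ| with h5 | h5
    · have h6 := ((isLocalPicture_openT.far h5).1 ⟨h4, rfl⟩).1
      obtain ⟨σ, hσ, rfl⟩ := exists_sign h6
      have hσ' : -σ = 1 ∨ -σ = -1 := by rcases hσ with rfl | rfl <;> simp
      have f1 := far_of_half_le hH hP h5
      have f2 := far_of_half_le_neg hH hP h5
      rcases lt_or_ge θ (-H) with h7 | h7
      · rw [abs_of_neg (by linarith)] at f2
        refine ⟨false, σ * (θ + 2 * P - H) + 2 * (2 * P - 2 * H) * (0 : ℤ), -1, ?_, ?_, rfl⟩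
        · rw [cond_false, hg.mid 0 hσ (by linarith) (by linarith), ← prof_shift (by linarith)]
          congr 2
          ring
        · rw [cond_false, wave_mid hw' hσ (by linarith) (by linarith)]
          push_cast
          ring
      rcases lt_or_ge H θ with h8 | h8
      · rw [abs_of_pos (by linarith)] at f1
        refine ⟨false, σ * (θ - H) + 2 * (2 * P - 2 * H) * (0 : ℤ), 0, ?_, ?_, rfl⟩
        · rw [cond_false, hg.mid 0 hσ (by linarith) (by linarith), sub_add_cancel]
        · rw [cond_false, wave_mid hw' hσ (by linarith) (by linarith)]
          simp
      · rw [abs_of_nonpos (by linarith)] at f1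
        rw [abs_of_nonneg (by linarith)] at f2
        refine ⟨true, -σ * (θ + H) + 2 * (2 * H) * (0 : ℤ), 0, ?_, ?_, rfl⟩
        · rw [cond_true, hf.mid 0 hσ' (by linarith) (by linarith), add_sub_cancel_right]
          ring
        · rw [cond_true, wave_mid hw hσ' (by linarith) (by linarith)]
          simp
    · have h8 := isLocalPicture_openT.near h5 ⟨h4, rfl⟩
      have h8' : |-u| < 1 / 2 := by rwa [abs_neg]
      rcases le_total 0 θ with h0 | h0
      · obtain ⟨h6, h7⟩ := prof_small hH hP h0 h1.2 h5
        rw [h6] at h4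
        rcases le_or_gt 0 (θ - H) with h9 | h9
        · rw [abs_of_nonneg h9] at h4
          refine ⟨false, u + 2 * (2 * P - 2 * H) * (0 : ℤ), 0, hg.near_zero 0 h8, ?_, rfl⟩
          rw [cond_false, wave_near_zero hw' h8, ← h4]
          simp
        · rw [abs_of_neg h9] at h4
          refine ⟨true, 2 * H + -u + 2 * (2 * H) * (0 : ℤ), 0, ?_, ?_, rfl⟩
          · rw [cond_true, hf.near_end 0 h8']; ring
          · rw [cond_true, wave_near_end hw h8', rnd_neg, ← h4]
            push_cast
            ring
      · obtain ⟨h6, h7⟩ := prof_small_neg hH hP h0 h1.1 h5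
        rw [h6, abs_neg] at h4
        rcases le_or_gt 0 (θ + H) with h9 | h9
        · rw [abs_of_nonneg h9] at h4
          refine ⟨true, u + 2 * (2 * H) * (0 : ℤ), 0, hf.near_zero 0 h8, ?_, rfl⟩
          rw [cond_true, wave_near_zero hw h8, ← h4]
          simp
        · rw [abs_of_neg h9] at h4
          refine ⟨false, 2 * P - 2 * H + -u + 2 * (2 * P - 2 * H) * (0 : ℤ), -1, ?_, ?_, rfl⟩
          · rw [cond_false, hg.near_end 0 h8']; ring
          · rw [cond_false, wave_near_end hw' h8', rnd_neg, ← h4]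
            push_cast
            ring

/-- The height of the curve that is joined at `θ = H` and crosses itself at `θ = - H`. -/
noncomputable def joinHeight (P : ℝ) : ℝ → ℝ :=
  antiExt (2 * P) fun x => bump x - bump (2 * P - x)

theorem joinHeight_anti (hP : 1 ≤ P) (x : ℝ) (hx : |x| < 1 / 2) :
    (fun x => bump x - bump (2 * P - x)) (2 * P + x) =
      -(fun x => bump x - bump (2 * P - x)) x := by
  rw [abs_lt] at hx
  simp only
  rw [bump_eq_zero (x := 2 * P + x) (by rw [abs_of_pos (by linarith)]; linarith),
    bump_eq_zero (x := 2 * P - x) (by rw [abs_of_pos (by linarith)]; linarith),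
    show 2 * P - (2 * P + x) = -x by ring, bump.neg]
  ring

theorem join_anti (hH : 4 ≤ H) (hP : H + 4 ≤ P) (x : ℝ) (hx : |x| < 1 / 2) :
    joinFn P H (2 * P + x) = -joinFn P H x := by
  rw [join_end hH hP (by linarith), join_zero hH hP (by linarith)]
  ring

theorem neg_one_zpow_cases (n : ℤ) : ((-1 : ℝ) ^ n = 1) ∨ ((-1 : ℝ) ^ n = -1) := by
  rcases Int.even_or_odd n with h | h
  · exact Or.inl h.neg_one_zpow
  · exact Or.inr h.neg_one_zpow

/-- The curve that is joined at `θ = H` and crosses itself at `θ = - H`. -/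
theorem sweeps_pinch_cross (hH : 4 ≤ H) (hP : H + 4 ≤ P) (δ : ℝ) :
    Sweeps P (fun (_ : Unit) t => antiExt (2 * P) (joinFn P H) t) (fun _ t => t - H)
      (fun _ t => 1 / 2 - δ * joinHeight P t) (mset P H pinchT (crossT δ)) where
  mem _ t := by
    obtain ⟨x, n, hx, hx', rfl⟩ := exists_eq_add_mul (w := 2 * P) (by linarith) t
    have hε := neg_one_zpow_cases n
    rw [antiExt_apply (by linarith) (join_anti hH hP) (by linarith) (by linarith), joinHeight,
      antiExt_apply (by linarith) (joinHeight_anti (by linarith)) (by linarith) (by linarith)]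
    rcases lt_or_ge x H with h1 | h1
    · refine ⟨-n, ?_⟩
      rw [show x + 2 * P * n - H + 2 * P * (-n : ℤ) = x - H by push_cast; ring]
      apply mem_mset_of_neg (by linarith) (by linarith)
      rw [join_lo hH hP hx h1.le, crossT, bump_prof_neg hH hP (by linarith) (by linarith),
        sub_add_cancel, bump_eq_zero (x := 2 * P - x) (by rw [abs_of_pos (by linarith)]; linarith)]
      rcases hε with e | e <;> rw [e]
      · exact Or.inr ⟨by ring, by ring⟩
      · exact Or.inl ⟨by ring, by ring⟩
    rcases lt_or_ge (P + H) x with h2 | h2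
    · refine ⟨-n - 1, ?_⟩
      rw [show x + 2 * P * n - H + 2 * P * (-n - 1 : ℤ) = x - H - 2 * P by push_cast; ring]
      apply mem_mset_of_neg (by linarith) (by linarith)
      rw [join_hi hH hP h2.le hx'.le, crossT, bump_prof_neg hH hP (by linarith) (by linarith),
        prof_shift (by linarith), show x - H - 2 * P + H = -(2 * P - x) by ring, bump.neg,
        bump_eq_zero (x := x) (by rw [abs_of_pos (by linarith)]; linarith)]
      rcases hε with e | e <;> rw [e]
      · exact Or.inl ⟨by ring, by ring⟩
      · exact Or.inr ⟨by ring, by ring⟩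
    · refine ⟨-n, ?_⟩
      rw [show x + 2 * P * n - H + 2 * P * (-n : ℤ) = x - H by push_cast; ring,
        bump_eq_zero (x := x) (by rw [abs_of_pos (by linarith)]; linarith),
        bump_eq_zero (x := 2 * P - x) (by rw [abs_of_pos (by linarith)]; linarith),
        join_mid (by linarith) (by linarith), sub_zero, mul_zero, mul_zero, sub_zero]
      have h3 : |(-1) ^ n * rnd (prof P H (x - H))| = rnd (prof P H (x - H)) := by
        rw [abs_sign_mul hε, abs_of_pos (rnd_pos _)]
      rcases h1.eq_or_lt with rfl | h1
      · have := prof_zero_le hH hP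
        rw [sub_self] at h3 ⊢
        have h4 : 1 / 2 ≤ |prof P H 0| := by rw [abs_of_neg (by linarith)]; linarith
        apply mem_mset_far isLocalPicture_pinchT (isLocalPicture_crossT δ)
          (by rw [abs_zero]; linarith) h4
        rw [h3, rnd_eq_abs (by linarith)]
      · exact mem_mset_of_pos (by linarith) (by linarith) ⟨h3, rfl⟩
  surj u θ h hm := by
    obtain ⟨h1, h2, h3⟩ := mem_mset.1 hm
    rw [abs_le] at h1
    have ev : ∀ (x σ : ℝ), (σ = 1 ∨ σ = -1) → 0 ≤ x → x ≤ 2 * P → ∃ n : ℤ,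
        antiExt (2 * P) (joinFn P H) (x + 2 * P * n) = σ * joinFn P H x ∧
        joinHeight P (x + 2 * P * n) = σ * (bump x - bump (2 * P - x)) := by
      intro x σ hσ hx hx'
      obtain ⟨n, hn⟩ : ∃ n : ℤ, (-1 : ℝ) ^ n = σ := by
        rcases hσ with rfl | rfl
        exacts [⟨0, by simp⟩, ⟨1, by simp⟩]
      refine ⟨n, ?_⟩
      rw [antiExt_apply (by linarith) (join_anti hH hP) (by linarith) (by linarith), joinHeight,
        antiExt_apply (by linarith) (joinHeight_anti (by linarith)) (by linarith) (by linarith), hn]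
      exact ⟨rfl, rfl⟩
    rcases lt_or_ge 0 θ with h0 | h0
    · obtain ⟨h4, rfl⟩ := h2 h0.le
      obtain ⟨σ, hσ, rfl⟩ := exists_sign (h4.trans (abs_of_pos (rnd_pos _)).symm)
      obtain ⟨n, e1, e2⟩ := ev (θ + H) σ hσ (by linarith) (by linarith)
      refine ⟨(), θ + H + 2 * P * n, -n, ?_, ?_, ?_⟩
      · rw [e1, join_mid (by linarith) (by linarith), add_sub_cancel_right]
      · push_cast
        ring
      · rw [e2, bump_eq_zero (x := θ + H) (by rw [abs_of_pos (by linarith)]; linarith),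
          bump_eq_zero (x := 2 * P - (θ + H)) (by rw [abs_of_pos (by linarith)]; linarith)]
        ring
    · obtain ⟨σ, hσ, rfl, rfl⟩ : ∃ σ : ℝ, (σ = 1 ∨ σ = -1) ∧ u = σ * prof P H θ ∧
          h = 1 / 2 + σ * (δ * bump (prof P H θ)) := by
        rcases h3 h0 with ⟨rfl, rfl⟩ | ⟨rfl, rfl⟩
        · exact ⟨1, Or.inl rfl, by ring, by ring⟩
        · exact ⟨-1, Or.inr rfl, by ring, by ring⟩
      have hσ' : -σ = 1 ∨ -σ = -1 := by rcases hσ with rfl | rfl <;> simp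
      rw [bump_prof_neg hH hP h0 h1.1]
      rcases lt_or_ge θ (-H) with h7 | h7
      · obtain ⟨n, e1, e2⟩ := ev (θ + H + 2 * P) σ hσ (by linarith) (by linarith)
        refine ⟨(), θ + H + 2 * P + 2 * P * n, -n - 1, ?_, ?_, ?_⟩
        · rw [e1, join_hi hH hP (by linarith) (by linarith), ← prof_shift (by linarith)]
          congr 2
          ring
        · push_cast
          ring
        · rw [e2, bump_eq_zero (x := θ + H + 2 * P) (by rw [abs_of_pos (by linarith)]; linarith),
            show 2 * P - (θ + H + 2 * P) = -(θ + H) by ring, bump.neg]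
          ring
      · obtain ⟨n, e1, e2⟩ := ev (θ + H) (-σ) hσ' (by linarith) (by linarith)
        refine ⟨(), θ + H + 2 * P * n, -n, ?_, ?_, ?_⟩
        · rw [e1, join_lo hH hP (by linarith) (by linarith), add_sub_cancel_right]
          ring
        · push_cast
          ring
        · rw [e2, bump_eq_zero (x := 2 * P - (θ + H)) (by rw [abs_of_pos (by linarith)]; linarith)]
          ring

/-- The height of the curve that is open at `θ = H` and crosses itself at `θ = - H`. -/
noncomputable def openHeight (P H : ℝ) : ℝ → ℝ :=
  oddExt (2 * P) fun x => bump (x - (2 * P - 2 * H))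

theorem openHeight_zero (hH : 4 ≤ H) (hP : H + 4 ≤ P) {x : ℝ} (hx : |x| < 1 / 2) :
    bump (x - (2 * P - 2 * H)) = 0 ∧ bump (2 * P + x - (2 * P - 2 * H)) = 0 := by
  rw [abs_lt] at hx
  constructor
  · apply bump_eq_zero
    rw [abs_of_neg (by linarith)]
    linarith
  · apply bump_eq_zero
    rw [abs_of_pos (by linarith)]
    linarith

theorem openHeight_odd (hH : 4 ≤ H) (hP : H + 4 ≤ P) (x : ℝ) (hx : |x| < 1 / 2) :
    bump (-x - (2 * P - 2 * H)) = -bump (x - (2 * P - 2 * H)) := by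
  rw [(openHeight_zero hH hP hx).1, (openHeight_zero hH hP (x := -x) (by rwa [abs_neg])).1,
    neg_zero]

theorem openHeight_odd_end (hH : 4 ≤ H) (hP : H + 4 ≤ P) (x : ℝ) (hx : |x| < 1 / 2) :
    bump (2 * P + x - (2 * P - 2 * H)) = -bump (2 * P - x - (2 * P - 2 * H)) := by
  rw [(openHeight_zero hH hP hx).2, sub_eq_add_neg (2 * P) x,
    (openHeight_zero hH hP (x := -x) (by rwa [abs_neg])).2, neg_zero]

theorem contDiff_openHeight (hH : 4 ≤ H) (hP : H + 4 ≤ P) : ContDiff ℝ ∞ (openHeight P H) := by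
  refine contDiff_oddExt (by linarith) ?_ (openHeight_odd hH hP) (openHeight_odd_end hH hP)
  have := contDiff_bump
  fun_prop

theorem openHeight_near_zero (hH : 4 ≤ H) (hP : H + 4 ≤ P) {x : ℝ} (hx : |x| < 1 / 2) (n : ℤ) :
    openHeight P H (x + 2 * (2 * P) * n) = 0 := by
  have h := abs_lt.1 hx
  rw [openHeight, oddExt_apply (by linarith) (openHeight_odd hH hP) (openHeight_odd_end hH hP)
    (by linarith) (by linarith), (openHeight_zero hH hP hx).1]

theorem openHeight_near_end (hH : 4 ≤ H) (hP : H + 4 ≤ P) {x : ℝ} (hx : |x| < 1 / 2) (n : ℤ) :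
    openHeight P H (2 * P + x + 2 * (2 * P) * n) = 0 := by
  have h := abs_lt.1 hx
  rw [openHeight, oddExt_apply (by linarith) (openHeight_odd hH hP) (openHeight_odd_end hH hP)
    (by linarith) (by linarith), (openHeight_zero hH hP hx).2]

theorem openHeight_mid (hH : 4 ≤ H) (hP : H + 4 ≤ P) {x σ : ℝ} (hσ : σ = 1 ∨ σ = -1) (hx : 0 ≤ x)
    (hx' : x ≤ 2 * P) (n : ℤ) :
    openHeight P H (σ * x + 2 * (2 * P) * n) = σ * bump (x - (2 * P - 2 * H)) := by
  have h1 : ∀ n : ℤ, openHeight P H (x + 2 * (2 * P) * n) = bump (x - (2 * P - 2 * H)) :=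
    oddExt_apply (by linarith) (openHeight_odd hH hP) (openHeight_odd_end hH hP)
      (by linarith) (by linarith)
  rcases hσ with rfl | rfl
  · rw [one_mul, h1, one_mul]
  · rw [show -1 * x + 2 * (2 * P) * n = -(x + 2 * (2 * P) * (-n : ℤ)) by push_cast; ring, openHeight,
      oddExt_neg (by linarith) (openHeight_odd hH hP) (openHeight_odd_end hH hP), neg_one_mul]
    congr 1
    exact h1 _

/-- The curve that is open at `θ = H` and crosses itself at `θ = - H`. -/
theorem sweeps_open_cross (hH : 4 ≤ H) (hP : H + 4 ≤ P) {f : ℝ → ℝ} (δ : ℝ)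
    (hf : IsOddExt (2 * P) 1 (fun x => prof P H (H + x)) f) :
    Sweeps P (fun (_ : Unit) t => f t) (fun _ t => H + wave (2 * P) t)
      (fun _ t => 1 / 2 + δ * openHeight P H t) (mset P H openT (crossT δ)) where
  mem _ t := by
    have hw : 1 ≤ 2 * P := by linarith
    obtain ⟨y, σ, n, hσ, ⟨h, rfl⟩ | ⟨h, rfl⟩ | ⟨h, h', rfl⟩⟩ := fold_cases hw t
    · have := rnd_lt_half h
      have := rnd_pos y
      refine ⟨0, ?_⟩
      rw [hf.near_zero n h, wave_near_zero hw h, openHeight_near_zero hH hP h, mul_zero, add_zero,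
        Int.cast_zero, mul_zero, add_zero]
      apply mem_mset_of_pos (by linarith) (by linarith)
      rw [prof_near hH hP (by rw [add_sub_cancel_left]; exact rnd_le_three h), add_sub_cancel_left]
      exact openT_rnd y
    · have := rnd_lt_half h
      have := rnd_pos y
      refine ⟨-1, ?_⟩
      rw [hf.near_end n h, wave_near_end hw h, openHeight_near_end hH hP h, mul_zero, add_zero,
        show H + (2 * P - rnd y) + 2 * P * ((-1 : ℤ) : ℝ) = H - rnd y by push_cast; ring]
      apply mem_mset_of_pos (by linarith) (by linarith)
      rw [prof_near hH hP (by rw [sub_sub_cancel_left, abs_neg]; exact rnd_le_three h),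
        sub_sub_cancel_left, one_mul]
      exact openT_neg_rnd y
    · rw [hf.mid n hσ (by linarith) (by linarith), wave_mid hw hσ h h',
        openHeight_mid hH hP hσ (by linarith) (by linarith)]
      rcases le_or_gt (H + y) P with h1 | h1
      · refine ⟨0, ?_⟩
        have h2 := prof_ge hH hP (θ := H + y) (by linarith) (by linarith)
        rw [bump_eq_zero (x := y - (2 * P - 2 * H)) (by rw [abs_of_neg (by linarith)]; linarith),
          mul_zero, mul_zero, add_zero, Int.cast_zero, mul_zero, add_zero]
        apply mem_mset_of_pos (by linarith) (by linarith)
        apply openT_of_abs (abs_sign_mul hσ)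
        rwa [abs_of_pos (by linarith)]
      refine ⟨-1, ?_⟩
      rw [show H + y + 2 * P * ((-1 : ℤ) : ℝ) = H + y - 2 * P by push_cast; ring,
        ← prof_shift (by linarith)]
      rcases lt_or_ge (H + y) (2 * P) with h2 | h2
      · apply mem_mset_of_neg (by linarith) (by linarith)
        rw [crossT, bump_prof_neg hH hP (by linarith) (by linarith),
          show H + y - 2 * P + H = y - (2 * P - 2 * H) by ring]
        rcases hσ with rfl | rfl
        · exact Or.inl ⟨by ring, by ring⟩
        · exact Or.inr ⟨by ring, by ring⟩
      · rw [bump_eq_zero (x := y - (2 * P - 2 * H)) (by rw [abs_of_pos (by linarith)]; linarith),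
          mul_zero, mul_zero, add_zero]
        rcases h2.eq_or_lt with h2 | h2
        · have := prof_zero_le hH hP
          rw [← h2, sub_self]
          apply mem_mset_far isLocalPicture_openT (isLocalPicture_crossT δ)
            (by rw [abs_zero]; linarith) _ (abs_sign_mul hσ)
          rw [abs_of_neg (by linarith)]
          linarith
        · have h3 := prof_le hH hP (θ := H + y - 2 * P) (by linarith) (by linarith)
          apply mem_mset_of_pos (by linarith) (by linarith)
          apply openT_of_abs (abs_sign_mul hσ)
          rw [abs_of_neg (by linarith)]
          linarith
  surj u θ h hm := by
    have hw : 1 ≤ 2 * P := by linarith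
    obtain ⟨h1, h2, h3⟩ := mem_mset.1 hm
    rw [abs_le] at h1
    rcases lt_or_ge 0 θ with h0 | h0
    · obtain ⟨h4, rfl⟩ := h2 h0.le
      rcases le_or_gt (1 / 2) |prof P H θ| with h5 | h5
      · have h6 := ((isLocalPicture_openT.far h5).1 ⟨h4, rfl⟩).1
        obtain ⟨σ, hσ, rfl⟩ := exists_sign h6
        have f1 := far_of_half_le hH hP h5
        rcases lt_or_ge θ H with h7 | h7
        · rw [abs_of_neg (by linarith)] at f1
          refine ⟨(), σ * (θ - H + 2 * P) + 2 * (2 * P) * (0 : ℤ), -1, ?_, ?_, ?_⟩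
          · rw [hf.mid 0 hσ (by linarith) (by linarith), ← prof_shift (by linarith)]
            congr 2
            ring
          · rw [wave_mid hw hσ (by linarith) (by linarith)]
            push_cast
            ring
          · rw [openHeight_mid hH hP hσ (by linarith) (by linarith), bump_eq_zero]
            · ring
            · rw [abs_of_pos (by linarith)]
              linarith
        · rw [abs_of_nonneg (by linarith)] at f1
          refine ⟨(), σ * (θ - H) + 2 * (2 * P) * (0 : ℤ), 0, ?_, ?_, ?_⟩
          · rw [hf.mid 0 hσ (by linarith) (by linarith), add_sub_cancel]
          · rw [wave_mid hw hσ (by linarith) (by linarith)]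
            simp
          · rw [openHeight_mid hH hP hσ (by linarith) (by linarith), bump_eq_zero]
            · ring
            · rw [abs_of_neg (by linarith)]
              linarith
      · have h8 := isLocalPicture_openT.near h5 ⟨h4, rfl⟩
        obtain ⟨h6, h7⟩ := prof_small hH hP h0.le h1.2 h5
        rw [h6] at h4
        rcases le_or_gt 0 (θ - H) with h9 | h9
        · rw [abs_of_nonneg h9] at h4
          refine ⟨(), u + 2 * (2 * P) * (0 : ℤ), 0, hf.near_zero 0 h8, ?_, ?_⟩
          · rw [wave_near_zero hw h8, ← h4]
            simp
          · rw [openHeight_near_zero hH hP h8]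
            ring
        · rw [abs_of_neg h9] at h4
          refine ⟨(), 2 * P + u + 2 * (2 * P) * (0 : ℤ), -1, ?_, ?_, ?_⟩
          · rw [hf.near_end 0 h8]; ring
          · rw [wave_near_end hw h8, ← h4]
            push_cast
            ring
          · rw [openHeight_near_end hH hP h8]
            ring
    · obtain ⟨σ, hσ, rfl, rfl⟩ : ∃ σ : ℝ, (σ = 1 ∨ σ = -1) ∧ u = σ * prof P H θ ∧
          h = 1 / 2 + σ * (δ * bump (prof P H θ)) := by
        rcases h3 h0 with ⟨rfl, rfl⟩ | ⟨rfl, rfl⟩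
        · exact ⟨1, Or.inl rfl, by ring, by ring⟩
        · exact ⟨-1, Or.inr rfl, by ring, by ring⟩
      refine ⟨(), σ * (θ - H + 2 * P) + 2 * (2 * P) * (0 : ℤ), -1, ?_, ?_, ?_⟩
      · rw [hf.mid 0 hσ (by linarith) (by linarith), ← prof_shift (by linarith)]
        congr 2
        ring
      · rw [wave_mid hw hσ (by linarith) (by linarith)]
        push_cast
        ring
      · rw [openHeight_mid hH hP hσ (by linarith) (by linarith), bump_prof_neg hH hP h0 h1.1]
        rw [show θ - H + 2 * P - (2 * P - 2 * H) = θ + H by ring]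
        ring

end Params

end Skein

namespace Skein

/-! ### Classes of loops -/

open Classical in
/-- The class of the closed curve `γ`, at height `1/2` and with vertical framing. -/
noncomputable def loopClass (X : Set ℂ) {R : Type*} [CommRing R] (s : Rˣ) (γ : ℝ → ℂ) :
    SkeinAlgebra X s :=
  if h : ∃ L : FramedLink X, L.carrier = loopSet γ then h.choose.toSkein s else 0

section LoopClass

variable {X : Set ℂ} {R : Type*} [CommRing R] {s : Rˣ}

theorem toSkein_eq_loopClass {γ : ℝ → ℂ} {L : FramedLink X} (h : L.carrier = loopSet γ) :
    L.toSkein s = loopClass X s γ := by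
  have h' : ∃ L : FramedLink X, L.carrier = loopSet γ := ⟨L, h⟩
  rw [loopClass, dif_pos h']
  congr 1
  exact FramedLink.ext (h.trans h'.choose_spec.symm)

theorem loopClass_eq_of_range {γ γ' : ℝ → ℂ} (h : Set.range γ = Set.range γ') :
    loopClass X s γ = loopClass X s γ' := by
  rw [loopClass, loopClass, loopSet_eq_of_range h]

theorem loopClass_eq_of_family {T : ℝ} {Γ : ℝ → ℝ → ℂ}
    (hΓ : ContDiff ℝ ∞ fun p : ℝ × ℝ => Γ p.1 p.2)
    (h : ∀ x ∈ Set.Icc (0 : ℝ) 1, IsLoop X T (Γ x)) :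
    loopClass X s (Γ 0) = loopClass X s (Γ 1) := by
  rw [← toSkein_eq_loopClass (L := (h 0 (by simp)).link) rfl,
    ← toSkein_eq_loopClass (L := (h 1 (by simp)).link) rfl]
  exact loop_toSkein_eq_of_family hΓ h rfl rfl

theorem loopClass_mul_comm {γ γ' : ℝ → ℂ} (h : ∀ t t', γ t ≠ γ' t') :
    loopClass X s γ * loopClass X s γ' = loopClass X s γ' * loopClass X s γ := by
  by_cases h1 : ∃ L : FramedLink X, L.carrier = loopSet γ
  · by_cases h2 : ∃ L : FramedLink X, L.carrier = loopSet γ'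
    · obtain ⟨L, hL⟩ := h1
      obtain ⟨L', hL'⟩ := h2
      rw [← toSkein_eq_loopClass hL, ← toSkein_eq_loopClass hL']
      apply toSkein_mul_comm
      rw [hL, hL']
      rintro _ ⟨t, rfl⟩ _ ⟨t', rfl⟩
      exact h t t'
    · rw [loopClass, loopClass, dif_neg h2, mul_zero, zero_mul]
  · rw [loopClass, dif_neg h1, mul_zero, zero_mul]

theorem loopClass_mul_eq {T T' : ℝ} {γ γ' : ℝ → ℂ}
    {η η' : ℝ → ℝ} (h : IsLoop X T γ)
    (h' : IsLoop X T' γ') (hη : ContDiff ℝ ∞ η) (hη' : ContDiff ℝ ∞ η')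
    (hp : Function.Periodic η T) (hp' : Function.Periodic η' T')
    (hm : ∀ t, η t ∈ Set.Icc (0 : ℝ) 1) (hm' : ∀ t, η' t ∈ Set.Icc (0 : ℝ) 1)
    (hd : ∀ t t', γ t = γ' t' → η' t' < η t) {M : FramedLink X}
    (hM : M.carrier = vset (fun b => cond b γ γ') (fun b : Bool => cond b η η')) :
    loopClass X s γ * loopClass X s γ' = M.toSkein s := by
  rw [← toSkein_eq_loopClass (L := h.link) rfl, ← toSkein_eq_loopClass (L := h'.link) rfl]
  exact toSkein_mul_eq h h' hη hη' hp hp' hm hm' hd rfl rfl hM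

theorem loopClass_mul_eq_of_disjoint {T T' : ℝ} {γ γ' : ℝ → ℂ} (h : IsLoop X T γ)
    (h' : IsLoop X T' γ') (hd : ∀ t t', γ t ≠ γ' t') {M : FramedLink X}
    (hM : M.carrier = vset (fun b : Bool => cond b γ γ') (fun _ _ => 1 / 2)) :
    loopClass X s γ * loopClass X s γ' = M.toSkein s := by
  apply loopClass_mul_eq (η := fun _ => 1 / 2) (η' := fun _ => 1 / 2) h h' contDiff_const
    contDiff_const (fun _ => rfl) (fun _ => rfl) (fun _ => by norm_num) (fun _ => by norm_num)
    (fun t t' e => absurd e (hd t t'))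
  rw [hM]
  congr 1
  funext b t
  cases b <;> rfl

theorem exists_link_of_disjoint {T T' : ℝ} {γ γ' : ℝ → ℂ} (h : IsLoop X T γ)
    (h' : IsLoop X T' γ') (hd : ∀ t t', γ t ≠ γ' t') :
    ∃ M : FramedLink X, M.carrier = vset (fun b : Bool => cond b γ γ') (fun _ _ => 1 / 2) := by
  have hV := isVLink_pair (η := fun _ => 3 / 4) (η' := fun _ => 1 / 2) h h' contDiff_const
    contDiff_const (fun _ => rfl) (fun _ => rfl)
    (fun _ => by norm_num) (fun _ => by norm_num) (fun t t' e => absurd e (hd t t'))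
  have hV' : IsVLink X (fun b : Bool => cond b T T') (fun b => cond b γ γ')
      (fun _ _ => 1 / 2) :=
    { hV with
      smooth_height := fun _ => contDiff_const
      periodic_height := fun _ _ => rfl
      height_mem := fun _ _ => by norm_num
      simple := by
        rintro (_ | _) (_ | _) t t' e -
        · exact ⟨rfl, h'.simple t t' e⟩
        · exact absurd e.symm (hd t' t)
        · exact absurd e (hd t t')
        · exact ⟨rfl, h.simple t t' e⟩ }
  exact ⟨hV'.link, rfl⟩

theorem toSkein_of_triple {L LA LB : FramedLink X} (h : IsSkeinTriple L LA LB) :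
    L.toSkein s = (s : R) • LA.toSkein s + ((s⁻¹ : Rˣ) : R) • LB.toSkein s := by
  have := mkₗ_relator s (Or.inl (Or.inr ⟨L, LA, LB, h, rfl⟩))
  rw [map_sub, map_sub, map_smul, map_smul, sub_sub, sub_eq_zero] at this
  exact this

end LoopClass

/-! ### The product of two curves with two crossings -/

/-- A curve that winds once around `a`. -/
noncomputable def graphCurve (P : ℝ) (a b : ℂ) (φ : ℝ → ℝ) (t : ℝ) : ℂ := pol P a b (φ t) t

/-- A curve in the sector `θ₁ ≤ θ ≤ θ₁ + w`. -/
noncomputable def foldCurve (P : ℝ) (a b : ℂ) (w θ₁ : ℝ) (f : ℝ → ℝ) (t : ℝ) : ℂ :=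
  pol P a b (f t) (θ₁ + wave w t)

/-- The fold function of the curve that is joined at one crossing and open at the other one. -/
noncomputable def joinFold (P H : ℝ) : ℝ → ℝ := oddExt (2 * P) (joinFn P H)

/-- The fold function of the curve in the sector `-H ≤ θ ≤ H`. -/
noncomputable def leftFold (P H : ℝ) : ℝ → ℝ := oddExt (2 * H) fun x => -prof P H (x - H)

/-- The fold function of the curve in the sector `H ≤ θ ≤ 2 P - H`. -/
noncomputable def rightFold (P H : ℝ) : ℝ → ℝ := oddExt (2 * P - 2 * H) fun x => prof P H (x + H)

theorem IsOddExt.deriv_zero {w c : ℝ} {b f : ℝ → ℝ} (h : IsOddExt w c b f) {t : ℝ}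
    (ht : |t| < 1 / 2) : deriv f t = 1 := by
  have : f =ᶠ[nhds t] id := by
    rw [abs_lt] at ht
    filter_upwards [Ioo_mem_nhds ht.1 ht.2] with y hy
    simpa using h.near_zero 0 (abs_lt.2 hy)
  rw [this.deriv_eq, deriv_id]

theorem IsOddExt.deriv_end {w c : ℝ} {b f : ℝ → ℝ} (h : IsOddExt w c b f) {t : ℝ}
    (ht : |t - w| < 1 / 2) : deriv f t = c := by
  have : f =ᶠ[nhds t] fun t => c * (t - w) := by
    rw [abs_lt] at ht
    filter_upwards [Ioo_mem_nhds (a := w - 1 / 2) (b := w + 1 / 2) (by linarith)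
      (by linarith)] with y hy
    have := h.near_end 0 (y := y - w) (abs_lt.2 ⟨by linarith [hy.1], by linarith [hy.2]⟩)
    simpa using this
  rw [this.deriv_eq]
  simp

section Product

variable {X : Set ℂ} {P H : ℝ} {a b : ℂ}

theorem isOddExt_joinFold (hH : 4 ≤ H) (hP : H + 4 ≤ P) :
    IsOddExt (2 * P) (-1) (joinFn P H) (joinFold P H) :=
  isOddExt_oddExt (by linarith) (contDiff_joinFn (by linarith)) (fun _ => join_zero hH hP)
    (fun _ => join_end hH hP)

theorem isFold_joinFold (hH : 4 ≤ H) (hP : H + 4 ≤ P) : IsFold (2 * P) (joinFold P H) :=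
  isFold_oddExt (by linarith) (contDiff_joinFn (by linarith)) (fun _ => join_zero hH hP)
    (fun _ => join_end hH hP) fun _ => join_pos hH hP

theorem left_zero (hH : 4 ≤ H) (hP : H + 4 ≤ P) {x : ℝ} (h : |x| ≤ 1) :
    -prof P H (x - H) = x := by
  rw [show x - H = -H + x by ring, prof_near_neg hH hP (by linarith), neg_neg]

theorem left_end (hH : 4 ≤ H) (hP : H + 4 ≤ P) {x : ℝ} (h : |x| ≤ 1) :
    -prof P H (2 * H + x - H) = -1 * x := by
  have e : 2 * H + x - H - H = x := by ring
  rw [prof_near hH hP (by rw [e]; linarith), e, neg_one_mul]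

theorem right_zero (hH : 4 ≤ H) (hP : H + 4 ≤ P) {x : ℝ} (h : |x| ≤ 1) :
    prof P H (x + H) = x := by
  rw [prof_near hH hP (by rw [add_sub_cancel_right]; linarith), add_sub_cancel_right]

theorem right_end (hH : 4 ≤ H) (hP : H + 4 ≤ P) {x : ℝ} (h : |x| ≤ 1) :
    prof P H (2 * P - 2 * H + x + H) = -1 * x := by
  rw [← prof_shift (by linarith), show 2 * P - 2 * H + x + H - 2 * P = -H + x by ring,
    prof_near_neg hH hP (by linarith), neg_one_mul]

theorem contDiff_left (hP : 1 ≤ P) : ContDiff ℝ ∞ fun x => -prof P H (x - H) := by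
  have := contDiff_prof (H := H) hP
  fun_prop

theorem contDiff_right (hP : 1 ≤ P) : ContDiff ℝ ∞ fun x => prof P H (x + H) := by
  have := contDiff_prof (H := H) hP
  fun_prop

theorem isOddExt_leftFold (hH : 4 ≤ H) (hP : H + 4 ≤ P) :
    IsOddExt (2 * H) (-1) (fun x => -prof P H (x - H)) (leftFold P H) :=
  isOddExt_oddExt (by linarith) (contDiff_left (by linarith)) (fun _ => left_zero hH hP)
    (fun _ => left_end hH hP)

theorem isFold_leftFold (hH : 4 ≤ H) (hP : H + 4 ≤ P) : IsFold (2 * H) (leftFold P H) := by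
  refine isFold_oddExt (by linarith) (contDiff_left (by linarith)) (fun _ => left_zero hH hP)
    (fun _ => left_end hH hP) fun x h0 h1 => ?_
  rcases le_or_gt x 1 with h2 | h2
  · rwa [left_zero hH hP (abs_le.2 ⟨by linarith, h2⟩)]
  rcases le_or_gt (2 * H - 1) x with h3 | h3
  · have := left_end hH hP (x := x - 2 * H) (abs_le.2 ⟨by linarith, by linarith⟩)
    rw [add_sub_cancel] at this
    rw [this]
    linarith
  rcases le_total H x with h4 | h4
  · linarith [prof_le hH hP (θ := x - H) (by linarith) (by linarith)]
  · rw [← prof_neg (by linarith)]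
    linarith [prof_le hH hP (θ := -(x - H)) (by linarith) (by linarith)]

theorem isOddExt_rightFold (hH : 4 ≤ H) (hP : H + 4 ≤ P) :
    IsOddExt (2 * P - 2 * H) (-1) (fun x => prof P H (x + H)) (rightFold P H) :=
  isOddExt_oddExt (by linarith) (contDiff_right (by linarith)) (fun _ => right_zero hH hP)
    (fun _ => right_end hH hP)

theorem isFold_rightFold (hH : 4 ≤ H) (hP : H + 4 ≤ P) :
    IsFold (2 * P - 2 * H) (rightFold P H) := by
  refine isFold_oddExt (by linarith) (contDiff_right (by linarith)) (fun _ => right_zero hH hP)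
    (fun _ => right_end hH hP) fun x h0 h1 => ?_
  rcases le_or_gt x 1 with h2 | h2
  · rwa [right_zero hH hP (abs_le.2 ⟨by linarith, h2⟩)]
  rcases le_or_gt (2 * P - 2 * H - 1) x with h3 | h3
  · have := right_end hH hP (x := x - (2 * P - 2 * H)) (abs_le.2 ⟨by linarith, by linarith⟩)
    rw [add_sub_cancel] at this
    rw [this]
    linarith
  rcases le_total (x + H) P with h4 | h4
  · linarith [prof_ge hH hP (θ := x + H) (by linarith) h4]
  · rw [← prof_shift (by linarith), ← prof_neg (by linarith)]
    linarith [prof_ge hH hP (θ := -(x + H - 2 * P)) (by linarith) (by linarith)]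

theorem isOddExt_cross (hH : 4 ≤ H) (hP : H + 4 ≤ P) :
    IsOddExt (2 * P) 1 (fun x => prof P H (H + x)) (oddExt (2 * P) fun x => prof P H (H + x)) := by
  refine isOddExt_oddExt (by linarith) ?_ (fun x h => ?_) (fun x h => ?_)
  · have := contDiff_prof (P := P) (H := H) (by linarith)
    fun_prop
  · rw [add_comm, right_zero hH hP h]
  · rw [← prof_shift (by linarith), show H + (2 * P + x) - 2 * P = x + H by ring,
      right_zero hH hP h, one_mul]

theorem height_mem {δ k : ℝ} (hδ : |δ| ≤ 1 / 2) (hk : |k| ≤ 1) :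
    1 / 2 + δ * k ∈ Set.Icc (0 : ℝ) 1 := by
  have h : |δ * k| ≤ 1 / 2 := by
    rw [abs_mul]
    nlinarith [abs_nonneg δ, abs_nonneg k]
  rw [abs_le] at h
  constructor <;> linarith

theorem abs_bump_le (x : ℝ) : |bump x| ≤ 1 := by
  rw [abs_of_nonneg bump.nonneg]
  exact bump.le_one

theorem contDiff_joinHeight (hP : 1 ≤ P) : ContDiff ℝ ∞ (joinHeight P) := by
  refine contDiff_antiExt (by linarith) ?_ (joinHeight_anti hP)
  have := contDiff_bump
  fun_prop

theorem joinHeight_add (hP : 1 ≤ P) (t : ℝ) (n : ℤ) :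
    joinHeight P (t + 2 * P * n) = (-1) ^ n * joinHeight P t :=
  antiExt_add (b := fun x => bump x - bump (2 * P - x)) (by linarith) (joinHeight_anti hP) t n

theorem isVLink_pinch_cross (hH : 4 ≤ H) (hP : H + 4 ≤ P) (hb : b ≠ 0)
    (hX : ∀ u θ : ℝ, |(|u| - |prof P H θ|)| ≤ 1 → pol P a b u θ ∈ X) {δ : ℝ} (hδ : δ ≠ 0)
    (hδ' : |δ| ≤ 1 / 2) :
    IsVLink X (fun _ : Unit => 2 * (2 * P))
      (fun _ t => pol P a b (antiExt (2 * P) (joinFn P H) t) (t - H))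
      (fun _ t => 1 / 2 - δ * joinHeight P t) := by
  have sm : ContDiff ℝ ∞ (antiExt (2 * P) (joinFn P H)) :=
    contDiff_antiExt (by linarith) (contDiff_joinFn (by linarith)) (join_anti hH hP)
  have sh := contDiff_joinHeight (P := P) (by linarith)
  have pm : ∀ t, antiExt (2 * P) (joinFn P H) (t + 2 * (2 * P)) =
      antiExt (2 * P) (joinFn P H) t := by
    intro t
    have := antiExt_add (w := 2 * P) (by linarith) (join_anti hH hP) t 2
    norm_num at this
    rw [← this]
    congr 1
    ring
  have ph : ∀ t, joinHeight P (t + 2 * (2 * P)) = joinHeight P t := by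
    intro t
    have := joinHeight_add (P := P) (by linarith) t 2
    norm_num at this
    rw [← this]
    congr 1
    ring
  refine ⟨fun _ => by linarith, fun _ => contDiff_pol sm (by fun_prop), fun _ => by fun_prop,
    fun _ t => ?_, fun _ t => ?_, fun i t => ?_, fun _ t => ?_, fun _ t => ?_, ?_⟩
  · have := pol_add_int (P := P) (a := a) (b := b) (by linarith)
      (antiExt (2 * P) (joinFn P H) t) (t - H) 2
    simp only [pm]
    rw [← this]
    congr 1
    push_cast
    ring
  · simp only [ph]
  · exact (sweeps_pinch_cross hH hP δ).mem_of_near (by linarith) isLocalPicture_pinchT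
      (isLocalPicture_crossT δ) hX i t
  · have hk : |-joinHeight P t| ≤ 1 := by
      obtain ⟨x, n, hx, hx', rfl⟩ := exists_eq_add_mul (w := 2 * P) (by linarith) t
      rw [joinHeight, antiExt_apply (by linarith) (joinHeight_anti (by linarith)) (by linarith)
        (by linarith), abs_neg, abs_sign_mul (neg_one_zpow_cases n), abs_le]
      have h1 := bump.nonneg (x := x)
      have h2 := bump.nonneg (x := 2 * P - x)
      have h3 := bump.le_one (x := x)
      have h4 := bump.le_one (x := 2 * P - x)
      constructor <;> linarith
    have := height_mem hδ' hk
    rwa [mul_neg, ← sub_eq_add_neg] at this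
  · exact deriv_pol_ne (by linarith) hb (sm.differentiable (by simp)).differentiableAt
      (by fun_prop) (Or.inr (by simp))
  · rintro _ _ t t' e e'
    refine ⟨rfl, ?_⟩
    obtain ⟨h1, n, h2⟩ := (pol_eq_iff (by linarith) hb).1 e
    have ht : t' = t + 2 * P * n := by linarith
    subst ht
    rcases Int.even_or_odd n with ⟨k, rfl⟩ | hn
    · exact ⟨k, by push_cast; ring⟩
    exfalso
    rw [antiExt_add (by linarith) (join_anti hH hP), hn.neg_one_zpow] at h1
    have e3 : joinHeight P (t + 2 * P * n) = -joinHeight P t := by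
      rw [joinHeight_add (by linarith), hn.neg_one_zpow]
      ring
    have h3 : antiExt (2 * P) (joinFn P H) t = 0 := by linarith
    obtain ⟨x, m, hx, hx', rfl⟩ := exists_eq_add_mul (w := 2 * P) (by linarith) t
    rw [antiExt_apply (by linarith) (join_anti hH hP) (by linarith) (by linarith)] at h3
    have h4 : joinFn P H x = 0 := (mul_eq_zero.1 h3).resolve_left (zpow_ne_zero _ (by norm_num))
    rcases hx.eq_or_lt with rfl | hx
    · have e4 : joinHeight P (0 + 2 * P * m) = (-1) ^ m := by
        rw [joinHeight, antiExt_apply (by linarith) (joinHeight_anti (by linarith)) (by linarith)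
          (by linarith), bump_zero, bump_eq_zero (by rw [abs_of_pos (by linarith)]; linarith)]
        ring
      rw [e3, e4] at e'
      have h5 : δ * (-1) ^ m = 0 := by linarith
      exact (mul_ne_zero hδ (zpow_ne_zero _ (by norm_num))) h5
    · exact (join_pos hH hP hx hx').ne' h4

theorem isVLink_open_cross (hH : 4 ≤ H) (hP : H + 4 ≤ P) (hb : b ≠ 0)
    (hX : ∀ u θ : ℝ, |(|u| - |prof P H θ|)| ≤ 1 → pol P a b u θ ∈ X) {δ : ℝ} (hδ : δ ≠ 0)
    (hδ' : |δ| ≤ 1 / 2) {f : ℝ → ℝ} (hf : IsOddExt (2 * P) 1 (fun x => prof P H (H + x)) f) :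
    IsVLink X (fun _ : Unit => 2 * (2 * P))
      (fun _ t => pol P a b (f t) (H + wave (2 * P) t))
      (fun _ t => 1 / 2 + δ * openHeight P H t) := by
  have hw : 1 ≤ 2 * P := by linarith
  have sw := contDiff_wave hw
  have sf := hf.smooth
  have sh := contDiff_openHeight hH hP
  refine ⟨fun _ => by linarith, fun _ => contDiff_pol hf.smooth (by fun_prop), fun _ => by fun_prop,
    fun _ t => ?_, fun _ t => ?_, fun i t => ?_, fun _ t => ?_, fun _ t => ?_, ?_⟩
  · simp only [hf.periodic t, wave_periodic hw t]
  · simp only [openHeight]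
    rw [oddExt_periodic (by linarith)]
  · exact (sweeps_open_cross hH hP δ hf).mem_of_near (by linarith) isLocalPicture_openT
      (isLocalPicture_crossT δ) hX i t
  · apply height_mem hδ'
    obtain ⟨y, σ, n, hσ, ⟨h, rfl⟩ | ⟨h, rfl⟩ | ⟨h, h', rfl⟩⟩ := fold_cases hw t
    · rw [openHeight_near_zero hH hP h]; simp
    · rw [openHeight_near_end hH hP h]; simp
    · rw [openHeight_mid hH hP hσ (by linarith) (by linarith), abs_sign_mul hσ]
      exact abs_bump_le _
  · apply deriv_pol_ne (by linarith) hb (sf.differentiable (by simp)).differentiableAt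
      ((contDiff_const.add sw).differentiable (by simp)).differentiableAt
    exact fold_deriv_ne hw hf.odd hf.periodic (fun t ht => by rw [hf.deriv_zero ht]; norm_num)
      (fun t ht => by rw [hf.deriv_end ht]; norm_num) H t
  · rintro _ _ t t' e e'
    refine ⟨rfl, ?_⟩
    obtain ⟨h1, n, h2⟩ := (pol_eq_iff (by linarith) hb).1 e
    have hn : n = 0 := by
      have b1 := wave_pos hw t
      have b2 := wave_pos hw t'
      have b3 := wave_lt hw t
      have b4 := wave_lt hw t'
      by_contra hn
      rcases lt_or_gt_of_ne hn with h | h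
      · have : (n : ℝ) ≤ -1 := by exact_mod_cast (by omega : n ≤ -1)
        nlinarith
      · have : (1 : ℝ) ≤ n := by exact_mod_cast (by omega : 1 ≤ n)
        nlinarith
    subst hn
    rw [Int.cast_zero, mul_zero, add_zero, add_right_inj] at h2
    have small : ∀ {x : ℝ}, |x| < 1 / 2 → 0 < rnd x ∧ rnd x < 1 / 2 :=
      fun h => ⟨rnd_pos _, rnd_lt_half h⟩
    have cases3 : ∀ {x : ℝ} {t : ℝ} (σ : ℝ) (n : ℤ), (σ = 1 ∨ σ = -1) → 1 / 4 ≤ x →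
        x ≤ 2 * P - 1 / 4 → t = σ * x + 2 * (2 * P) * n → (∃ (y : ℝ) (n : ℤ), |y| < 1 / 2 ∧
          t = y + 2 * (2 * P) * n) ∨ (∃ (y : ℝ) (n : ℤ), |y| < 1 / 2 ∧
          t = 2 * P + y + 2 * (2 * P) * n) ∨ (1 / 2 ≤ x ∧ x ≤ 2 * P - 1 / 2) := by
      intro x t σ n hσ h h' ht
      rcases lt_or_ge x (1 / 2) with h3 | h3
      · exact Or.inl ⟨σ * x, n, by rw [abs_sign_mul hσ, abs_of_pos (by linarith)]; exact h3, ht⟩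
      rcases lt_or_ge (2 * P - 1 / 2) x with h4 | h4
      · right; left
        rcases hσ with rfl | rfl
        · exact ⟨x - 2 * P, n, by rw [abs_lt]; constructor <;> linarith, by rw [ht]; ring⟩
        · exact ⟨2 * P - x, n - 1, by rw [abs_lt]; constructor <;> linarith,
            by rw [ht]; push_cast; ring⟩
      · exact Or.inr (Or.inr ⟨h3, h4⟩)
    have tri : ∀ t : ℝ, (∃ (y : ℝ) (n : ℤ), |y| < 1 / 2 ∧ t = y + 2 * (2 * P) * n) ∨
        (∃ (y : ℝ) (n : ℤ), |y| < 1 / 2 ∧ t = 2 * P + y + 2 * (2 * P) * n) ∨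
        (∃ (y σ : ℝ) (n : ℤ), (σ = 1 ∨ σ = -1) ∧ 1 / 2 ≤ y ∧ y ≤ 2 * P - 1 / 2 ∧
          t = σ * y + 2 * (2 * P) * n) := by
      intro t
      obtain ⟨y, σ, n, hσ, ⟨h, h'⟩ | ⟨h, h'⟩ | ⟨h, h', h''⟩⟩ := fold_cases hw t
      · exact Or.inl ⟨y, n, h, h'⟩
      · exact Or.inr (Or.inl ⟨y, n, h, h'⟩)
      · rcases cases3 σ n hσ h h' h'' with h3 | h3 | h3
        · exact Or.inl h3
        · exact Or.inr (Or.inl h3)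
        · exact Or.inr (Or.inr ⟨y, σ, n, hσ, h3.1, h3.2, h''⟩)
    rcases tri t with ⟨y, n, h, rfl⟩ | ⟨y, n, h, rfl⟩ | ⟨y, σ, n, hσ, h, h3, rfl⟩ <;>
    rcases tri t' with ⟨y', n', h', rfl⟩ | ⟨y', n', h', rfl⟩ | ⟨y', σ', n', hσ', h', h3', rfl⟩
    · rw [hf.near_zero n h, hf.near_zero n' h'] at h1
      exact ⟨n' - n, by rw [h1]; push_cast; ring⟩
    · rw [wave_near_zero hw h, wave_near_end hw h'] at h2
      linarith [(small h).2, (small h').2]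
    · rw [wave_near_zero hw h, wave_mid hw hσ' (by linarith) (by linarith)] at h2
      linarith [(small h).2]
    · rw [wave_near_end hw h, wave_near_zero hw h'] at h2
      linarith [(small h).2, (small h').2]
    · rw [hf.near_end n h, hf.near_end n' h'] at h1
      exact ⟨n' - n, by rw [show y' = y by linarith]; push_cast; ring⟩
    · rw [wave_near_end hw h, wave_mid hw hσ' (by linarith) (by linarith)] at h2
      linarith [(small h).2]
    · rw [wave_mid hw hσ (by linarith) (by linarith), wave_near_zero hw h'] at h2
      linarith [(small h').2]
    · rw [wave_mid hw hσ (by linarith) (by linarith), wave_near_end hw h'] at h2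
      linarith [(small h').2]
    · rw [wave_mid hw hσ (by linarith) (by linarith),
        wave_mid hw hσ' (by linarith) (by linarith)] at h2
      subst h2
      by_cases hσσ : σ = σ'
      · subst hσσ
        exact ⟨n' - n, by push_cast; ring⟩
      exfalso
      have hσ2 : σ' = -σ := by
        rcases hσ with rfl | rfl <;> rcases hσ' with rfl | rfl <;>
          first | exact absurd rfl hσσ | norm_num
      subst hσ2
      have hσ0 : σ ≠ 0 := by rcases hσ with rfl | rfl <;> norm_num
      rw [hf.mid n hσ (by linarith) (by linarith), hf.mid n' hσ' (by linarith) (by linarith)] at h1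
      have h4 : prof P H (H + y') = 0 := by
        have : σ * prof P H (H + y') = 0 := by linarith
        exact (mul_eq_zero.1 this).resolve_left hσ0
      have h5 : y' = 2 * P - 2 * H := by
        rcases le_or_gt (H + y') P with h6 | h6
        · linarith [prof_ge hH hP (θ := H + y') (by linarith) h6]
        rw [← prof_shift (by linarith)] at h4
        rcases le_or_gt (H + y' - 2 * P) 0 with h7 | h7
        · have := (prof_small_neg hH hP h7 (by linarith) (by rw [h4]; norm_num)).1
          linarith
        · linarith [prof_le hH hP (θ := H + y' - 2 * P) (by linarith) h7.le]
      rw [openHeight_mid hH hP hσ (by linarith) (by linarith),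
        openHeight_mid hH hP hσ' (by linarith) (by linarith), h5, sub_self, bump_zero] at e'
      have : δ * σ = 0 := by linarith
      exact mul_ne_zero hδ hσ0 this

end Product

end Skein

namespace Skein

section Product

variable {X : Set ℂ} {P H : ℝ} {a b : ℂ}

theorem isLoop_graphCurve (hP : 0 < P) (hb : b ≠ 0) {φ : ℝ → ℝ} (hφ : ContDiff ℝ ∞ φ)
    (hp : Function.Periodic φ (2 * P)) (hm : ∀ t, pol P a b (φ t) t ∈ X) :
    IsLoop X (2 * P) (graphCurve P a b φ) :=
  isLoop_graph hP hb hφ hp hm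

theorem isLoop_foldCurve (hP : 0 < P) (hb : b ≠ 0) {w : ℝ} {f : ℝ → ℝ}
    (hw : 1 ≤ w) (hwP : w ≤ 2 * P) (hf : IsFold w f) (θ₁ : ℝ)
    (hm : ∀ t, pol P a b (f t) (θ₁ + wave w t) ∈ X) :
    IsLoop X (2 * w) (foldCurve P a b w θ₁ f) :=
  isLoop_fold hP hb hw hwP hf θ₁ hm

theorem isLoop_cross_left (hH : 4 ≤ H) (hP : H + 4 ≤ P) (hb : b ≠ 0)
    (hX : ∀ u θ : ℝ, |(|u| - |prof P H θ|)| ≤ 1 → pol P a b u θ ∈ X) :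
    IsLoop X (2 * P) (graphCurve P a b (prof P H)) :=
  isLoop_graphCurve (by linarith) hb (contDiff_prof (by linarith)) (prof_periodic (by linarith))
    fun t => hX _ _ (by simp)

theorem isLoop_cross_right (hH : 4 ≤ H) (hP : H + 4 ≤ P) (hb : b ≠ 0)
    (hX : ∀ u θ : ℝ, |(|u| - |prof P H θ|)| ≤ 1 → pol P a b u θ ∈ X) :
    IsLoop X (2 * P) (graphCurve P a b fun t => -prof P H t) :=
  isLoop_graphCurve (by linarith) hb (contDiff_prof (by linarith)).neg
    (fun t => by simp only [prof_periodic (P := P) (by linarith) t]) fun t => hX _ _ (by simp)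

theorem isLoop_outer (hH : 4 ≤ H) (hP : H + 4 ≤ P) (hb : b ≠ 0)
    (hX : ∀ u θ : ℝ, |(|u| - |prof P H θ|)| ≤ 1 → pol P a b u θ ∈ X) :
    IsLoop X (2 * P) (graphCurve P a b fun t => rnd (prof P H t)) :=
  isLoop_graphCurve (by linarith) hb (contDiff_rnd.comp (contDiff_prof (by linarith)))
    (fun t => by simp only [prof_periodic (P := P) (by linarith) t]) fun t => hX _ _ (by
      have h1 := rnd_le (prof P H t)
      have h2 := abs_le_rnd (prof P H t)
      rw [abs_of_pos (rnd_pos _), abs_le]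
      constructor <;> linarith)

theorem isLoop_inner (hH : 4 ≤ H) (hP : H + 4 ≤ P) (hb : b ≠ 0)
    (hX : ∀ u θ : ℝ, |(|u| - |prof P H θ|)| ≤ 1 → pol P a b u θ ∈ X) :
    IsLoop X (2 * P) (graphCurve P a b fun t => -rnd (prof P H t)) :=
  isLoop_graphCurve (by linarith) hb (contDiff_rnd.comp (contDiff_prof (by linarith))).neg
    (fun t => by simp only [prof_periodic (P := P) (by linarith) t]) fun t => hX _ _ (by
      have h1 := rnd_le (prof P H t)
      have h2 := abs_le_rnd (prof P H t)
      rw [abs_neg, abs_of_pos (rnd_pos _), abs_le]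
      constructor <;> linarith)

theorem isLoop_join (hH : 4 ≤ H) (hP : H + 4 ≤ P) (hb : b ≠ 0)
    (hX : ∀ u θ : ℝ, |(|u| - |prof P H θ|)| ≤ 1 → pol P a b u θ ∈ X) :
    IsLoop X (2 * (2 * P)) (foldCurve P a b (2 * P) (-H) (joinFold P H)) :=
  isLoop_foldCurve (by linarith) hb (by linarith) le_rfl (isFold_joinFold hH hP) _
    fun t => (sweeps_pinch_open hH hP (isOddExt_joinFold hH hP)).mem_of_near (by linarith)
      isLocalPicture_pinchT isLocalPicture_openT hX () t

theorem isLoop_join_flip (hH : 4 ≤ H) (hP : H + 4 ≤ P) (hb : b ≠ 0)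
    (hX : ∀ u θ : ℝ, |(|u| - |prof P H θ|)| ≤ 1 → pol P a b u θ ∈ X) :
    IsLoop X (2 * (2 * P)) (foldCurve P a b (2 * P) H fun t => joinFold P H (2 * P - t)) :=
  isLoop_foldCurve (by linarith) hb (by linarith) le_rfl (isFold_joinFold hH hP).flip _
    fun t => (sweeps_open_pinch hH hP (isOddExt_joinFold hH hP)).mem_of_near (by linarith)
      isLocalPicture_openT isLocalPicture_pinchT hX () t

theorem isLoop_left (hH : 4 ≤ H) (hP : H + 4 ≤ P) (hb : b ≠ 0)
    (hX : ∀ u θ : ℝ, |(|u| - |prof P H θ|)| ≤ 1 → pol P a b u θ ∈ X) :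
    IsLoop X (2 * (2 * H)) (foldCurve P a b (2 * H) (-H) (leftFold P H)) :=
  isLoop_foldCurve (by linarith) hb (by linarith) (by linarith) (isFold_leftFold hH hP) _
    fun t => (sweeps_open hH hP (isOddExt_leftFold hH hP)
      (isOddExt_rightFold hH hP)).mem_of_near (by linarith)
      isLocalPicture_openT isLocalPicture_openT hX true t

theorem isLoop_right (hH : 4 ≤ H) (hP : H + 4 ≤ P) (hb : b ≠ 0)
    (hX : ∀ u θ : ℝ, |(|u| - |prof P H θ|)| ≤ 1 → pol P a b u θ ∈ X) :
    IsLoop X (2 * (2 * P - 2 * H)) (foldCurve P a b (2 * P - 2 * H) H (rightFold P H)) :=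
  isLoop_foldCurve (by linarith) hb (by linarith) (by linarith) (isFold_rightFold hH hP) _
    fun t => (sweeps_open hH hP (isOddExt_leftFold hH hP)
      (isOddExt_rightFold hH hP)).mem_of_near (by linarith)
      isLocalPicture_openT isLocalPicture_openT hX false t

theorem loopSet_eq_vset (γ : ℝ → ℂ) : loopSet γ = vset (fun _ : Unit => γ) (fun _ _ => 1 / 2) :=
  (vset_unit γ).symm

theorem left_ne_right (hH : 4 ≤ H) (hP : H + 4 ≤ P) (hb : b ≠ 0) (f g : ℝ → ℝ) (t t' : ℝ) :
    foldCurve P a b (2 * H) (-H) f t ≠ foldCurve P a b (2 * P - 2 * H) H g t' := by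
  intro e
  obtain ⟨-, n, h⟩ := (pol_eq_iff (by linarith) hb).1 e
  have h1 := wave_pos (w := 2 * H) (by linarith) t
  have h2 := wave_lt (w := 2 * H) (by linarith) t
  have h3 := wave_pos (w := 2 * P - 2 * H) (by linarith) t'
  have h4 := wave_lt (w := 2 * P - 2 * H) (by linarith) t'
  rcases le_or_gt n 0 with hn | hn
  · have : (n : ℝ) ≤ 0 := by exact_mod_cast hn
    nlinarith
  · have : (1 : ℝ) ≤ n := by exact_mod_cast (by omega : 1 ≤ n)
    nlinarith

theorem inner_ne_outer (hP : 0 < P) (hb : b ≠ 0) (t t' : ℝ) :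
    graphCurve P a b (fun t => -rnd (prof P H t)) t ≠
      graphCurve P a b (fun t => rnd (prof P H t)) t' := by
  intro e
  have := ((pol_eq_iff hP hb).1 e).1
  linarith [rnd_pos (prof P H t), rnd_pos (prof P H t')]

/-- The four states of the two curves `u = prof θ` and `u = - prof θ`, with either one of them
above the other one. -/
theorem loopClass_mul_cross (hH : 4 ≤ H) (hP : H + 4 ≤ P) (hb : b ≠ 0)
    (hX : ∀ u θ : ℝ, |(|u| - |prof P H θ|)| ≤ 1 → pol P a b u θ ∈ X)
    {R : Type*} [CommRing R] (s : Rˣ) :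
    loopClass X s (graphCurve P a b (prof P H)) *
        loopClass X s (graphCurve P a b fun t => -prof P H t) =
      ((s ^ 2 : Rˣ) : R) • loopClass X s (foldCurve P a b (2 * P) (-H) (joinFold P H)) +
      (((s ^ 2)⁻¹ : Rˣ) : R) • loopClass X s (foldCurve P a b (2 * P) H
        fun t => joinFold P H (2 * P - t)) +
      loopClass X s (foldCurve P a b (2 * H) (-H) (leftFold P H)) *
        loopClass X s (foldCurve P a b (2 * P - 2 * H) H (rightFold P H)) +
      loopClass X s (graphCurve P a b fun t => -rnd (prof P H t)) *
        loopClass X s (graphCurve P a b fun t => rnd (prof P H t)) ∧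
    loopClass X s (graphCurve P a b fun t => -prof P H t) *
        loopClass X s (graphCurve P a b (prof P H)) =
      (((s ^ 2)⁻¹ : Rˣ) : R) • loopClass X s (foldCurve P a b (2 * P) (-H) (joinFold P H)) +
      ((s ^ 2 : Rˣ) : R) • loopClass X s (foldCurve P a b (2 * P) H
        fun t => joinFold P H (2 * P - t)) +
      loopClass X s (foldCurve P a b (2 * H) (-H) (leftFold P H)) *
        loopClass X s (foldCurve P a b (2 * P - 2 * H) H (rightFold P H)) +
      loopClass X s (graphCurve P a b fun t => -rnd (prof P H t)) *
        loopClass X s (graphCurve P a b fun t => rnd (prof P H t)) := by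
  have hP0 : 0 < P := by linarith
  have hP1 : 1 ≤ P := by linarith
  have kA := isLoop_cross_left hH hP hb hX
  have kB := isLoop_cross_right hH hP hb hX
  obtain ⟨MO, hMO⟩ := exists_link_of_disjoint (isLoop_left hH hP hb hX)
    (isLoop_right hH hP hb hX) (left_ne_right hH hP hb _ _)
  obtain ⟨MI, hMI⟩ := exists_link_of_disjoint (isLoop_inner hH hP hb hX)
    (isLoop_outer hH hP hb hX) (inner_ne_outer hP0 hb)
  rw [loopClass_mul_eq_of_disjoint (isLoop_left hH hP hb hX)
    (isLoop_right hH hP hb hX) (left_ne_right hH hP hb _ _) hMO,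
    loopClass_mul_eq_of_disjoint (isLoop_inner hH hP hb hX)
    (isLoop_outer hH hP hb hX) (inner_ne_outer hP0 hb) hMI]
  have eMO : MO.carrier = mcar P H a b openT openT := by
    rw [hMO, ← (sweeps_open hH hP (isOddExt_leftFold hH hP) (isOddExt_rightFold hH hP)).vset_eq hP0]
    congr 1
    funext c t
    cases c <;> rfl
  have eMI : MI.carrier = mcar P H a b pinchT pinchT := by
    rw [hMI, ← (sweeps_pinch hP1).vset_eq hP0]
    congr 1
    funext c t
    cases c <;> rfl
  obtain ⟨Sp, hSp, eSp⟩ : ∃ L : FramedLink X, L.toSkein s =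
      loopClass X s (foldCurve P a b (2 * P) (-H) (joinFold P H)) ∧
      L.carrier = mcar P H a b pinchT openT :=
    ⟨(isLoop_join hH hP hb hX).link, toSkein_eq_loopClass rfl, (loopSet_eq_vset _).trans
      ((sweeps_pinch_open hH hP (isOddExt_joinFold hH hP)).vset_eq hP0)⟩
  obtain ⟨Sm, hSm, eSm⟩ : ∃ L : FramedLink X, L.toSkein s =
      loopClass X s (foldCurve P a b (2 * P) H fun t => joinFold P H (2 * P - t)) ∧
      L.carrier = mcar P H a b openT pinchT :=
    ⟨(isLoop_join_flip hH hP hb hX).link, toSkein_eq_loopClass rfl, (loopSet_eq_vset _).trans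
      ((sweeps_open_pinch hH hP (isOddExt_joinFold hH hP)).vset_eq hP0)⟩
  rw [← hSp, ← hSm]
  have meet : ∀ t t', graphCurve P a b (prof P H) t = graphCurve P a b (fun t => -prof P H t) t' →
      prof P H t = 0 ∧ prof P H t' = 0 := by
    intro t t' e
    obtain ⟨h1, n, rfl⟩ := (pol_eq_iff hP0 hb).1 e
    simp only [prof_add_int hP1] at h1 ⊢
    exact ⟨by linarith, by linarith⟩
  have sp := contDiff_prof (H := H) hP1
  have sb := contDiff_bump
  have key : ∀ δ : ℝ, δ ≠ 0 → |δ| ≤ 1 / 2 → ∃ M K₁ K₂ : FramedLink X,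
      M.carrier = vset (fun c => cond c (graphCurve P a b (prof P H))
        (graphCurve P a b fun t => -prof P H t)) (fun c : Bool => cond c
        (fun t => 1 / 2 + δ * bump (prof P H t)) (fun t => 1 / 2 - δ * bump (prof P H t))) ∧
      M.carrier = mcar P H a b (crossT δ) (crossT δ) ∧
      K₁.carrier = mcar P H a b pinchT (crossT δ) ∧
      K₂.carrier = mcar P H a b openT (crossT δ) := by
    intro δ hδ hδ'
    have hV : IsVLink X (fun c : Bool => cond c (2 * P) (2 * P)) _ _ :=
      isVLink_pair (η := fun t => 1 / 2 + δ * bump (prof P H t))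
      (η' := fun t => 1 / 2 - δ * bump (prof P H t)) kA kB
      (by fun_prop) (by fun_prop) (fun t => by simp only [prof_periodic hP1 t])
      (fun t => by simp only [prof_periodic hP1 t]) (fun t => height_mem hδ' (abs_bump_le _))
      (fun t => by
        have := height_mem (δ := -δ) (by rwa [abs_neg]) (abs_bump_le (prof P H t))
        rwa [neg_mul, ← sub_eq_add_neg] at this)
      (by
        intro t t' e h
        obtain ⟨h1, h2⟩ := meet t t' e
        rw [h1, h2, bump_zero] at h
        exact hδ (by linarith))
    refine ⟨hV.link, (isVLink_pinch_cross hH hP hb hX hδ hδ').link,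
      (isVLink_open_cross hH hP hb hX hδ hδ' (isOddExt_cross hH hP)).link, rfl, ?_,
      (sweeps_pinch_cross hH hP δ).vset_eq hP0,
      (sweeps_open_cross hH hP δ (isOddExt_cross hH hP)).vset_eq hP0⟩
    change vset _ _ = _
    rw [← (sweeps_cross hP1 δ).vset_eq hP0]
    congr 1
    · funext c t
      cases c <;> rfl
    · funext c t
      cases c <;> rfl
  have pw : (s : R) * (s : R) = ((s ^ 2 : Rˣ) : R) := by push_cast; ring
  have pw' : ((s⁻¹ : Rˣ) : R) * ((s⁻¹ : Rˣ) : R) = (((s ^ 2)⁻¹ : Rˣ) : R) := by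
    rw [← Units.val_mul, ← mul_inv, sq]
  constructor
  · obtain ⟨M, K₁, K₂, hM, eM, e₁, e₂⟩ := key (1 / 4) (by norm_num) (by norm_num [abs_le])
    rw [loopClass_mul_eq (η := fun t => 1 / 2 + 1 / 4 * bump (prof P H t))
      (η' := fun t => 1 / 2 - 1 / 4 * bump (prof P H t)) kA kB (by fun_prop) (by fun_prop)
      (fun t => by simp only [prof_periodic hP1 t]) (fun t => by simp only [prof_periodic hP1 t])
      (fun t => height_mem (by norm_num [abs_le]) (abs_bump_le _)) (fun t => by
        have := height_mem (δ := -(1 / 4)) (by norm_num [abs_le]) (abs_bump_le (prof P H t))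
        rwa [neg_mul, ← sub_eq_add_neg] at this) (by
        intro t t' e
        obtain ⟨h1, h2⟩ := meet t t' e
        rw [h1, h2, bump_zero]
        norm_num) hM,
      toSkein_of_triple ((isSkeinTriple_mcar hH hP hb hX eM e₁ e₂).1 (by norm_num)),
      toSkein_of_triple ((isSkeinTriple_mcar_neg hH hP hb hX e₁ eMI eSp).1 (by norm_num)),
      toSkein_of_triple ((isSkeinTriple_mcar_neg hH hP hb hX e₂ eSm eMO).1 (by norm_num))]
    simp only [smul_add, smul_smul, pw, pw', Units.mul_inv, Units.inv_mul, one_smul]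
    abel
  · obtain ⟨M, K₁, K₂, hM, eM, e₁, e₂⟩ := key (-(1 / 4)) (by norm_num) (by norm_num [abs_le])
    rw [loopClass_mul_eq (M := M) (η := fun t => 1 / 2 - -(1 / 4) * bump (prof P H t))
      (η' := fun t => 1 / 2 + -(1 / 4) * bump (prof P H t)) kB kA (by fun_prop) (by fun_prop)
      (fun t => by simp only [prof_periodic hP1 t]) (fun t => by simp only [prof_periodic hP1 t])
      (fun t => by
        have := height_mem (δ := - -(1 / 4)) (by norm_num [abs_le]) (abs_bump_le (prof P H t))
        rwa [neg_mul, ← sub_eq_add_neg] at this)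
      (fun t => height_mem (by norm_num [abs_le]) (abs_bump_le _)) (by
        intro t t' e
        obtain ⟨h1, h2⟩ := meet t' t e.symm
        rw [h1, h2, bump_zero]
        norm_num) (by
        rw [hM]
        ext x
        constructor
        · rintro ⟨c, t, rfl⟩
          exact ⟨!c, t, by cases c <;> rfl⟩
        · rintro ⟨c, t, rfl⟩
          exact ⟨!c, t, by cases c <;> rfl⟩),
      toSkein_of_triple ((isSkeinTriple_mcar hH hP hb hX eM e₁ e₂).2 (by norm_num)),
      toSkein_of_triple ((isSkeinTriple_mcar_neg hH hP hb hX e₁ eMI eSp).2 (by norm_num)),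
      toSkein_of_triple ((isSkeinTriple_mcar_neg hH hP hb hX e₂ eSm eMO).2 (by norm_num))]
    simp only [smul_add, smul_smul, pw, pw', Units.mul_inv, Units.inv_mul, one_smul]
    abel

end Product

end Skein

namespace Skein

/-! ### Isotopies of loops -/

/-- The closed curves `γ` and `γ'` are isotopic through regular simple loops in `X`. -/
def LoopIsotopic (X : Set ℂ) (γ γ' : ℝ → ℂ) : Prop :=
  ∃ (T : ℝ) (Γ : ℝ → ℝ → ℂ), (ContDiff ℝ ∞ fun p : ℝ × ℝ => Γ p.1 p.2) ∧
    (∀ x ∈ Set.Icc (0 : ℝ) 1, IsLoop X T (Γ x)) ∧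
    Set.range (Γ 0) = Set.range γ ∧ Set.range (Γ 1) = Set.range γ'

theorem LoopIsotopic.loopClass_eq {X : Set ℂ} {R : Type*} [CommRing R] {s : Rˣ} {γ γ' : ℝ → ℂ}
    (h : LoopIsotopic X γ γ') : loopClass X s γ = loopClass X s γ' := by
  obtain ⟨T, Γ, h1, h2, h3, h4⟩ := h
  rw [← loopClass_eq_of_range h3, ← loopClass_eq_of_range h4]
  exact loopClass_eq_of_family h1 h2

theorem LoopIsotopic.congr {X : Set ℂ} {γ γ' δ δ' : ℝ → ℂ} (h : LoopIsotopic X γ γ')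
    (h1 : Set.range γ = Set.range δ) (h2 : Set.range γ' = Set.range δ') :
    LoopIsotopic X δ δ' := by
  obtain ⟨T, Γ, a1, a2, a3, a4⟩ := h
  exact ⟨T, Γ, a1, a2, a3.trans h1, a4.trans h2⟩

theorem IsLoop.map {X Y : Set ℂ} {T : ℝ} {γ : ℝ → ℂ} (h : IsLoop Y T γ) {F : ℂ → ℂ}
    (hF : ContDiff ℝ ∞ F) (hd : ∀ z, ∃ F', HasDerivAt F F' z ∧ F' ≠ 0) (hi : Set.InjOn F Y)
    (hm : Set.MapsTo F Y X) : IsLoop X T fun t => F (γ t) where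
  pos := h.pos
  smooth := hF.comp h.smooth
  periodic t := by simp only [h.periodic t]
  mem t := hm (h.mem t)
  deriv_ne t := by
    obtain ⟨F', h1, h2⟩ := hd (γ t)
    have h3 := ((h.smooth.differentiable (by simp)).differentiableAt (x := t)).hasDerivAt
    have h4 := h1.comp_of_eq t h3 rfl
    have h5 : HasDerivAt (fun t => F (γ t)) (F' * deriv γ t) t := h4
    rw [h5.deriv]
    exact mul_ne_zero h2 (h.deriv_ne t)
  simple t t' e := h.simple t t' (hi (h.mem t) (h.mem t') e)

theorem LoopIsotopic.map {X Y : Set ℂ} {γ γ' : ℝ → ℂ} (h : LoopIsotopic Y γ γ') {F : ℂ → ℂ}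
    (hF : ContDiff ℝ ∞ F) (hd : ∀ z, ∃ F', HasDerivAt F F' z ∧ F' ≠ 0) (hi : Set.InjOn F Y)
    (hm : Set.MapsTo F Y X) : LoopIsotopic X (fun t => F (γ t)) (fun t => F (γ' t)) := by
  obtain ⟨T, Γ, a1, a2, a3, a4⟩ := h
  refine ⟨T, fun x t => F (Γ x t), hF.comp a1, fun x hx => (a2 x hx).map hF hd hi hm, ?_, ?_⟩
  · have := congrArg (fun S => F '' S) a3
    simp only [← Set.range_comp] at this
    exact this
  · have := congrArg (fun S => F '' S) a4
    simp only [← Set.range_comp] at this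
    exact this

theorem lt_combo {x m a b : ℝ} (hx : 0 ≤ x) (hx' : x ≤ 1) (ha : m < a) (hb : m < b) :
    m < (1 - x) * a + x * b := by
  rcases hx.eq_or_lt with rfl | hx
  · linarith
  · nlinarith [mul_pos hx (sub_pos.2 hb), mul_nonneg (sub_nonneg.2 hx') (sub_pos.2 ha).le]

theorem combo_lt {x m a b : ℝ} (hx : 0 ≤ x) (hx' : x ≤ 1) (ha : a < m) (hb : b < m) :
    (1 - x) * a + x * b < m := by
  have := lt_combo hx hx' (neg_lt_neg ha) (neg_lt_neg hb)
  linarith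

/-- Curves that wind once around a point are isotopic if they separate the complement of the
surface in the same way. -/
theorem loopIsotopic_graph {X : Set ℂ} {P : ℝ} {a b : ℂ} (hP : 0 < P) (hb : b ≠ 0) {φ ψ : ℝ → ℝ}
    (hφ : ContDiff ℝ ∞ φ) (hψ : ContDiff ℝ ∞ ψ) (hφP : Function.Periodic φ (2 * P))
    (hψP : Function.Periodic ψ (2 * P)) (hX : ∀ u θ : ℝ, pol P a b u θ ∉ X →
      (u < φ θ ∧ u < ψ θ) ∨ (φ θ < u ∧ ψ θ < u)) :
    LoopIsotopic X (graphCurve P a b φ) (graphCurve P a b ψ) := by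
  refine ⟨2 * P, fun x => graphCurve P a b fun t => (1 - x) * φ t + x * ψ t, ?_, ?_, ?_, ?_⟩
  · refine contDiff_pol ?_ contDiff_snd
    fun_prop
  · rintro x ⟨hx, hx'⟩
    refine isLoop_graphCurve hP hb (by fun_prop) (fun t => by simp only [hφP t, hψP t]) fun t => ?_
    by_contra h
    rcases hX _ _ h with ⟨h1, h2⟩ | ⟨h1, h2⟩
    · exact lt_irrefl _ (lt_combo hx hx' h1 h2)
    · exact lt_irrefl _ (combo_lt hx hx' h1 h2)
  · simp
  · simp

/-! ### Ovals -/

/-- The ellipse with centre `c` and half-axes `p δ` and `q i δ`. -/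
noncomputable def oval (c δ : ℂ) (p q t : ℝ) : ℂ :=
  c + δ * (p * Real.cos t + q * Real.sin t * Complex.I)

/-- The quadratic function that has the value `1` on the ellipse. -/
noncomputable def ovalQ (c δ : ℂ) (p q : ℝ) (z : ℂ) : ℝ :=
  (((z - c) / δ).re / p) ^ 2 + (((z - c) / δ).im / q) ^ 2

theorem range_oval {c δ : ℂ} {p q : ℝ} (hδ : δ ≠ 0) (hp : 0 < p) (hq : 0 < q) :
    Set.range (oval c δ p q) = {z | ovalQ c δ p q z = 1} := by
  ext z
  constructor
  · rintro ⟨t, rfl⟩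
    have h : (oval c δ p q t - c) / δ = p * Real.cos t + q * Real.sin t * Complex.I := by
      rw [oval]
      field_simp
      ring
    rw [Set.mem_ofPred_eq, ovalQ, h]
    have e1 : ((p * Real.cos t + q * Real.sin t * Complex.I : ℂ)).re = p * Real.cos t := by
      simp [-Complex.ofReal_cos, -Complex.ofReal_sin]
    have e2 : ((p * Real.cos t + q * Real.sin t * Complex.I : ℂ)).im = q * Real.sin t := by
      simp [-Complex.ofReal_cos, -Complex.ofReal_sin]
    rw [e1, e2, mul_div_cancel_left₀ _ hp.ne', mul_div_cancel_left₀ _ hq.ne']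
    exact Real.cos_sq_add_sin_sq t
  · intro h
    rw [Set.mem_ofPred_eq, ovalQ] at h
    set v := (z - c) / δ with hv
    have h1 : ‖((v.re / p : ℝ) + (v.im / q : ℝ) * Complex.I : ℂ)‖ = 1 := by
      rw [← sq_eq_sq₀ (norm_nonneg _) zero_le_one, ← Complex.normSq_eq_norm_sq,
        Complex.normSq_add_mul_I, h, one_pow]
    refine ⟨Complex.arg ((v.re / p : ℝ) + (v.im / q : ℝ) * Complex.I), ?_⟩
    have h2 := Complex.norm_mul_cos_arg ((v.re / p : ℝ) + (v.im / q : ℝ) * Complex.I)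
    have h3 := Complex.norm_mul_sin_arg ((v.re / p : ℝ) + (v.im / q : ℝ) * Complex.I)
    rw [h1, one_mul] at h2 h3
    rw [oval, h2, h3]
    have e1 : ((v.re / p : ℝ) + (v.im / q : ℝ) * Complex.I : ℂ).re = v.re / p := by simp
    have e2 : ((v.re / p : ℝ) + (v.im / q : ℝ) * Complex.I : ℂ).im = v.im / q := by simp
    rw [e1, e2]
    have hp' : (p : ℂ) ≠ 0 := Complex.ofReal_ne_zero.2 hp.ne'
    have hq' : (q : ℂ) ≠ 0 := Complex.ofReal_ne_zero.2 hq.ne'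
    have e3 : (p : ℂ) * ((v.re / p : ℝ) : ℂ) + q * ((v.im / q : ℝ) : ℂ) * Complex.I = v := by
      push_cast
      rw [mul_div_cancel₀ _ hp', mul_div_cancel₀ _ hq', Complex.re_add_im]
    rw [e3, hv]
    field_simp
    ring

theorem quadratic_sign {A B C ρ : ℝ} (hA : 0 < A) (hC : C < 0) (hρ : 0 < ρ) :
    (A * ρ ^ 2 + 2 * B * ρ + C < 0 ↔ ρ < (-B + √(B ^ 2 - A * C)) / A) ∧
    (A * ρ ^ 2 + 2 * B * ρ + C = 0 ↔ ρ = (-B + √(B ^ 2 - A * C)) / A) := by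
  have hd : 0 < B ^ 2 - A * C := by nlinarith [sq_nonneg B]
  set r := √(B ^ 2 - A * C) with hr
  have h1 : r ^ 2 = B ^ 2 - A * C := Real.sq_sqrt hd.le
  have h2 : 0 < r := Real.sqrt_pos.2 hd
  have h3 : 0 < A * ρ + B + r := by
    have : |B| < r := by
      apply abs_lt_of_sq_lt_sq _ h2.le
      rw [h1]
      nlinarith
    have := (abs_lt.1 this).1
    nlinarith
  have key : A * (A * ρ ^ 2 + 2 * B * ρ + C) = (A * ρ + B + r) * (A * ρ + B - r) := by
    linear_combination h1
  rw [lt_div_iff₀ hA, eq_div_iff hA.ne']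
  constructor
  · constructor
    · intro h
      have : (A * ρ + B + r) * (A * ρ + B - r) < 0 := by
        rw [← key]
        exact mul_neg_of_pos_of_neg hA h
      have := neg_of_mul_neg_right this h3.le
      linarith
    · intro h
      have : (A * ρ + B + r) * (A * ρ + B - r) < 0 :=
        mul_neg_of_pos_of_neg h3 (by linarith)
      rw [← key] at this
      exact neg_of_mul_neg_right this hA.le
  · constructor
    · intro h
      rw [h, mul_zero] at key
      have := (mul_eq_zero.1 key.symm).resolve_left h3.ne'
      linarith
    · intro h
      have h4 : A * ρ + B - r = 0 := by linarith
      rw [h4, mul_zero] at key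
      exact (mul_eq_zero.1 key).resolve_left hA.ne'

/-- In polar coordinates with a centre in its interior, an ellipse is a graph. -/
theorem exists_ovalGraph {P : ℝ} {a b c δ : ℂ} {p q : ℝ} (hP : 0 < P) (hb : b ≠ 0) (hδ : δ ≠ 0)
    (hp : 0 < p) (hq : 0 < q) (ha : ovalQ c δ p q a < 1) :
    ∃ ψ : ℝ → ℝ, ContDiff ℝ ∞ ψ ∧ Function.Periodic ψ (2 * P) ∧ ∀ u θ : ℝ,
      (ovalQ c δ p q (pol P a b u θ) < 1 ↔ u < ψ θ) ∧
      (ovalQ c δ p q (pol P a b u θ) = 1 ↔ u = ψ θ) := by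
  have hr : 0 < π / P := div_pos Real.pi_pos hP
  set e : ℝ → ℂ := fun θ => pol P 0 (b / δ) 0 θ with he
  set v := (a - c) / δ with hv
  have hee : ∀ u θ, (pol P a b u θ - c) / δ = v + (Real.exp (π / P * u) : ℝ) * e θ := by
    intro u θ
    have h1 : ((π / P : ℝ) : ℂ) * (u + θ * Complex.I) =
        ((π / P * u : ℝ) : ℂ) + ((π / P : ℝ) : ℂ) * (((0 : ℝ) : ℂ) + θ * Complex.I) := by
      push_cast
      ring
    rw [he, hv]
    simp only [pol]
    rw [h1, Complex.exp_add, Complex.ofReal_exp]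
    field_simp
    ring
  have he0 : ∀ θ, e θ ≠ 0 := by
    intro θ
    simp only [he, pol, zero_add]
    exact mul_ne_zero (div_ne_zero hb hδ) (Complex.exp_ne_zero _)
  have hes : ContDiff ℝ ∞ e := contDiff_pol contDiff_const contDiff_id
  have hep : Function.Periodic e (2 * P) := by
    intro θ
    have := pol_add_int (P := P) (a := 0) (b := b / δ) hP 0 θ 1
    rwa [Int.cast_one, mul_one] at this
  have her : ContDiff ℝ ∞ fun θ => (e θ).re := Complex.reCLM.contDiff.comp hes
  have hei : ContDiff ℝ ∞ fun θ => (e θ).im := Complex.imCLM.contDiff.comp hes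
  set A : ℝ → ℝ := fun θ => ((e θ).re / p) ^ 2 + ((e θ).im / q) ^ 2 with hA
  set B : ℝ → ℝ := fun θ => v.re * (e θ).re / p ^ 2 + v.im * (e θ).im / q ^ 2 with hB
  set C : ℝ := (v.re / p) ^ 2 + (v.im / q) ^ 2 - 1 with hC
  have hC0 : C < 0 := by
    rw [ovalQ, ← hv] at ha
    rw [hC]
    linarith
  have hA0 : ∀ θ, 0 < A θ := by
    intro θ
    rcases eq_or_ne (e θ).re 0 with h | h
    · have h' : (e θ).im ≠ 0 := fun h' => he0 θ (Complex.ext h h')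
      have := pow_pos (abs_pos.2 (div_ne_zero h' hq.ne')) 2
      rw [sq_abs] at this
      simp only [hA]
      positivity
    · have := pow_pos (abs_pos.2 (div_ne_zero h hp.ne')) 2
      rw [sq_abs] at this
      simp only [hA]
      positivity
  have hAs : ContDiff ℝ ∞ A := by
    simp only [hA]
    fun_prop
  have hBs : ContDiff ℝ ∞ B := by
    simp only [hB]
    fun_prop
  have hd : ∀ θ, 0 < B θ ^ 2 - A θ * C := by
    intro θ
    nlinarith [sq_nonneg (B θ), hA0 θ, mul_pos (hA0 θ) (neg_pos.2 hC0)]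
  set ρ : ℝ → ℝ := fun θ => (-B θ + √(B θ ^ 2 - A θ * C)) / A θ with hρ
  have hρ0 : ∀ θ, 0 < ρ θ := by
    intro θ
    apply div_pos _ (hA0 θ)
    have : |B θ| < √(B θ ^ 2 - A θ * C) := by
      apply abs_lt_of_sq_lt_sq _ (Real.sqrt_nonneg _)
      rw [Real.sq_sqrt (hd θ).le]
      nlinarith [mul_pos (hA0 θ) (neg_pos.2 hC0)]
    linarith [(abs_lt.1 this).2]
  have hρs : ContDiff ℝ ∞ ρ := by
    have h1 : ContDiff ℝ ∞ fun θ => √(B θ ^ 2 - A θ * C) :=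
      ContDiff.sqrt (by fun_prop) fun θ => (hd θ).ne'
    exact ContDiff.div (by fun_prop) hAs fun θ => (hA0 θ).ne'
  refine ⟨fun θ => P / π * Real.log (ρ θ), ?_, ?_, ?_⟩
  · exact contDiff_const.mul (hρs.log fun θ => (hρ0 θ).ne')
  · intro θ
    simp only [hρ, hA, hB, hep θ]
  · intro u θ
    have h1 : ovalQ c δ p q (pol P a b u θ) - 1 = A θ * Real.exp (π / P * u) ^ 2 +
        2 * B θ * Real.exp (π / P * u) + C := by
      rw [ovalQ, hee, hA, hB, hC]
      simp only [Complex.add_re, Complex.add_im, Complex.re_ofReal_mul, Complex.im_ofReal_mul]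
      field_simp
      ring
    have h2 := quadratic_sign (A := A θ) (B := B θ) (hA0 θ) hC0 (Real.exp_pos (π / P * u))
    rw [← h1, sub_neg, sub_eq_zero] at h2
    have h3 : ∀ u : ℝ, π / P * (P / π * u) = u := by
      intro u
      have := Real.pi_ne_zero
      field_simp
    have h4 : ρ θ = Real.exp (π / P * (P / π * Real.log (ρ θ))) := by
      rw [h3, Real.exp_log (hρ0 θ)]
    rw [h2.1, h2.2]
    change (_ < ρ θ ↔ _) ∧ (_ = ρ θ ↔ _)
    rw [h4, Real.exp_lt_exp, Real.exp_injective.eq_iff, mul_lt_mul_iff_right₀ hr,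
      mul_right_inj' hr.ne']
    exact ⟨Iff.rfl, Iff.rfl⟩

theorem exists_pol {P : ℝ} {a b : ℂ} (hP : 0 < P) (hb : b ≠ 0) {z : ℂ} (hz : z ≠ a) :
    ∃ u θ : ℝ, z = pol P a b u θ := by
  have h1 : (z - a) / b ≠ 0 := div_ne_zero (sub_ne_zero.2 hz) hb
  refine ⟨P / π * (Complex.log ((z - a) / b)).re, P / π * (Complex.log ((z - a) / b)).im, ?_⟩
  have h2 : ((π / P : ℝ) : ℂ) * (((P / π * (Complex.log ((z - a) / b)).re : ℝ) : ℂ) +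
      ((P / π * (Complex.log ((z - a) / b)).im : ℝ) : ℂ) * Complex.I) =
      Complex.log ((z - a) / b) := by
    conv_rhs => rw [← Complex.re_add_im (Complex.log ((z - a) / b))]
    have : (P : ℂ) ≠ 0 := Complex.ofReal_ne_zero.2 hP.ne'
    have : (π : ℂ) ≠ 0 := Complex.ofReal_ne_zero.2 Real.pi_ne_zero
    push_cast
    field_simp
  rw [pol, h2, Complex.exp_log h1]
  field_simp
  ring

theorem range_graph_eq_oval {P : ℝ} {a b c δ : ℂ} {p q : ℝ} (hP : 0 < P) (hb : b ≠ 0) (hδ : δ ≠ 0)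
    (hp : 0 < p) (hq : 0 < q) (ha : ovalQ c δ p q a < 1) {ψ : ℝ → ℝ}
    (h : ∀ u θ : ℝ, ovalQ c δ p q (pol P a b u θ) = 1 ↔ u = ψ θ) :
    Set.range (graphCurve P a b ψ) = Set.range (oval c δ p q) := by
  rw [range_oval hδ hp hq]
  ext z
  constructor
  · rintro ⟨t, rfl⟩
    exact (h _ _).2 rfl
  · intro hz
    have hza : z ≠ a := by
      rintro rfl
      exact absurd hz ha.ne
    obtain ⟨u, θ, rfl⟩ := exists_pol hP hb hza
    exact ⟨θ, by rw [graphCurve, ← (h u θ).1 hz]⟩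

/-- A curve that winds once around the point `a` is isotopic to an ellipse around `a` that separates
the complement of the surface in the same way. -/
theorem loopIsotopic_graph_oval {X : Set ℂ} {P : ℝ} {a b c δ : ℂ} {p q : ℝ} (hP : 0 < P)
    (hb : b ≠ 0) (hδ : δ ≠ 0) (hp : 0 < p) (hq : 0 < q) (ha : ovalQ c δ p q a < 1) {φ : ℝ → ℝ}
    (hφ : ContDiff ℝ ∞ φ) (hφP : Function.Periodic φ (2 * P)) (hX : ∀ u θ : ℝ, pol P a b u θ ∉ X →
      (u < φ θ ∧ ovalQ c δ p q (pol P a b u θ) < 1) ∨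
      (φ θ < u ∧ 1 < ovalQ c δ p q (pol P a b u θ))) :
    LoopIsotopic X (graphCurve P a b φ) (oval c δ p q) := by
  obtain ⟨ψ, h1, h2, h3⟩ := exists_ovalGraph hP hb hδ hp hq ha
  refine (loopIsotopic_graph hP hb hφ h1 hφP h2 fun u θ h => ?_).congr rfl
    (range_graph_eq_oval hP hb hδ hp hq ha fun u θ => (h3 u θ).2)
  have h4 := h3 u θ
  rcases hX u θ h with ⟨h5, h6⟩ | ⟨h5, h6⟩
  · exact Or.inl ⟨h5, h4.1.1 h6⟩
  · refine Or.inr ⟨h5, ?_⟩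
    rcases lt_trichotomy u (ψ θ) with h7 | h7 | h7
    · linarith [h4.1.2 h7]
    · linarith [h4.2.2 h7]
    · exact h7

/-- Two ellipses with a common interior point are isotopic if they separate the complement of the
surface in the same way. -/
theorem loopIsotopic_oval {X : Set ℂ} {c δ c' δ' : ℂ} {p q p' q' : ℝ} (a : ℂ)
    (hδ : δ ≠ 0) (hp : 0 < p) (hq : 0 < q) (hδ' : δ' ≠ 0) (hp' : 0 < p') (hq' : 0 < q')
    (ha : ovalQ c δ p q a < 1) (ha' : ovalQ c' δ' p' q' a < 1)
    (hX : ∀ z, z ∉ X → z ≠ a → (ovalQ c δ p q z < 1 ∧ ovalQ c' δ' p' q' z < 1) ∨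
      (1 < ovalQ c δ p q z ∧ 1 < ovalQ c' δ' p' q' z)) :
    LoopIsotopic X (oval c δ p q) (oval c' δ' p' q') := by
  obtain ⟨ψ, h1, h2, h3⟩ := exists_ovalGraph (P := 1) (b := 1) one_pos one_ne_zero hδ hp hq ha
  refine (loopIsotopic_graph_oval one_pos one_ne_zero hδ' hp' hq' ha' h1 h2
    fun u θ h => ?_).congr (range_graph_eq_oval one_pos one_ne_zero hδ hp hq ha
      fun u θ => (h3 u θ).2) rfl
  have h4 := h3 u θ
  have h0 : pol 1 a 1 u θ ≠ a := by simp [pol]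
  rcases hX _ h h0 with ⟨h5, h6⟩ | ⟨h5, h6⟩
  · exact Or.inl ⟨h4.1.1 h5, h6⟩
  · refine Or.inr ⟨?_, h6⟩
    rcases lt_trichotomy u (ψ θ) with h7 | h7 | h7
    · linarith [h4.1.2 h7]
    · linarith [h4.2.2 h7]
    · exact h7

end Skein

namespace Skein

/-! ### Isotopies of folded curves -/

theorem abs_fold_eq {w : ℝ} (hw : 1 ≤ w) {f : ℝ → ℝ} (hf : ∀ t, f (-t) = -f t)
    (hp : Function.Periodic f (2 * w)) {t x : ℝ} (hx : 1 / 2 ≤ x) (hx' : x ≤ w - 1 / 2)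
    (h : wave w t = x) : ∃ σ : ℝ, (σ = 1 ∨ σ = -1) ∧ ∃ n : ℤ, t = σ * x + 2 * w * n := by
  obtain ⟨y, σ, n, hy, hyw, hσ, rfl, e1, -⟩ := odd_cases hw hf hp t
  have h1 : bend w y = bend w x := by
    rw [← e1, h, bend_eq_self (by linarith) (by linarith)]
  rcases bend_inj hw hy hyw (by linarith) (by linarith) h1 with h2 | ⟨h2, h3⟩ | ⟨h2, h3⟩
  · exact ⟨σ, hσ, n, by rw [h2]⟩
  · linarith
  · linarith

theorem odd_apply_sign {w : ℝ} {f : ℝ → ℝ} (hf : ∀ t, f (-t) = -f t)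
    (hp : Function.Periodic f (2 * w)) {σ : ℝ} (hσ : σ = 1 ∨ σ = -1) (x : ℝ) (n : ℤ) :
    f (σ * x + 2 * w * n) = σ * f x := by
  rw [odd_add_int hp]
  rcases hσ with rfl | rfl
  · rw [one_mul, one_mul]
  · rw [neg_one_mul, hf, neg_one_mul]

theorem IsFold.combo {w x : ℝ} {f g : ℝ → ℝ} (hf : IsFold w f) (hg : IsFold w g) (hx : 0 ≤ x)
    (hx' : x ≤ 1) : IsFold w fun t => (1 - x) * f t + x * g t := by
  have h1 := hf.smooth
  have h2 := hg.smooth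
  have hd : ∀ t, deriv (fun t => (1 - x) * f t + x * g t) t =
      (1 - x) * deriv f t + x * deriv g t := by
    intro t
    have d1 := ((h1.differentiable (by simp)).differentiableAt (x := t)).hasDerivAt
    have d2 := ((h2.differentiable (by simp)).differentiableAt (x := t)).hasDerivAt
    exact ((d1.const_mul (1 - x)).add (d2.const_mul x)).deriv
  refine ⟨by fun_prop, fun t => ?_, fun t => ?_, fun t h h' => ?_, fun t h => ?_, fun t h => ?_⟩
  · rw [hf.odd, hg.odd]
    ring
  · simp only [hf.periodic t, hg.periodic t]
  · exact lt_combo hx hx' (hf.pos t h h') (hg.pos t h h')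
  · rw [hd]
    exact lt_combo hx hx' (hf.deriv_pos t h) (hg.deriv_pos t h)
  · rw [hd]
    exact combo_lt hx hx' (hf.deriv_neg t h) (hg.deriv_neg t h)

theorem isFold_sin {w B : ℝ} (hw : 1 < w) (hB : 0 < B) :
    IsFold w fun t => B * Real.sin (π / w * t) := by
  have hw0 : 0 < w := by linarith
  have hr : 0 < π / w := div_pos Real.pi_pos hw0
  have hrw : π / w * w = π := by field_simp
  have hd : ∀ t, deriv (fun t => B * Real.sin (π / w * t)) t =
      B * (Real.cos (π / w * t) * (π / w)) := by
    intro t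
    have h1 : HasDerivAt (fun t => π / w * t) (π / w) t := by
      simpa using (hasDerivAt_id t).const_mul (π / w)
    exact (h1.sin.const_mul B).deriv
  have hc : ∀ t : ℝ, |t| < 1 / 2 → 0 < Real.cos (π / w * t) := by
    intro t ht
    rw [abs_lt] at ht
    apply Real.cos_pos_of_mem_Ioo
    constructor <;> nlinarith
  refine ⟨by fun_prop, fun t => ?_, fun t => ?_, fun t h h' => ?_, fun t h => ?_, fun t h => ?_⟩
  · rw [mul_neg, Real.sin_neg, mul_neg]
  · rw [show π / w * (t + 2 * w) = π / w * t + 2 * π by linear_combination 2 * hrw,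
      Real.sin_add_two_pi]
  · apply mul_pos hB
    apply Real.sin_pos_of_pos_of_lt_pi (by positivity)
    exact (mul_lt_mul_of_pos_left h' hr).trans_eq hrw
  · rw [hd]
    have := hc t h
    positivity
  · rw [hd, show π / w * t = π / w * (t - w) + π by linear_combination hrw, Real.cos_add_pi]
    have := mul_pos (hc _ h) hr
    nlinarith

/-- Folded curves in the same sector are isotopic if they separate the complement of the surface
in the same way. -/
theorem loopIsotopic_fold {X : Set ℂ} {P : ℝ} {a b : ℂ} (hP : 0 < P) (hb : b ≠ 0) {w θ₁ : ℝ}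
    (hw : 1 ≤ w) (hwP : w ≤ 2 * P) {f g : ℝ → ℝ} (hf : IsFold w f) (hg : IsFold w g)
    (hX : ∀ u x : ℝ, 0 < x → x < w → pol P a b u (θ₁ + x) ∉ X → 1 / 2 ≤ x ∧ x ≤ w - 1 / 2 ∧
      ((|u| < f x ∧ |u| < g x) ∨ (f x < |u| ∧ g x < |u|))) :
    LoopIsotopic X (foldCurve P a b w θ₁ f) (foldCurve P a b w θ₁ g) := by
  refine ⟨2 * w, fun x => foldCurve P a b w θ₁ fun t => (1 - x) * f t + x * g t, ?_, ?_, ?_, ?_⟩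
  · have h1 := hf.smooth
    have h2 := hg.smooth
    have h3 := contDiff_wave hw
    exact contDiff_pol (by fun_prop) (by fun_prop)
  · rintro x ⟨hx, hx'⟩
    refine isLoop_foldCurve hP hb hw hwP (hf.combo hg hx hx') θ₁ fun t => ?_
    by_contra h
    obtain ⟨h1, h2, h3⟩ := hX _ _ (wave_pos hw t) (wave_lt hw t) h
    have hk := hf.combo hg hx hx'
    obtain ⟨σ, hσ, n, ht⟩ := abs_fold_eq hw hk.odd hk.periodic h1 h2 rfl
    set y := wave w t with hy
    have e : (1 - x) * f t + x * g t = σ * ((1 - x) * f y + x * g y) := by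
      rw [ht]
      exact odd_apply_sign hk.odd hk.periodic hσ y n
    have p : 0 < (1 - x) * f y + x * g y := hk.pos y (wave_pos hw t) (wave_lt hw t)
    rw [e, abs_sign_mul hσ, abs_of_pos p] at h3
    rcases h3 with ⟨h3, h4⟩ | ⟨h3, h4⟩
    · exact lt_irrefl _ (lt_combo hx hx' h3 h4)
    · exact lt_irrefl _ (combo_lt hx hx' h3 h4)
  · simp
  · simp

theorem wave_sub_half {w : ℝ} (hw : 1 ≤ w) (t : ℝ) :
    (0 < Real.cos (π / w * t) ∧ wave w t < w / 2) ∨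
    (Real.cos (π / w * t) = 0 ∧ wave w t = w / 2) ∨
    (Real.cos (π / w * t) < 0 ∧ w / 2 < wave w t) := by
  obtain ⟨x, n, hx, hxw, ht, e⟩ := wave_cases hw t
  have hr : 0 < π / w := div_pos Real.pi_pos (by linarith)
  have hrw : π / w * w = π := by field_simp
  have hc : Real.cos (π / w * t) = Real.cos (π / w * x) := by
    rcases ht with rfl | rfl
    · rw [show π / w * (x + 2 * w * n) = π / w * x + n * (2 * π) by linear_combination 2 * n * hrw,
        Real.cos_add_int_mul_two_pi]
    · rw [show π / w * (-x + 2 * w * n) = -(π / w * x) + n * (2 * π) by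
        linear_combination 2 * n * hrw, Real.cos_add_int_mul_two_pi, Real.cos_neg]
  have key : ∀ x, 0 ≤ x → x < w / 2 → bend w x < w / 2 := by
    intro x hx hxw
    rw [bend_of_le (by linarith)]
    rcases lt_or_ge x (1 / 4) with h | h
    · have := rnd_lt_half (x := x) (by rw [abs_of_nonneg hx]; linarith)
      linarith
    · rwa [rnd_eq_self h]
  rw [hc, e]
  rcases lt_trichotomy x (w / 2) with h | h | h
  · left
    refine ⟨Real.cos_pos_of_mem_Ioo ⟨?_, ?_⟩, key x hx h⟩
    · have := mul_nonneg hr.le hx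
      linarith [Real.pi_pos]
    · nlinarith
  · right; left
    rw [h]
    refine ⟨?_, bend_eq_self (by linarith) (by linarith)⟩
    rw [show π / w * (w / 2) = π / 2 by linear_combination hrw / 2, Real.cos_pi_div_two]
  · right; right
    constructor
    · apply Real.cos_neg_of_pi_div_two_lt_of_lt
      · nlinarith
      · have := mul_le_mul_of_nonneg_left hxw hr.le
        linarith [Real.pi_pos]
    · have := key (w - x) (by linarith) (by linarith)
      rw [bend_sub] at this
      linarith

theorem le_abs_wave_sub_half {w R : ℝ} (hw : 1 ≤ w) (hR : 0 ≤ R) (hRw : R ≤ w / 2 - 1 / 2) (t : ℝ) :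
    R * (1 - |Real.sin (π / w * t)|) ≤ |wave w t - w / 2| := by
  obtain ⟨x, n, hx, hxw, ht, e⟩ := wave_cases hw t
  have hr : 0 < π / w := div_pos Real.pi_pos (by linarith)
  have hrw : π / w * w = π := by field_simp
  have hc : |Real.sin (π / w * t)| = |Real.sin (π / w * x)| := by
    rcases ht with rfl | rfl
    · rw [show π / w * (x + 2 * w * n) = π / w * x + n * (2 * π) by linear_combination 2 * n * hrw,
        Real.sin_add_int_mul_two_pi]
    · rw [show π / w * (-x + 2 * w * n) = -(π / w * x) + n * (2 * π) by
        linear_combination 2 * n * hrw, Real.sin_add_int_mul_two_pi, Real.sin_neg, abs_neg]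
  have key : ∀ x, 0 ≤ x → x ≤ w / 2 → R * (1 - |Real.sin (π / w * x)|) ≤ w / 2 - bend w x := by
    intro x hx hxw
    rw [bend_of_le (by linarith)]
    rcases lt_or_ge x (1 / 4) with h | h
    · have h1 := rnd_lt_half (x := x) (by rw [abs_of_nonneg hx]; linarith)
      have h2 := abs_nonneg (Real.sin (π / w * x))
      nlinarith
    · rw [rnd_eq_self h]
      have h1 : 2 / π * (π / w * x) ≤ Real.sin (π / w * x) := by
        apply Real.mul_le_sin (by positivity)
        nlinarith
      have h2 := h1.trans (le_abs_self _)
      have h3 : 2 / π * (π / w * x) = 2 * x / w := by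
        have := Real.pi_ne_zero
        field_simp
      rw [h3] at h2
      have h4 : R * (1 - |Real.sin (π / w * x)|) ≤ R * (1 - 2 * x / w) := by
        apply mul_le_mul_of_nonneg_left _ hR
        linarith
      have h5 : 0 ≤ 1 - 2 * x / w := by
        rw [sub_nonneg, div_le_one (by linarith)]
        linarith
      have h6 : R * (1 - 2 * x / w) ≤ w / 2 * (1 - 2 * x / w) :=
        mul_le_mul_of_nonneg_right (by linarith) h5
      have h7 : w / 2 * (1 - 2 * x / w) = w / 2 - x := by
        field_simp
      linarith
  rw [hc, e]
  rcases le_total x (w / 2) with h | h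
  · have h1 := key x hx h
    rw [abs_sub_comm]
    exact h1.trans (le_abs_self _)
  · have h1 := key (w - x) (by linarith) (by linarith)
    rw [show π / w * (w - x) = π - π / w * x by linear_combination hrw, Real.sin_pi_sub,
      bend_sub] at h1
    exact (by linarith : _ ≤ bend w x - w / 2).trans (le_abs_self _)

theorem deriv_wave_half {w : ℝ} (hw : 1 ≤ w) {σ : ℝ} (hσ : σ = 1 ∨ σ = -1) (n : ℤ) :
    deriv (wave w) (σ * (w / 2) + 2 * w * n) = σ := by
  rw [deriv_add_two_mul (wave_periodic hw)]
  rcases hσ with rfl | rfl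
  · rw [one_mul, deriv_wave hw (by linarith) (by linarith)]
  · rw [neg_one_mul, deriv_neg_of_even (wave_neg hw), deriv_wave hw (by linarith) (by linarith)]

theorem exists_half_of_cos {w t : ℝ} (hw : 0 < w) (h : Real.cos (π / w * t) = 0) :
    ∃ σ : ℝ, (σ = 1 ∨ σ = -1) ∧ ∃ n : ℤ, t = σ * (w / 2) + 2 * w * n := by
  obtain ⟨k, hk⟩ := Real.cos_eq_zero_iff.1 h
  have hπ := Real.pi_ne_zero
  have ht : t = (2 * k + 1) * (w / 2) := by
    field_simp at hk
    linarith
  rcases Int.even_or_odd' k with ⟨n, rfl | rfl⟩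
  · exact ⟨1, Or.inl rfl, n, by rw [ht]; push_cast; ring⟩
  · exact ⟨-1, Or.inr rfl, n + 1, by rw [ht]; push_cast; ring⟩

/-- The folded curve with profile `B sin` is isotopic to an ellipse in logarithmic polar
coordinates. -/
theorem loopIsotopic_sin {X : Set ℂ} {P : ℝ} {a b : ℂ} (hP : 0 < P) (hb : b ≠ 0) {w θ₁ B R : ℝ}
    (hw : 1 ≤ w) (hwP : w ≤ 2 * P) (hB : 0 < B) (hR : 0 < R) (hRw : R ≤ w / 2 - 1 / 2)
    (hX : ∀ u x : ℝ, 0 < x → x < w → pol P a b u (θ₁ + x) ∉ X →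
      |u| / B + |x - w / 2| / R < 1 ∨ B < |u|) :
    LoopIsotopic X (foldCurve P a b w θ₁ fun t => B * Real.sin (π / w * t))
      (fun t => pol P a b (B * Real.sin (π / w * t)) (θ₁ + (w / 2 - R * Real.cos (π / w * t)))) := by
  have hw0 : 0 < w := by linarith
  have hr : 0 < π / w := div_pos Real.pi_pos hw0
  have hrw : π / w * w = π := by field_simp
  have sw := contDiff_wave hw
  refine ⟨2 * w, fun x t => pol P a b (B * Real.sin (π / w * t))
    (θ₁ + ((1 - x) * wave w t + x * (w / 2 - R * Real.cos (π / w * t)))), ?_, ?_, ?_, ?_⟩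
  · exact contDiff_pol (by fun_prop) (by fun_prop)
  · rintro x ⟨hx, hx'⟩
    have hc : ∀ t, Real.cos (π / w * (t + 2 * w)) = Real.cos (π / w * t) := by
      intro t
      rw [show π / w * (t + 2 * w) = π / w * t + 2 * π by linear_combination 2 * hrw,
        Real.cos_add_two_pi]
    have hs : ∀ t, Real.sin (π / w * (t + 2 * w)) = Real.sin (π / w * t) := by
      intro t
      rw [show π / w * (t + 2 * w) = π / w * t + 2 * π by linear_combination 2 * hrw,
        Real.sin_add_two_pi]
    have hcb : ∀ t, |R * Real.cos (π / w * t)| ≤ R := by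
      intro t
      rw [abs_mul, abs_of_pos hR]
      nlinarith [Real.abs_cos_le_one (π / w * t)]
    have pos : ∀ t, 0 < (1 - x) * wave w t + x * (w / 2 - R * Real.cos (π / w * t)) := fun t =>
      lt_combo hx hx' (wave_pos hw t) (by linarith [(abs_le.1 (hcb t)).2])
    have lt : ∀ t, (1 - x) * wave w t + x * (w / 2 - R * Real.cos (π / w * t)) < w := fun t =>
      combo_lt hx hx' (wave_lt hw t) (by linarith [(abs_le.1 (hcb t)).1])
    have sgn : ∀ t, (0 < Real.cos (π / w * t) →
          (1 - x) * wave w t + x * (w / 2 - R * Real.cos (π / w * t)) < w / 2) ∧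
        (Real.cos (π / w * t) < 0 →
          w / 2 < (1 - x) * wave w t + x * (w / 2 - R * Real.cos (π / w * t))) := by
      intro t
      constructor
      · intro h
        rcases wave_sub_half hw t with h1 | h1 | h1
        · exact combo_lt hx hx' h1.2 (by nlinarith)
        · linarith [h1.1]
        · linarith [h1.1]
      · intro h
        rcases wave_sub_half hw t with h1 | h1 | h1
        · linarith [h1.1]
        · linarith [h1.1]
        · exact lt_combo hx hx' h1.2 (by nlinarith)
    refine isLoop_pol hP hb (by linarith) (by fun_prop) (by fun_prop) (fun t => by simp only [hs])
      (fun t => ⟨0, by rw [hc, wave_periodic hw t]; simp⟩) (fun t => ?_) (fun t => ?_) ?_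
    · by_contra h
      have h0 := hX _ _ (pos t) (lt t) h
      have hsin := Real.abs_sin_le_one (π / w * t)
      rw [abs_mul, abs_of_pos hB] at h0
      rcases h0 with h0 | h0
      · rw [mul_div_cancel_left₀ _ hB.ne', ← sub_pos] at h0
        have h1 : |(1 - x) * wave w t + x * (w / 2 - R * Real.cos (π / w * t)) - w / 2| <
            R * (1 - |Real.sin (π / w * t)|) := by
          have : |(1 - x) * wave w t + x * (w / 2 - R * Real.cos (π / w * t)) - w / 2| / R <
            1 - |Real.sin (π / w * t)| := by linarith
          have := (div_lt_iff₀ hR).1 this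
          rwa [mul_comm (1 - |Real.sin (π / w * t)|)] at this
        have h2 := le_abs_wave_sub_half hw hR.le hRw t
        have h3 : R * (1 - |Real.sin (π / w * t)|) ≤ |R * Real.cos (π / w * t)| := by
          rw [abs_mul, abs_of_pos hR]
          apply mul_le_mul_of_nonneg_left _ hR.le
          have h4 := Real.sin_sq_add_cos_sq (π / w * t)
          rw [← sq_abs (Real.sin _), ← sq_abs (Real.cos _)] at h4
          nlinarith [abs_nonneg (Real.sin (π / w * t)), abs_nonneg (Real.cos (π / w * t))]
        have h5 : (1 - x) * |wave w t - w / 2| + x * |R * Real.cos (π / w * t)| =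
            |(1 - x) * wave w t + x * (w / 2 - R * Real.cos (π / w * t)) - w / 2| := by
          rcases wave_sub_half hw t with h6 | h6 | h6
          · rw [abs_of_neg (by linarith [h6.2]), abs_of_pos (mul_pos hR h6.1),
              abs_of_neg (by linarith [(sgn t).1 h6.1])]
            ring
          · rw [h6.1, h6.2, mul_zero, sub_zero, sub_self, abs_zero,
              show (1 - x) * (w / 2) + x * (w / 2) - w / 2 = 0 by ring, abs_zero]
            ring
          · rw [abs_of_pos (by linarith [h6.2]), abs_of_neg (by nlinarith [h6.1]),
              abs_of_pos (by linarith [(sgn t).2 h6.1])]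
            ring
        rw [← h5] at h1
        nlinarith
      · nlinarith
    · by_cases h : Real.cos (π / w * t) = 0
      · right
        obtain ⟨σ, hσ, n, rfl⟩ := exists_half_of_cos hw0 h
        set t := σ * (w / 2) + 2 * w * n with ht
        have hsin : Real.sin (π / w * t) = σ := by
          rw [ht, show π / w * (σ * (w / 2) + 2 * w * n) = σ * (π / 2) + n * (2 * π) by
            linear_combination (σ / 2 + 2 * n) * hrw, Real.sin_add_int_mul_two_pi]
          rcases hσ with rfl | rfl
          · rw [one_mul, Real.sin_pi_div_two]
          · rw [neg_one_mul, Real.sin_neg, Real.sin_pi_div_two]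
        have d1 := ((sw.differentiable (by simp)).differentiableAt (x := t)).hasDerivAt
        rw [deriv_wave_half hw hσ n] at d1
        have d0 : HasDerivAt (fun t => π / w * t) (π / w) t := by
          simpa using (hasDerivAt_id t).const_mul (π / w)
        have d2 := ((d1.const_mul (1 - x)).add (((d0.cos.const_mul R).const_sub
          (w / 2)).const_mul x)).const_add θ₁
        have d3 : deriv (fun t => θ₁ + ((1 - x) * wave w t +
            x * (w / 2 - R * Real.cos (π / w * t)))) t =
            σ * ((1 - x) + x * (R * (π / w))) := by
          have := d2.deriv
          rw [hsin] at this
          rw [show σ * ((1 - x) + x * (R * (π / w))) =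
            (1 - x) * σ + x * -(R * (-σ * (π / w))) by ring, ← this]
          rfl
        rw [d3]
        refine mul_ne_zero (by rcases hσ with rfl | rfl <;> norm_num) (ne_of_gt ?_)
        have := lt_combo (m := 0) (a := 1) (b := R * (π / w)) hx hx' one_pos (by positivity)
        linarith
      · left
        have d0 : HasDerivAt (fun t => π / w * t) (π / w) t := by
          simpa using (hasDerivAt_id t).const_mul (π / w)
        rw [(d0.sin.const_mul B).deriv]
        exact mul_ne_zero hB.ne' (mul_ne_zero h hr.ne')
    · intro t t' n h1 h2
      have hn : n = 0 := by
        have b1 := pos t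
        have b2 := pos t'
        have b3 := lt t
        have b4 := lt t'
        by_contra hn
        rcases lt_or_gt_of_ne hn with h | h
        · have : (n : ℝ) ≤ -1 := by exact_mod_cast (by omega : n ≤ -1)
          nlinarith
        · have : (1 : ℝ) ≤ n := by exact_mod_cast (by omega : 1 ≤ n)
          nlinarith
      rw [hn, Int.cast_zero, mul_zero, add_zero, add_right_inj] at h2
      obtain ⟨k, hk | hk⟩ := Real.sin_eq_sin_iff.1 (mul_left_cancel₀ hB.ne' h1)
      · refine ⟨-k, ?_⟩
        have : π / w * t = π / w * (t' + k * (2 * w)) := by linear_combination hk - 2 * k * hrw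
        have := mul_left_cancel₀ hr.ne' this
        rw [this]
        push_cast
        ring
      · have hcc : Real.cos (π / w * t) = -Real.cos (π / w * t') := by
          rw [hk, show (2 * (k : ℝ) + 1) * π - π / w * t' =
            π - π / w * t' + k * (2 * π) by ring, Real.cos_add_int_mul_two_pi, Real.cos_pi_sub]
        have h0 : Real.cos (π / w * t) = 0 := by
          rcases lt_trichotomy (Real.cos (π / w * t)) 0 with h3 | h3 | h3
          · have := (sgn t).2 h3
            have := (sgn t').1 (by linarith)
            linarith
          · exact h3
          · have := (sgn t).1 h3
            have := (sgn t').2 (by linarith)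
            linarith
        obtain ⟨j, hj⟩ := Real.cos_eq_zero_iff.1 h0
        refine ⟨k - j, mul_left_cancel₀ hr.ne' ?_⟩
        push_cast
        linear_combination hk - 2 * hj - 2 * (k - j) * hrw
  · simp only [sub_zero, one_mul, zero_mul, add_zero]
    rfl
  · simp

/-! ### The exponential map -/

/-- The exponential map to the complement of the point `1`. -/
noncomputable def expMap (ζ : ℂ) : ℂ := 1 - Complex.exp ζ

theorem contDiff_expMap : ContDiff ℝ ∞ expMap := by
  unfold expMap
  fun_prop

theorem hasDerivAt_expMap (ζ : ℂ) : HasDerivAt expMap (-Complex.exp ζ) ζ :=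
  (Complex.hasDerivAt_exp ζ).const_sub 1

theorem exp_inj_of_im {z w : ℂ} (h : |z.im - w.im| < 2 * π) (e : Complex.exp z = Complex.exp w) :
    z = w := by
  obtain ⟨n, hn⟩ := Complex.exp_eq_exp_iff_exists_int.1 e
  have h1 := congrArg Complex.im hn
  simp only [Complex.add_im, Complex.mul_im, Complex.intCast_re, Complex.intCast_im, Complex.re_ofNat,
    Complex.im_ofNat, Complex.ofReal_re, Complex.ofReal_im, Complex.I_re, Complex.I_im,
    Complex.mul_re, mul_zero, zero_mul, mul_one, add_zero, sub_zero] at h1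
  have h2 : z.im - w.im = n * (2 * π) := by linarith
  rw [h2, abs_mul, abs_of_pos Real.two_pi_pos] at h
  have h3 : |(n : ℝ)| < 1 := by
    by_contra h4
    nlinarith [Real.pi_pos]
  have h4 : n = 0 := by
    rw [← Int.abs_lt_one_iff]
    exact_mod_cast h3
  rw [hn, h4]
  simp

theorem abs_im_le_of_ovalQ {c ζ : ℂ} {p q : ℝ} (hq : 0 < q) (h : ovalQ c 1 p q ζ ≤ 1) :
    |ζ.im - c.im| ≤ q := by
  rw [ovalQ, div_one, Complex.sub_im] at h
  have h1 : ((ζ.im - c.im) / q) ^ 2 ≤ 1 := by nlinarith [sq_nonneg ((ζ - c).re / p)]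
  rw [sq_le_one_iff_abs_le_one, abs_div, abs_of_pos hq, div_le_one hq] at h1
  exact h1

/-- Ellipses in a strip of logarithmic coordinates. -/
theorem loopIsotopic_expMap_oval {X : Set ℂ} {c c' : ℂ} {p q p' q' σ : ℝ} (a : ℂ)
    (hp : 0 < p) (hq : 0 < q) (hp' : 0 < p') (hq' : 0 < q')
    (ha : ovalQ c 1 p q a < 1) (ha' : ovalQ c' 1 p' q' a < 1)
    (hs : σ < c.im - q) (hs' : c.im + q < σ + 2 * π) (hs₁ : σ < c'.im - q')
    (hs₁' : c'.im + q' < σ + 2 * π)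
    (hX : ∀ ζ : ℂ, σ < ζ.im → ζ.im < σ + 2 * π → expMap ζ ∉ X →
      (ovalQ c 1 p q ζ < 1 ∧ ovalQ c' 1 p' q' ζ < 1) ∨
      (1 < ovalQ c 1 p q ζ ∧ 1 < ovalQ c' 1 p' q' ζ)) :
    LoopIsotopic X (fun t => expMap (oval c 1 p q t)) (fun t => expMap (oval c' 1 p' q' t)) := by
  have key : LoopIsotopic {ζ | (σ < ζ.im ∧ ζ.im < σ + 2 * π) ∧ expMap ζ ∈ X} (oval c 1 p q)
      (oval c' 1 p' q') := by
    refine loopIsotopic_oval a one_ne_zero hp hq one_ne_zero hp' hq' ha ha' fun ζ hζ _ => ?_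
    by_cases h : σ < ζ.im ∧ ζ.im < σ + 2 * π
    · exact hX ζ h.1 h.2 fun h' => hζ ⟨h, h'⟩
    · right
      constructor
      · by_contra h1
        have := abs_le.1 (abs_im_le_of_ovalQ hq (not_lt.1 h1))
        exact h ⟨by linarith, by linarith⟩
      · by_contra h1
        have := abs_le.1 (abs_im_le_of_ovalQ hq' (not_lt.1 h1))
        exact h ⟨by linarith, by linarith⟩
  refine key.map contDiff_expMap
    (fun z => ⟨_, hasDerivAt_expMap z, neg_ne_zero.2 (Complex.exp_ne_zero z)⟩) ?_ fun ζ hζ => hζ.2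
  intro z hz w hw e
  apply exp_inj_of_im
  · rw [abs_lt]
    constructor <;> linarith [hz.1.1, hz.1.2, hw.1.1, hw.1.2]
  · exact sub_right_injective e

theorem isLoop_oval {X : Set ℂ} {c δ : ℂ} {p q : ℝ} (hδ : δ ≠ 0) (hp : 0 < p) (hq : 0 < q)
    (hX : ∀ z, ovalQ c δ p q z = 1 → z ∈ X) : IsLoop X (2 * π) (oval c δ p q) where
  pos := Real.two_pi_pos
  smooth := by
    have h1 : ContDiff ℝ ∞ fun t : ℝ => ((Real.cos t : ℝ) : ℂ) :=
      Complex.ofRealCLM.contDiff.comp Real.contDiff_cos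
    have h2 : ContDiff ℝ ∞ fun t : ℝ => ((Real.sin t : ℝ) : ℂ) :=
      Complex.ofRealCLM.contDiff.comp Real.contDiff_sin
    unfold oval
    fun_prop
  periodic t := by
    simp only [oval, Real.cos_add_two_pi, Real.sin_add_two_pi]
  mem t := by
    apply hX
    have : oval c δ p q t ∈ Set.range (oval c δ p q) := ⟨t, rfl⟩
    rwa [range_oval hδ hp hq] at this
  deriv_ne t := by
    have h1 : HasDerivAt (oval c δ p q) (δ * (p * ((-Real.sin t : ℝ) : ℂ) +
        q * (Real.cos t : ℝ) * Complex.I)) t :=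
      ((((Real.hasDerivAt_cos t).ofReal_comp.const_mul (p : ℂ)).add
        (((Real.hasDerivAt_sin t).ofReal_comp.const_mul (q : ℂ)).mul_const
          Complex.I)).const_mul δ).const_add c
    rw [h1.deriv]
    refine mul_ne_zero hδ fun h => ?_
    have e1 := congrArg Complex.re h
    have e2 := congrArg Complex.im h
    simp [-Complex.ofReal_cos, -Complex.ofReal_sin, hp.ne', hq.ne'] at e1 e2
    have := Real.sin_sq_add_cos_sq t
    rw [e1, e2] at this
    norm_num at this
  simple t t' e := by
    simp only [oval, add_right_inj, mul_right_inj' hδ] at e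
    have e1 := congrArg Complex.re e
    have e2 := congrArg Complex.im e
    simp [-Complex.ofReal_cos, -Complex.ofReal_sin, hp.ne', hq.ne'] at e1 e2
    have hang : (t' : Real.Angle) = t := Real.Angle.cos_sin_inj e1.symm e2.symm
    obtain ⟨m, hm⟩ := Real.Angle.angle_eq_iff_two_pi_dvd_sub.1 hang
    exact ⟨m, by linarith⟩

/-- The entire function `(exp z - 1) / z`. -/
noncomputable def expQuot : ℂ → ℂ := dslope Complex.exp 0

theorem mul_expQuot (z : ℂ) : z * expQuot z = Complex.exp z - 1 := by
  have := sub_smul_dslope Complex.exp 0 z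
  simpa [expQuot] using this

theorem expQuot_zero : expQuot 0 = 1 := by
  simp [expQuot, dslope_same]

theorem contDiff_expQuot : ContDiff ℝ ∞ expQuot := by
  have h : DifferentiableOn ℂ expQuot Set.univ :=
    (Complex.differentiableOn_dslope Filter.univ_mem).2
      Complex.differentiable_exp.differentiableOn
  exact (differentiableOn_univ.1 h).contDiff.restrict_scalars ℝ

theorem hasDerivAt_mul_expQuot (x : ℝ) (v : ℂ) :
    HasDerivAt (fun v : ℂ => v * expQuot (x * v)) (Complex.exp (x * v)) v := by
  rcases eq_or_ne x 0 with rfl | hx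
  · simpa [expQuot_zero] using hasDerivAt_id' v
  · have hx' : (x : ℂ) ≠ 0 := Complex.ofReal_ne_zero.2 hx
    have h1 : (fun v : ℂ => v * expQuot (x * v)) = fun v => (Complex.exp (x * v) - 1) / x := by
      funext v
      rw [← mul_expQuot]
      field_simp
    have h2 : HasDerivAt (fun v : ℂ => (x : ℂ) * v) x v := by
      simpa using (hasDerivAt_id v).const_mul (x : ℂ)
    rw [h1]
    have h3 := (h2.cexp.sub_const 1).div_const (x : ℂ)
    rwa [mul_div_cancel_right₀ _ hx'] at h3

/-- An ellipse in logarithmic coordinates is isotopic to an ellipse in the plane. -/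
theorem loopIsotopic_expMap_plane {X : Set ℂ} {ζ₀ : ℂ} {p q : ℝ} (hp : 0 < p) (hq : 0 < q)
    (hqπ : q < π) (hX : ∀ x : ℝ, 0 ≤ x → x ≤ 1 → ∀ v : ℂ, (v.re / p) ^ 2 + (v.im / q) ^ 2 = 1 →
      expMap ζ₀ + (expMap ζ₀ - 1) * (v * expQuot (x * v)) ∈ X) :
    LoopIsotopic X (fun t => expMap (oval ζ₀ 1 p q t))
      (oval (expMap ζ₀) (expMap ζ₀ - 1) p q) := by
  have hd0 : expMap ζ₀ - 1 ≠ 0 := by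
    rw [expMap, sub_sub_cancel_left]
    exact neg_ne_zero.2 (Complex.exp_ne_zero _)
  have hv : ∀ v, ovalQ 0 1 p q v = (v.re / p) ^ 2 + (v.im / q) ^ 2 := by
    intro v
    rw [ovalQ, sub_zero, div_one]
  have hL : IsLoop {v | (v.re / p) ^ 2 + (v.im / q) ^ 2 = 1} (2 * π) (oval 0 1 p q) :=
    isLoop_oval one_ne_zero hp hq fun v h => by rwa [hv] at h
  refine ⟨2 * π, fun x t => expMap ζ₀ + (expMap ζ₀ - 1) *
    (oval 0 1 p q t * expQuot (((1 - x : ℝ) : ℂ) * oval 0 1 p q t)), ?_, ?_, ?_, ?_⟩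
  · have h1 : ContDiff ℝ ∞ fun y : ℝ × ℝ => oval 0 1 p q y.2 := hL.smooth.comp contDiff_snd
    have h2 : ContDiff ℝ ∞ fun y : ℝ × ℝ => ((1 - y.1 : ℝ) : ℂ) :=
      Complex.ofRealCLM.contDiff.comp (contDiff_const.sub contDiff_fst)
    have h3 := contDiff_expQuot.comp (h2.mul h1)
    exact contDiff_const.add (contDiff_const.mul (h1.mul h3))
  · rintro x ⟨hx, hx'⟩
    refine hL.map (F := fun v => expMap ζ₀ + (expMap ζ₀ - 1) *
      (v * expQuot (((1 - x : ℝ) : ℂ) * v))) ?_ (fun v => ⟨_,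
      ((hasDerivAt_mul_expQuot (1 - x) v).const_mul (expMap ζ₀ - 1)).const_add (expMap ζ₀),
      mul_ne_zero hd0 (Complex.exp_ne_zero _)⟩) ?_
      fun v h => hX (1 - x) (by linarith) (by linarith) v h
    · have h3 := contDiff_expQuot
      fun_prop
    · intro v hv1 v' hv2 e
      simp only [add_right_inj, mul_right_inj' hd0] at e
      rcases eq_or_ne (1 - x) 0 with h0 | h0
      · simpa [h0, expQuot_zero] using e
      · have h0' : ((1 - x : ℝ) : ℂ) ≠ 0 := Complex.ofReal_ne_zero.2 h0
        have e1 : Complex.exp (((1 - x : ℝ) : ℂ) * v) = Complex.exp (((1 - x : ℝ) : ℂ) * v') := by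
          have e2 := mul_expQuot (((1 - x : ℝ) : ℂ) * v)
          have e3 := mul_expQuot (((1 - x : ℝ) : ℂ) * v')
          linear_combination -e2 + e3 + ((1 - x : ℝ) : ℂ) * e
        refine mul_left_cancel₀ h0' (exp_inj_of_im ?_ e1)
        have i1 := abs_im_le_of_ovalQ hq (le_of_eq ((hv v).trans hv1))
        have i2 := abs_im_le_of_ovalQ hq (le_of_eq ((hv v').trans hv2))
        rw [Complex.zero_im, sub_zero] at i1 i2
        rw [Complex.im_ofReal_mul, Complex.im_ofReal_mul, ← mul_sub, abs_mul,
          abs_of_nonneg (by linarith : 0 ≤ 1 - x)]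
        have i3 : |v.im - v'.im| ≤ 2 * q := by
          rw [abs_le] at i1 i2 ⊢
          constructor <;> linarith
        have i4 := abs_nonneg (v.im - v'.im)
        nlinarith
  · congr 1
    funext t
    simp only [sub_zero, Complex.ofReal_one, one_mul, mul_expQuot]
    rw [oval, oval, zero_add, expMap, expMap, Complex.exp_add]
    ring
  · congr 1
    funext t
    simp only [sub_self, Complex.ofReal_zero, zero_mul, expQuot_zero, oval]
    ring

end Skein

namespace Skein

/-! ### The symmetry of the five-punctured sphere -/

theorem puncture_ne_zero (k : ZMod 4) : puncture k ≠ 0 :=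
  pow_ne_zero _ (neg_ne_zero.2 Complex.I_ne_zero)

theorem puncture_add (j k : ZMod 4) : puncture (j + k) = puncture j * puncture k := by
  revert j
  apply forall_zmod4
  · rw [zero_add, puncture_zero, one_mul]
  · rw [add_comm, puncture_add_one, puncture_one]
  · rw [show 2 + k = k + 1 + 1 by ring, puncture_add_one, puncture_add_one, puncture_two]
    linear_combination puncture k * Complex.I_mul_I
  · rw [show 3 + k = k + 1 + 1 + 1 by ring, puncture_add_one, puncture_add_one, puncture_add_one,
      puncture_three]
    linear_combination -Complex.I * puncture k * Complex.I_mul_I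

section Rotation

variable {R : Type*} [CommRing R] (s : Rˣ) (k : ZMod 4)

/-- The class of the curve obtained from `γ` by the rotation that maps `p₄` to `pₖ`. -/
noncomputable def rotClass (γ : ℝ → ℂ) : SkeinAlgebra Sigma05 s :=
  loopClass Sigma05 s fun t => γ t * puncture k

variable {s k}

theorem LoopIsotopic.rotClass_eq {γ γ' : ℝ → ℂ} (h : LoopIsotopic Sigma05 γ γ') :
    rotClass s k γ = rotClass s k γ' :=
  (h.map (F := fun z => z * puncture k) (contDiff_id.mul contDiff_const)
    (fun z => ⟨_, (hasDerivAt_id' z).mul_const _, by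
      rw [one_mul]
      exact puncture_ne_zero k⟩)
    (fun _ _ _ _ e => mul_right_cancel₀ (puncture_ne_zero k) e)
    fun _ hz => mul_puncture_mem k hz).loopClass_eq

/-- The curves `γ` and `γ'` are connected by a chain of isotopies. -/
def SameClass (γ γ' : ℝ → ℂ) : Prop := Relation.ReflTransGen (LoopIsotopic Sigma05) γ γ'

theorem LoopIsotopic.same {γ γ' : ℝ → ℂ} (h : LoopIsotopic Sigma05 γ γ') : SameClass γ γ' :=
  Relation.ReflTransGen.single h

theorem SameClass.trans {γ γ' γ'' : ℝ → ℂ} (h : SameClass γ γ') (h' : SameClass γ' γ'') :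
    SameClass γ γ'' :=
  Relation.ReflTransGen.trans h h'

theorem SameClass.rotClass_eq {γ γ' : ℝ → ℂ} (h : SameClass γ γ') :
    rotClass s k γ = rotClass s k γ' := by
  induction h with
  | refl => rfl
  | tail _ h ih => rw [ih, h.rotClass_eq]

theorem rotClass_mul_comm {γ γ' : ℝ → ℂ} (h : ∀ t t', γ t ≠ γ' t') :
    rotClass s k γ * rotClass s k γ' = rotClass s k γ' * rotClass s k γ :=
  loopClass_mul_comm fun t t' e => h t t' (mul_right_cancel₀ (puncture_ne_zero k) e)

theorem toSkein_rotatedEllipseLink {j : ZMod 4} {c u w : ℂ}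
    {hdet : u.re * w.im - u.im * w.re ≠ 0}
    {h : ∀ x y : ℝ, x ^ 2 + y ^ 2 = 1 → c + x * u + y * w ∈ Sigma05} {c' δ : ℂ} {p q : ℝ}
    (hc : c * puncture j = c') (hu : u * puncture j = δ * p)
    (hw : w * puncture j = δ * (q * Complex.I)) :
    (rotatedEllipseLink (j + k) c u w hdet h).toSkein s = rotClass s k (oval c' δ p q) := by
  apply toSkein_eq_loopClass
  have e : ∀ θ, ellipse (c * puncture (j + k)) (u * puncture (j + k)) (w * puncture (j + k)) θ =
      oval c' δ p q θ * puncture k := by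
    intro θ
    rw [ellipse, oval, puncture_add, ← hc]
    linear_combination Real.cos θ * puncture k * hu + Real.sin θ * puncture k * hw
  ext x
  simp [rotatedEllipseLink, ellipseLink, trace, loopSet, e]

theorem graphCurve_mul (P : ℝ) (a b ρ : ℂ) (φ : ℝ → ℝ) :
    graphCurve P (a * ρ) (b * ρ) φ = fun t => graphCurve P a b φ t * ρ := by
  funext t
  rw [graphCurve, graphCurve, pol, pol]
  ring

theorem foldCurve_mul (P : ℝ) (a b ρ : ℂ) (w θ₁ : ℝ) (f : ℝ → ℝ) :
    foldCurve P (a * ρ) (b * ρ) w θ₁ f = fun t => foldCurve P a b w θ₁ f t * ρ := by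
  funext t
  rw [foldCurve, foldCurve, pol, pol]
  ring

theorem rotClass_mul_cross {P H : ℝ} {a b : ℂ} (hH : 4 ≤ H) (hP : H + 4 ≤ P) (hb : b ≠ 0)
    (hX : ∀ u θ : ℝ, |(|u| - |prof P H θ|)| ≤ 1 → pol P a b u θ ∈ Sigma05) :
    rotClass s k (graphCurve P a b (prof P H)) *
        rotClass s k (graphCurve P a b fun t => -prof P H t) =
      ((s ^ 2 : Rˣ) : R) • rotClass s k (foldCurve P a b (2 * P) (-H) (joinFold P H)) +
      (((s ^ 2)⁻¹ : Rˣ) : R) • rotClass s k (foldCurve P a b (2 * P) H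
        fun t => joinFold P H (2 * P - t)) +
      rotClass s k (foldCurve P a b (2 * H) (-H) (leftFold P H)) *
        rotClass s k (foldCurve P a b (2 * P - 2 * H) H (rightFold P H)) +
      rotClass s k (graphCurve P a b fun t => -rnd (prof P H t)) *
        rotClass s k (graphCurve P a b fun t => rnd (prof P H t)) ∧
    rotClass s k (graphCurve P a b fun t => -prof P H t) *
        rotClass s k (graphCurve P a b (prof P H)) =
      (((s ^ 2)⁻¹ : Rˣ) : R) • rotClass s k (foldCurve P a b (2 * P) (-H) (joinFold P H)) +
      ((s ^ 2 : Rˣ) : R) • rotClass s k (foldCurve P a b (2 * P) H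
        fun t => joinFold P H (2 * P - t)) +
      rotClass s k (foldCurve P a b (2 * H) (-H) (leftFold P H)) *
        rotClass s k (foldCurve P a b (2 * P - 2 * H) H (rightFold P H)) +
      rotClass s k (graphCurve P a b fun t => -rnd (prof P H t)) *
        rotClass s k (graphCurve P a b fun t => rnd (prof P H t)) := by
  have h := loopClass_mul_cross (a := a * puncture k) hH hP (mul_ne_zero hb (puncture_ne_zero k))
    (fun u θ h => by
      have h1 := mul_puncture_mem k (hX u θ h)
      rwa [show pol P a b u θ * puncture k = pol P (a * puncture k) (b * puncture k) u θ by
        rw [pol, pol]; ring] at h1) s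
  simp only [graphCurve_mul, foldCurve_mul] at h
  exact h

end Rotation

/-! ### Logarithmic coordinates of the punctures -/

theorem expMap_log_two_div_two (ε : ℝ) (hε : ε = 1 ∨ ε = -1) :
    expMap ((Real.log 2 / 2 : ℝ) + (ε * (π / 4) : ℝ) * Complex.I) = -ε * Complex.I := by
  have h2 : Real.exp (Real.log 2 / 2) = √2 := by
    rw [Real.exp_half, Real.exp_log two_pos]
  have h3 : (√2 : ℂ) * (√2 / 2) = 1 := by
    have : √2 * (√2 / 2) = 1 := by
      have := Real.mul_self_sqrt (show (0 : ℝ) ≤ 2 by norm_num)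
      linarith
    exact_mod_cast this
  have hc : Real.cos (ε * (π / 4)) = √2 / 2 := by
    rcases hε with rfl | rfl
    · rw [one_mul, Real.cos_pi_div_four]
    · rw [neg_one_mul, Real.cos_neg, Real.cos_pi_div_four]
  have hs : Real.sin (ε * (π / 4)) = ε * (√2 / 2) := by
    rcases hε with rfl | rfl
    · rw [one_mul, Real.sin_pi_div_four, one_mul]
    · rw [neg_one_mul, Real.sin_neg, Real.sin_pi_div_four, neg_one_mul]
  rw [expMap, Complex.exp_add, ← Complex.ofReal_exp, h2, Complex.exp_mul_I, ← Complex.ofReal_cos,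
    ← Complex.ofReal_sin, hc, hs]
  push_cast
  linear_combination (-1 - ε * Complex.I) * h3

theorem expMap_log_two : expMap (Real.log 2 : ℝ) = -1 := by
  rw [expMap, ← Complex.ofReal_exp, Real.exp_log two_pos]
  norm_num

theorem expMap_eq_expMap {z w : ℂ} (h : expMap z = expMap w) :
    ∃ n : ℤ, z.re = w.re ∧ z.im = w.im + 2 * π * n := by
  obtain ⟨n, hn⟩ := Complex.exp_eq_exp_iff_exists_int.1 (sub_right_injective h)
  have h1 := congrArg Complex.im hn
  have h2 := congrArg Complex.re hn
  simp only [Complex.add_im, Complex.mul_im, Complex.intCast_re, Complex.intCast_im,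
    Complex.re_ofNat, Complex.im_ofNat, Complex.ofReal_re, Complex.ofReal_im, Complex.I_re,
    Complex.I_im, Complex.mul_re, Complex.add_re, mul_zero, zero_mul, mul_one, add_zero,
    sub_zero] at h1 h2
  exact ⟨n, by linarith, by linarith⟩

theorem expMap_not_mem {ζ : ℂ} (h : expMap ζ ∉ Sigma05) : ∃ n : ℤ,
    (ζ.re = Real.log 2 / 2 ∧ ζ.im = π / 4 + 2 * π * n ∧ expMap ζ = -Complex.I) ∨
    (ζ.re = Real.log 2 ∧ ζ.im = 2 * π * n ∧ expMap ζ = -1) ∨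
    (ζ.re = Real.log 2 / 2 ∧ ζ.im = -(π / 4) + 2 * π * n ∧ expMap ζ = Complex.I) := by
  have h0 : expMap ζ ≠ 1 := by
    rw [expMap, ne_eq, sub_eq_self]
    exact Complex.exp_ne_zero ζ
  by_cases h1 : expMap ζ = -Complex.I
  · have e := expMap_log_two_div_two 1 (Or.inl rfl)
    obtain ⟨n, hn, hn'⟩ := expMap_eq_expMap (z := ζ) (h1.trans (by rw [e]; push_cast; ring))
    simp only [Complex.add_re, Complex.add_im, Complex.ofReal_re, Complex.ofReal_im,
      Complex.re_ofReal_mul, Complex.im_ofReal_mul, Complex.I_re, Complex.I_im, mul_zero, mul_one,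
      add_zero, zero_add] at hn hn'
    exact ⟨n, Or.inl ⟨hn, by linarith, h1⟩⟩
  by_cases h2 : expMap ζ = -1
  · obtain ⟨n, hn, hn'⟩ := expMap_eq_expMap (z := ζ) (h2.trans expMap_log_two.symm)
    rw [Complex.ofReal_re] at hn
    rw [Complex.ofReal_im, zero_add] at hn'
    exact ⟨n, Or.inr (Or.inl ⟨hn, by linarith, h2⟩)⟩
  by_cases h3 : expMap ζ = Complex.I
  · have e := expMap_log_two_div_two (-1) (Or.inr rfl)
    obtain ⟨n, hn, hn'⟩ := expMap_eq_expMap (z := ζ) (h3.trans (by rw [e]; push_cast; ring))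
    simp only [Complex.add_re, Complex.add_im, Complex.ofReal_re, Complex.ofReal_im,
      Complex.re_ofReal_mul, Complex.im_ofReal_mul, Complex.I_re, Complex.I_im, mul_zero, mul_one,
      add_zero, zero_add] at hn hn'
    exact ⟨n, Or.inr (Or.inr ⟨hn, by linarith, h3⟩)⟩
  exact absurd (mem_Sigma05 h0 h1 h2 h3) h

/-- The base vector of logarithmic polar coordinates around `p₄ = 1`. -/
noncomputable def base (c σ : ℝ) : ℂ := -Complex.exp (c + σ * Complex.I)

theorem base_ne_zero (c σ : ℝ) : base c σ ≠ 0 := neg_ne_zero.2 (Complex.exp_ne_zero _)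

theorem pol_base (c σ u θ : ℝ) : pol (100 * π) 1 (base c σ) u θ =
    expMap ((c + u / 100 : ℝ) + (σ + θ / 100 : ℝ) * Complex.I) := by
  have h : ((π / (100 * π) : ℝ) : ℂ) = 1 / 100 := by
    have := Real.pi_ne_zero
    rw [show π / (100 * π) = 1 / 100 by field_simp]
    norm_num
  rw [pol, base, expMap, h, neg_mul, ← Complex.exp_add, ← sub_eq_add_neg]
  congr 2
  push_cast
  ring

theorem pol_base_not_mem {c σ u θ φ₁ φ₂ φ₃ : ℝ} (h₁ : ∃ k : ℤ, φ₁ = π / 4 + 2 * π * k)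
    (h₂ : ∃ k : ℤ, φ₂ = 2 * π * k) (h₃ : ∃ k : ℤ, φ₃ = -(π / 4) + 2 * π * k)
    (h : pol (100 * π) 1 (base c σ) u θ ∉ Sigma05) : ∃ n : ℤ,
    (u = 100 * (Real.log 2 / 2 - c) ∧ θ = 100 * (φ₁ - σ) + 2 * (100 * π) * n ∧
      pol (100 * π) 1 (base c σ) u θ = -Complex.I) ∨
    (u = 100 * (Real.log 2 - c) ∧ θ = 100 * (φ₂ - σ) + 2 * (100 * π) * n ∧
      pol (100 * π) 1 (base c σ) u θ = -1) ∨
    (u = 100 * (Real.log 2 / 2 - c) ∧ θ = 100 * (φ₃ - σ) + 2 * (100 * π) * n ∧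
      pol (100 * π) 1 (base c σ) u θ = Complex.I) := by
  rw [pol_base] at h ⊢
  obtain ⟨k₁, rfl⟩ := h₁
  obtain ⟨k₂, rfl⟩ := h₂
  obtain ⟨k₃, rfl⟩ := h₃
  obtain ⟨n, ⟨h1, h2, h3⟩ | ⟨h1, h2, h3⟩ | ⟨h1, h2, h3⟩⟩ := expMap_not_mem h
  · simp at h1 h2
    exact ⟨n - k₁, Or.inl ⟨by linarith, by push_cast; linarith, h3⟩⟩
  · simp at h1 h2
    exact ⟨n - k₂, Or.inr (Or.inl ⟨by linarith, by push_cast; linarith, h3⟩)⟩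
  · simp at h1 h2
    exact ⟨n - k₃, Or.inr (Or.inr ⟨by linarith, by push_cast; linarith, h3⟩)⟩

/-! ### Two curves around the puncture `p₄` with two crossings -/

theorem abs_prof_sub_le {P H θ : ℝ} (hP : 1 ≤ P) (h : |θ| ≤ P) :
    |prof P H θ - (|θ| - H)| ≤ 1 / 2 := by
  have h1 : prof P H θ = prof P H |θ| := by
    rcases abs_choice θ with h | h <;> rw [h]
    rw [prof_neg hP]
  have h0 := abs_nonneg θ
  rw [h1, prof, wave_eq_bend hP (by linarith) (by linarith)]
  have := bend_near hP h0 h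
  rwa [show bend P |θ| - H - (|θ| - H) = bend P |θ| - |θ| by ring]

section Curves

variable (c θ h : ℝ)

noncomputable abbrev firstCurve : ℝ → ℂ :=
  graphCurve (100 * π) 1 (base c θ) (prof (100 * π) (100 * h))

noncomputable abbrev secondCurve : ℝ → ℂ :=
  graphCurve (100 * π) 1 (base c θ) fun t => -prof (100 * π) (100 * h) t

noncomputable abbrev innerCurve : ℝ → ℂ :=
  graphCurve (100 * π) 1 (base c θ) fun t => -rnd (prof (100 * π) (100 * h) t)

noncomputable abbrev outerCurve : ℝ → ℂ :=
  graphCurve (100 * π) 1 (base c θ) fun t => rnd (prof (100 * π) (100 * h) t)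

/-- The curve that arises by the smoothing of the first kind at both crossings. -/
noncomputable abbrev joinCurve : ℝ → ℂ :=
  foldCurve (100 * π) 1 (base c θ) (2 * (100 * π)) (-(100 * h)) (joinFold (100 * π) (100 * h))

/-- The curve that arises by the smoothing of the second kind at both crossings. -/
noncomputable abbrev flipCurve : ℝ → ℂ :=
  foldCurve (100 * π) 1 (base c θ) (2 * (100 * π)) (100 * h)
    fun t => joinFold (100 * π) (100 * h) (2 * (100 * π) - t)

/-- The first of the two curves that arise from mixed smoothings and do not wind around `p₄`. -/
noncomputable abbrev leftCurve : ℝ → ℂ :=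
  foldCurve (100 * π) 1 (base c θ) (2 * (100 * h)) (-(100 * h)) (leftFold (100 * π) (100 * h))

/-- The second of the two curves that arise from mixed smoothings and do not wind around `p₄`. -/
noncomputable abbrev rightCurve : ℝ → ℂ :=
  foldCurve (100 * π) 1 (base c θ) (2 * (100 * π) - 2 * (100 * h)) (100 * h)
    (rightFold (100 * π) (100 * h))

end Curves

/-- The two curves have the equations `u = ± (|φ - θ| - h)`, where `c + u + φ i` is the logarithmic
coordinate. The numbers `φᵢ` are the angles of the punctures `pᵢ`, and `Fᵢ` are the heights of the
first curve there; `M` is the distance of `p₁` and `p₃` from the circle `u = 0`, and `N` is that of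
`p₂`. -/
structure CrossData (c θ h φ₁ φ₂ φ₃ F₁ F₂ F₃ G₁ G₂ G₃ M N : ℝ) : Prop where
  angle₁ : ∃ k : ℤ, φ₁ = π / 4 + 2 * π * k
  angle₂ : ∃ k : ℤ, φ₂ = 2 * π * k
  angle₃ : ∃ k : ℤ, φ₃ = -(π / 4) + 2 * π * k
  height₁ : |φ₁ - θ| = F₁ + h
  height₂ : |φ₂ - θ| = F₂ + h
  height₃ : |φ₃ - θ| = F₃ + h
  le₁ : F₁ + h ≤ π
  le₂ : F₂ + h ≤ π
  le₃ : F₃ + h ≤ π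
  abs₁ : |F₁| = G₁
  abs₂ : |F₂| = G₂
  abs₃ : |F₃| = G₃
  dist : |Real.log 2 / 2 - c| = M
  dist₂ : |Real.log 2 - c| = N
  margin₁ : M + 1 / 50 ≤ G₁ ∨ G₁ + 1 / 50 ≤ M
  margin₂ : N + 1 / 50 ≤ G₂ ∨ G₂ + 1 / 50 ≤ N
  margin₃ : M + 1 / 50 ≤ G₃ ∨ G₃ + 1 / 50 ≤ M
  lo : 1 / 25 ≤ h
  hi : h + 1 / 25 ≤ π

/-- The position of a puncture relative to a curve in a sector `σ < φ < σ + W` and to an ellipse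
with half-axes `B` and `R`. -/
def FoldSide (σ W B R ψ M G : ℝ) : Prop :=
  ψ ≤ σ ∨ σ + W ≤ ψ ∨ (σ + 1 / 200 ≤ ψ ∧ ψ ≤ σ + W - 1 / 200 ∧
    ((M < G ∧ M / B + |ψ - (σ + W / 2)| / R < 1) ∨ (G < M ∧ B < M)))

section CrossData

variable {c θ h φ₁ φ₂ φ₃ F₁ F₂ F₃ G₁ G₂ G₃ M N : ℝ}

theorem CrossData.le_H (D : CrossData c θ h φ₁ φ₂ φ₃ F₁ F₂ F₃ G₁ G₂ G₃ M N) : 4 ≤ 100 * h := by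
  linarith [D.lo]

theorem CrossData.H_le (D : CrossData c θ h φ₁ φ₂ φ₃ F₁ F₂ F₃ G₁ G₂ G₃ M N) :
    100 * h + 4 ≤ 100 * π := by
  linarith [D.hi]

theorem one_le_hundred_pi : 1 ≤ 100 * π := by linarith [Real.pi_gt_three]

theorem hundred_pi_pos : 0 < 100 * π := by linarith [Real.pi_gt_three]

theorem CrossData.not_mem (D : CrossData c θ h φ₁ φ₂ φ₃ F₁ F₂ F₃ G₁ G₂ G₃ M N) {u x : ℝ}
    (hX : pol (100 * π) 1 (base c θ) u x ∉ Sigma05) : ∃ n : ℤ,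
    (u = 100 * (Real.log 2 / 2 - c) ∧ x = 100 * (φ₁ - θ) + 2 * (100 * π) * n ∧
      |prof (100 * π) (100 * h) x - 100 * F₁| ≤ 1 / 2 ∧
      pol (100 * π) 1 (base c θ) u x = -Complex.I) ∨
    (u = 100 * (Real.log 2 - c) ∧ x = 100 * (φ₂ - θ) + 2 * (100 * π) * n ∧
      |prof (100 * π) (100 * h) x - 100 * F₂| ≤ 1 / 2 ∧
      pol (100 * π) 1 (base c θ) u x = -1) ∨
    (u = 100 * (Real.log 2 / 2 - c) ∧ x = 100 * (φ₃ - θ) + 2 * (100 * π) * n ∧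
      |prof (100 * π) (100 * h) x - 100 * F₃| ≤ 1 / 2 ∧
      pol (100 * π) 1 (base c θ) u x = Complex.I) := by
  have key : ∀ {φ F : ℝ} (n : ℤ), |φ - θ| = F + h → F + h ≤ π →
      |prof (100 * π) (100 * h) (100 * (φ - θ) + 2 * (100 * π) * n) - 100 * F| ≤ 1 / 2 := by
    intro φ F n h1 h2
    have h3 : |100 * (φ - θ)| = 100 * (F + h) := by
      rw [abs_mul, h1, abs_of_pos (by norm_num : (0 : ℝ) < 100)]
    rw [prof_add_int one_le_hundred_pi]
    have := abs_prof_sub_le (P := 100 * π) (H := 100 * h) (θ := 100 * (φ - θ)) one_le_hundred_pi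
      (by rw [h3]; linarith)
    rwa [h3, show 100 * (F + h) - 100 * h = 100 * F by ring] at this
  obtain ⟨n, ⟨h1, h2, h3⟩ | ⟨h1, h2, h3⟩ | ⟨h1, h2, h3⟩⟩ :=
    pol_base_not_mem D.angle₁ D.angle₂ D.angle₃ hX
  · exact ⟨n, Or.inl ⟨h1, h2, h2 ▸ key n D.height₁ D.le₁, h3⟩⟩
  · exact ⟨n, Or.inr (Or.inl ⟨h1, h2, h2 ▸ key n D.height₂ D.le₂, h3⟩)⟩
  · exact ⟨n, Or.inr (Or.inr ⟨h1, h2, h2 ▸ key n D.height₃ D.le₃, h3⟩)⟩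

theorem abs_abs_sub_le {x F G : ℝ} (h : |x - 100 * F| ≤ 1 / 2) (hG : |F| = G) :
    |(|x| - 100 * G)| ≤ 1 / 2 := by
  have h1 := abs_abs_sub_abs_le_abs_sub x (100 * F)
  rw [abs_mul, hG, abs_of_pos (by norm_num : (0 : ℝ) < 100)] at h1
  exact h1.trans h

theorem abs_hundred_mul {m M : ℝ} (h : |m| = M) : |100 * m| = 100 * M := by
  rw [abs_mul, h, abs_of_pos (by norm_num : (0 : ℝ) < 100)]

theorem CrossData.mem (D : CrossData c θ h φ₁ φ₂ φ₃ F₁ F₂ F₃ G₁ G₂ G₃ M N) (u x : ℝ)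
    (hu : |(|u| - |prof (100 * π) (100 * h) x|)| ≤ 1) :
    pol (100 * π) 1 (base c θ) u x ∈ Sigma05 := by
  by_contra hX
  have key : ∀ {m M F G : ℝ}, u = 100 * m → |m| = M → |F| = G →
      |prof (100 * π) (100 * h) x - 100 * F| ≤ 1 / 2 → M + 1 / 50 ≤ G ∨ G + 1 / 50 ≤ M →
      False := by
    intro m M F G h1 h2 h3 h4 h5
    have h6 := abs_le.1 (abs_abs_sub_le h4 h3)
    rw [h1, abs_hundred_mul h2, abs_le] at hu
    rcases h5 with h5 | h5 <;> linarith
  obtain ⟨n, ⟨h1, -, h2, -⟩ | ⟨h1, -, h2, -⟩ | ⟨h1, -, h2, -⟩⟩ := D.not_mem hX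
  · exact key h1 D.dist D.abs₁ h2 D.margin₁
  · exact key h1 D.dist₂ D.abs₂ h2 D.margin₂
  · exact key h1 D.dist D.abs₃ h2 D.margin₃

theorem lt_of_margin {m M G E x : ℝ} (hM : |m| = M) (hE : |E| = G)
    (hm : M + 1 / 50 ≤ G ∨ G + 1 / 50 ≤ M) (hx : |x - 100 * E| ≤ 1) :
    (m < E → 100 * m < x) ∧ (E < m → x < 100 * m) := by
  have h1 : 1 / 50 ≤ |m - E| := by
    have := abs_abs_sub_abs_le_abs_sub m E
    rw [hM, hE] at this
    refine le_trans ?_ this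
    rcases hm with hm | hm
    · rw [abs_of_neg (by linarith)]
      linarith
    · rw [abs_of_pos (by linarith)]
      linarith
  rw [abs_le] at hx
  constructor
  · intro h
    rw [abs_of_neg (by linarith)] at h1
    linarith
  · intro h
    rw [abs_of_pos (by linarith)] at h1
    linarith

/-- The identification of curves that wind once around `p₄`. -/
theorem CrossData.graph_isotopic (D : CrossData c θ h φ₁ φ₂ φ₃ F₁ F₂ F₃ G₁ G₂ G₃ M N)
    {z δ : ℂ} {p q : ℝ} (hδ : δ ≠ 0) (hp : 0 < p) (hq : 0 < q) (h0 : ovalQ z δ p q 1 < 1)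
    {f e : ℝ → ℝ} (hf : ContDiff ℝ ∞ f) (he : ∀ x, |e x| = |x|)
    (hfe : ∀ x F, |x - 100 * F| ≤ 1 / 2 → |f x - 100 * e F| ≤ 1)
    (h₁ : (Real.log 2 / 2 - c < e F₁ ∧ ovalQ z δ p q (-Complex.I) < 1) ∨
      (e F₁ < Real.log 2 / 2 - c ∧ 1 < ovalQ z δ p q (-Complex.I)))
    (h₂ : (Real.log 2 - c < e F₂ ∧ ovalQ z δ p q (-1) < 1) ∨
      (e F₂ < Real.log 2 - c ∧ 1 < ovalQ z δ p q (-1)))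
    (h₃ : (Real.log 2 / 2 - c < e F₃ ∧ ovalQ z δ p q Complex.I < 1) ∨
      (e F₃ < Real.log 2 / 2 - c ∧ 1 < ovalQ z δ p q Complex.I)) :
    LoopIsotopic Sigma05
      (graphCurve (100 * π) 1 (base c θ) fun t => f (prof (100 * π) (100 * h) t))
      (oval z δ p q) := by
  refine loopIsotopic_graph_oval hundred_pi_pos (base_ne_zero c θ) hδ hp hq h0
    (hf.comp (contDiff_prof one_le_hundred_pi))
    (fun t => by simp only [prof_periodic one_le_hundred_pi t]) fun u x hX => ?_
  obtain ⟨n, ⟨h1, -, h2, h3⟩ | ⟨h1, -, h2, h3⟩ | ⟨h1, -, h2, h3⟩⟩ := D.not_mem hX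
  · have k := lt_of_margin D.dist ((he _).trans D.abs₁) D.margin₁ (hfe _ _ h2)
    rw [h3, h1]
    exact h₁.imp (And.imp_left k.1) (And.imp_left k.2)
  · have k := lt_of_margin D.dist₂ ((he _).trans D.abs₂) D.margin₂ (hfe _ _ h2)
    rw [h3, h1]
    exact h₂.imp (And.imp_left k.1) (And.imp_left k.2)
  · have k := lt_of_margin D.dist ((he _).trans D.abs₃) D.margin₃ (hfe _ _ h2)
    rw [h3, h1]
    exact h₃.imp (And.imp_left k.1) (And.imp_left k.2)

theorem CrossData.first_isotopic (D : CrossData c θ h φ₁ φ₂ φ₃ F₁ F₂ F₃ G₁ G₂ G₃ M N)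
    {z δ : ℂ} {p q : ℝ} (hδ : δ ≠ 0) (hp : 0 < p) (hq : 0 < q) (h0 : ovalQ z δ p q 1 < 1)
    (h₁ : (Real.log 2 / 2 - c < F₁ ∧ ovalQ z δ p q (-Complex.I) < 1) ∨
      (F₁ < Real.log 2 / 2 - c ∧ 1 < ovalQ z δ p q (-Complex.I)))
    (h₂ : (Real.log 2 - c < F₂ ∧ ovalQ z δ p q (-1) < 1) ∨
      (F₂ < Real.log 2 - c ∧ 1 < ovalQ z δ p q (-1)))
    (h₃ : (Real.log 2 / 2 - c < F₃ ∧ ovalQ z δ p q Complex.I < 1) ∨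
      (F₃ < Real.log 2 / 2 - c ∧ 1 < ovalQ z δ p q Complex.I)) :
    LoopIsotopic Sigma05 (firstCurve c θ h)
      (oval z δ p q) :=
  D.graph_isotopic (f := fun x => x) (e := fun x => x) hδ hp hq h0 contDiff_id (fun _ => rfl)
    (fun x F h => h.trans (by norm_num)) h₁ h₂ h₃

theorem CrossData.second_isotopic (D : CrossData c θ h φ₁ φ₂ φ₃ F₁ F₂ F₃ G₁ G₂ G₃ M N)
    {z δ : ℂ} {p q : ℝ} (hδ : δ ≠ 0) (hp : 0 < p) (hq : 0 < q) (h0 : ovalQ z δ p q 1 < 1)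
    (h₁ : (Real.log 2 / 2 - c < -F₁ ∧ ovalQ z δ p q (-Complex.I) < 1) ∨
      (-F₁ < Real.log 2 / 2 - c ∧ 1 < ovalQ z δ p q (-Complex.I)))
    (h₂ : (Real.log 2 - c < -F₂ ∧ ovalQ z δ p q (-1) < 1) ∨
      (-F₂ < Real.log 2 - c ∧ 1 < ovalQ z δ p q (-1)))
    (h₃ : (Real.log 2 / 2 - c < -F₃ ∧ ovalQ z δ p q Complex.I < 1) ∨
      (-F₃ < Real.log 2 / 2 - c ∧ 1 < ovalQ z δ p q Complex.I)) :
    LoopIsotopic Sigma05 (secondCurve c θ h)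
      (oval z δ p q) :=
  D.graph_isotopic (f := fun x => -x) (e := fun x => -x) hδ hp hq h0 contDiff_neg abs_neg
    (fun x F h => by
      rw [show -x - 100 * -F = -(x - 100 * F) by ring, abs_neg]
      exact h.trans (by norm_num)) h₁ h₂ h₃

theorem abs_rnd_sub_le {x F : ℝ} (h : |x - 100 * F| ≤ 1 / 2) : |rnd x - 100 * (|F|)| ≤ 1 := by
  have h1 := abs_le.1 (abs_abs_sub_le h rfl)
  have h2 := rnd_le x
  have h3 := abs_le_rnd x
  rw [abs_le]
  constructor <;> linarith

theorem CrossData.outer_isotopic (D : CrossData c θ h φ₁ φ₂ φ₃ F₁ F₂ F₃ G₁ G₂ G₃ M N)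
    {z δ : ℂ} {p q : ℝ} (hδ : δ ≠ 0) (hp : 0 < p) (hq : 0 < q) (h0 : ovalQ z δ p q 1 < 1)
    (h₁ : (Real.log 2 / 2 - c < G₁ ∧ ovalQ z δ p q (-Complex.I) < 1) ∨
      (G₁ < Real.log 2 / 2 - c ∧ 1 < ovalQ z δ p q (-Complex.I)))
    (h₂ : (Real.log 2 - c < G₂ ∧ ovalQ z δ p q (-1) < 1) ∨
      (G₂ < Real.log 2 - c ∧ 1 < ovalQ z δ p q (-1)))
    (h₃ : (Real.log 2 / 2 - c < G₃ ∧ ovalQ z δ p q Complex.I < 1) ∨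
      (G₃ < Real.log 2 / 2 - c ∧ 1 < ovalQ z δ p q Complex.I)) :
    LoopIsotopic Sigma05
      (outerCurve c θ h)
      (oval z δ p q) := by
  rw [← D.abs₁] at h₁
  rw [← D.abs₂] at h₂
  rw [← D.abs₃] at h₃
  exact D.graph_isotopic (e := fun x => |x|) hδ hp hq h0 contDiff_rnd abs_abs
    (fun x F h => abs_rnd_sub_le h) h₁ h₂ h₃

theorem CrossData.inner_isotopic (D : CrossData c θ h φ₁ φ₂ φ₃ F₁ F₂ F₃ G₁ G₂ G₃ M N)
    {z δ : ℂ} {p q : ℝ} (hδ : δ ≠ 0) (hp : 0 < p) (hq : 0 < q) (h0 : ovalQ z δ p q 1 < 1)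
    (h₁ : (Real.log 2 / 2 - c < -G₁ ∧ ovalQ z δ p q (-Complex.I) < 1) ∨
      (-G₁ < Real.log 2 / 2 - c ∧ 1 < ovalQ z δ p q (-Complex.I)))
    (h₂ : (Real.log 2 - c < -G₂ ∧ ovalQ z δ p q (-1) < 1) ∨
      (-G₂ < Real.log 2 - c ∧ 1 < ovalQ z δ p q (-1)))
    (h₃ : (Real.log 2 / 2 - c < -G₃ ∧ ovalQ z δ p q Complex.I < 1) ∨
      (-G₃ < Real.log 2 / 2 - c ∧ 1 < ovalQ z δ p q Complex.I)) :
    LoopIsotopic Sigma05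
      (innerCurve c θ h)
      (oval z δ p q) := by
  rw [← D.abs₁] at h₁
  rw [← D.abs₂] at h₂
  rw [← D.abs₃] at h₃
  exact D.graph_isotopic (f := fun x => -rnd x) (e := fun x => -|x|) hδ hp hq h0 contDiff_rnd.neg
    (fun x => by rw [abs_neg, abs_abs])
    (fun x F h => by
      rw [show -rnd x - 100 * -|F| = -(rnd x - 100 * |F|) by ring, abs_neg]
      exact abs_rnd_sub_le h) h₁ h₂ h₃

end CrossData

end Skein

namespace Skein

/-! ### Folded curves in logarithmic coordinates -/

/-- The curve `c + f + φ i` in the sector `σ < φ < σ + w / 100` of logarithmic coordinates. -/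
noncomputable def logFold (c σ w : ℝ) (f : ℝ → ℝ) : ℝ → ℂ :=
  foldCurve (100 * π) 1 (base c σ) w 0 f

theorem foldCurve_base (c θ w θ₁ : ℝ) (f : ℝ → ℝ) :
    foldCurve (100 * π) 1 (base c θ) w θ₁ f = logFold c (θ + θ₁ / 100) w f := by
  funext t
  rw [logFold, foldCurve, foldCurve, pol_base, pol_base]
  congr 4
  ring

theorem range_expMap_oval {c σ w B R : ℝ} (hw : 0 < w) :
    (Set.range fun t => pol (100 * π) 1 (base c σ) (100 * B * Real.sin (π / w * t))
      (0 + (w / 2 - 100 * R * Real.cos (π / w * t)))) =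
    Set.range fun t => expMap (oval ((c : ℝ) + (σ + w / 200 : ℝ) * Complex.I) 1 B R t) := by
  have hr : π / w ≠ 0 := (div_pos Real.pi_pos hw).ne'
  have key : ∀ t, pol (100 * π) 1 (base c σ) (100 * B * Real.sin (π / w * t))
      (0 + (w / 2 - 100 * R * Real.cos (π / w * t))) =
      expMap (oval ((c : ℝ) + (σ + w / 200 : ℝ) * Complex.I) 1 B R (π / w * t - π / 2)) := by
    intro t
    rw [pol_base, oval, Real.cos_sub_pi_div_two, Real.sin_sub_pi_div_two]
    congr 1
    push_cast
    ring
  ext z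
  constructor
  · rintro ⟨t, rfl⟩
    exact ⟨_, (key t).symm⟩
  · rintro ⟨t, rfl⟩
    refine ⟨(t + π / 2) / (π / w), ?_⟩
    simp only [key]
    rw [mul_div_cancel₀ _ hr, add_sub_cancel_right]

theorem two_mul_div_pi_mul_le {x y : ℝ} (h0 : 0 ≤ x) (hy : 0 < y) (h : x ≤ y) :
    1 - |x - y / 2| / (y / 2) ≤ Real.sin (π / y * x) := by
  have hr : 0 < π / y := div_pos Real.pi_pos hy
  have hry : π / y * y = π := by field_simp
  have key : ∀ x, 0 ≤ x → x ≤ y / 2 → 1 - |x - y / 2| / (y / 2) ≤ Real.sin (π / y * x) := by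
    intro x h0 h
    have h1 : 2 / π * (π / y * x) ≤ Real.sin (π / y * x) :=
      Real.mul_le_sin (by positivity) (by nlinarith)
    refine le_trans (le_of_eq ?_) h1
    rw [abs_of_nonpos (by linarith)]
    have := Real.pi_ne_zero
    field_simp
    ring
  rcases le_total x (y / 2) with h1 | h1
  · exact key x h0 h1
  · have := key (y - x) (by linarith) (by linarith)
    rw [show π / y * (y - x) = π - π / y * x by linear_combination hry, Real.sin_pi_sub,
      show y - x - y / 2 = -(x - y / 2) by ring, abs_neg] at this
    exact this

section CrossData

variable {c θ h φ₁ φ₂ φ₃ F₁ F₂ F₃ G₁ G₂ G₃ M N : ℝ}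

/-- The position of the punctures relative to a folded curve. -/
theorem CrossData.fold_not_mem (D : CrossData c θ h φ₁ φ₂ φ₃ F₁ F₂ F₃ G₁ G₂ G₃ M N)
    {w θ₁ σ W B R ψ₁ ψ₂ ψ₃ : ℝ} {f : ℝ → ℝ} (hW : w = 100 * W) (hWπ : W ≤ 2 * π)
    (hσ : θ + θ₁ / 100 = σ)
    (hf : ∀ x, 1 / 4 ≤ x → x ≤ w - 1 / 4 →
      |f x - (|prof (100 * π) (100 * h) (θ₁ + x)|)| ≤ 1 / 2)
    (hψ₁ : ∃ k : ℤ, ψ₁ = φ₁ + 2 * π * k) (hψ₂ : ∃ k : ℤ, ψ₂ = φ₂ + 2 * π * k)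
    (hψ₃ : ∃ k : ℤ, ψ₃ = φ₃ + 2 * π * k)
    (hs₁ : σ ≤ ψ₁ ∧ ψ₁ ≤ σ + 2 * π) (hs₂ : σ ≤ ψ₂ ∧ ψ₂ ≤ σ + 2 * π)
    (hs₃ : σ ≤ ψ₃ ∧ ψ₃ ≤ σ + 2 * π)
    (h₁ : FoldSide σ W B R ψ₁ M G₁) (h₂ : FoldSide σ W B R ψ₂ N G₂)
    (h₃ : FoldSide σ W B R ψ₃ M G₃) {u x : ℝ} (hx : 0 < x) (hxw : x < w)
    (hX : pol (100 * π) 1 (base c σ) u (0 + x) ∉ Sigma05) :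
    1 / 2 ≤ x ∧ x ≤ w - 1 / 2 ∧
      ((|u| < f x ∧ |u| / (100 * B) + |x - w / 2| / (100 * R) < 1) ∨
        (f x < |u| ∧ 100 * B < |u|)) := by
  have hX' : pol (100 * π) 1 (base c θ) u (θ₁ + x) ∉ Sigma05 := by
    rw [pol_base] at hX ⊢
    convert hX using 5
    rw [← hσ]
    ring
  have key : ∀ {m M φ ψ F G : ℝ} {n k : ℤ}, u = 100 * m → |m| = M →
      θ₁ + x = 100 * (φ - θ) + 2 * (100 * π) * n →
      |prof (100 * π) (100 * h) (θ₁ + x) - 100 * F| ≤ 1 / 2 → |F| = G →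
      M + 1 / 50 ≤ G ∨ G + 1 / 50 ≤ M → ψ = φ + 2 * π * k → (σ ≤ ψ ∧ ψ ≤ σ + 2 * π) →
      FoldSide σ W B R ψ M G → 1 / 2 ≤ x ∧ x ≤ w - 1 / 2 ∧
      ((|u| < f x ∧ |u| / (100 * B) + |x - w / 2| / (100 * R) < 1) ∨
        (f x < |u| ∧ 100 * B < |u|)) := by
    intro m M φ ψ F G n k h1 h2 h3 h4 h5 h6 h7 h8 h9
    have hn : n = k := by
      have e : x = 100 * (ψ - σ) + 200 * π * ((n : ℝ) - k) := by
        rw [h7, ← hσ]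
        linear_combination h3
      by_contra hne
      have hπ := Real.pi_pos
      rcases lt_or_gt_of_ne hne with h | h
      · have : (n : ℝ) - k ≤ -1 := by
          have : (n : ℝ) + 1 ≤ k := by exact_mod_cast h
          linarith
        nlinarith
      · have : 1 ≤ (n : ℝ) - k := by
          have : (k : ℝ) + 1 ≤ n := by exact_mod_cast h
          linarith
        nlinarith
    have hxψ : x = 100 * (ψ - σ) := by
      rw [h7, ← hσ, ← hn]
      linear_combination h3
    rcases h9 with h9 | h9 | ⟨h9, h10, h11⟩
    · linarith
    · linarith
    · have hx1 : 1 / 2 ≤ x := by linarith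
      have hx2 : x ≤ w - 1 / 2 := by linarith
      have h12 := abs_le.1 (hf x (by linarith) (by linarith))
      have h13 := abs_le.1 (abs_abs_sub_le h4 h5)
      rw [h1, abs_hundred_mul h2]
      refine ⟨hx1, hx2, h11.imp (fun h => ⟨?_, ?_⟩) fun h => ⟨?_, by linarith [h.2]⟩⟩
      · rcases h6 with h6 | h6 <;> linarith [h.1]
      · have e : x - w / 2 = 100 * (ψ - (σ + W / 2)) := by
          rw [hxψ, hW]
          ring
        rw [e, abs_hundred_mul rfl, mul_div_mul_left _ _ (by norm_num),
          mul_div_mul_left _ _ (by norm_num)]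
        exact h.2
      · rcases h6 with h6 | h6 <;> linarith [h.1]
  obtain ⟨k₁, hk₁⟩ := hψ₁
  obtain ⟨k₂, hk₂⟩ := hψ₂
  obtain ⟨k₃, hk₃⟩ := hψ₃
  obtain ⟨n, ⟨e1, e2, e3, -⟩ | ⟨e1, e2, e3, -⟩ | ⟨e1, e2, e3, -⟩⟩ := D.not_mem hX'
  · exact key e1 D.dist e2 e3 D.abs₁ D.margin₁ hk₁ hs₁ h₁
  · exact key e1 D.dist₂ e2 e3 D.abs₂ D.margin₂ hk₂ hs₂ h₂
  · exact key e1 D.dist e2 e3 D.abs₃ D.margin₃ hk₃ hs₃ h₃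

/-- A folded curve is isotopic to an ellipse in logarithmic coordinates. -/
theorem CrossData.fold_isotopic (D : CrossData c θ h φ₁ φ₂ φ₃ F₁ F₂ F₃ G₁ G₂ G₃ M N)
    {w θ₁ σ W B R ψ₁ ψ₂ ψ₃ : ℝ} {f : ℝ → ℝ} (hw : 8 ≤ w) (hW : w = 100 * W) (hWπ : W ≤ 2 * π)
    (hσ : θ + θ₁ / 100 = σ) (hF : IsFold w f)
    (hf : ∀ x, 1 / 4 ≤ x → x ≤ w - 1 / 4 →
      |f x - (|prof (100 * π) (100 * h) (θ₁ + x)|)| ≤ 1 / 2)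
    (hψ₁ : ∃ k : ℤ, ψ₁ = φ₁ + 2 * π * k) (hψ₂ : ∃ k : ℤ, ψ₂ = φ₂ + 2 * π * k)
    (hψ₃ : ∃ k : ℤ, ψ₃ = φ₃ + 2 * π * k)
    (hs₁ : σ ≤ ψ₁ ∧ ψ₁ ≤ σ + 2 * π) (hs₂ : σ ≤ ψ₂ ∧ ψ₂ ≤ σ + 2 * π)
    (hs₃ : σ ≤ ψ₃ ∧ ψ₃ ≤ σ + 2 * π) (hB : 0 < B) (hR : 0 < R) (hRW : R ≤ W / 2 - 1 / 200)
    (h₁ : FoldSide σ W B R ψ₁ M G₁) (h₂ : FoldSide σ W B R ψ₂ N G₂)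
    (h₃ : FoldSide σ W B R ψ₃ M G₃) :
    SameClass (foldCurve (100 * π) 1 (base c θ) w θ₁ f)
      (fun t => expMap (oval ((c : ℝ) + (σ + W / 2 : ℝ) * Complex.I) 1 B R t)) := by
  have hX := fun u x => D.fold_not_mem (u := u) (x := x) hW hWπ hσ hf hψ₁ hψ₂ hψ₃ hs₁ hs₂ hs₃
    h₁ h₂ h₃
  have hw0 : 0 < w := by linarith
  have hw2 : w ≤ 2 * (100 * π) := by linarith
  rw [foldCurve_base, hσ, logFold]
  refine (loopIsotopic_fold hundred_pi_pos (base_ne_zero c σ) (by linarith) hw2 hF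
    (isFold_sin (w := w) (B := 100 * B) (by linarith) (by linarith)) fun u x hx hxw h => ?_).same.trans
    ((loopIsotopic_sin (R := 100 * R) hundred_pi_pos (base_ne_zero c σ) (by linarith) hw2
      (by linarith) (by linarith) (by linarith) fun u x hx hxw h =>
        (hX u x hx hxw h).2.2.imp And.right And.right).congr rfl ?_).same
  · obtain ⟨a1, a2, a3⟩ := hX u x hx hxw h
    refine ⟨a1, a2, a3.imp (fun a => ⟨a.1, ?_⟩) fun a => ⟨a.1, lt_of_le_of_lt ?_ a.2⟩⟩
    · have b1 := two_mul_div_pi_mul_le hx.le hw0 hxw.le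
      have b2 : |x - w / 2| / (w / 2) ≤ |x - w / 2| / (100 * R) :=
        div_le_div_of_nonneg_left (abs_nonneg _) (by linarith) (by linarith)
      have b3 : |u| / (100 * B) < Real.sin (π / w * x) := by linarith [a.2]
      have := (div_lt_iff₀ (by linarith)).1 b3
      linarith
    · nlinarith [Real.sin_le_one (π / w * x)]
  · rw [range_expMap_oval hw0, show σ + w / 200 = σ + W / 2 by rw [hW]; ring]

theorem abs_rnd_sub_abs_le (x : ℝ) : |rnd x - (|x|)| ≤ 1 / 2 := by
  have h1 := rnd_le x
  have h2 := abs_le_rnd x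
  rw [abs_le]
  constructor <;> linarith

theorem joinFold_near {P H x : ℝ} (hH : 4 ≤ H) (hP : H + 4 ≤ P) (h : 1 / 4 ≤ x)
    (h' : x ≤ 2 * P - 1 / 4) : |joinFold P H x - (|prof P H (-H + x)|)| ≤ 1 / 2 := by
  have := (isOddExt_joinFold hH hP).mid (y := x) (σ := 1) 0 (Or.inl rfl) (by linarith) (by linarith)
  rw [Int.cast_zero, mul_zero, add_zero, one_mul, one_mul] at this
  rw [this, join_mid h h', show x - H = -H + x by ring]
  exact abs_rnd_sub_abs_le _

theorem joinFold_flip_near {P H x : ℝ} (hH : 4 ≤ H) (hP : H + 4 ≤ P) (h : 1 / 4 ≤ x)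
    (h' : x ≤ 2 * P - 1 / 4) : |joinFold P H (2 * P - x) - (|prof P H (H + x)|)| ≤ 1 / 2 := by
  have := joinFold_near (x := 2 * P - x) hH hP (by linarith) (by linarith)
  rwa [← prof_neg (by linarith), show -(-H + (2 * P - x)) = H + x - 2 * P by ring,
    prof_shift (by linarith)] at this

theorem leftFold_near {P H x : ℝ} (hH : 4 ≤ H) (hP : H + 4 ≤ P) (h : 1 / 4 ≤ x)
    (h' : x ≤ 2 * H - 1 / 4) : |leftFold P H x - (|prof P H (-H + x)|)| ≤ 1 / 2 := by
  have := (isOddExt_leftFold hH hP).mid (y := x) (σ := 1) 0 (Or.inl rfl) (by linarith) (by linarith)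
  rw [Int.cast_zero, mul_zero, add_zero, one_mul, one_mul] at this
  have h1 : prof P H (-H + x) ≤ -(1 / 4) := by
    rcases le_total x H with h2 | h2
    · rw [← prof_neg (by linarith)]
      exact prof_le hH hP (by linarith) (by linarith)
    · exact prof_le hH hP (by linarith) (by linarith)
  rw [this, show x - H = -H + x by ring, abs_of_neg (a := prof P H (-H + x)) (by linarith),
    sub_self, abs_zero]
  norm_num

theorem rightFold_near {P H x : ℝ} (hH : 4 ≤ H) (hP : H + 4 ≤ P) (h : 1 / 4 ≤ x)
    (h' : x ≤ 2 * P - 2 * H - 1 / 4) : |rightFold P H x - (|prof P H (H + x)|)| ≤ 1 / 2 := by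
  have := (isOddExt_rightFold hH hP).mid (y := x) (σ := 1) 0 (Or.inl rfl) (by linarith)
    (by linarith)
  rw [Int.cast_zero, mul_zero, add_zero, one_mul, one_mul] at this
  have h1 : 1 / 4 ≤ prof P H (H + x) := by
    rcases le_total (H + x) P with h2 | h2
    · exact prof_ge hH hP (by linarith) h2
    · rw [← prof_neg (by linarith), ← prof_add_int (by linarith) _ 1, Int.cast_one, mul_one]
      exact prof_ge hH hP (by linarith) (by linarith)
  rw [this, add_comm x H, abs_of_pos (a := prof P H (H + x)) (by linarith), sub_self, abs_zero]
  norm_num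

theorem CrossData.join_isotopic (D : CrossData c θ h φ₁ φ₂ φ₃ F₁ F₂ F₃ G₁ G₂ G₃ M N)
    {σ B R ψ₁ ψ₂ ψ₃ : ℝ} (hσ : θ - h = σ)
    (hψ₁ : ∃ k : ℤ, ψ₁ = φ₁ + 2 * π * k) (hψ₂ : ∃ k : ℤ, ψ₂ = φ₂ + 2 * π * k)
    (hψ₃ : ∃ k : ℤ, ψ₃ = φ₃ + 2 * π * k)
    (hs₁ : σ ≤ ψ₁ ∧ ψ₁ ≤ σ + 2 * π) (hs₂ : σ ≤ ψ₂ ∧ ψ₂ ≤ σ + 2 * π)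
    (hs₃ : σ ≤ ψ₃ ∧ ψ₃ ≤ σ + 2 * π) (hB : 0 < B) (hR : 0 < R) (hRW : R ≤ π - 1 / 200)
    (h₁ : FoldSide σ (2 * π) B R ψ₁ M G₁) (h₂ : FoldSide σ (2 * π) B R ψ₂ N G₂)
    (h₃ : FoldSide σ (2 * π) B R ψ₃ M G₃) :
    SameClass (joinCurve c θ h)
      (fun t => expMap (oval ((c : ℝ) + (σ + π : ℝ) * Complex.I) 1 B R t)) := by
  have := D.fold_isotopic (w := 2 * (100 * π)) (W := 2 * π) (θ₁ := -(100 * h))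
    (by linarith [Real.pi_gt_three]) (by ring) le_rfl (by rw [← hσ]; ring)
    (isFold_joinFold D.le_H D.H_le) (fun x h h' => joinFold_near D.le_H D.H_le h h')
    hψ₁ hψ₂ hψ₃ hs₁ hs₂ hs₃ hB hR (by linarith) h₁ h₂ h₃
  rwa [show σ + 2 * π / 2 = σ + π by ring] at this

theorem CrossData.left_isotopic (D : CrossData c θ h φ₁ φ₂ φ₃ F₁ F₂ F₃ G₁ G₂ G₃ M N)
    {σ B R ψ₁ ψ₂ ψ₃ : ℝ} (hσ : θ - h = σ)
    (hψ₁ : ∃ k : ℤ, ψ₁ = φ₁ + 2 * π * k) (hψ₂ : ∃ k : ℤ, ψ₂ = φ₂ + 2 * π * k)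
    (hψ₃ : ∃ k : ℤ, ψ₃ = φ₃ + 2 * π * k)
    (hs₁ : σ ≤ ψ₁ ∧ ψ₁ ≤ σ + 2 * π) (hs₂ : σ ≤ ψ₂ ∧ ψ₂ ≤ σ + 2 * π)
    (hs₃ : σ ≤ ψ₃ ∧ ψ₃ ≤ σ + 2 * π) (hB : 0 < B) (hR : 0 < R) (hRW : R ≤ h - 1 / 200)
    (h₁ : FoldSide σ (2 * h) B R ψ₁ M G₁) (h₂ : FoldSide σ (2 * h) B R ψ₂ N G₂)
    (h₃ : FoldSide σ (2 * h) B R ψ₃ M G₃) :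
    SameClass (leftCurve c θ h)
      (fun t => expMap (oval ((c : ℝ) + (θ : ℝ) * Complex.I) 1 B R t)) := by
  have := D.fold_isotopic (w := 2 * (100 * h)) (W := 2 * h) (θ₁ := -(100 * h))
    (by linarith [D.lo]) (by ring) (by linarith [D.hi]) (by rw [← hσ]; ring)
    (isFold_leftFold D.le_H D.H_le) (fun x h h' => leftFold_near D.le_H D.H_le h h')
    hψ₁ hψ₂ hψ₃ hs₁ hs₂ hs₃ hB hR (by linarith) h₁ h₂ h₃
  rwa [show σ + 2 * h / 2 = θ by linarith] at this

theorem CrossData.right_isotopic (D : CrossData c θ h φ₁ φ₂ φ₃ F₁ F₂ F₃ G₁ G₂ G₃ M N)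
    {σ B R ψ₁ ψ₂ ψ₃ : ℝ} (hσ : θ + h = σ)
    (hψ₁ : ∃ k : ℤ, ψ₁ = φ₁ + 2 * π * k) (hψ₂ : ∃ k : ℤ, ψ₂ = φ₂ + 2 * π * k)
    (hψ₃ : ∃ k : ℤ, ψ₃ = φ₃ + 2 * π * k)
    (hs₁ : σ ≤ ψ₁ ∧ ψ₁ ≤ σ + 2 * π) (hs₂ : σ ≤ ψ₂ ∧ ψ₂ ≤ σ + 2 * π)
    (hs₃ : σ ≤ ψ₃ ∧ ψ₃ ≤ σ + 2 * π) (hB : 0 < B) (hR : 0 < R) (hRW : R ≤ π - h - 1 / 200)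
    (h₁ : FoldSide σ (2 * π - 2 * h) B R ψ₁ M G₁) (h₂ : FoldSide σ (2 * π - 2 * h) B R ψ₂ N G₂)
    (h₃ : FoldSide σ (2 * π - 2 * h) B R ψ₃ M G₃) :
    SameClass (rightCurve c θ h)
      (fun t => expMap (oval ((c : ℝ) + (θ + π : ℝ) * Complex.I) 1 B R t)) := by
  have := D.fold_isotopic (w := 2 * (100 * π) - 2 * (100 * h)) (W := 2 * π - 2 * h)
    (θ₁ := 100 * h) (by linarith [D.hi]) (by ring) (by linarith [D.lo]) (by rw [← hσ]; ring)
    (isFold_rightFold D.le_H D.H_le) (fun x h h' => rightFold_near D.le_H D.H_le h h')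
    hψ₁ hψ₂ hψ₃ hs₁ hs₂ hs₃ hB hR (by linarith) h₁ h₂ h₃
  rwa [show σ + (2 * π - 2 * h) / 2 = θ + π by linarith] at this

/-- The products of the two curves. -/
theorem CrossData.mul (D : CrossData c θ h φ₁ φ₂ φ₃ F₁ F₂ F₃ G₁ G₂ G₃ M N)
    {R : Type*} [CommRing R] (s : Rˣ) (k : ZMod 4) : ∃ X Y Z : SkeinAlgebra Sigma05 s,
    X = rotClass s k (joinCurve c θ h) ∧
    Y = rotClass s k (flipCurve c θ h) ∧
    Z = rotClass s k (leftCurve c θ h) *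
      rotClass s k (rightCurve c θ h) +
      rotClass s k (innerCurve c θ h) *
      rotClass s k (outerCurve c θ h) ∧
    rotClass s k (firstCurve c θ h) *
      rotClass s k (secondCurve c θ h) =
      ((s ^ 2 : Rˣ) : R) • X + (((s ^ 2)⁻¹ : Rˣ) : R) • Y + Z ∧
    rotClass s k (secondCurve c θ h) *
      rotClass s k (firstCurve c θ h) =
      (((s ^ 2)⁻¹ : Rˣ) : R) • X + ((s ^ 2 : Rˣ) : R) • Y + Z := by
  obtain ⟨h1, h2⟩ := rotClass_mul_cross (s := s) (k := k) (a := 1) D.le_H D.H_le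
    (base_ne_zero c θ) D.mem
  exact ⟨_, _, _, rfl, rfl, rfl, by rw [h1, add_assoc], by rw [h2, add_assoc]⟩

end CrossData

end Skein

namespace Skein

/-! ### Ellipses in logarithmic coordinates -/

theorem exp_eq_of_mul_expQuot {x : ℝ} {v w : ℂ} (h : v * expQuot (x * v) = w) :
    Complex.exp (x * v) = 1 + x * w := by
  linear_combination -mul_expQuot (x * v) + x * h

theorem eq_of_mul_expQuot_zero {v w : ℂ} (h : v * expQuot ((0 : ℝ) * v) = w) : w = v := by
  rw [← h, Complex.ofReal_zero, zero_mul, expQuot_zero, mul_one]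

theorem abs_im_le_of_exp_eq {y : ℂ} {A B : ℝ} (hA : 0 < A) (hy : |y.im| < π)
    (h : Complex.exp y = A + B * Complex.I) : |y.im| ≤ |B| / A := by
  have e1 := congrArg Complex.re h
  have e2 := congrArg Complex.im h
  rw [Complex.exp_re] at e1
  rw [Complex.exp_im] at e2
  simp only [Complex.add_re, Complex.add_im, Complex.ofReal_re, Complex.ofReal_im,
    Complex.re_ofReal_mul, Complex.im_ofReal_mul, Complex.I_re, Complex.I_im, mul_zero, mul_one,
    add_zero, zero_add] at e1 e2
  have hE := Real.exp_pos y.re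
  have hc : 0 < Real.cos |y.im| := by
    rw [Real.cos_abs]
    by_contra hc
    nlinarith
  have hlt : |y.im| < π / 2 := by
    by_contra hlt
    have := Real.cos_nonpos_of_pi_div_two_le_of_le (not_lt.1 hlt) (by linarith)
    linarith
  have h1 := Real.le_tan (abs_nonneg y.im) hlt
  have h2 : |B| / A = Real.tan |y.im| := by
    have hs : |B| = Real.exp y.re * Real.sin |y.im| := by
      rw [← e2, abs_mul, abs_of_pos hE,
        ← Real.abs_sin_eq_sin_abs_of_abs_le_pi hy.le]
    rw [Real.tan_eq_sin_div_cos, hs, ← e1, ← Real.cos_abs]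
    field_simp
  rwa [h2]

theorem exp_two_mul_re_of_exp_eq {y : ℂ} {A B : ℝ} (h : Complex.exp y = A + B * Complex.I) :
    Real.exp (2 * y.re) = A ^ 2 + B ^ 2 := by
  have h1 := congrArg Complex.normSq h
  rw [Complex.normSq_add_mul_I, Complex.normSq_eq_norm_sq, Complex.norm_exp] at h1
  rw [← h1, ← Real.exp_nat_mul]
  norm_num

theorem exp_mul_lt {x a b : ℝ} (hx : 0 < x) (hx' : x ≤ 1) (h : Real.exp a < 1 + b) :
    Real.exp (x * a) < 1 + x * b := by
  have h1 := convexOn_exp.2 (Set.mem_univ (0 : ℝ)) (Set.mem_univ a) (sub_nonneg.2 hx') hx.le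
    (by ring)
  simp only [smul_eq_mul, mul_zero, zero_add, Real.exp_zero, mul_one] at h1
  nlinarith

theorem quadratic_mono {a b p q α β : ℝ} (hp : 0 < p) (hq : 0 < q) (ha : |a| ≤ α * p)
    (hb : |b| ≤ β * q) : (a / p) ^ 2 + (b / q) ^ 2 ≤ α ^ 2 + β ^ 2 := by
  have h1 : |a / p| ≤ α := by rwa [abs_div, abs_of_pos hp, div_le_iff₀ hp]
  have h2 : |b / q| ≤ β := by rwa [abs_div, abs_of_pos hq, div_le_iff₀ hq]
  exact add_le_add (sq_le_sq' (abs_le.1 h1).1 (abs_le.1 h1).2)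
    (sq_le_sq' (abs_le.1 h2).1 (abs_le.1 h2).2)

theorem abs_re_le {p q : ℝ} {v : ℂ} (hp : 0 < p) (hv : (v.re / p) ^ 2 + (v.im / q) ^ 2 = 1) :
    |v.re| ≤ p := by
  have h : (v.re / p) ^ 2 ≤ 1 := by nlinarith [sq_nonneg (v.im / q)]
  rwa [sq_le_one_iff_abs_le_one, abs_div, abs_of_pos hp, div_le_one hp] at h

theorem abs_im_le {p q : ℝ} {v : ℂ} (hq : 0 < q) (hv : (v.re / p) ^ 2 + (v.im / q) ^ 2 = 1) :
    |v.im| ≤ q := by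
  have h : (v.im / q) ^ 2 ≤ 1 := by nlinarith [sq_nonneg (v.re / p)]
  rwa [sq_le_one_iff_abs_le_one, abs_div, abs_of_pos hq, div_le_one hq] at h

theorem mul_expQuot_ne_neg_one {x p : ℝ} {v : ℂ} (hx : 0 ≤ x) (hx' : x ≤ 1) (hp : p < 1)
    (hv : |v.re| ≤ p) : v * expQuot (x * v) ≠ -1 := by
  intro h
  have h0 := (abs_le.1 hv).1
  rcases hx.eq_or_lt with rfl | hx
  · rw [← eq_of_mul_expQuot_zero h] at h0
    norm_num at h0
    linarith
  · have h1 := congrArg norm (exp_eq_of_mul_expQuot h)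
    rw [Complex.norm_exp, Complex.re_ofReal_mul,
      show (1 + x * -1 : ℂ) = ((1 - x : ℝ) : ℂ) by push_cast; ring, Complex.norm_real,
      Real.norm_of_nonneg (by linarith)] at h1
    have h2 := Real.add_one_le_exp (x * v.re)
    nlinarith

theorem mul_expQuot_ne_one {x p : ℝ} {v : ℂ} (hx : 0 ≤ x) (hx' : x ≤ 1) (hp : p < 1)
    (hp' : Real.exp p < 2) (hv : |v.re| ≤ p) : v * expQuot (x * v) ≠ 1 := by
  intro h
  have h0 := (abs_le.1 hv).2
  rcases hx.eq_or_lt with rfl | hx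
  · rw [← eq_of_mul_expQuot_zero h] at h0
    norm_num at h0
    linarith
  · have h1 := congrArg norm (exp_eq_of_mul_expQuot h)
    rw [Complex.norm_exp, Complex.re_ofReal_mul,
      show (1 + x * 1 : ℂ) = ((1 + x : ℝ) : ℂ) by push_cast; ring, Complex.norm_real,
      Real.norm_of_nonneg (by linarith)] at h1
    have h2 := exp_mul_lt (a := p) (b := 1) hx hx' (by linarith)
    have h3 : Real.exp (x * v.re) ≤ Real.exp (x * p) := by
      rw [Real.exp_le_exp]
      nlinarith
    linarith

theorem exp_lt_two {p : ℝ} (h : p ≤ 69 / 100) : Real.exp p < 2 := by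
  rw [← Real.lt_log_iff_exp_lt two_pos]
  linarith [Real.log_two_gt_d9]

theorem mul_expQuot_ne_I {x : ℝ} {v : ℂ} (hx : 0 ≤ x) (hx' : x ≤ 1)
    (hv : (v.re / (3 / 5)) ^ 2 + (v.im / (5 / 2)) ^ 2 = 1) {ε : ℝ} (hε : ε = 1 ∨ ε = -1) :
    v * expQuot (x * v) ≠ ε * Complex.I := by
  intro h
  have hε1 : |ε| = 1 := by rcases hε with rfl | rfl <;> norm_num
  have hε2 : ε ^ 2 = 1 := by rw [← sq_abs, hε1, one_pow]
  rcases hx.eq_or_lt with rfl | hx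
  · rw [← eq_of_mul_expQuot_zero h] at hv
    simp only [Complex.re_ofReal_mul, Complex.im_ofReal_mul, Complex.I_re, Complex.I_im, mul_zero,
      mul_one, div_pow, hε2] at hv
    norm_num at hv
  · have hi := abs_im_le (by norm_num) hv
    have h1 : Complex.exp (x * v) = (1 : ℝ) + (x * ε : ℝ) * Complex.I := by
      rw [exp_eq_of_mul_expQuot h]
      push_cast
      ring
    have hx0 : |x * v.im| = x * |v.im| := by rw [abs_mul, abs_of_pos hx]
    have h2 := abs_im_le_of_exp_eq one_pos (by
      rw [Complex.im_ofReal_mul, hx0]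
      nlinarith [Real.pi_gt_three, abs_nonneg v.im]) h1
    have h3 := exp_two_mul_re_of_exp_eq h1
    rw [Complex.im_ofReal_mul, hx0, abs_mul, hε1, abs_of_pos hx, div_one, mul_one] at h2
    rw [Complex.re_ofReal_mul, mul_pow, hε2] at h3
    have h4 : |v.im| ≤ 1 := by
      by_contra hc
      nlinarith
    have h5 : 2 * (x * v.re) + 1 ≤ 1 ^ 2 + x ^ 2 * 1 := by
      rw [← h3]
      exact Real.add_one_le_exp _
    have h6 : 0 ≤ 2 * (x * v.re) := by
      rw [← Real.one_le_exp_iff, h3]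
      nlinarith
    have h7 : 0 ≤ v.re := by
      by_contra hc
      nlinarith
    have h8 : v.re ≤ 1 / 2 := by
      by_contra hc
      nlinarith
    have := quadratic_mono (a := v.re) (b := v.im) (p := 3 / 5) (q := 5 / 2) (α := 5 / 6)
      (β := 2 / 5) (by norm_num) (by norm_num) (by rw [abs_of_nonneg h7]; linarith) (by linarith)
    rw [hv] at this
    norm_num at this

theorem mul_expQuot_ne_half {x : ℝ} {v : ℂ} (hx : 0 ≤ x) (hx' : x ≤ 1)
    (hv : (v.re / (9 / 10)) ^ 2 + (v.im / 2) ^ 2 = 1) {ε : ℝ} (hε : ε = 1 ∨ ε = -1) :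
    v * expQuot (x * v) ≠ (-1 + ε * Complex.I) / 2 := by
  intro h
  have hε1 : |ε| = 1 := by rcases hε with rfl | rfl <;> norm_num
  have hε2 : ε ^ 2 = 1 := by rw [← sq_abs, hε1, one_pow]
  rcases hx.eq_or_lt with rfl | hx
  · rw [← eq_of_mul_expQuot_zero h] at hv
    have e1 : ((-1 + ε * Complex.I) / 2).re = -1 / 2 := by simp
    have e2 : ((-1 + ε * Complex.I) / 2).im = ε / 2 := by simp
    rw [e1, e2, show (ε / 2 / 2) ^ 2 = ε ^ 2 / 16 by ring, hε2] at hv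
    norm_num at hv
  · have hi := abs_im_le (by norm_num) hv
    have h1 : Complex.exp (x * v) = (1 - x / 2 : ℝ) + (x * ε / 2 : ℝ) * Complex.I := by
      rw [exp_eq_of_mul_expQuot h]
      push_cast
      ring
    have hx0 : |x * v.im| = x * |v.im| := by rw [abs_mul, abs_of_pos hx]
    have h2 := abs_im_le_of_exp_eq (by linarith) (by
      rw [Complex.im_ofReal_mul, hx0]
      nlinarith [Real.pi_gt_three, abs_nonneg v.im]) h1
    have h3 := exp_two_mul_re_of_exp_eq h1
    rw [Complex.im_ofReal_mul, hx0, abs_div, abs_mul, hε1, abs_of_pos hx, mul_one, abs_two,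
      le_div_iff₀ (by linarith)] at h2
    rw [Complex.re_ofReal_mul, div_pow, mul_pow, hε2] at h3
    have h4 : |v.im| ≤ 1 := by
      by_contra hc
      have : 1 / 2 < |v.im| * (1 - x / 2) := by nlinarith
      nlinarith
    have hY : 0 < (1 - x / 2) ^ 2 + x ^ 2 * 1 / 2 ^ 2 := by rw [← h3]; exact Real.exp_pos _
    have h5 : 1 - ((1 - x / 2) ^ 2 + x ^ 2 * 1 / 2 ^ 2)⁻¹ ≤ 2 * (x * v.re) := by
      have := Real.one_sub_inv_le_log_of_pos hY
      rwa [← h3, Real.log_exp, h3] at this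
    have h6 : 2 * (x * v.re) ≤ 0 := by
      rw [← Real.exp_le_one_iff, h3]
      nlinarith
    have h7 : v.re ≤ 0 := by
      by_contra hc
      nlinarith
    have h8 : -(3 / 4) ≤ v.re := by
      have h9 : -(3 / 2 * x) ≤ 1 - ((1 - x / 2) ^ 2 + x ^ 2 * 1 / 2 ^ 2)⁻¹ := by
        rw [neg_le_sub_iff_le_add, inv_le_iff_one_le_mul₀ hY]
        nlinarith [mul_nonneg hx.le (sq_nonneg (x - 2 / 3)), mul_nonneg hx.le hx.le]
      by_contra hc
      nlinarith
    have := quadratic_mono (a := v.re) (b := v.im) (p := 9 / 10) (q := 2) (α := 5 / 6)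
      (β := 1 / 2) (by norm_num) (by norm_num) (by rw [abs_of_nonpos h7]; linarith) (by linarith)
    rw [hv] at this
    norm_num at this

theorem mul_expQuot_ne_zero {x : ℝ} {v : ℂ} (hx : 0 ≤ x) (hx' : x ≤ 1) (hv : |v.im| < π)
    (hv0 : v ≠ 0) : v * expQuot (x * v) ≠ 0 := by
  intro h
  rcases hx.eq_or_lt with rfl | hx
  · exact hv0 (eq_of_mul_expQuot_zero h).symm
  · have h1 := exp_eq_of_mul_expQuot h
    rw [mul_zero, add_zero, ← Complex.exp_zero] at h1
    have h2 := exp_inj_of_im (by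
      rw [Complex.im_ofReal_mul, Complex.zero_im, sub_zero, abs_mul, abs_of_pos hx]
      nlinarith [abs_nonneg v.im, Real.pi_pos]) h1
    exact hv0 ((mul_eq_zero.1 h2).resolve_left (Complex.ofReal_ne_zero.2 hx.ne'))

theorem norm_mul_expQuot_ge {x : ℝ} {v : ℂ} (hx : 0 ≤ x) (hx' : x ≤ 1) (hv : ‖v‖ ≤ 3 / 4) :
    2 / 3 * ‖v‖ ≤ ‖v * expQuot (x * v)‖ := by
  set w := v * expQuot (x * v) with hw
  rcases hx.eq_or_lt with rfl | hx
  · rw [eq_of_mul_expQuot_zero hw.symm]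
    linarith [norm_nonneg v]
  · have h1 := exp_eq_of_mul_expQuot hw.symm
    have hxn : ∀ z : ℂ, ‖(x : ℂ) * z‖ = x * ‖z‖ := fun z => by
      rw [norm_mul, Complex.norm_real, Real.norm_of_nonneg hx.le]
    rcases le_or_gt ‖(x : ℂ) * w‖ (1 / 2) with h | h
    · have h2 := Complex.norm_log_one_add_half_le_self h
      have hi : |((x : ℂ) * v).im| < π := by
        refine lt_of_le_of_lt (Complex.abs_im_le_norm _) ?_
        rw [hxn]
        nlinarith [Real.pi_gt_three, norm_nonneg v]
      rw [abs_lt] at hi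
      rw [← h1, Complex.log_exp hi.1 hi.2.le, hxn, hxn] at h2
      by_contra hc
      nlinarith
    · rw [hxn] at h
      have := norm_nonneg w
      nlinarith

theorem norm_mul_expQuot_lt {x : ℝ} {v : ℂ} (hx : 0 ≤ x) (hx' : x ≤ 1) (hv : ‖v‖ ≤ 69 / 100) :
    ‖v * expQuot (x * v)‖ < 1 := by
  set w := v * expQuot (x * v) with hw
  rcases hx.eq_or_lt with rfl | hx
  · rw [eq_of_mul_expQuot_zero hw.symm]
    linarith
  · have h1 : Complex.exp (x * v) - 1 = x * w := by
      rw [exp_eq_of_mul_expQuot hw.symm]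
      ring
    have h2 := Complex.norm_exp_sub_sum_le_exp_norm_sub_sum (x * v) 1
    have h3 := exp_mul_lt (a := ‖v‖) (b := 1) hx hx' (by linarith [exp_lt_two hv])
    simp only [Finset.sum_range_one, pow_zero, Nat.factorial_zero, Nat.cast_one, div_one, h1,
      norm_mul, Complex.norm_real, Real.norm_of_nonneg hx.le] at h2
    by_contra hc
    nlinarith

theorem eq_puncture_of_not_mem {z : ℂ} (h : z ∉ Sigma05) :
    z = 1 ∨ z = -Complex.I ∨ z = -1 ∨ z = Complex.I := by
  by_contra hc
  push Not at hc
  exact h (mem_Sigma05 hc.1 hc.2.1 hc.2.2.1 hc.2.2.2)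

/-! ### The standard curves in logarithmic coordinates -/

theorem expMap_zero : expMap 0 = 0 := by rw [expMap, Complex.exp_zero, sub_self]

/-- The curve around `p₁` and `p₃`. -/
theorem log_oval_opposite : SameClass (fun t => expMap (oval 0 1 (3 / 5) (5 / 2) t))
    (oval 0 (-Complex.I) (3 / 2) (1 / 2)) := by
  refine (loopIsotopic_expMap_plane (ζ₀ := 0) (by norm_num) (by norm_num)
    (by linarith [Real.pi_gt_three]) fun x hx hx' v hv => ?_).same.trans
    (loopIsotopic_oval 0 ?_ (by norm_num) (by norm_num) ?_ (by norm_num) (by norm_num) ?_ ?_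
      fun z hz _ => ?_).same
  · have hr := abs_re_le (by norm_num) hv
    rw [expMap_zero, zero_add, zero_sub, neg_one_mul]
    apply mem_Sigma05
    · rw [ne_eq, neg_eq_iff_eq_neg]
      exact mul_expQuot_ne_neg_one hx hx' (by norm_num) hr
    · rw [ne_eq, neg_inj]
      simpa using mul_expQuot_ne_I hx hx' hv (Or.inl rfl)
    · rw [ne_eq, neg_inj]
      exact mul_expQuot_ne_one hx hx' (by norm_num) (exp_lt_two (by norm_num)) hr
    · rw [ne_eq, neg_eq_iff_eq_neg]
      simpa using mul_expQuot_ne_I hx hx' hv (Or.inr rfl)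
  · norm_num [expMap_zero]
  · norm_num
  · norm_num [expMap_zero, ovalQ]
  · norm_num [ovalQ]
  · rcases eq_puncture_of_not_mem hz with rfl | rfl | rfl | rfl
    · right
      norm_num [ovalQ, expMap_zero]
    · left
      norm_num [ovalQ, expMap_zero]
    · right
      norm_num [ovalQ, expMap_zero]
    · left
      norm_num [ovalQ, expMap_zero, Complex.div_re, Complex.div_im]

/-- The curve around `p₁`, `p₂` and `p₃`. -/
theorem log_oval_three :
    SameClass (fun t => expMap (oval (Real.log 2 : ℝ) 1 (9 / 10) 2 t))
      (oval (-1) (-Complex.I) (17 / 10) (17 / 10)) := by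
  refine (loopIsotopic_expMap_plane (ζ₀ := (Real.log 2 : ℝ)) (by norm_num) (by norm_num)
    (by linarith [Real.pi_gt_three]) fun x hx hx' v hv => ?_).same.trans
    (loopIsotopic_oval (-1) ?_ (by norm_num) (by norm_num) ?_ (by norm_num) (by norm_num) ?_ ?_
      fun z hz hz' => ?_).same
  · have hr := abs_re_le (by norm_num) hv
    have hi := abs_im_le (by norm_num) hv
    have h0 : v ≠ 0 := by
      rintro rfl
      norm_num at hv
    rw [expMap_log_two]
    apply mem_Sigma05
    · intro h
      exact mul_expQuot_ne_neg_one hx hx' (by norm_num) hr (by linear_combination -h / 2)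
    · intro h
      refine mul_expQuot_ne_half hx hx' hv (Or.inl rfl) ?_
      push_cast
      linear_combination -h / 2
    · intro h
      exact mul_expQuot_ne_zero hx hx' (by linarith [Real.pi_gt_three]) h0
        (by linear_combination -h / 2)
    · intro h
      refine mul_expQuot_ne_half hx hx' hv (Or.inr rfl) ?_
      push_cast
      linear_combination -h / 2
  · rw [expMap_log_two]
    norm_num
  · norm_num
  · rw [expMap_log_two]
    norm_num [ovalQ]
  · norm_num [ovalQ]
  · rw [expMap_log_two]
    rcases eq_puncture_of_not_mem hz with rfl | rfl | rfl | rfl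
    · right
      norm_num [ovalQ, Complex.div_re, Complex.div_im, Complex.normSq_apply]
    · left
      norm_num [ovalQ, Complex.div_re, Complex.div_im, Complex.normSq_apply]
    · exact absurd rfl hz'
    · left
      norm_num [ovalQ, Complex.div_re, Complex.div_im, Complex.normSq_apply]

theorem norm_eq_of_circle {v : ℂ} {ρ : ℝ} (hρ : 0 < ρ)
    (h : (v.re / ρ) ^ 2 + (v.im / ρ) ^ 2 = 1) : ‖v‖ = ρ := by
  rw [← sq_eq_sq₀ (norm_nonneg v) hρ.le, ← Complex.normSq_eq_norm_sq, Complex.normSq_apply]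
  field_simp at h
  linarith

/-- The curve around one of the punctures `p₁`, `p₂`, `p₃`. -/
theorem log_oval_one {ζ z : ℂ} (hζ : expMap ζ = z)
    (hz : z = -Complex.I ∨ z = -1 ∨ z = Complex.I) :
    SameClass (fun t => expMap (oval ζ 1 (1 / 20) (1 / 20) t)) (oval z z (1 / 10) (1 / 10)) := by
  refine (loopIsotopic_expMap_plane (ζ₀ := ζ) (by norm_num) (by norm_num)
    (by linarith [Real.pi_gt_three]) fun x hx hx' v hv => ?_).same.trans
    (loopIsotopic_oval z ?_ (by norm_num) (by norm_num) ?_ (by norm_num) (by norm_num) ?_ ?_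
      fun y hy hy' => ?_).same
  · have hn := norm_eq_of_circle (by norm_num) hv
    have h1 := norm_mul_expQuot_ge hx hx' (v := v) (by rw [hn]; norm_num)
    have h2 : ‖v * expQuot (x * v)‖ ≤ 1 / 10 := by
      set w := v * expQuot (x * v) with hw
      rcases hx.eq_or_lt with rfl | hx
      · rw [eq_of_mul_expQuot_zero hw.symm, hn]
        norm_num
      · have hxn : ∀ z : ℂ, ‖(x : ℂ) * z‖ = x * ‖z‖ := fun z => by
          rw [norm_mul, Complex.norm_real, Real.norm_of_nonneg hx.le]
        have h3 := Complex.norm_exp_sub_one_le (x := x * v) (by rw [hxn, hn]; linarith)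
        rw [exp_eq_of_mul_expQuot hw.symm, add_sub_cancel_left, hxn, hxn, hn] at h3
        by_contra hc
        nlinarith
    rw [hζ]
    set w := v * expQuot (x * v)
    have h3 : 0 < ‖w‖ := lt_of_lt_of_le (by rw [hn]; norm_num) h1
    have h4 : w ≠ 0 := norm_pos_iff.1 h3
    have a1 := abs_le.1 ((Complex.abs_re_le_norm w).trans h2)
    have a2 := abs_le.1 ((Complex.abs_im_le_norm w).trans h2)
    have key : ¬ (w.re = 0 ∧ w.im = 0) := fun h => h4 (Complex.ext h.1 h.2)
    rcases hz with rfl | rfl | rfl <;> apply mem_Sigma05 <;> intro h <;>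
      have e1 := congrArg Complex.re h <;> have e2 := congrArg Complex.im h <;>
      simp at e1 e2 <;> first
        | linarith
        | exact key ⟨by linarith, by linarith⟩
        | (norm_num at e1 e2; exact key ⟨e1, e2⟩)
  · rw [hζ]
    rcases hz with rfl | rfl | rfl <;> norm_num [Complex.ext_iff]
  · rcases hz with rfl | rfl | rfl <;> norm_num
  · norm_num [hζ, ovalQ]
  · norm_num [ovalQ]
  · right
    rw [hζ]
    rcases hz with rfl | rfl | rfl <;>
      rcases eq_puncture_of_not_mem hy with rfl | rfl | rfl | rfl <;>
      first
        | exact absurd rfl hy'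
        | norm_num [ovalQ, Complex.div_re, Complex.div_im, Complex.normSq_apply]

/-- The curve around `p₂` and one of its neighbours. -/
theorem log_oval_two {ε : ℝ} (hε : ε = 1 ∨ ε = -1) {ζ : ℂ}
    (hζ : Complex.exp ζ = (3 + ε * Complex.I) / 2) :
    SameClass (fun t => expMap (oval ζ 1 (17 / 25) (17 / 25) t))
      (oval ((-1 - ε * Complex.I) / 2) (-ε + Complex.I) (3 / 5) (9 / 20)) := by
  have hz : expMap ζ = (-1 - ε * Complex.I) / 2 := by
    rw [expMap, hζ]
    ring
  refine (loopIsotopic_expMap_plane (ζ₀ := ζ) (by norm_num) (by norm_num)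
    (by linarith [Real.pi_gt_three]) fun x hx hx' v hv => ?_).same.trans
    (loopIsotopic_oval ((-1 - ε * Complex.I) / 2) ?_ (by norm_num) (by norm_num) ?_ (by norm_num)
      (by norm_num) ?_ ?_ fun y hy hy' => ?_).same
  · have hn := norm_eq_of_circle (by norm_num) hv
    have h1 := norm_mul_expQuot_ge hx hx' (v := v) (by rw [hn]; norm_num)
    have h2 := norm_mul_expQuot_lt hx hx' (v := v) (by rw [hn]; norm_num)
    rw [hz]
    set w := v * expQuot (x * v)
    have h3 : 1 / 5 < w.re ^ 2 + w.im ^ 2 := by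
      have : w.re ^ 2 + w.im ^ 2 = ‖w‖ ^ 2 := by
        rw [← Complex.normSq_eq_norm_sq, Complex.normSq_apply]
        ring
      rw [this]
      rw [hn] at h1
      nlinarith
    have h4 : w.re ^ 2 + w.im ^ 2 < 1 := by
      have : w.re ^ 2 + w.im ^ 2 = ‖w‖ ^ 2 := by
        rw [← Complex.normSq_eq_norm_sq, Complex.normSq_apply]
        ring
      rw [this]
      nlinarith [norm_nonneg w]
    rcases hε with rfl | rfl <;> apply mem_Sigma05 <;> intro h <;>
      have e1 := congrArg Complex.re h <;> have e2 := congrArg Complex.im h <;>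
      norm_num at e1 e2 <;> nlinarith
  · rw [hz]
    rcases hε with rfl | rfl <;> norm_num [Complex.ext_iff]
  · rcases hε with rfl | rfl <;> norm_num [Complex.ext_iff]
  · norm_num [hz, ovalQ]
  · norm_num [ovalQ]
  · rw [hz]
    rcases hε with rfl | rfl <;>
      rcases eq_puncture_of_not_mem hy with rfl | rfl | rfl | rfl <;>
      first
        | (left; norm_num [ovalQ, Complex.div_re, Complex.div_im, Complex.normSq_apply]; done)
        | (right; norm_num [ovalQ, Complex.div_re, Complex.div_im, Complex.normSq_apply])

end Skein

namespace Skein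

theorem ovalQ_real (c₀ c₁ p q u v : ℝ) :
    ovalQ ((c₀ : ℝ) + (c₁ : ℝ) * Complex.I) 1 p q ((u : ℝ) + (v : ℝ) * Complex.I) =
      ((u - c₀) / p) ^ 2 + ((v - c₁) / q) ^ 2 := by
  simp [ovalQ]

theorem quadratic_lt_of_diamond {a b p q : ℝ} (hp : 0 < p) (hq : 0 < q)
    (h : |a| / p + |b| / q < 1) : (a / p) ^ 2 + (b / q) ^ 2 < 1 := by
  rw [← sq_abs (a / p), ← sq_abs (b / q), abs_div, abs_div, abs_of_pos hp, abs_of_pos hq]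
  have h1 : 0 ≤ |a| / p := by positivity
  have h2 : 0 ≤ |b| / q := by positivity
  nlinarith

theorem lt_quadratic_of_or {a b p q : ℝ} (hp : 0 < p) (hq : 0 < q) (h : p < |a| ∨ q < |b|) :
    1 < (a / p) ^ 2 + (b / q) ^ 2 := by
  rw [← sq_abs (a / p), ← sq_abs (b / q), abs_div, abs_div, abs_of_pos hp, abs_of_pos hq]
  have h1 : 0 ≤ |a| / p := by positivity
  have h2 : 0 ≤ |b| / q := by positivity
  rcases h with h | h
  · have := (one_lt_div hp).2 h
    nlinarith
  · have := (one_lt_div hq).2 h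
    nlinarith

theorem eq_of_mem_window {σ ψ v : ℝ} {n : ℤ} (h : v = ψ + 2 * π * n) (h₁ : σ < v)
    (h₂ : v < σ + 2 * π) (h₃ : σ ≤ ψ) (h₄ : ψ ≤ σ + 2 * π) : v = ψ := by
  have hn : n = 0 := by
    by_contra hn
    have hπ := Real.pi_pos
    rcases lt_or_gt_of_ne hn with h | h
    · have : (n : ℝ) ≤ -1 := by exact_mod_cast (by omega : n ≤ -1)
      nlinarith
    · have : (1 : ℝ) ≤ n := by exact_mod_cast (by omega : 1 ≤ n)
      nlinarith
  rw [h, hn, Int.cast_zero, mul_zero, add_zero]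

/-- Two ellipses in logarithmic coordinates that separate the punctures in the same way. -/
theorem log_oval_isotopic {c₀ c₁ p q d₀ d₁ p' q' σ ψ₁ ψ₂ ψ₃ : ℝ} (a₀ a₁ : ℝ)
    (hψ₁ : ∃ k : ℤ, ψ₁ = π / 4 + 2 * π * k) (hψ₂ : ∃ k : ℤ, ψ₂ = 2 * π * k)
    (hψ₃ : ∃ k : ℤ, ψ₃ = -(π / 4) + 2 * π * k)
    (hs₁ : σ ≤ ψ₁ ∧ ψ₁ ≤ σ + 2 * π) (hs₂ : σ ≤ ψ₂ ∧ ψ₂ ≤ σ + 2 * π)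
    (hs₃ : σ ≤ ψ₃ ∧ ψ₃ ≤ σ + 2 * π) (hp : 0 < p) (hq : 0 < q) (hp' : 0 < p') (hq' : 0 < q')
    (hc : σ < c₁ - q ∧ c₁ + q < σ + 2 * π) (hd : σ < d₁ - q' ∧ d₁ + q' < σ + 2 * π)
    (ha : ((a₀ - c₀) / p) ^ 2 + ((a₁ - c₁) / q) ^ 2 < 1)
    (ha' : ((a₀ - d₀) / p') ^ 2 + ((a₁ - d₁) / q') ^ 2 < 1)
    (h₁ : (((Real.log 2 / 2 - c₀) / p) ^ 2 + ((ψ₁ - c₁) / q) ^ 2 < 1 ∧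
        ((Real.log 2 / 2 - d₀) / p') ^ 2 + ((ψ₁ - d₁) / q') ^ 2 < 1) ∨
      (1 < ((Real.log 2 / 2 - c₀) / p) ^ 2 + ((ψ₁ - c₁) / q) ^ 2 ∧
        1 < ((Real.log 2 / 2 - d₀) / p') ^ 2 + ((ψ₁ - d₁) / q') ^ 2))
    (h₂ : (((Real.log 2 - c₀) / p) ^ 2 + ((ψ₂ - c₁) / q) ^ 2 < 1 ∧
        ((Real.log 2 - d₀) / p') ^ 2 + ((ψ₂ - d₁) / q') ^ 2 < 1) ∨
      (1 < ((Real.log 2 - c₀) / p) ^ 2 + ((ψ₂ - c₁) / q) ^ 2 ∧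
        1 < ((Real.log 2 - d₀) / p') ^ 2 + ((ψ₂ - d₁) / q') ^ 2))
    (h₃ : (((Real.log 2 / 2 - c₀) / p) ^ 2 + ((ψ₃ - c₁) / q) ^ 2 < 1 ∧
        ((Real.log 2 / 2 - d₀) / p') ^ 2 + ((ψ₃ - d₁) / q') ^ 2 < 1) ∨
      (1 < ((Real.log 2 / 2 - c₀) / p) ^ 2 + ((ψ₃ - c₁) / q) ^ 2 ∧
        1 < ((Real.log 2 / 2 - d₀) / p') ^ 2 + ((ψ₃ - d₁) / q') ^ 2)) :
    LoopIsotopic Sigma05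
      (fun t => expMap (oval ((c₀ : ℝ) + (c₁ : ℝ) * Complex.I) 1 p q t))
      (fun t => expMap (oval ((d₀ : ℝ) + (d₁ : ℝ) * Complex.I) 1 p' q' t)) := by
  have him : ∀ x y : ℝ, ((x : ℝ) + (y : ℝ) * Complex.I : ℂ).im = y := fun x y => by simp
  refine loopIsotopic_expMap_oval (σ := σ) (a₀ + a₁ * Complex.I) hp hq hp' hq'
    (by rwa [ovalQ_real]) (by rwa [ovalQ_real]) (by rw [him]; exact hc.1)
    (by rw [him]; exact hc.2) (by rw [him]; exact hd.1) (by rw [him]; exact hd.2)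
    fun ζ h1 h2 hX => ?_
  obtain ⟨k₁, rfl⟩ := hψ₁
  obtain ⟨k₂, rfl⟩ := hψ₂
  obtain ⟨k₃, rfl⟩ := hψ₃
  obtain ⟨n, ⟨e1, e2, -⟩ | ⟨e1, e2, -⟩ | ⟨e1, e2, -⟩⟩ := expMap_not_mem hX
  · have e3 := eq_of_mem_window (ψ := π / 4 + 2 * π * k₁) (n := n - k₁)
      (by rw [e2]; push_cast; ring) h1 h2 hs₁.1 hs₁.2
    rw [← Complex.re_add_im ζ, e1, e3, ovalQ_real, ovalQ_real]
    exact h₁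
  · have e3 := eq_of_mem_window (ψ := 2 * π * k₂) (n := n - k₂)
      (by rw [e2]; push_cast; ring) h1 h2 hs₂.1 hs₂.2
    rw [← Complex.re_add_im ζ, e1, e3, ovalQ_real, ovalQ_real]
    exact h₂
  · have e3 := eq_of_mem_window (ψ := -(π / 4) + 2 * π * k₃) (n := n - k₃)
      (by rw [e2]; push_cast; ring) h1 h2 hs₃.1 hs₃.2
    rw [← Complex.re_add_im ζ, e1, e3, ovalQ_real, ovalQ_real]
    exact h₃

/-- A condition for the puncture with the coordinates `(v, ψ')` to be outside an ellipse and outside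
a small circle about `(u, ψ)`, unless it is the centre of the circle. -/
def Away (c₀ c₁ B R u ψ v ψ' : ℝ) : Prop :=
  (v = u ∧ ψ' = ψ) ∨ ((B < |v - c₀| ∨ R < |ψ' - c₁|) ∧ 1 / 20 < |ψ' - ψ|)

/-- An ellipse in logarithmic coordinates around one puncture. -/
theorem log_oval_same_one {c₀ c₁ B R σ u ψ ψ₁ ψ₂ ψ₃ : ℝ} {z : ℂ}
    (hζ : expMap ((u : ℝ) + (ψ : ℝ) * Complex.I) = z)
    (hz : z = -Complex.I ∨ z = -1 ∨ z = Complex.I)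
    (hψ₁ : ∃ k : ℤ, ψ₁ = π / 4 + 2 * π * k) (hψ₂ : ∃ k : ℤ, ψ₂ = 2 * π * k)
    (hψ₃ : ∃ k : ℤ, ψ₃ = -(π / 4) + 2 * π * k)
    (hs₁ : σ ≤ ψ₁ ∧ ψ₁ ≤ σ + 2 * π) (hs₂ : σ ≤ ψ₂ ∧ ψ₂ ≤ σ + 2 * π)
    (hs₃ : σ ≤ ψ₃ ∧ ψ₃ ≤ σ + 2 * π) (hB : 0 < B) (hR : 0 < R)
    (hc : σ < c₁ - R ∧ c₁ + R < σ + 2 * π) (hd : σ < ψ - 1 / 20 ∧ ψ + 1 / 20 < σ + 2 * π)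
    (hin : |u - c₀| / B + |ψ - c₁| / R < 1)
    (h₁ : Away c₀ c₁ B R u ψ (Real.log 2 / 2) ψ₁) (h₂ : Away c₀ c₁ B R u ψ (Real.log 2) ψ₂)
    (h₃ : Away c₀ c₁ B R u ψ (Real.log 2 / 2) ψ₃) :
    SameClass (fun t => expMap (oval ((c₀ : ℝ) + (c₁ : ℝ) * Complex.I) 1 B R t))
      (oval z z (1 / 10) (1 / 10)) := by
  have hr : (0 : ℝ) < 1 / 20 := by norm_num
  have key : ∀ {v ψ' : ℝ}, Away c₀ c₁ B R u ψ v ψ' →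
      (((v - c₀) / B) ^ 2 + ((ψ' - c₁) / R) ^ 2 < 1 ∧
        ((v - u) / (1 / 20)) ^ 2 + ((ψ' - ψ) / (1 / 20)) ^ 2 < 1) ∨
      (1 < ((v - c₀) / B) ^ 2 + ((ψ' - c₁) / R) ^ 2 ∧
        1 < ((v - u) / (1 / 20)) ^ 2 + ((ψ' - ψ) / (1 / 20)) ^ 2) := by
    rintro v ψ' (⟨rfl, rfl⟩ | ⟨h, h'⟩)
    · exact Or.inl ⟨quadratic_lt_of_diamond hB hR hin, by norm_num⟩
    · exact Or.inr ⟨lt_quadratic_of_or hB hR h, lt_quadratic_of_or hr hr (Or.inr h')⟩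
  exact (log_oval_isotopic u ψ hψ₁ hψ₂ hψ₃ hs₁ hs₂ hs₃ hB hR hr hr hc hd
    (quadratic_lt_of_diamond hB hR hin) (by norm_num) (key h₁) (key h₂) (key h₃)).same.trans
    (log_oval_one hζ hz)

theorem exists_log_midpoint : ∃ u a : ℝ, Real.log 2 / 2 < u ∧ u < Real.log 2 ∧ 3 / 10 < a ∧
    a < 1 / 2 ∧ ∀ ε : ℝ, ε = 1 ∨ ε = -1 → ∀ n : ℤ,
      Complex.exp ((u : ℝ) + (ε * a + 2 * π * n : ℝ) * Complex.I) = (3 + ε * Complex.I) / 2 := by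
  have h10 : √(1 + (1 / 3 : ℝ) ^ 2) ^ 2 = 10 / 9 := by
    rw [Real.sq_sqrt (by norm_num)]
    norm_num
  have hr : 0 < √(1 + (1 / 3 : ℝ) ^ 2) := Real.sqrt_pos.2 (by norm_num)
  set r := √(1 + (1 / 3 : ℝ) ^ 2) with hrdef
  have hlog : Real.exp (Real.log (5 / 2) / 2) = 3 / 2 * r := by
    rw [Real.exp_half, Real.exp_log (by norm_num), Real.sqrt_eq_iff_mul_self_eq (by norm_num)
      (by positivity)]
    linear_combination (-9 / 4) * h10
  have hs : Real.sin (Real.arctan (1 / 3)) = 1 / 3 / r := Real.sin_arctan _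
  have hc : Real.cos (Real.arctan (1 / 3)) = 1 / r := Real.cos_arctan _
  have ha0 : 0 < Real.arctan (1 / 3) := Real.arctan_pos.2 (by norm_num)
  refine ⟨Real.log (5 / 2) / 2, Real.arctan (1 / 3), ?_, ?_, ?_, ?_, ?_⟩
  · have := Real.log_lt_log (by norm_num : (0 : ℝ) < 2) (by norm_num : (2 : ℝ) < 5 / 2)
    linarith
  · have := Real.log_lt_log (by norm_num : (0 : ℝ) < 5 / 2) (by norm_num : (5 / 2 : ℝ) < 2 ^ 2)
    rw [Real.log_pow] at this
    push_cast at this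
    linarith
  · have h1 := Real.sin_lt ha0
    rw [hs] at h1
    refine lt_trans ?_ h1
    rw [lt_div_iff₀ hr]
    nlinarith
  · have h1 := Real.mul_le_sin ha0.le (Real.arctan_lt_pi_div_two _).le
    rw [hs] at h1
    have h2 : 1 / 3 / r < 317 / 1000 := by
      rw [div_lt_iff₀ hr]
      nlinarith
    have h3 : 2 / π * Real.arctan (1 / 3) = 2 * Real.arctan (1 / 3) / π := by ring
    rw [h3, div_le_iff₀ Real.pi_pos] at h1
    have h4 := mul_lt_mul_of_pos_right h2 Real.pi_pos
    linarith [Real.pi_lt_d2]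
  · intro ε hε n
    have e1 : Complex.exp ((Real.log (5 / 2) / 2 : ℝ) +
        (ε * Real.arctan (1 / 3) + 2 * π * n : ℝ) * Complex.I) =
        Complex.exp ((Real.log (5 / 2) / 2 : ℝ) + (ε * Real.arctan (1 / 3) : ℝ) * Complex.I) := by
      rw [Complex.exp_eq_exp_iff_exists_int]
      exact ⟨n, by push_cast; ring⟩
    have e2 : Real.cos (ε * Real.arctan (1 / 3)) = 1 / r := by
      rcases hε with rfl | rfl
      · rw [one_mul, hc]
      · rw [neg_one_mul, Real.cos_neg, hc]
    have e3 : Real.sin (ε * Real.arctan (1 / 3)) = ε * (1 / 3 / r) := by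
      rcases hε with rfl | rfl
      · rw [one_mul, hs, one_mul]
      · rw [neg_one_mul, Real.sin_neg, hs, neg_one_mul]
    have hr' : (r : ℂ) ≠ 0 := Complex.ofReal_ne_zero.2 hr.ne'
    rw [e1, Complex.exp_add, ← Complex.ofReal_exp, hlog, Complex.exp_mul_I, ← Complex.ofReal_cos,
      ← Complex.ofReal_sin, e2, e3]
    push_cast
    field_simp

/-- An ellipse in logarithmic coordinates around `p₂` and one of its neighbours. -/
theorem log_oval_same_two {ε : ℝ} (hε : ε = 1 ∨ ε = -1) (n : ℤ) :
    SameClass (fun t => expMap (oval ((3 / 10 : ℝ) +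
        (ε * (3 * π / 4) + 2 * π * n : ℝ) * Complex.I) 1 (12 / 5) (31 / 10) t))
      (oval ((-1 - ε * Complex.I) / 2) (-ε + Complex.I) (3 / 5) (9 / 20)) := by
  obtain ⟨u, a, hu, hu', ha, ha', he⟩ := exists_log_midpoint
  refine SameClass.trans (LoopIsotopic.same ?_) (log_oval_two hε (he ε hε n))
  have p1 := Real.pi_gt_d2
  have p2 := Real.pi_lt_d2
  have l1 := Real.log_two_gt_d9
  have l2 := Real.log_two_lt_d9
  have hB : (0 : ℝ) < 12 / 5 := by norm_num
  have hR : (0 : ℝ) < 31 / 10 := by norm_num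
  have hρ : (0 : ℝ) < 17 / 25 := by norm_num
  have inside : ∀ {x y : ℝ}, |x| ≤ 2 / 5 → |y| ≤ 237 / 100 →
      (x / (12 / 5)) ^ 2 + (y / (31 / 10)) ^ 2 < 1 := by
    intro x y hx hy
    refine lt_of_le_of_lt (quadratic_mono (α := 1 / 6) (β := 4 / 5) hB hR ?_ ?_) (by norm_num)
    · linarith
    · linarith
  have inside' : ∀ {x y : ℝ}, |x| ≤ 7 / 20 → |y| ≤ 1 / 2 →
      (x / (17 / 25)) ^ 2 + (y / (17 / 25)) ^ 2 < 1 := by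
    intro x y hx hy
    refine lt_of_le_of_lt (quadratic_mono (α := 35 / 68) (β := 25 / 34) hρ hρ ?_ ?_)
      (by norm_num)
    · linarith
    · linarith
  rcases hε with rfl | rfl
  · refine log_oval_isotopic (σ := -(π / 4) + 2 * π * n) (ψ₁ := π / 4 + 2 * π * n)
      (ψ₂ := 2 * π * n) (ψ₃ := -(π / 4) + 2 * π * n) u (1 * a + 2 * π * n) ⟨n, rfl⟩ ⟨n, rfl⟩
      ⟨n, rfl⟩ ⟨by linarith, by linarith⟩ ⟨by linarith, by linarith⟩ ⟨by linarith, by linarith⟩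
      hB hR hρ hρ ⟨by linarith, by linarith⟩ ⟨by linarith, by linarith⟩ (inside ?_ ?_)
      (by norm_num) (Or.inl ⟨inside ?_ ?_, inside' ?_ ?_⟩) (Or.inl ⟨inside ?_ ?_, inside' ?_ ?_⟩)
      (Or.inr ⟨lt_quadratic_of_or hB hR (Or.inr ?_), lt_quadratic_of_or hρ hρ (Or.inr ?_)⟩)
    all_goals first
      | (rw [abs_le]; constructor <;> linarith)
      | (rw [lt_abs]; right; linarith)
  · refine log_oval_isotopic (σ := -(7 * π / 4) + 2 * π * n) (ψ₁ := π / 4 + 2 * π * n)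
      (ψ₂ := 2 * π * n) (ψ₃ := -(π / 4) + 2 * π * n) u (-1 * a + 2 * π * n) ⟨n, rfl⟩ ⟨n, rfl⟩
      ⟨n, rfl⟩ ⟨by linarith, by linarith⟩ ⟨by linarith, by linarith⟩ ⟨by linarith, by linarith⟩
      hB hR hρ hρ ⟨by linarith, by linarith⟩ ⟨by linarith, by linarith⟩ (inside ?_ ?_)
      (by norm_num)
      (Or.inr ⟨lt_quadratic_of_or hB hR (Or.inr ?_), lt_quadratic_of_or hρ hρ (Or.inr ?_)⟩)
      (Or.inl ⟨inside ?_ ?_, inside' ?_ ?_⟩) (Or.inl ⟨inside ?_ ?_, inside' ?_ ?_⟩)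
    all_goals first
      | (rw [abs_le]; constructor <;> linarith)
      | (rw [lt_abs]; left; linarith)

end Skein

namespace Skein

theorem pi_log_bounds : 314 < 100 * π ∧ 100 * π < 315 ∧ 69 < 100 * Real.log 2 ∧
    10 * Real.log 2 < 7 := by
  have := Real.pi_gt_d2
  have := Real.pi_lt_d2
  have := Real.log_two_gt_d9
  have := Real.log_two_lt_d9
  refine ⟨?_, ?_, ?_, ?_⟩ <;> linarith

/-! ### The standard curves -/

/-- The curve around the puncture `z`. -/
noncomputable def around₁ (z : ℂ) : ℝ → ℂ := oval z z (1 / 10) (1 / 10)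

/-- The curve around the puncture `z` and the next one. -/
noncomputable def around₂ (z : ℂ) : ℝ → ℂ :=
  oval ((1 - Complex.I) / 2 * z) ((-1 - Complex.I) * z) (3 / 5) (9 / 20)

/-- The curve around the puncture `z` and the opposite one. -/
noncomputable def aroundOpp (z : ℂ) : ℝ → ℂ := oval 0 z (3 / 2) (1 / 2)

/-- The curve around the puncture `z` and the next two. -/
noncomputable def around₃ (z : ℂ) : ℝ → ℂ := oval (-Complex.I * z) z (17 / 10) (17 / 10)

/-- The curve around all punctures. -/
noncomputable def around₄ : ℝ → ℂ := oval 0 1 2 2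

section Standard

variable {R : Type*} [CommRing R] (s : Rˣ) (j k : ZMod 4)

theorem toSkein_loop₁ : (loop₁ (j + k)).toSkein s = rotClass s k (around₁ (puncture j)) :=
  toSkein_rotatedEllipseLink (by ring) (by push_cast; ring) (by push_cast; ring)

theorem toSkein_loop₂ : (loop₂ (j + k)).toSkein s = rotClass s k (around₂ (puncture j)) :=
  toSkein_rotatedEllipseLink (by ring) (by push_cast; ring) (by push_cast; ring)

theorem toSkein_loopOpp : (loopOpp (j + k)).toSkein s = rotClass s k (aroundOpp (puncture j)) :=
  toSkein_rotatedEllipseLink (by ring) (by push_cast; ring) (by push_cast; ring)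

theorem toSkein_loop₃ : (loop₃ (j + k)).toSkein s = rotClass s k (around₃ (puncture j)) :=
  toSkein_rotatedEllipseLink (by ring) (by push_cast; ring) (by push_cast; ring)

theorem toSkein_loop₄ : loop₄.toSkein s = rotClass s k around₄ := by
  have h : loop₄.toSkein s = rotClass s 0 around₄ := by
    rw [loop₄]
    exact toSkein_rotatedEllipseLink (j := 0) (k := 0) (by rw [zero_mul])
      (by rw [puncture_zero]; push_cast; ring) (by rw [puncture_zero]; push_cast; ring)
  rw [h]
  apply loopClass_eq_of_range
  have key : ∀ t, around₄ t = 2 * Complex.exp (t * Complex.I) := by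
    intro t
    rw [around₄, oval, Complex.exp_mul_I]
    push_cast
    ring
  have hk : ∃ α : ℝ, puncture k = Complex.exp (α * Complex.I) := by
    refine ⟨Complex.arg (puncture k), ?_⟩
    have := Complex.norm_mul_exp_arg_mul_I (puncture k)
    rwa [puncture, norm_pow, norm_neg, Complex.norm_I, one_pow, Complex.ofReal_one, one_mul,
      eq_comm] at this
  obtain ⟨α, hα⟩ := hk
  rw [puncture_zero, hα]
  ext z
  constructor
  · rintro ⟨t, rfl⟩
    refine ⟨t - α, ?_⟩
    simp only [key, mul_one, mul_assoc, ← Complex.exp_add]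
    congr 2
    push_cast
    ring
  · rintro ⟨t, rfl⟩
    refine ⟨t + α, ?_⟩
    simp only [key, mul_one, mul_assoc, ← Complex.exp_add]
    congr 2
    push_cast
    ring

end Standard

theorem expMap_first (n : ℤ) :
    expMap ((Real.log 2 / 2 : ℝ) + (π / 4 + 2 * π * n : ℝ) * Complex.I) = -Complex.I := by
  have h := expMap_log_two_div_two 1 (Or.inl rfl)
  rw [show -(1 : ℝ) * Complex.I = -Complex.I by push_cast; ring] at h
  refine Eq.trans ?_ h
  rw [expMap, expMap, sub_right_inj, Complex.exp_eq_exp_iff_exists_int]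
  exact ⟨n, by push_cast; ring⟩

theorem expMap_second (n : ℤ) :
    expMap ((Real.log 2 : ℝ) + (2 * π * n : ℝ) * Complex.I) = -1 := by
  rw [← expMap_log_two, expMap, expMap, sub_right_inj, Complex.exp_eq_exp_iff_exists_int]
  exact ⟨n, by push_cast; ring⟩

theorem expMap_third (n : ℤ) :
    expMap ((Real.log 2 / 2 : ℝ) + (-(π / 4) + 2 * π * n : ℝ) * Complex.I) = Complex.I := by
  have h := expMap_log_two_div_two (-1) (Or.inr rfl)
  rw [show -((-1 : ℝ) : ℂ) * Complex.I = Complex.I by push_cast; ring] at h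
  refine Eq.trans ?_ h
  rw [expMap, expMap, sub_right_inj, Complex.exp_eq_exp_iff_exists_int]
  exact ⟨n, by push_cast; ring⟩

theorem log_oval_same_12 :
    SameClass (fun t => expMap (oval ((3 / 10 : ℝ) + (3 * π / 4 : ℝ) * Complex.I) 1
      (12 / 5) (31 / 10) t)) (around₂ (-Complex.I)) := by
  have h := log_oval_same_two (Or.inl rfl) 0
  rw [Int.cast_zero, mul_zero, add_zero, one_mul, Complex.ofReal_one, one_mul] at h
  rwa [around₂, show (1 - Complex.I) / 2 * -Complex.I = (-1 - Complex.I) / 2 by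
    linear_combination Complex.I_mul_I / 2, show (-1 - Complex.I) * -Complex.I = -1 + Complex.I by
    linear_combination Complex.I_mul_I]

theorem log_oval_same_23 (n : ℤ) :
    SameClass (fun t => expMap (oval ((3 / 10 : ℝ) + (-(3 * π / 4) + 2 * π * n : ℝ) * Complex.I) 1
      (12 / 5) (31 / 10) t)) (around₂ (-1)) := by
  have h := log_oval_same_two (Or.inr rfl) n
  rw [show (-1 : ℝ) * (3 * π / 4) = -(3 * π / 4) by ring] at h
  rwa [around₂, show (1 - Complex.I) / 2 * (-1) = (-1 - ((-1 : ℝ) : ℂ) * Complex.I) / 2 by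
    push_cast; ring, show (-1 - Complex.I) * (-1) = -((-1 : ℝ) : ℂ) + Complex.I by push_cast; ring]

theorem ovalQ_eq (c δ : ℂ) (p q : ℝ) (z : ℂ) : ovalQ c δ p q z =
    (((z.re - c.re) * δ.re + (z.im - c.im) * δ.im) / (δ.re ^ 2 + δ.im ^ 2) / p) ^ 2 +
    (((z.im - c.im) * δ.re - (z.re - c.re) * δ.im) / (δ.re ^ 2 + δ.im ^ 2) / q) ^ 2 := by
  rw [ovalQ, Complex.div_re, Complex.div_im, Complex.normSq_apply, ← add_div, ← sub_div,
    Complex.sub_re, Complex.sub_im, sq δ.re, sq δ.im]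

section Sides

variable {σ W B R ψ M G : ℝ}

theorem FoldSide.below (h : ψ ≤ σ) : FoldSide σ W B R ψ M G := Or.inl h

theorem FoldSide.above (h : σ + W ≤ ψ) : FoldSide σ W B R ψ M G := Or.inr (Or.inl h)

theorem FoldSide.outside (h₁ : σ + 1 / 200 ≤ ψ) (h₂ : ψ ≤ σ + W - 1 / 200) (h₃ : G < M)
    (h₄ : B < M) : FoldSide σ W B R ψ M G :=
  Or.inr (Or.inr ⟨h₁, h₂, Or.inr ⟨h₃, h₄⟩⟩)

theorem FoldSide.inside (h₁ : σ + 1 / 200 ≤ ψ) (h₂ : ψ ≤ σ + W - 1 / 200) (h₃ : M < G)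
    (h₄ : M / B + (ψ - (σ + W / 2)) / R < 1) (h₅ : M / B - (ψ - (σ + W / 2)) / R < 1) :
    FoldSide σ W B R ψ M G := by
  refine Or.inr (Or.inr ⟨h₁, h₂, Or.inl ⟨h₃, ?_⟩⟩)
  rcases abs_choice (ψ - (σ + W / 2)) with h | h
  · rwa [h]
  · rwa [h, neg_div, ← sub_eq_add_neg]

theorem Away.self {c₀ c₁ B R u ψ : ℝ} : Away c₀ c₁ B R u ψ u ψ := Or.inl ⟨rfl, rfl⟩

theorem Away.above {c₀ c₁ B R u ψ v ψ' : ℝ} (h₁ : c₁ + R < ψ') (h₂ : ψ + 1 / 20 < ψ') :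
    Away c₀ c₁ B R u ψ v ψ' :=
  Or.inr ⟨Or.inr (lt_abs.2 (Or.inl (by linarith))), lt_abs.2 (Or.inl (by linarith))⟩

theorem Away.below {c₀ c₁ B R u ψ v ψ' : ℝ} (h₁ : ψ' < c₁ - R) (h₂ : ψ' < ψ - 1 / 20) :
    Away c₀ c₁ B R u ψ v ψ' :=
  Or.inr ⟨Or.inr (lt_abs.2 (Or.inr (by linarith))), lt_abs.2 (Or.inr (by linarith))⟩

end Sides

/-- Two folded curves in the same sector that separate the punctures in the same way. -/
theorem CrossData.fold_same {c θ h φ₁ φ₂ φ₃ F₁ F₂ F₃ G₁ G₂ G₃ M N : ℝ}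
    {θ' h' φ₁' φ₂' φ₃' F₁' F₂' F₃' G₁' G₂' G₃' M' N' : ℝ}
    (D : CrossData c θ h φ₁ φ₂ φ₃ F₁ F₂ F₃ G₁ G₂ G₃ M N)
    (D' : CrossData c θ' h' φ₁' φ₂' φ₃' F₁' F₂' F₃' G₁' G₂' G₃' M' N')
    {w θ₁ θ₁' σ W B R ψ₁ ψ₂ ψ₃ : ℝ} {f f' : ℝ → ℝ} (hw : 8 ≤ w) (hW : w = 100 * W)
    (hWπ : W ≤ 2 * π) (hσ : θ + θ₁ / 100 = σ) (hσ' : θ' + θ₁' / 100 = σ) (hF : IsFold w f)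
    (hF' : IsFold w f')
    (hf : ∀ x, 1 / 4 ≤ x → x ≤ w - 1 / 4 →
      |f x - (|prof (100 * π) (100 * h) (θ₁ + x)|)| ≤ 1 / 2)
    (hf' : ∀ x, 1 / 4 ≤ x → x ≤ w - 1 / 4 →
      |f' x - (|prof (100 * π) (100 * h') (θ₁' + x)|)| ≤ 1 / 2)
    (hψ₁ : ∃ k : ℤ, ψ₁ = φ₁ + 2 * π * k) (hψ₂ : ∃ k : ℤ, ψ₂ = φ₂ + 2 * π * k)
    (hψ₃ : ∃ k : ℤ, ψ₃ = φ₃ + 2 * π * k)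
    (hψ₁' : ∃ k : ℤ, ψ₁ = φ₁' + 2 * π * k) (hψ₂' : ∃ k : ℤ, ψ₂ = φ₂' + 2 * π * k)
    (hψ₃' : ∃ k : ℤ, ψ₃ = φ₃' + 2 * π * k)
    (hs₁ : σ ≤ ψ₁ ∧ ψ₁ ≤ σ + 2 * π) (hs₂ : σ ≤ ψ₂ ∧ ψ₂ ≤ σ + 2 * π)
    (hs₃ : σ ≤ ψ₃ ∧ ψ₃ ≤ σ + 2 * π) (hB : 0 < B) (hR : 0 < R)
    (h₁ : FoldSide σ W B R ψ₁ M G₁) (h₂ : FoldSide σ W B R ψ₂ N G₂)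
    (h₃ : FoldSide σ W B R ψ₃ M G₃)
    (h₁' : FoldSide σ W B R ψ₁ M' G₁') (h₂' : FoldSide σ W B R ψ₂ N' G₂')
    (h₃' : FoldSide σ W B R ψ₃ M' G₃') :
    SameClass (foldCurve (100 * π) 1 (base c θ) w θ₁ f)
      (foldCurve (100 * π) 1 (base c θ') w θ₁' f') := by
  rw [foldCurve_base, foldCurve_base, hσ, hσ', logFold, logFold]
  refine (loopIsotopic_fold hundred_pi_pos (base_ne_zero c σ) (by linarith) (by linarith) hF hF'
    fun u x hx hxw hX => ?_).same
  obtain ⟨a1, a2, a3⟩ := D.fold_not_mem hW hWπ hσ hf hψ₁ hψ₂ hψ₃ hs₁ hs₂ hs₃ h₁ h₂ h₃ hx hxw hX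
  obtain ⟨-, -, b3⟩ := D'.fold_not_mem hW hWπ hσ' hf' hψ₁' hψ₂' hψ₃' hs₁ hs₂ hs₃ h₁' h₂' h₃' hx
    hxw hX
  have key : |u| / (100 * B) + |x - w / 2| / (100 * R) < 1 → ¬ 100 * B < |u| := by
    intro h h'
    have e1 := (one_lt_div (by linarith : 0 < 100 * B)).2 h'
    have e2 : 0 ≤ |x - w / 2| / (100 * R) := by positivity
    linarith
  refine ⟨a1, a2, ?_⟩
  rcases a3 with ⟨a3, a4⟩ | ⟨a3, a4⟩ <;> rcases b3 with ⟨b3, b4⟩ | ⟨b3, b4⟩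
  · exact Or.inl ⟨a3, b3⟩
  · exact absurd b4 (key a4)
  · exact absurd a4 (key b4)
  · exact Or.inr ⟨a3, b3⟩

/-! ### The crossing data of pairs of standard curves -/

theorem crossData_14_34 : CrossData 0 (-(π / 2)) (π / 2) (π / 4) 0 (-(π / 4)) (π / 4) 0 (-(π / 4))
    (π / 4) 0 (π / 4) (Real.log 2 / 2) (Real.log 2) := by
  obtain ⟨p1, -, l1, l2⟩ := pi_log_bounds
  exact ⟨⟨0, by simp⟩, ⟨0, by simp⟩, ⟨0, by simp⟩,
    by rw [abs_of_nonneg] <;> linarith, by rw [abs_of_nonneg] <;> linarith,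
    by rw [abs_of_nonneg] <;> linarith, by linarith, by linarith, by linarith,
    by rw [abs_of_nonneg]; linarith, abs_zero, by rw [abs_of_nonpos] <;> linarith,
    by rw [abs_of_nonneg] <;> linarith, by rw [abs_of_nonneg] <;> linarith,
    Or.inl (by linarith), Or.inr (by linarith), Or.inl (by linarith), by linarith, by linarith⟩

theorem crossData_14_234 : CrossData (Real.log 2) (-(15 * π / 32)) (17 * π / 32) (π / 4) 0
    (-(π / 4)) (3 * π / 16) (-(π / 16)) (-(5 * π / 16)) (3 * π / 16) (π / 16) (5 * π / 16)
    (Real.log 2 / 2) 0 := by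
  obtain ⟨p1, -, l1, l2⟩ := pi_log_bounds
  exact ⟨⟨0, by simp⟩, ⟨0, by simp⟩, ⟨0, by simp⟩,
    by rw [abs_of_nonneg] <;> linarith, by rw [abs_of_nonneg] <;> linarith,
    by rw [abs_of_nonneg] <;> linarith, by linarith, by linarith, by linarith,
    by rw [abs_of_nonneg]; linarith, by rw [abs_of_nonpos] <;> linarith,
    by rw [abs_of_nonpos] <;> linarith,
    by rw [abs_of_nonpos] <;> linarith, by rw [sub_self, abs_zero],
    Or.inl (by linarith), Or.inl (by linarith), Or.inl (by linarith), by linarith, by linarith⟩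

theorem crossData_124_34 : CrossData (Real.log 2) (-(17 * π / 32)) (15 * π / 32) (π / 4) 0
    (-(π / 4)) (5 * π / 16) (π / 16) (-(3 * π / 16)) (5 * π / 16) (π / 16) (3 * π / 16)
    (Real.log 2 / 2) 0 := by
  obtain ⟨p1, -, l1, l2⟩ := pi_log_bounds
  exact ⟨⟨0, by simp⟩, ⟨0, by simp⟩, ⟨0, by simp⟩,
    by rw [abs_of_nonneg] <;> linarith, by rw [abs_of_nonneg] <;> linarith,
    by rw [abs_of_nonneg] <;> linarith, by linarith, by linarith, by linarith,
    by rw [abs_of_nonneg]; linarith, by rw [abs_of_nonneg]; linarith,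
    by rw [abs_of_nonpos] <;> linarith,
    by rw [abs_of_nonpos] <;> linarith, by rw [sub_self, abs_zero],
    Or.inl (by linarith), Or.inl (by linarith), Or.inl (by linarith), by linarith, by linarith⟩

theorem crossData_134_24 : CrossData (Real.log 2) 0 (π / 16) (π / 4) 0
    (-(π / 4)) (3 * π / 16) (-(π / 16)) (3 * π / 16) (3 * π / 16) (π / 16) (3 * π / 16)
    (Real.log 2 / 2) 0 := by
  obtain ⟨p1, -, l1, l2⟩ := pi_log_bounds
  exact ⟨⟨0, by simp⟩, ⟨0, by simp⟩, ⟨0, by simp⟩,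
    by rw [abs_of_nonneg] <;> linarith, by rw [abs_of_nonneg] <;> linarith,
    by rw [abs_of_nonpos] <;> linarith, by linarith, by linarith, by linarith,
    by rw [abs_of_nonneg]; linarith, by rw [abs_of_nonpos] <;> linarith,
    by rw [abs_of_nonneg]; linarith,
    by rw [abs_of_nonpos] <;> linarith, by rw [sub_self, abs_zero],
    Or.inl (by linarith), Or.inl (by linarith), Or.inl (by linarith), by linarith, by linarith⟩

theorem crossData_14_24 : CrossData (3 / 10) (-(π / 20)) (π / 5) (π / 4) 0
    (-(π / 4)) (π / 10) (-(3 * π / 20)) 0 (π / 10) (3 * π / 20) 0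
    (Real.log 2 / 2 - 3 / 10) (Real.log 2 - 3 / 10) := by
  obtain ⟨p1, -, l1, l2⟩ := pi_log_bounds
  exact ⟨⟨0, by simp⟩, ⟨0, by simp⟩, ⟨0, by simp⟩,
    by rw [abs_of_nonneg] <;> linarith, by rw [abs_of_nonneg] <;> linarith,
    by rw [abs_of_nonpos] <;> linarith, by linarith, by linarith, by linarith,
    by rw [abs_of_nonneg]; linarith, by rw [abs_of_nonpos] <;> linarith, abs_zero,
    by rw [abs_of_nonneg]; linarith, by rw [abs_of_nonneg]; linarith,
    Or.inl (by linarith), Or.inl (by linarith), Or.inr (by linarith), by linarith, by linarith⟩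

theorem crossData_24_34 : CrossData (3 / 10) (21 * π / 20) (4 * π / 5) (π / 4) (2 * π)
    (7 * π / 4) 0 (3 * π / 20) (-(π / 10)) 0 (3 * π / 20) (π / 10)
    (Real.log 2 / 2 - 3 / 10) (Real.log 2 - 3 / 10) := by
  obtain ⟨p1, -, l1, l2⟩ := pi_log_bounds
  exact ⟨⟨0, by simp⟩, ⟨1, by simp⟩, ⟨1, by push_cast; ring⟩,
    by rw [abs_of_nonpos] <;> linarith, by rw [abs_of_nonneg] <;> linarith,
    by rw [abs_of_nonneg] <;> linarith, by linarith, by linarith, by linarith,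
    abs_zero, by rw [abs_of_nonneg]; linarith, by rw [abs_of_nonpos] <;> linarith,
    by rw [abs_of_nonneg]; linarith, by rw [abs_of_nonneg]; linarith,
    Or.inr (by linarith), Or.inl (by linarith), Or.inl (by linarith), by linarith, by linarith⟩

end Skein

namespace Skein

/-! ### The products of pairs of standard curves -/

theorem abs_div_add_abs_div_lt {a b p q : ℝ} (h₁ : a / p + b / q < 1) (h₂ : a / p - b / q < 1)
    (h₃ : -(a / p) + b / q < 1) (h₄ : -(a / p) - b / q < 1) : |a| / p + |b| / q < 1 := by
  rcases abs_choice a with h | h <;> rcases abs_choice b with h' | h' <;> rw [h, h'] <;>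
    simpa only [neg_div, ← sub_eq_add_neg]

theorem quadratic_lt {a b p q : ℝ} (hp : 0 < p) (hq : 0 < q) (h₁ : a / p + b / q < 1)
    (h₂ : a / p - b / q < 1) (h₃ : -(a / p) + b / q < 1) (h₄ : -(a / p) - b / q < 1) :
    (a / p) ^ 2 + (b / q) ^ 2 < 1 :=
  quadratic_lt_of_diamond hp hq (abs_div_add_abs_div_lt h₁ h₂ h₃ h₄)

theorem first_14_34 :
    LoopIsotopic Sigma05 (firstCurve 0 (-(π / 2)) (π / 2)) (around₂ 1) := by
  obtain ⟨p1, p2, l1, l2⟩ := pi_log_bounds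
  refine crossData_14_34.first_isotopic (by norm_num [Complex.ext_iff]) ?_ ?_ ?_
    (Or.inl ⟨?_, ?_⟩) (Or.inr ⟨?_, ?_⟩) (Or.inr ⟨?_, ?_⟩) <;>
    first | linarith | norm_num [ovalQ_eq]

theorem second_14_34 :
    LoopIsotopic Sigma05 (secondCurve 0 (-(π / 2)) (π / 2)) (around₂ Complex.I) := by
  obtain ⟨p1, p2, l1, l2⟩ := pi_log_bounds
  refine crossData_14_34.second_isotopic (by norm_num [Complex.ext_iff]) ?_ ?_ ?_
    (Or.inr ⟨?_, ?_⟩) (Or.inr ⟨?_, ?_⟩) (Or.inl ⟨?_, ?_⟩) <;>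
    first | linarith | norm_num [ovalQ_eq]

theorem inner_14_34 :
    LoopIsotopic Sigma05 (innerCurve 0 (-(π / 2)) (π / 2)) (around₁ 1) := by
  obtain ⟨p1, p2, l1, l2⟩ := pi_log_bounds
  refine crossData_14_34.inner_isotopic (by norm_num [Complex.ext_iff]) ?_ ?_ ?_
    (Or.inr ⟨?_, ?_⟩) (Or.inr ⟨?_, ?_⟩) (Or.inr ⟨?_, ?_⟩) <;>
    first | linarith | norm_num [ovalQ_eq]

theorem outer_14_34 :
    LoopIsotopic Sigma05 (outerCurve 0 (-(π / 2)) (π / 2)) (around₃ Complex.I) := by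
  obtain ⟨p1, p2, l1, l2⟩ := pi_log_bounds
  refine crossData_14_34.outer_isotopic (by norm_num [Complex.ext_iff]) ?_ ?_ ?_
    (Or.inl ⟨?_, ?_⟩) (Or.inr ⟨?_, ?_⟩) (Or.inl ⟨?_, ?_⟩) <;>
    first | linarith | norm_num [ovalQ_eq]

theorem join_14_34 :
    SameClass (joinCurve 0 (-(π / 2)) (π / 2)) (aroundOpp (-Complex.I)) := by
  obtain ⟨p1, p2, l1, l2⟩ := pi_log_bounds
  have h : SameClass (joinCurve 0 (-(π / 2)) (π / 2)) fun t =>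
      expMap (oval ((0 : ℝ) + (-π + π : ℝ) * Complex.I) 1 (3 / 5) (5 / 2) t) := by
    refine crossData_14_34.join_isotopic (σ := -π) (ψ₁ := π / 4) (ψ₂ := 0)
      (ψ₃ := -(π / 4)) ?_ ⟨0, by push_cast; ring⟩ ⟨0, by push_cast; ring⟩ ⟨0, by push_cast; ring⟩
      ⟨?_, ?_⟩ ⟨?_, ?_⟩ ⟨?_, ?_⟩ ?_ ?_ ?_ (.inside ?_ ?_ ?_ ?_ ?_) (.outside ?_ ?_ ?_ ?_)
      (.inside ?_ ?_ ?_ ?_ ?_) <;> linarith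
  rw [neg_add_cancel, Complex.ofReal_zero, zero_mul, add_zero] at h
  exact h.trans log_oval_opposite

theorem left_14_34 :
    SameClass (leftCurve 0 (-(π / 2)) (π / 2)) (around₁ Complex.I) := by
  obtain ⟨p1, p2, l1, l2⟩ := pi_log_bounds
  have h : SameClass (leftCurve 0 (-(π / 2)) (π / 2)) fun t =>
      expMap (oval ((0 : ℝ) + (-(π / 2) : ℝ) * Complex.I) 1 1 (3 / 2) t) := by
    refine crossData_14_34.left_isotopic (σ := -π) (ψ₁ := π / 4) (ψ₂ := 0)
      (ψ₃ := -(π / 4)) ?_ ⟨0, by push_cast; ring⟩ ⟨0, by push_cast; ring⟩ ⟨0, by push_cast; ring⟩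
      ⟨?_, ?_⟩ ⟨?_, ?_⟩ ⟨?_, ?_⟩ ?_ ?_ ?_ (.above ?_) (.above ?_)
      (.inside ?_ ?_ ?_ ?_ ?_) <;> linarith
  refine h.trans (log_oval_same_one (σ := -π) (ψ₁ := π / 4) (ψ₂ := 0) (ψ₃ := -(π / 4))
    (u := Real.log 2 / 2) (ψ := -(π / 4)) ?_ (by simp)
    ⟨0, by push_cast; ring⟩ ⟨0, by push_cast; ring⟩ ⟨0, by push_cast; ring⟩
    ⟨?_, ?_⟩ ⟨?_, ?_⟩ ⟨?_, ?_⟩ ?_ ?_ ⟨?_, ?_⟩ ⟨?_, ?_⟩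
    (abs_div_add_abs_div_lt ?_ ?_ ?_ ?_) (.above ?_ ?_) (.above ?_ ?_) .self)
  any_goals linarith
  have e := expMap_third 0
  rwa [show (-(π / 4) + 2 * π * (0 : ℤ) : ℝ) = -(π / 4) by push_cast; ring] at e

theorem right_14_34 :
    SameClass (rightCurve 0 (-(π / 2)) (π / 2)) (around₁ (-Complex.I)) := by
  obtain ⟨p1, p2, l1, l2⟩ := pi_log_bounds
  have h : SameClass (rightCurve 0 (-(π / 2)) (π / 2)) fun t =>
      expMap (oval ((0 : ℝ) + (-(π / 2) + π : ℝ) * Complex.I) 1 1 (3 / 2) t) := by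
    refine crossData_14_34.right_isotopic (σ := 0) (ψ₁ := π / 4) (ψ₂ := 0)
      (ψ₃ := 7 * π / 4) ?_ ⟨0, by push_cast; ring⟩ ⟨0, by push_cast; ring⟩ ⟨1, by push_cast; ring⟩
      ⟨?_, ?_⟩ ⟨?_, ?_⟩ ⟨?_, ?_⟩ ?_ ?_ ?_ (.inside ?_ ?_ ?_ ?_ ?_) (.below ?_)
      (.above ?_) <;> linarith
  refine h.trans (log_oval_same_one (σ := 0) (ψ₁ := π / 4) (ψ₂ := 0) (ψ₃ := 7 * π / 4)
    (u := Real.log 2 / 2) (ψ := π / 4) ?_ (by simp)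
    ⟨0, by push_cast; ring⟩ ⟨0, by push_cast; ring⟩ ⟨1, by push_cast; ring⟩
    ⟨?_, ?_⟩ ⟨?_, ?_⟩ ⟨?_, ?_⟩ ?_ ?_ ⟨?_, ?_⟩ ⟨?_, ?_⟩
    (abs_div_add_abs_div_lt ?_ ?_ ?_ ?_) .self (.below ?_ ?_) (.above ?_ ?_))
  any_goals linarith
  have e := expMap_first 0
  rwa [show (π / 4 + 2 * π * (0 : ℤ) : ℝ) = π / 4 by push_cast; ring] at e

theorem mul_14_34 {R : Type*} [CommRing R] (s : Rˣ) (k : ZMod 4) :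
    rotClass s k (around₂ 1) * rotClass s k (around₂ Complex.I) =
      ((s ^ 2 : Rˣ) : R) • rotClass s k (aroundOpp (-Complex.I)) +
      (((s ^ 2)⁻¹ : Rˣ) : R) • rotClass s k (flipCurve 0 (-(π / 2)) (π / 2)) +
      (rotClass s k (around₁ Complex.I) * rotClass s k (around₁ (-Complex.I)) +
        rotClass s k (around₁ 1) * rotClass s k (around₃ Complex.I)) ∧
    rotClass s k (around₂ Complex.I) * rotClass s k (around₂ 1) =
      (((s ^ 2)⁻¹ : Rˣ) : R) • rotClass s k (aroundOpp (-Complex.I)) +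
      ((s ^ 2 : Rˣ) : R) • rotClass s k (flipCurve 0 (-(π / 2)) (π / 2)) +
      (rotClass s k (around₁ Complex.I) * rotClass s k (around₁ (-Complex.I)) +
        rotClass s k (around₁ 1) * rotClass s k (around₃ Complex.I)) := by
  obtain ⟨X, Y, Z, rfl, rfl, rfl, h⟩ := crossData_14_34.mul s k
  rwa [first_14_34.rotClass_eq, second_14_34.rotClass_eq, inner_14_34.rotClass_eq,
    outer_14_34.rotClass_eq, join_14_34.rotClass_eq, left_14_34.rotClass_eq,
    right_14_34.rotClass_eq] at h

theorem first_14_234 :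
    LoopIsotopic Sigma05 (firstCurve (Real.log 2) (-(15 * π / 32)) (17 * π / 32)) (around₂ 1) := by
  obtain ⟨p1, p2, l1, l2⟩ := pi_log_bounds
  refine crossData_14_234.first_isotopic (by norm_num [Complex.ext_iff]) ?_ ?_ ?_
    (Or.inl ⟨?_, ?_⟩) (Or.inr ⟨?_, ?_⟩) (Or.inr ⟨?_, ?_⟩) <;>
    first | linarith | norm_num [ovalQ_eq]

theorem second_14_234 :
    LoopIsotopic Sigma05 (secondCurve (Real.log 2) (-(15 * π / 32)) (17 * π / 32)) (around₃ (-1)) := by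
  obtain ⟨p1, p2, l1, l2⟩ := pi_log_bounds
  refine crossData_14_234.second_isotopic (by norm_num [Complex.ext_iff]) ?_ ?_ ?_
    (Or.inr ⟨?_, ?_⟩) (Or.inl ⟨?_, ?_⟩) (Or.inl ⟨?_, ?_⟩) <;>
    first | linarith | norm_num [ovalQ_eq]

theorem inner_14_234 :
    LoopIsotopic Sigma05 (innerCurve (Real.log 2) (-(15 * π / 32)) (17 * π / 32)) (around₁ 1) := by
  obtain ⟨p1, p2, l1, l2⟩ := pi_log_bounds
  refine crossData_14_234.inner_isotopic (by norm_num [Complex.ext_iff]) ?_ ?_ ?_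
    (Or.inr ⟨?_, ?_⟩) (Or.inr ⟨?_, ?_⟩) (Or.inr ⟨?_, ?_⟩) <;>
    first | linarith | norm_num [ovalQ_eq]

theorem outer_14_234 :
    LoopIsotopic Sigma05 (outerCurve (Real.log 2) (-(15 * π / 32)) (17 * π / 32)) (around₄) := by
  obtain ⟨p1, p2, l1, l2⟩ := pi_log_bounds
  refine crossData_14_234.outer_isotopic (by norm_num [Complex.ext_iff]) ?_ ?_ ?_
    (Or.inl ⟨?_, ?_⟩) (Or.inl ⟨?_, ?_⟩) (Or.inl ⟨?_, ?_⟩) <;>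
    first | linarith | norm_num [ovalQ_eq]

theorem join_14_234 :
    SameClass (joinCurve (Real.log 2) (-(15 * π / 32)) (17 * π / 32)) (around₃ (-Complex.I)) := by
  obtain ⟨p1, p2, l1, l2⟩ := pi_log_bounds
  have h : SameClass (joinCurve (Real.log 2) (-(15 * π / 32)) (17 * π / 32)) fun t =>
      expMap (oval ((Real.log 2 : ℝ) + (-π + π : ℝ) * Complex.I) 1 (9 / 10) 2 t) := by
    refine crossData_14_234.join_isotopic (σ := -π) (ψ₁ := π / 4) (ψ₂ := 0)
      (ψ₃ := -(π / 4)) ?_ ⟨0, by push_cast; ring⟩ ⟨0, by push_cast; ring⟩ ⟨0, by push_cast; ring⟩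
      ⟨?_, ?_⟩ ⟨?_, ?_⟩ ⟨?_, ?_⟩ ?_ ?_ ?_ (.inside ?_ ?_ ?_ ?_ ?_) (.inside ?_ ?_ ?_ ?_ ?_)
      (.inside ?_ ?_ ?_ ?_ ?_) <;> linarith
  rw [neg_add_cancel, Complex.ofReal_zero, zero_mul, add_zero] at h
  rw [around₃, neg_mul_neg, Complex.I_mul_I]
  exact h.trans log_oval_three

theorem right_14_234 :
    SameClass (rightCurve (Real.log 2) (-(15 * π / 32)) (17 * π / 32)) (around₁ (-Complex.I)) := by
  obtain ⟨p1, p2, l1, l2⟩ := pi_log_bounds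
  have h : SameClass (rightCurve (Real.log 2) (-(15 * π / 32)) (17 * π / 32)) fun t =>
      expMap (oval ((Real.log 2 : ℝ) + (-(15 * π / 32) + π : ℝ) * Complex.I) 1 (6 / 5) (7 / 5) t) := by
    refine crossData_14_234.right_isotopic (σ := π / 16) (ψ₁ := π / 4) (ψ₂ := 2 * π)
      (ψ₃ := 7 * π / 4) ?_ ⟨0, by push_cast; ring⟩ ⟨1, by push_cast; ring⟩ ⟨1, by push_cast; ring⟩
      ⟨?_, ?_⟩ ⟨?_, ?_⟩ ⟨?_, ?_⟩ ?_ ?_ ?_ (.inside ?_ ?_ ?_ ?_ ?_) (.above ?_)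
      (.above ?_) <;> linarith
  refine h.trans (log_oval_same_one (σ := π / 16) (ψ₁ := π / 4) (ψ₂ := 2 * π) (ψ₃ := 7 * π / 4)
    (u := Real.log 2 / 2) (ψ := π / 4) ?_ (by simp)
    ⟨0, by push_cast; ring⟩ ⟨1, by push_cast; ring⟩ ⟨1, by push_cast; ring⟩
    ⟨?_, ?_⟩ ⟨?_, ?_⟩ ⟨?_, ?_⟩ ?_ ?_ ⟨?_, ?_⟩ ⟨?_, ?_⟩
    (abs_div_add_abs_div_lt ?_ ?_ ?_ ?_) .self (.above ?_ ?_) (.above ?_ ?_))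
  any_goals linarith
  have e := expMap_first 0
  rwa [show (π / 4 + 2 * π * (0 : ℤ) : ℝ) = π / 4 by push_cast; ring] at e

theorem left_14_234 :
    SameClass (leftCurve (Real.log 2) (-(15 * π / 32)) (17 * π / 32)) (around₂ (-1)) := by
  obtain ⟨p1, p2, l1, l2⟩ := pi_log_bounds
  have h : SameClass (leftCurve (Real.log 2) (-(15 * π / 32)) (17 * π / 32)) fun t =>
      expMap (oval ((Real.log 2 : ℝ) + (-(15 * π / 32) : ℝ) * Complex.I) 1 1 (8 / 5) t) := by
    refine crossData_14_234.left_isotopic (σ := -π) (ψ₁ := π / 4) (ψ₂ := 0)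
      (ψ₃ := -(π / 4)) ?_ ⟨0, by push_cast; ring⟩ ⟨0, by push_cast; ring⟩ ⟨0, by push_cast; ring⟩
      ⟨?_, ?_⟩ ⟨?_, ?_⟩ ⟨?_, ?_⟩ ?_ ?_ ?_ (.above ?_) (.inside ?_ ?_ ?_ ?_ ?_)
      (.inside ?_ ?_ ?_ ?_ ?_) <;> linarith
  have e : LoopIsotopic Sigma05
      (fun t => expMap (oval ((Real.log 2 : ℝ) + (-(15 * π / 32) : ℝ) * Complex.I) 1 1 (8 / 5) t))
      (fun t => expMap (oval ((3 / 10 : ℝ) + (-(3 * π / 4) : ℝ) * Complex.I) 1 (12 / 5) (31 / 10) t)) := by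
    refine log_oval_isotopic (σ := -(7 * π / 4)) (ψ₁ := π / 4) (ψ₂ := 0) (ψ₃ := -(π / 4))
      (Real.log 2) (-(15 * π / 32)) ⟨0, by push_cast; ring⟩ ⟨0, by push_cast; ring⟩ ⟨0, by push_cast; ring⟩
      ⟨?_, ?_⟩ ⟨?_, ?_⟩ ⟨?_, ?_⟩ ?_ ?_ ?_ ?_ ⟨?_, ?_⟩ ⟨?_, ?_⟩
      (quadratic_lt ?_ ?_ ?_ ?_ ?_ ?_) (quadratic_lt ?_ ?_ ?_ ?_ ?_ ?_)
      (Or.inr ⟨lt_quadratic_of_or ?_ ?_ (Or.inr (lt_abs.2 (Or.inl ?_))),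
        lt_quadratic_of_or ?_ ?_ (Or.inr (lt_abs.2 (Or.inl ?_)))⟩)
      (Or.inl ⟨quadratic_lt ?_ ?_ ?_ ?_ ?_ ?_, quadratic_lt ?_ ?_ ?_ ?_ ?_ ?_⟩)
      (Or.inl ⟨quadratic_lt ?_ ?_ ?_ ?_ ?_ ?_, quadratic_lt ?_ ?_ ?_ ?_ ?_ ?_⟩) <;> linarith
  have e' := log_oval_same_23 0
  rw [show (-(3 * π / 4) + 2 * π * (0 : ℤ) : ℝ) = -(3 * π / 4) by push_cast; ring] at e'
  exact (h.trans e.same).trans e'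

theorem mul_14_234 {R : Type*} [CommRing R] (s : Rˣ) (k : ZMod 4) :
    rotClass s k (around₂ 1) * rotClass s k (around₃ (-1)) =
      ((s ^ 2 : Rˣ) : R) • rotClass s k (around₃ (-Complex.I)) +
      (((s ^ 2)⁻¹ : Rˣ) : R) • rotClass s k (flipCurve (Real.log 2) (-(15 * π / 32)) (17 * π / 32)) +
      (rotClass s k (around₂ (-1)) * rotClass s k (around₁ (-Complex.I)) +
        rotClass s k (around₁ 1) * rotClass s k (around₄)) ∧
    rotClass s k (around₃ (-1)) * rotClass s k (around₂ 1) =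
      (((s ^ 2)⁻¹ : Rˣ) : R) • rotClass s k (around₃ (-Complex.I)) +
      ((s ^ 2 : Rˣ) : R) • rotClass s k (flipCurve (Real.log 2) (-(15 * π / 32)) (17 * π / 32)) +
      (rotClass s k (around₂ (-1)) * rotClass s k (around₁ (-Complex.I)) +
        rotClass s k (around₁ 1) * rotClass s k (around₄)) := by
  obtain ⟨X, Y, Z, rfl, rfl, rfl, h⟩ := crossData_14_234.mul s k
  rwa [first_14_234.rotClass_eq, second_14_234.rotClass_eq, inner_14_234.rotClass_eq,
    outer_14_234.rotClass_eq, join_14_234.rotClass_eq, left_14_234.rotClass_eq,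
    right_14_234.rotClass_eq] at h

theorem first_124_34 :
    LoopIsotopic Sigma05 (firstCurve (Real.log 2) (-(17 * π / 32)) (15 * π / 32)) (around₃ 1) := by
  obtain ⟨p1, p2, l1, l2⟩ := pi_log_bounds
  refine crossData_124_34.first_isotopic (by norm_num [Complex.ext_iff]) ?_ ?_ ?_
    (Or.inl ⟨?_, ?_⟩) (Or.inl ⟨?_, ?_⟩) (Or.inr ⟨?_, ?_⟩) <;>
    first | linarith | norm_num [ovalQ_eq]

theorem second_124_34 :
    LoopIsotopic Sigma05 (secondCurve (Real.log 2) (-(17 * π / 32)) (15 * π / 32)) (around₂ Complex.I) := by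
  obtain ⟨p1, p2, l1, l2⟩ := pi_log_bounds
  refine crossData_124_34.second_isotopic (by norm_num [Complex.ext_iff]) ?_ ?_ ?_
    (Or.inr ⟨?_, ?_⟩) (Or.inr ⟨?_, ?_⟩) (Or.inl ⟨?_, ?_⟩) <;>
    first | linarith | norm_num [ovalQ_eq]

theorem inner_124_34 :
    LoopIsotopic Sigma05 (innerCurve (Real.log 2) (-(17 * π / 32)) (15 * π / 32)) (around₁ 1) := by
  obtain ⟨p1, p2, l1, l2⟩ := pi_log_bounds
  refine crossData_124_34.inner_isotopic (by norm_num [Complex.ext_iff]) ?_ ?_ ?_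
    (Or.inr ⟨?_, ?_⟩) (Or.inr ⟨?_, ?_⟩) (Or.inr ⟨?_, ?_⟩) <;>
    first | linarith | norm_num [ovalQ_eq]

theorem outer_124_34 :
    LoopIsotopic Sigma05 (outerCurve (Real.log 2) (-(17 * π / 32)) (15 * π / 32)) (around₄) := by
  obtain ⟨p1, p2, l1, l2⟩ := pi_log_bounds
  refine crossData_124_34.outer_isotopic (by norm_num [Complex.ext_iff]) ?_ ?_ ?_
    (Or.inl ⟨?_, ?_⟩) (Or.inl ⟨?_, ?_⟩) (Or.inl ⟨?_, ?_⟩) <;>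
    first | linarith | norm_num [ovalQ_eq]

theorem join_124_34 :
    SameClass (joinCurve (Real.log 2) (-(17 * π / 32)) (15 * π / 32)) (around₃ (-Complex.I)) := by
  obtain ⟨p1, p2, l1, l2⟩ := pi_log_bounds
  have h : SameClass (joinCurve (Real.log 2) (-(17 * π / 32)) (15 * π / 32)) fun t =>
      expMap (oval ((Real.log 2 : ℝ) + (-π + π : ℝ) * Complex.I) 1 (9 / 10) 2 t) := by
    refine crossData_124_34.join_isotopic (σ := -π) (ψ₁ := π / 4) (ψ₂ := 0)
      (ψ₃ := -(π / 4)) ?_ ⟨0, by push_cast; ring⟩ ⟨0, by push_cast; ring⟩ ⟨0, by push_cast; ring⟩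
      ⟨?_, ?_⟩ ⟨?_, ?_⟩ ⟨?_, ?_⟩ ?_ ?_ ?_ (.inside ?_ ?_ ?_ ?_ ?_) (.inside ?_ ?_ ?_ ?_ ?_)
      (.inside ?_ ?_ ?_ ?_ ?_) <;> linarith
  rw [neg_add_cancel, Complex.ofReal_zero, zero_mul, add_zero] at h
  rw [around₃, neg_mul_neg, Complex.I_mul_I]
  exact h.trans log_oval_three

theorem left_124_34 :
    SameClass (leftCurve (Real.log 2) (-(17 * π / 32)) (15 * π / 32)) (around₁ Complex.I) := by
  obtain ⟨p1, p2, l1, l2⟩ := pi_log_bounds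
  have h : SameClass (leftCurve (Real.log 2) (-(17 * π / 32)) (15 * π / 32)) fun t =>
      expMap (oval ((Real.log 2 : ℝ) + (-(17 * π / 32) : ℝ) * Complex.I) 1 (6 / 5) (7 / 5) t) := by
    refine crossData_124_34.left_isotopic (σ := -π) (ψ₁ := π / 4) (ψ₂ := 0)
      (ψ₃ := -(π / 4)) ?_ ⟨0, by push_cast; ring⟩ ⟨0, by push_cast; ring⟩ ⟨0, by push_cast; ring⟩
      ⟨?_, ?_⟩ ⟨?_, ?_⟩ ⟨?_, ?_⟩ ?_ ?_ ?_ (.above ?_) (.above ?_)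
      (.inside ?_ ?_ ?_ ?_ ?_) <;> linarith
  refine h.trans (log_oval_same_one (σ := -π) (ψ₁ := π / 4) (ψ₂ := 0) (ψ₃ := -(π / 4))
    (u := Real.log 2 / 2) (ψ := -(π / 4)) ?_ (by simp)
    ⟨0, by push_cast; ring⟩ ⟨0, by push_cast; ring⟩ ⟨0, by push_cast; ring⟩
    ⟨?_, ?_⟩ ⟨?_, ?_⟩ ⟨?_, ?_⟩ ?_ ?_ ⟨?_, ?_⟩ ⟨?_, ?_⟩
    (abs_div_add_abs_div_lt ?_ ?_ ?_ ?_) (.above ?_ ?_) (.above ?_ ?_) .self)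
  any_goals linarith
  have e := expMap_third 0
  rwa [show (-(π / 4) + 2 * π * (0 : ℤ) : ℝ) = -(π / 4) by push_cast; ring] at e

theorem right_124_34 :
    SameClass (rightCurve (Real.log 2) (-(17 * π / 32)) (15 * π / 32)) (around₂ (-Complex.I)) := by
  obtain ⟨p1, p2, l1, l2⟩ := pi_log_bounds
  have h : SameClass (rightCurve (Real.log 2) (-(17 * π / 32)) (15 * π / 32)) fun t =>
      expMap (oval ((Real.log 2 : ℝ) + (-(17 * π / 32) + π : ℝ) * Complex.I) 1 1 (8 / 5) t) := by
    refine crossData_124_34.right_isotopic (σ := -(π / 16)) (ψ₁ := π / 4) (ψ₂ := 0)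
      (ψ₃ := 7 * π / 4) ?_ ⟨0, by push_cast; ring⟩ ⟨0, by push_cast; ring⟩ ⟨1, by push_cast; ring⟩
      ⟨?_, ?_⟩ ⟨?_, ?_⟩ ⟨?_, ?_⟩ ?_ ?_ ?_ (.inside ?_ ?_ ?_ ?_ ?_) (.inside ?_ ?_ ?_ ?_ ?_)
      (.above ?_) <;> linarith
  have e : LoopIsotopic Sigma05
      (fun t => expMap (oval ((Real.log 2 : ℝ) + (-(17 * π / 32) + π : ℝ) * Complex.I) 1 1 (8 / 5) t))
      (fun t => expMap (oval ((3 / 10 : ℝ) + (3 * π / 4 : ℝ) * Complex.I) 1 (12 / 5) (31 / 10) t)) := by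
    refine log_oval_isotopic (σ := -(π / 4)) (ψ₁ := π / 4) (ψ₂ := 0) (ψ₃ := 7 * π / 4)
      (Real.log 2) (15 * π / 32) ⟨0, by push_cast; ring⟩ ⟨0, by push_cast; ring⟩ ⟨1, by push_cast; ring⟩
      ⟨?_, ?_⟩ ⟨?_, ?_⟩ ⟨?_, ?_⟩ ?_ ?_ ?_ ?_ ⟨?_, ?_⟩ ⟨?_, ?_⟩
      (quadratic_lt ?_ ?_ ?_ ?_ ?_ ?_) (quadratic_lt ?_ ?_ ?_ ?_ ?_ ?_)
      (Or.inl ⟨quadratic_lt ?_ ?_ ?_ ?_ ?_ ?_, quadratic_lt ?_ ?_ ?_ ?_ ?_ ?_⟩)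
      (Or.inl ⟨quadratic_lt ?_ ?_ ?_ ?_ ?_ ?_, quadratic_lt ?_ ?_ ?_ ?_ ?_ ?_⟩)
      (Or.inr ⟨lt_quadratic_of_or ?_ ?_ (Or.inr (lt_abs.2 (Or.inl ?_))),
        lt_quadratic_of_or ?_ ?_ (Or.inr (lt_abs.2 (Or.inl ?_)))⟩) <;> linarith
  exact (h.trans e.same).trans log_oval_same_12

theorem mul_124_34 {R : Type*} [CommRing R] (s : Rˣ) (k : ZMod 4) :
    rotClass s k (around₃ 1) * rotClass s k (around₂ Complex.I) =
      ((s ^ 2 : Rˣ) : R) • rotClass s k (around₃ (-Complex.I)) +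
      (((s ^ 2)⁻¹ : Rˣ) : R) • rotClass s k (flipCurve (Real.log 2) (-(17 * π / 32)) (15 * π / 32)) +
      (rotClass s k (around₁ Complex.I) * rotClass s k (around₂ (-Complex.I)) +
        rotClass s k (around₁ 1) * rotClass s k (around₄)) ∧
    rotClass s k (around₂ Complex.I) * rotClass s k (around₃ 1) =
      (((s ^ 2)⁻¹ : Rˣ) : R) • rotClass s k (around₃ (-Complex.I)) +
      ((s ^ 2 : Rˣ) : R) • rotClass s k (flipCurve (Real.log 2) (-(17 * π / 32)) (15 * π / 32)) +
      (rotClass s k (around₁ Complex.I) * rotClass s k (around₂ (-Complex.I)) +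
        rotClass s k (around₁ 1) * rotClass s k (around₄)) := by
  obtain ⟨X, Y, Z, rfl, rfl, rfl, h⟩ := crossData_124_34.mul s k
  rwa [first_124_34.rotClass_eq, second_124_34.rotClass_eq, inner_124_34.rotClass_eq,
    outer_124_34.rotClass_eq, join_124_34.rotClass_eq, left_124_34.rotClass_eq,
    right_124_34.rotClass_eq] at h

theorem first_14_24 :
    LoopIsotopic Sigma05 (firstCurve (3 / 10) (-(π / 20)) (π / 5)) (around₂ 1) := by
  obtain ⟨p1, p2, l1, l2⟩ := pi_log_bounds
  refine crossData_14_24.first_isotopic (by norm_num [Complex.ext_iff]) ?_ ?_ ?_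
    (Or.inl ⟨?_, ?_⟩) (Or.inr ⟨?_, ?_⟩) (Or.inr ⟨?_, ?_⟩) <;>
    first | linarith | norm_num [ovalQ_eq]

theorem second_14_24 :
    LoopIsotopic Sigma05 (secondCurve (3 / 10) (-(π / 20)) (π / 5)) (aroundOpp (-1)) := by
  obtain ⟨p1, p2, l1, l2⟩ := pi_log_bounds
  refine crossData_14_24.second_isotopic (by norm_num [Complex.ext_iff]) ?_ ?_ ?_
    (Or.inr ⟨?_, ?_⟩) (Or.inl ⟨?_, ?_⟩) (Or.inr ⟨?_, ?_⟩) <;>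
    first | linarith | norm_num [ovalQ_eq]

theorem inner_14_24 :
    LoopIsotopic Sigma05 (innerCurve (3 / 10) (-(π / 20)) (π / 5)) (around₁ 1) := by
  obtain ⟨p1, p2, l1, l2⟩ := pi_log_bounds
  refine crossData_14_24.inner_isotopic (by norm_num [Complex.ext_iff]) ?_ ?_ ?_
    (Or.inr ⟨?_, ?_⟩) (Or.inr ⟨?_, ?_⟩) (Or.inr ⟨?_, ?_⟩) <;>
    first | linarith | norm_num [ovalQ_eq]

theorem outer_14_24 :
    LoopIsotopic Sigma05 (outerCurve (3 / 10) (-(π / 20)) (π / 5)) (around₃ 1) := by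
  obtain ⟨p1, p2, l1, l2⟩ := pi_log_bounds
  refine crossData_14_24.outer_isotopic (by norm_num [Complex.ext_iff]) ?_ ?_ ?_
    (Or.inl ⟨?_, ?_⟩) (Or.inl ⟨?_, ?_⟩) (Or.inr ⟨?_, ?_⟩) <;>
    first | linarith | norm_num [ovalQ_eq]

theorem join_14_24 :
    SameClass (joinCurve (3 / 10) (-(π / 20)) (π / 5)) (around₂ (-Complex.I)) := by
  obtain ⟨p1, p2, l1, l2⟩ := pi_log_bounds
  have h : SameClass (joinCurve (3 / 10) (-(π / 20)) (π / 5)) fun t =>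
      expMap (oval ((3 / 10 : ℝ) + (-(π / 4) + π : ℝ) * Complex.I) 1 (12 / 5) (31 / 10) t) := by
    refine crossData_14_24.join_isotopic (σ := -(π / 4)) (ψ₁ := π / 4) (ψ₂ := 0)
      (ψ₃ := -(π / 4)) ?_ ⟨0, by push_cast; ring⟩ ⟨0, by push_cast; ring⟩ ⟨0, by push_cast; ring⟩
      ⟨?_, ?_⟩ ⟨?_, ?_⟩ ⟨?_, ?_⟩ ?_ ?_ ?_ (.inside ?_ ?_ ?_ ?_ ?_) (.inside ?_ ?_ ?_ ?_ ?_)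
      (.below ?_) <;> linarith
  rw [show -(π / 4) + π = 3 * π / 4 by ring] at h
  exact h.trans log_oval_same_12

theorem left_14_24 :
    SameClass (leftCurve (3 / 10) (-(π / 20)) (π / 5)) (around₁ (-1)) := by
  obtain ⟨p1, p2, l1, l2⟩ := pi_log_bounds
  have h : SameClass (leftCurve (3 / 10) (-(π / 20)) (π / 5)) fun t =>
      expMap (oval ((3 / 10 : ℝ) + (-(π / 20) : ℝ) * Complex.I) 1 (4 / 5) (3 / 5) t) := by
    refine crossData_14_24.left_isotopic (σ := -(π / 4)) (ψ₁ := π / 4) (ψ₂ := 0)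
      (ψ₃ := -(π / 4)) ?_ ⟨0, by push_cast; ring⟩ ⟨0, by push_cast; ring⟩ ⟨0, by push_cast; ring⟩
      ⟨?_, ?_⟩ ⟨?_, ?_⟩ ⟨?_, ?_⟩ ?_ ?_ ?_ (.above ?_) (.inside ?_ ?_ ?_ ?_ ?_)
      (.below ?_) <;> linarith
  refine h.trans (log_oval_same_one (σ := -(π / 4)) (ψ₁ := π / 4) (ψ₂ := 0) (ψ₃ := -(π / 4))
    (u := Real.log 2) (ψ := 0) ?_ (by simp)
    ⟨0, by push_cast; ring⟩ ⟨0, by push_cast; ring⟩ ⟨0, by push_cast; ring⟩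
    ⟨?_, ?_⟩ ⟨?_, ?_⟩ ⟨?_, ?_⟩ ?_ ?_ ⟨?_, ?_⟩ ⟨?_, ?_⟩
    (abs_div_add_abs_div_lt ?_ ?_ ?_ ?_) (.above ?_ ?_) .self (.below ?_ ?_))
  any_goals linarith
  have e := expMap_second 0
  rwa [show (2 * π * (0 : ℤ) : ℝ) = 0 by push_cast; ring] at e

theorem right_14_24 :
    SameClass (rightCurve (3 / 10) (-(π / 20)) (π / 5)) (around₁ (-Complex.I)) := by
  obtain ⟨p1, p2, l1, l2⟩ := pi_log_bounds
  have h : SameClass (rightCurve (3 / 10) (-(π / 20)) (π / 5)) fun t =>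
      expMap (oval ((3 / 10 : ℝ) + (-(π / 20) + π : ℝ) * Complex.I) 1 1 (49 / 20) t) := by
    refine crossData_14_24.right_isotopic (σ := 3 * π / 20) (ψ₁ := π / 4) (ψ₂ := 2 * π)
      (ψ₃ := 7 * π / 4) ?_ ⟨0, by push_cast; ring⟩ ⟨1, by push_cast; ring⟩ ⟨1, by push_cast; ring⟩
      ⟨?_, ?_⟩ ⟨?_, ?_⟩ ⟨?_, ?_⟩ ?_ ?_ ?_ (.inside ?_ ?_ ?_ ?_ ?_) (.above ?_)
      (.above ?_) <;> linarith
  refine h.trans (log_oval_same_one (σ := 3 * π / 20) (ψ₁ := π / 4) (ψ₂ := 2 * π) (ψ₃ := 7 * π / 4)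
    (u := Real.log 2 / 2) (ψ := π / 4) ?_ (by simp)
    ⟨0, by push_cast; ring⟩ ⟨1, by push_cast; ring⟩ ⟨1, by push_cast; ring⟩
    ⟨?_, ?_⟩ ⟨?_, ?_⟩ ⟨?_, ?_⟩ ?_ ?_ ⟨?_, ?_⟩ ⟨?_, ?_⟩
    (abs_div_add_abs_div_lt ?_ ?_ ?_ ?_) .self (.above ?_ ?_) (.above ?_ ?_))
  any_goals linarith
  have e := expMap_first 0
  rwa [show (π / 4 + 2 * π * (0 : ℤ) : ℝ) = π / 4 by push_cast; ring] at e

theorem mul_14_24 {R : Type*} [CommRing R] (s : Rˣ) (k : ZMod 4) :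
    rotClass s k (around₂ 1) * rotClass s k (aroundOpp (-1)) =
      ((s ^ 2 : Rˣ) : R) • rotClass s k (around₂ (-Complex.I)) +
      (((s ^ 2)⁻¹ : Rˣ) : R) • rotClass s k (flipCurve (3 / 10) (-(π / 20)) (π / 5)) +
      (rotClass s k (around₁ (-1)) * rotClass s k (around₁ (-Complex.I)) +
        rotClass s k (around₁ 1) * rotClass s k (around₃ 1)) ∧
    rotClass s k (aroundOpp (-1)) * rotClass s k (around₂ 1) =
      (((s ^ 2)⁻¹ : Rˣ) : R) • rotClass s k (around₂ (-Complex.I)) +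
      ((s ^ 2 : Rˣ) : R) • rotClass s k (flipCurve (3 / 10) (-(π / 20)) (π / 5)) +
      (rotClass s k (around₁ (-1)) * rotClass s k (around₁ (-Complex.I)) +
        rotClass s k (around₁ 1) * rotClass s k (around₃ 1)) := by
  obtain ⟨X, Y, Z, rfl, rfl, rfl, h⟩ := crossData_14_24.mul s k
  rwa [first_14_24.rotClass_eq, second_14_24.rotClass_eq, inner_14_24.rotClass_eq,
    outer_14_24.rotClass_eq, join_14_24.rotClass_eq, left_14_24.rotClass_eq,
    right_14_24.rotClass_eq] at h

theorem first_24_34 :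
    LoopIsotopic Sigma05 (firstCurve (3 / 10) (21 * π / 20) (4 * π / 5)) (aroundOpp (-1)) := by
  obtain ⟨p1, p2, l1, l2⟩ := pi_log_bounds
  refine crossData_24_34.first_isotopic (by norm_num [Complex.ext_iff]) ?_ ?_ ?_
    (Or.inr ⟨?_, ?_⟩) (Or.inl ⟨?_, ?_⟩) (Or.inr ⟨?_, ?_⟩) <;>
    first | linarith | norm_num [ovalQ_eq]

theorem second_24_34 :
    LoopIsotopic Sigma05 (secondCurve (3 / 10) (21 * π / 20) (4 * π / 5)) (around₂ Complex.I) := by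
  obtain ⟨p1, p2, l1, l2⟩ := pi_log_bounds
  refine crossData_24_34.second_isotopic (by norm_num [Complex.ext_iff]) ?_ ?_ ?_
    (Or.inr ⟨?_, ?_⟩) (Or.inr ⟨?_, ?_⟩) (Or.inl ⟨?_, ?_⟩) <;>
    first | linarith | norm_num [ovalQ_eq]

theorem inner_24_34 :
    LoopIsotopic Sigma05 (innerCurve (3 / 10) (21 * π / 20) (4 * π / 5)) (around₁ 1) := by
  obtain ⟨p1, p2, l1, l2⟩ := pi_log_bounds
  refine crossData_24_34.inner_isotopic (by norm_num [Complex.ext_iff]) ?_ ?_ ?_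
    (Or.inr ⟨?_, ?_⟩) (Or.inr ⟨?_, ?_⟩) (Or.inr ⟨?_, ?_⟩) <;>
    first | linarith | norm_num [ovalQ_eq]

theorem outer_24_34 :
    LoopIsotopic Sigma05 (outerCurve (3 / 10) (21 * π / 20) (4 * π / 5)) (around₃ (-1)) := by
  obtain ⟨p1, p2, l1, l2⟩ := pi_log_bounds
  refine crossData_24_34.outer_isotopic (by norm_num [Complex.ext_iff]) ?_ ?_ ?_
    (Or.inr ⟨?_, ?_⟩) (Or.inl ⟨?_, ?_⟩) (Or.inl ⟨?_, ?_⟩) <;>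
    first | linarith | norm_num [ovalQ_eq]

theorem join_24_34 :
    SameClass (joinCurve (3 / 10) (21 * π / 20) (4 * π / 5)) (around₂ (-1)) := by
  obtain ⟨p1, p2, l1, l2⟩ := pi_log_bounds
  have h : SameClass (joinCurve (3 / 10) (21 * π / 20) (4 * π / 5)) fun t =>
      expMap (oval ((3 / 10 : ℝ) + (π / 4 + π : ℝ) * Complex.I) 1 (12 / 5) (31 / 10) t) := by
    refine crossData_24_34.join_isotopic (σ := π / 4) (ψ₁ := π / 4) (ψ₂ := 2 * π)
      (ψ₃ := 7 * π / 4) ?_ ⟨0, by push_cast; ring⟩ ⟨0, by push_cast; ring⟩ ⟨0, by push_cast; ring⟩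
      ⟨?_, ?_⟩ ⟨?_, ?_⟩ ⟨?_, ?_⟩ ?_ ?_ ?_ (.below ?_) (.inside ?_ ?_ ?_ ?_ ?_)
      (.inside ?_ ?_ ?_ ?_ ?_) <;> linarith
  have e' := log_oval_same_23 1
  rw [show (-(3 * π / 4) + 2 * π * (1 : ℤ) : ℝ) = π / 4 + π by push_cast; ring] at e'
  exact h.trans e'

theorem left_24_34 :
    SameClass (leftCurve (3 / 10) (21 * π / 20) (4 * π / 5)) (around₁ Complex.I) := by
  obtain ⟨p1, p2, l1, l2⟩ := pi_log_bounds
  have h : SameClass (leftCurve (3 / 10) (21 * π / 20) (4 * π / 5)) fun t =>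
      expMap (oval ((3 / 10 : ℝ) + (21 * π / 20 : ℝ) * Complex.I) 1 1 (49 / 20) t) := by
    refine crossData_24_34.left_isotopic (σ := π / 4) (ψ₁ := π / 4) (ψ₂ := 2 * π)
      (ψ₃ := 7 * π / 4) ?_ ⟨0, by push_cast; ring⟩ ⟨0, by push_cast; ring⟩ ⟨0, by push_cast; ring⟩
      ⟨?_, ?_⟩ ⟨?_, ?_⟩ ⟨?_, ?_⟩ ?_ ?_ ?_ (.below ?_) (.above ?_)
      (.inside ?_ ?_ ?_ ?_ ?_) <;> linarith
  refine h.trans (log_oval_same_one (σ := π / 4) (ψ₁ := π / 4) (ψ₂ := 2 * π) (ψ₃ := 7 * π / 4)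
    (u := Real.log 2 / 2) (ψ := 7 * π / 4) ?_ (by simp)
    ⟨0, by push_cast; ring⟩ ⟨1, by push_cast; ring⟩ ⟨1, by push_cast; ring⟩
    ⟨?_, ?_⟩ ⟨?_, ?_⟩ ⟨?_, ?_⟩ ?_ ?_ ⟨?_, ?_⟩ ⟨?_, ?_⟩
    (abs_div_add_abs_div_lt ?_ ?_ ?_ ?_) (.below ?_ ?_) (.above ?_ ?_) .self)
  any_goals linarith
  have e := expMap_third 1
  rwa [show (-(π / 4) + 2 * π * (1 : ℤ) : ℝ) = 7 * π / 4 by push_cast; ring] at e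

theorem right_24_34 :
    SameClass (rightCurve (3 / 10) (21 * π / 20) (4 * π / 5)) (around₁ (-1)) := by
  obtain ⟨p1, p2, l1, l2⟩ := pi_log_bounds
  have h : SameClass (rightCurve (3 / 10) (21 * π / 20) (4 * π / 5)) fun t =>
      expMap (oval ((3 / 10 : ℝ) + (21 * π / 20 + π : ℝ) * Complex.I) 1 (4 / 5) (3 / 5) t) := by
    refine crossData_24_34.right_isotopic (σ := 37 * π / 20) (ψ₁ := 9 * π / 4) (ψ₂ := 2 * π)
      (ψ₃ := 15 * π / 4) ?_ ⟨1, by push_cast; ring⟩ ⟨0, by push_cast; ring⟩ ⟨1, by push_cast; ring⟩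
      ⟨?_, ?_⟩ ⟨?_, ?_⟩ ⟨?_, ?_⟩ ?_ ?_ ?_ (.above ?_) (.inside ?_ ?_ ?_ ?_ ?_)
      (.above ?_) <;> linarith
  refine h.trans (log_oval_same_one (σ := 37 * π / 20) (ψ₁ := 9 * π / 4) (ψ₂ := 2 * π) (ψ₃ := 15 * π / 4)
    (u := Real.log 2) (ψ := 2 * π) ?_ (by simp)
    ⟨1, by push_cast; ring⟩ ⟨1, by push_cast; ring⟩ ⟨2, by push_cast; ring⟩
    ⟨?_, ?_⟩ ⟨?_, ?_⟩ ⟨?_, ?_⟩ ?_ ?_ ⟨?_, ?_⟩ ⟨?_, ?_⟩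
    (abs_div_add_abs_div_lt ?_ ?_ ?_ ?_) (.above ?_ ?_) .self (.above ?_ ?_))
  any_goals linarith
  have e := expMap_second 1
  rwa [show (2 * π * (1 : ℤ) : ℝ) = 2 * π by push_cast; ring] at e

theorem mul_24_34 {R : Type*} [CommRing R] (s : Rˣ) (k : ZMod 4) :
    rotClass s k (aroundOpp (-1)) * rotClass s k (around₂ Complex.I) =
      ((s ^ 2 : Rˣ) : R) • rotClass s k (around₂ (-1)) +
      (((s ^ 2)⁻¹ : Rˣ) : R) • rotClass s k (flipCurve (3 / 10) (21 * π / 20) (4 * π / 5)) +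
      (rotClass s k (around₁ Complex.I) * rotClass s k (around₁ (-1)) +
        rotClass s k (around₁ 1) * rotClass s k (around₃ (-1))) ∧
    rotClass s k (around₂ Complex.I) * rotClass s k (aroundOpp (-1)) =
      (((s ^ 2)⁻¹ : Rˣ) : R) • rotClass s k (around₂ (-1)) +
      ((s ^ 2 : Rˣ) : R) • rotClass s k (flipCurve (3 / 10) (21 * π / 20) (4 * π / 5)) +
      (rotClass s k (around₁ Complex.I) * rotClass s k (around₁ (-1)) +
        rotClass s k (around₁ 1) * rotClass s k (around₃ (-1))) := by
  obtain ⟨X, Y, Z, rfl, rfl, rfl, h⟩ := crossData_24_34.mul s k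
  rwa [first_24_34.rotClass_eq, second_24_34.rotClass_eq, inner_24_34.rotClass_eq,
    outer_24_34.rotClass_eq, join_24_34.rotClass_eq, left_24_34.rotClass_eq,
    right_24_34.rotClass_eq] at h

end Skein

namespace Skein

theorem flip_134_24 : SameClass (flipCurve (Real.log 2) 0 (π / 16))
    (flipCurve (Real.log 2) (-(15 * π / 32)) (17 * π / 32)) := by
  obtain ⟨p1, p2, l1, l2⟩ := pi_log_bounds
  have D := crossData_134_24
  have D' := crossData_14_234
  refine D.fold_same D' (W := 2 * π) (B := 20) (R := 31 / 10) (σ := π / 16) (ψ₁ := π / 4)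
    (ψ₂ := 2 * π) (ψ₃ := 7 * π / 4) (by linarith) (by ring) le_rfl (by ring) (by ring)
    (isFold_joinFold D.le_H D.H_le).flip (isFold_joinFold D'.le_H D'.H_le).flip
    (fun x h h' => joinFold_flip_near D.le_H D.H_le h h')
    (fun x h h' => joinFold_flip_near D'.le_H D'.H_le h h')
    ⟨0, by push_cast; ring⟩ ⟨1, by push_cast; ring⟩ ⟨1, by push_cast; ring⟩
    ⟨0, by push_cast; ring⟩ ⟨1, by push_cast; ring⟩ ⟨1, by push_cast; ring⟩
    ⟨?_, ?_⟩ ⟨?_, ?_⟩ ⟨?_, ?_⟩ ?_ ?_ (.inside ?_ ?_ ?_ ?_ ?_) (.inside ?_ ?_ ?_ ?_ ?_)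
    (.inside ?_ ?_ ?_ ?_ ?_) (.inside ?_ ?_ ?_ ?_ ?_) (.inside ?_ ?_ ?_ ?_ ?_)
    (.inside ?_ ?_ ?_ ?_ ?_) <;> linarith

theorem join_134_24 : SameClass (joinCurve (Real.log 2) 0 (π / 16))
    (flipCurve (Real.log 2) (-(17 * π / 32)) (15 * π / 32)) := by
  obtain ⟨p1, p2, l1, l2⟩ := pi_log_bounds
  have D := crossData_134_24
  have D' := crossData_124_34
  refine D.fold_same D' (W := 2 * π) (B := 20) (R := 31 / 10) (σ := -(π / 16)) (ψ₁ := π / 4)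
    (ψ₂ := 0) (ψ₃ := 7 * π / 4) (by linarith) (by ring) le_rfl (by ring) (by ring)
    (isFold_joinFold D.le_H D.H_le) (isFold_joinFold D'.le_H D'.H_le).flip
    (fun x h h' => joinFold_near D.le_H D.H_le h h')
    (fun x h h' => joinFold_flip_near D'.le_H D'.H_le h h')
    ⟨0, by push_cast; ring⟩ ⟨0, by push_cast; ring⟩ ⟨1, by push_cast; ring⟩
    ⟨0, by push_cast; ring⟩ ⟨0, by push_cast; ring⟩ ⟨1, by push_cast; ring⟩
    ⟨?_, ?_⟩ ⟨?_, ?_⟩ ⟨?_, ?_⟩ ?_ ?_ (.inside ?_ ?_ ?_ ?_ ?_) (.inside ?_ ?_ ?_ ?_ ?_)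
    (.inside ?_ ?_ ?_ ?_ ?_) (.inside ?_ ?_ ?_ ?_ ?_) (.inside ?_ ?_ ?_ ?_ ?_)
    (.inside ?_ ?_ ?_ ?_ ?_) <;> linarith

theorem first_134_24 :
    LoopIsotopic Sigma05 (firstCurve (Real.log 2) 0 (π / 16)) (around₃ Complex.I) := by
  obtain ⟨p1, p2, l1, l2⟩ := pi_log_bounds
  refine crossData_134_24.first_isotopic (by norm_num) ?_ ?_ ?_
    (Or.inl ⟨?_, ?_⟩) (Or.inr ⟨?_, ?_⟩) (Or.inl ⟨?_, ?_⟩) <;>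
    first | linarith | norm_num [ovalQ_eq]

theorem second_134_24 :
    LoopIsotopic Sigma05 (secondCurve (Real.log 2) 0 (π / 16)) (aroundOpp (-1)) := by
  obtain ⟨p1, p2, l1, l2⟩ := pi_log_bounds
  refine crossData_134_24.second_isotopic (by norm_num) ?_ ?_ ?_
    (Or.inr ⟨?_, ?_⟩) (Or.inl ⟨?_, ?_⟩) (Or.inr ⟨?_, ?_⟩) <;>
    first | linarith | norm_num [ovalQ_eq]

section Rot

variable {R : Type*} [CommRing R] (s : Rˣ) (k : ZMod 4)

theorem mul_134_24 : ∃ V : SkeinAlgebra Sigma05 s,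
    rotClass s k (around₃ Complex.I) * rotClass s k (aroundOpp (-1)) =
      ((s ^ 2 : Rˣ) : R) • rotClass s k (flipCurve (Real.log 2) (-(17 * π / 32)) (15 * π / 32)) +
      (((s ^ 2)⁻¹ : Rˣ) : R) •
        rotClass s k (flipCurve (Real.log 2) (-(15 * π / 32)) (17 * π / 32)) + V ∧
    rotClass s k (aroundOpp (-1)) * rotClass s k (around₃ Complex.I) =
      (((s ^ 2)⁻¹ : Rˣ) : R) •
        rotClass s k (flipCurve (Real.log 2) (-(17 * π / 32)) (15 * π / 32)) +
      ((s ^ 2 : Rˣ) : R) •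
        rotClass s k (flipCurve (Real.log 2) (-(15 * π / 32)) (17 * π / 32)) + V := by
  obtain ⟨X, Y, Z, rfl, rfl, -, h⟩ := crossData_134_24.mul s k
  rw [first_134_24.rotClass_eq, second_134_24.rotClass_eq, join_134_24.rotClass_eq,
    flip_134_24.rotClass_eq] at h
  exact ⟨Z, h⟩

end Rot

/-! ### A curve that is disjoint from the curve around two opposite punctures -/

theorem eighth_le_rnd (y : ℝ) : 1 / 8 ≤ rnd y := by
  rcases le_or_gt (1 / 8) |y| with h | h
  · exact h.trans (abs_le_rnd y)
  · have : bump y = 1 :=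
      bump.one_of_mem_closedBall (by simpa [bump, Real.dist_eq] using h.le)
    rw [rnd, this]
    apply Real.le_sqrt_of_sq_le
    nlinarith [sq_nonneg y]

theorem flip_bounds {P H : ℝ} (hH : 4 ≤ H) (hP : H + 4 ≤ P) (t : ℝ) :
    1 / 8 ≤ wave (2 * P) t ∧ wave (2 * P) t ≤ 2 * P - 1 / 8 ∧
      -rnd (prof P H (H + wave (2 * P) t)) ≤ joinFold P H (2 * P - t) := by
  have hw : 1 ≤ 2 * P := by linarith
  have hf := isOddExt_joinFold hH hP
  obtain ⟨t', rfl⟩ : ∃ t', t = 2 * P - t' := ⟨2 * P - t, by ring⟩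
  rw [sub_sub_cancel]
  obtain ⟨y, σ, n, hσ, ⟨h, rfl⟩ | ⟨h, rfl⟩ | ⟨h, h', rfl⟩⟩ := fold_cases hw t'
  · have h1 := eighth_le_rnd y
    have h2 := rnd_lt_half h
    have h3 := abs_le_rnd (-rnd y)
    have h4 := abs_le_rnd y
    rw [abs_neg, abs_of_pos (rnd_pos y)] at h3
    rw [show 2 * P - (y + 2 * (2 * P) * n) = 2 * P + -y + 2 * (2 * P) * (-n : ℤ) by push_cast; ring,
      wave_near_end hw (by rwa [abs_neg]), rnd_neg, hf.near_zero n h,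
      show H + (2 * P - rnd y) = H - rnd y + 2 * P * (1 : ℤ) by push_cast; ring,
      prof_add_int (by linarith), prof_near hH hP (by rw [abs_le]; constructor <;> linarith),
      show H - rnd y - H = -rnd y by ring]
    exact ⟨by linarith, by linarith, by linarith [neg_abs_le y]⟩
  · have h1 := eighth_le_rnd y
    have h2 := rnd_lt_half h
    have h3 := abs_le_rnd (rnd y)
    have h4 := abs_le_rnd y
    rw [abs_of_pos (rnd_pos y)] at h3
    rw [show 2 * P - (2 * P + y + 2 * (2 * P) * n) = -y + 2 * (2 * P) * (-n : ℤ) by push_cast; ring,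
      wave_near_zero hw (by rwa [abs_neg]), rnd_neg, hf.near_end n h,
      prof_near hH hP (by rw [abs_le]; constructor <;> linarith), add_sub_cancel_left]
    exact ⟨by linarith, by linarith, by linarith [le_abs_self y]⟩
  · have e : wave (2 * P) (2 * P - (σ * y + 2 * (2 * P) * n)) = 2 * P - y := by
      rcases hσ with rfl | rfl
      · rw [show 2 * P - (1 * y + 2 * (2 * P) * n) =
          1 * (2 * P - y) + 2 * (2 * P) * (-n : ℤ) by push_cast; ring,
          wave_mid hw (Or.inl rfl) (by linarith) (by linarith)]
      · rw [show 2 * P - (-1 * y + 2 * (2 * P) * n) =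
          -1 * (2 * P - y) + 2 * (2 * P) * (-n + 1 : ℤ) by push_cast; ring,
          wave_mid hw (Or.inr rfl) (by linarith) (by linarith)]
    rw [e, hf.mid n hσ (by linarith) (by linarith), join_mid h h',
      show H + (2 * P - y) = -(y - H) + 2 * P * (1 : ℤ) by push_cast; ring,
      prof_add_int (by linarith), prof_neg (by linarith)]
    refine ⟨by linarith, by linarith, ?_⟩
    have := rnd_pos (prof P H (y - H))
    rcases hσ with rfl | rfl <;> linarith

/-- The height of a curve that goes around the end of a folded curve. -/
noncomputable def detour (P H θ : ℝ) : ℝ :=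
  -rnd (prof P H θ) - 1 + 100 * evenExt P (fun x => bump (2 * x)) (θ - H)

section Detour

variable {P H : ℝ}

theorem bump_two_mul_neg (x : ℝ) : bump (2 * -x) = bump (2 * x) := by
  rw [mul_neg, bump.neg]

theorem bump_two_mul_eq_zero {x : ℝ} (h : 1 / 8 ≤ x) : bump (2 * x) = 0 := by
  apply bump_eq_zero
  rw [abs_of_nonneg] <;> linarith

theorem bump_two_mul_add (hP : 1 ≤ P) (x : ℝ) (h : |x| < 1 / 2) :
    bump (2 * (P + x)) = bump (2 * (P - x)) := by
  rw [abs_lt] at h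
  rw [bump_two_mul_eq_zero (by linarith), bump_two_mul_eq_zero (by linarith)]

theorem detour_periodic (hP : 1 ≤ P) : Function.Periodic (detour P H) (2 * P) := fun θ => by
  rw [detour, detour, prof_periodic hP, add_sub_right_comm, evenExt_periodic (by linarith)]

theorem contDiff_detour (hP : 1 ≤ P) : ContDiff ℝ ∞ (detour P H) := by
  have h1 : ContDiff ℝ ∞ (evenExt P fun x => bump (2 * x)) :=
    contDiff_evenExt (by linarith) (contDiff_bump.comp (contDiff_const.mul contDiff_id))
      (fun x _ => bump_two_mul_neg x) (bump_two_mul_add hP)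
  have h2 : ContDiff ℝ ∞ fun θ => rnd (prof P H θ) := contDiff_rnd.comp (contDiff_prof hP)
  exact (h2.neg.sub contDiff_const).add
    (contDiff_const.mul (h1.comp (contDiff_id.sub contDiff_const)))

theorem detour_eq (hP : 1 ≤ P) {x : ℝ} (h : 1 / 8 ≤ x) (h' : x ≤ 2 * P - 1 / 8) :
    detour P H (H + x) = -rnd (prof P H (H + x)) - 1 := by
  have key : ∀ {y : ℝ}, 1 / 8 ≤ y → y ≤ P → ∀ n : ℤ,
      evenExt P (fun x => bump (2 * x)) (y + 2 * P * n) = 0 := fun {y} h1 h2 n => by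
    rw [evenExt_apply (by linarith) (fun x _ => bump_two_mul_neg x) (bump_two_mul_add hP)
      (by linarith) (by linarith), bump_two_mul_eq_zero h1]
  have : evenExt P (fun x => bump (2 * x)) x = 0 := by
    rcases le_total x P with h1 | h1
    · have := key h h1 0
      rwa [Int.cast_zero, mul_zero, add_zero] at this
    · rw [← evenExt_neg (by linarith) (fun x _ => bump_two_mul_neg x) (bump_two_mul_add hP)]
      have := key (y := 2 * P - x) (by linarith) (by linarith) (-1)
      rwa [show 2 * P - x + 2 * P * ((-1 : ℤ) : ℝ) = -x by push_cast; ring] at this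
  rw [detour, add_sub_cancel_left, this, mul_zero, add_zero]

theorem lt_detour (hH : 4 ≤ H) (hP : H + 4 ≤ P) : 98 < detour P H H := by
  have h1 : evenExt P (fun x => bump (2 * x)) 0 = 1 := by
    have := evenExt_apply (w := P) (k := fun x => bump (2 * x)) (x := 0) (by linarith)
      (fun x _ => bump_two_mul_neg x) (bump_two_mul_add (by linarith)) (by norm_num)
      (by linarith) 0
    rwa [Int.cast_zero, mul_zero, add_zero, mul_zero, bump_zero] at this
  have h2 := prof_near hH hP (θ := H) (by simp)
  have h3 := rnd_lt_half (x := 0) (by norm_num)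
  rw [sub_self] at h2
  rw [detour, sub_self, h1, h2]
  linarith

theorem fold_ne_detour {a b : ℂ} (hH : 4 ≤ H) (hP : H + 4 ≤ P) (hb : b ≠ 0) (t t' : ℝ) :
    foldCurve P a b (2 * P) H (fun t => joinFold P H (2 * P - t)) t ≠
      graphCurve P a b (detour P H) t' := by
  intro e
  rw [foldCurve, graphCurve, pol_eq_iff (by linarith) hb] at e
  obtain ⟨e, n, rfl⟩ := e
  obtain ⟨h1, h2, h3⟩ := flip_bounds hH hP t
  have := (detour_periodic (H := H) (by linarith : 1 ≤ P)).int_mul n (H + wave (2 * P) t)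
  rw [mul_comm (n : ℝ)] at this
  rw [this, detour_eq (by linarith) h1 h2] at e
  linarith

end Detour

theorem detour_isotopic : LoopIsotopic Sigma05
    (graphCurve (100 * π) 1 (base 0 (-(π / 2))) (detour (100 * π) (100 * (π / 2))))
    (aroundOpp (-1)) := by
  have p1 := Real.pi_gt_d2
  have l1 := Real.log_two_gt_d9
  have l2 := Real.log_two_lt_d9
  have D := crossData_14_34
  have hP := one_le_hundred_pi
  have key : ∀ {x : ℝ} (n : ℤ), 1 / 8 ≤ x → x ≤ 2 * (100 * π) - 1 / 8 →
      detour (100 * π) (100 * (π / 2)) (100 * (π / 2) + x + 2 * (100 * π) * n) < 0 := by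
    intro x n h1 h2
    have := (detour_periodic (H := 100 * (π / 2)) hP).int_mul n (100 * (π / 2) + x)
    rw [mul_comm (n : ℝ)] at this
    rw [this, detour_eq hP h1 h2]
    linarith [rnd_pos (prof (100 * π) (100 * (π / 2)) (100 * (π / 2) + x))]
  refine loopIsotopic_graph_oval hundred_pi_pos (base_ne_zero _ _) (by norm_num) (by norm_num)
    (by norm_num) (by norm_num [ovalQ_eq]) (contDiff_detour hP) (detour_periodic hP)
    fun u x hX => ?_
  obtain ⟨n, ⟨h1, h2, -, h3⟩ | ⟨h1, h2, -, h3⟩ | ⟨h1, h2, -, h3⟩⟩ := D.not_mem hX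
  · rw [h3, h1, h2]
    refine Or.inr ⟨?_, by norm_num [ovalQ_eq]⟩
    have := key (x := 25 * π) n (by linarith) (by linarith)
    rw [show 100 * (π / 4 - -(π / 2)) = 100 * (π / 2) + 25 * π by ring]
    linarith
  · rw [h3, h1, h2]
    refine Or.inl ⟨?_, by norm_num [ovalQ_eq]⟩
    have := (detour_periodic (H := 100 * (π / 2)) hP).int_mul n (100 * (π / 2))
    rw [mul_comm (n : ℝ)] at this
    rw [show 100 * (0 - -(π / 2)) = 100 * (π / 2) by ring, this]
    have := lt_detour D.le_H D.H_le
    linarith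
  · rw [h3, h1, h2]
    refine Or.inr ⟨?_, by norm_num [ovalQ_eq]⟩
    have := key (x := 2 * (100 * π) - 25 * π) (n - 1) (by linarith) (by linarith)
    rw [show 100 * (-(π / 4) - -(π / 2)) + 2 * (100 * π) * (n : ℝ) = 100 * (π / 2) +
      (2 * (100 * π) - 25 * π) + 2 * (100 * π) * ((n - 1 : ℤ) : ℝ) by push_cast; ring]
    linarith

/-! ### Pairs of disjoint curves -/

theorem oval_re (c δ : ℂ) (p q t : ℝ) :
    (oval c δ p q t).re = c.re + (δ.re * (p * Real.cos t) - δ.im * (q * Real.sin t)) := by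
  simp [oval, -Complex.ofReal_cos, -Complex.ofReal_sin]

theorem oval_im (c δ : ℂ) (p q t : ℝ) :
    (oval c δ p q t).im = c.im + (δ.re * (q * Real.sin t) + δ.im * (p * Real.cos t)) := by
  simp [oval, -Complex.ofReal_cos, -Complex.ofReal_sin]

section Comm

variable {R : Type*} [CommRing R] (s : Rˣ) (k : ZMod 4)

theorem flip_mul_comm :
    rotClass s k (flipCurve 0 (-(π / 2)) (π / 2)) * rotClass s k (aroundOpp (-1)) =
      rotClass s k (aroundOpp (-1)) * rotClass s k (flipCurve 0 (-(π / 2)) (π / 2)) := by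
  rw [← detour_isotopic.rotClass_eq]
  exact rotClass_mul_comm
    (fold_ne_detour crossData_14_34.le_H crossData_14_34.H_le (base_ne_zero _ _))

/-- Curves that are separated by a line commute. -/
theorem mul_comm_of_separated {c δ c' δ' : ℂ} {p q p' q' : ℝ} (a b : ℝ)
    (h : ∀ x y, |x| ≤ 1 → |y| ≤ 1 → 0 < a * (c.re + (δ.re * (p * x) - δ.im * (q * y))) +
      b * (c.im + (δ.re * (q * y) + δ.im * (p * x))))
    (h' : ∀ x y, |x| ≤ 1 → |y| ≤ 1 → a * (c'.re + (δ'.re * (p' * x) - δ'.im * (q' * y))) +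
      b * (c'.im + (δ'.re * (q' * y) + δ'.im * (p' * x))) ≤ 0) :
    rotClass s k (oval c δ p q) * rotClass s k (oval c' δ' p' q') =
      rotClass s k (oval c' δ' p' q') * rotClass s k (oval c δ p q) := by
  refine rotClass_mul_comm fun t t' e => ?_
  have h1 := h _ _ (Real.abs_cos_le_one t) (Real.abs_sin_le_one t)
  have h2 := h' _ _ (Real.abs_cos_le_one t') (Real.abs_sin_le_one t')
  rw [← oval_re, ← oval_im] at h1 h2
  rw [e] at h1
  linarith

end Comm

end Skein

namespace Skein

section Comm

variable {R : Type*} [CommRing R] (s : Rˣ) (k : ZMod 4)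

theorem mul_comm_23_14 : rotClass s k (around₂ (-1)) * rotClass s k (around₂ 1) =
    rotClass s k (around₂ 1) * rotClass s k (around₂ (-1)) := by
  apply mul_comm_of_separated s k (-1) 1 <;> intro x y hx hy <;> rw [abs_le] at hx hy <;>
    norm_num <;> linarith

theorem mul_comm_34_12 : rotClass s k (around₂ Complex.I) * rotClass s k (around₂ (-Complex.I)) =
    rotClass s k (around₂ (-Complex.I)) * rotClass s k (around₂ Complex.I) := by
  apply mul_comm_of_separated s k 1 1 <;> intro x y hx hy <;> rw [abs_le] at hx hy <;>
    norm_num <;> linarith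

theorem mul_comm_3_4 : rotClass s k (around₁ Complex.I) * rotClass s k (around₁ 1) =
    rotClass s k (around₁ 1) * rotClass s k (around₁ Complex.I) := by
  apply mul_comm_of_separated s k (-1) 1 <;> intro x y hx hy <;> rw [abs_le] at hx hy <;>
    norm_num <;> linarith

theorem mul_comm_2_1 : rotClass s k (around₁ (-1)) * rotClass s k (around₁ (-Complex.I)) =
    rotClass s k (around₁ (-Complex.I)) * rotClass s k (around₁ (-1)) := by
  apply mul_comm_of_separated s k (-1) 1 <;> intro x y hx hy <;> rw [abs_le] at hx hy <;>
    norm_num <;> linarith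

theorem mul_comm_23_1 : rotClass s k (around₂ (-1)) * rotClass s k (around₁ (-Complex.I)) =
    rotClass s k (around₁ (-Complex.I)) * rotClass s k (around₂ (-1)) := by
  apply mul_comm_of_separated s k (-1) 1 <;> intro x y hx hy <;> rw [abs_le] at hx hy <;>
    norm_num <;> linarith

theorem mul_comm_23_4 : rotClass s k (around₂ (-1)) * rotClass s k (around₁ 1) =
    rotClass s k (around₁ 1) * rotClass s k (around₂ (-1)) := by
  apply mul_comm_of_separated s k (-1) 1 <;> intro x y hx hy <;> rw [abs_le] at hx hy <;>
    norm_num <;> linarith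

theorem mul_comm_3_24 : rotClass s k (around₁ Complex.I) * rotClass s k (aroundOpp (-1)) =
    rotClass s k (aroundOpp (-1)) * rotClass s k (around₁ Complex.I) := by
  refine rotClass_mul_comm fun t t' e => ?_
  have e' := congrArg Complex.im e
  have h1 := Real.neg_one_le_cos t
  have h2 := Real.neg_one_le_sin t'
  simp only [around₁, aroundOpp, oval_im] at e'
  norm_num at e'
  linarith

theorem mul_comm_1_24 : rotClass s k (around₁ (-Complex.I)) * rotClass s k (aroundOpp (-1)) =
    rotClass s k (aroundOpp (-1)) * rotClass s k (around₁ (-Complex.I)) := by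
  refine rotClass_mul_comm fun t t' e => ?_
  have e' := congrArg Complex.im e
  have h1 := Real.neg_one_le_cos t
  have h2 := Real.sin_le_one t'
  simp only [around₁, aroundOpp, oval_im] at e'
  norm_num at e'
  linarith

theorem mul_comm_2_24 : rotClass s k (around₁ (-1)) * rotClass s k (aroundOpp (-1)) =
    rotClass s k (aroundOpp (-1)) * rotClass s k (around₁ (-1)) := by
  refine rotClass_mul_comm fun t t' e => ?_
  have e1 := congrArg Complex.re e
  have e2 := congrArg Complex.im e
  simp only [around₁, aroundOpp, oval_re, oval_im] at e1 e2
  norm_num at e1 e2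
  have h1 : Real.cos t' = (10 + Real.cos t) / 15 := by linarith
  have h2 : Real.sin t' = Real.sin t / 5 := by linarith
  have h3 := Real.sin_sq_add_cos_sq t'
  rw [h1, h2] at h3
  nlinarith [Real.sin_sq_add_cos_sq t, Real.cos_le_one t]

theorem mul_comm_23_2 : rotClass s k (around₂ (-1)) * rotClass s k (around₁ (-1)) =
    rotClass s k (around₁ (-1)) * rotClass s k (around₂ (-1)) := by
  refine rotClass_mul_comm fun t t' e => ?_
  have e1 := congrArg Complex.re e
  have e2 := congrArg Complex.im e
  simp only [around₁, around₂, oval_re, oval_im] at e1 e2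
  norm_num at e1 e2
  have h1 : Real.cos t = -(10 + (Real.cos t' + Real.sin t')) / 12 := by linarith
  have h2 : Real.sin t = (Real.cos t' - Real.sin t') / 9 := by linarith
  have h3 := Real.sin_sq_add_cos_sq t
  rw [h1, h2] at h3
  nlinarith [Real.sin_sq_add_cos_sq t', sq_nonneg (Real.cos t' - Real.sin t'),
    sq_nonneg (Real.cos t' + Real.sin t' - 1)]

/-! ### Rotation by half a turn -/

theorem rotClass_add_two (γ : ℝ → ℂ) : rotClass s (k + 2) γ = rotClass s k fun t => -γ t := by
  simp only [rotClass, puncture_add, puncture_two, mul_neg, mul_one, neg_mul]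

theorem neg_oval (c δ : ℂ) (p q : ℝ) : (fun t => -oval c δ p q t) = oval (-c) (-δ) p q := by
  funext t
  rw [oval, oval]
  ring

theorem rotClass_around₁ (z : ℂ) : rotClass s (k + 2) (around₁ z) = rotClass s k (around₁ (-z)) := by
  rw [rotClass_add_two, around₁, neg_oval, around₁]

theorem rotClass_around₂ (z : ℂ) : rotClass s (k + 2) (around₂ z) = rotClass s k (around₂ (-z)) := by
  rw [rotClass_add_two, around₂, neg_oval, around₂, mul_neg, mul_neg]

theorem rotClass_around₃ (z : ℂ) : rotClass s (k + 2) (around₃ z) = rotClass s k (around₃ (-z)) := by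
  rw [rotClass_add_two, around₃, neg_oval, around₃, mul_neg]

theorem rotClass_aroundOpp (z : ℂ) :
    rotClass s (k + 2) (aroundOpp z) = rotClass s k (aroundOpp z) := by
  rw [rotClass_add_two]
  apply loopClass_eq_of_range
  have key : ∀ t, -aroundOpp z t = aroundOpp z (t + π) := by
    intro t
    rw [aroundOpp, oval, oval, Real.cos_add_pi, Real.sin_add_pi]
    push_cast
    ring
  simp only [key]
  exact (Equiv.addRight π).surjective.range_comp fun t => aroundOpp z t * puncture k

theorem rotClass_around₄ : rotClass s (k + 2) around₄ = rotClass s k around₄ := by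
  rw [← toSkein_loop₄, ← toSkein_loop₄]

end Comm

/-! ### Consequences of the product formulas -/

section Algebra

variable {R A : Type*} [CommRing R] [Ring A] [Algebra R A] {q q' : R}

theorem commutator_of_products {a b x y z : A} (h : a * b = q • x + q' • y + z)
    (h' : b * a = q' • x + q • y + z) :
    q • (a * b) - q' • (b * a) = (q ^ 2 - q' ^ 2) • x + (q - q') • z := by
  rw [h, h']
  module

theorem triple_commutator (hq : q * q' = 1) {a b c d x y z v w₁ w₂ t u : A}
    (hx : a * b = q • x + q' • y + v) (hx' : b * a = q' • x + q • y + v)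
    (h₁ : c * d = q • t + q' • y + w₁) (h₂ : z * u = q' • t + q • x + w₂) :
    a * b - b * a = (q - q') • (q' • (z * u) - q • (c * d) + q • w₁ - q' • w₂) +
      (q - q') • (q ^ 2 - q' ^ 2) • t := by
  rw [hx, hx', h₁, h₂]
  match_scalars <;> grind

theorem opposite_commutator (hq : q * q' = 1) {t0 t1 t2 t3 t4 t12 t23 t34 t14 t13 t24 t123 t234 t134
    t124 T : A} (h₁ : t23 * t12 = q • t13 + q' • T + (t1 * t3 + t2 * t123))
    (hT : T * t24 = t24 * T) (c₁ : t1 * t24 = t24 * t1) (c₃ : t3 * t24 = t24 * t3)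
    (c₂ : t2 * t24 = t24 * t2)
    (he : q • (t23 * t24) - q' • (t24 * t23) =
      (q ^ 2 - q' ^ 2) • t34 + (q - q') • (t4 * t3 + t2 * t234))
    (hf : q • (t24 * t12) - q' • (t12 * t24) =
      (q ^ 2 - q' ^ 2) • t14 + (q - q') • (t1 * t4 + t2 * t124))
    (h₄ : q • (t234 * t12) - q' • (t12 * t234) =
      (q ^ 2 - q' ^ 2) • t134 + (q - q') • (t2 * t0 + t1 * t34))
    (h₅ : t123 * t24 - t24 * t123 =
      (q - q') • (q' • (t12 * t234) - q • (t23 * t124) + q • (t3 * t14) - q' • (t1 * t34)) +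
        (q - q') ^ 2 • (t2 * t0 + (q + q') • t134))
    (d₁ : t23 * t14 = t14 * t23) (d₂ : t34 * t12 = t12 * t34) (d₃ : t3 * t4 = t4 * t3)
    (d₄ : t2 * t1 = t1 * t2) (d₅ : t23 * t1 = t1 * t23) (d₆ : t23 * t4 = t4 * t23)
    (d₇ : t23 * t2 = t2 * t23) :
    t24 * t13 - t13 * t24 = (q' ^ 2 - q ^ 2) • (t12 * t34 - t14 * t23) +
      (q' - q) • (t3 * t4 * t12 - t1 * t4 * t23 + t1 * t2 * t34 - t2 * t3 * t14) := by
  have e₁ : q • (t24 * t13 - t13 * t24) =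
      t24 * (t23 * t12) - t23 * t12 * t24 + t2 * (t123 * t24 - t24 * t123) := by
    rw [h₁]
    simp only [mul_add, add_mul, mul_sub, mul_smul_comm, smul_mul_assoc, hT, ← mul_assoc, ← c₁,
      ← c₂]
    simp only [mul_assoc, c₃]
    simp only [← mul_assoc, c₁]
    module
  have e₂ : q' • (t24 * (t23 * t12) - t23 * t12 * t24) =
      t23 * (q • (t24 * t12) - q' • (t12 * t24)) -
        (q • (t23 * t24) - q' • (t24 * t23)) * t12 := by
    simp only [sub_mul, mul_sub, mul_smul_comm, smul_mul_assoc, mul_assoc]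
    module
  have e₃ := congrArg (fun x => t2 * x) h₄
  have e₄ : t24 * t13 - t13 * t24 = q' • q • (t24 * t13 - t13 * t24) := by
    rw [smul_smul, mul_comm, hq, one_smul]
  have d₈ : t23 * (t1 * t4) = t1 * (t4 * t23) := by
    rw [← mul_assoc, d₅, mul_assoc, d₆]
  have d₉ : t23 * (t2 * t124) = t2 * (t23 * t124) := by
    rw [← mul_assoc, d₇, mul_assoc]
  have d₁₀ : t2 * (t1 * t34) = t1 * (t2 * t34) := by
    rw [← mul_assoc, d₄, mul_assoc]
  have d₁₁ : t3 * (t4 * t12) = t4 * (t3 * t12) := by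
    rw [← mul_assoc, d₃, mul_assoc]
  rw [e₄, e₁, smul_add, e₂, hf, he, h₅]
  simp only [mul_add, add_mul, mul_sub, mul_smul_comm, smul_mul_assoc, mul_assoc, d₁, d₂, d₈, d₉,
    d₁₀, d₁₁] at e₃ ⊢
  linear_combination (norm := skip) (-(q' * (q - q'))) • e₃
  match_scalars <;> grind

end Algebra

end Skein

namespace Skein

theorem triple_relation {R : Type*} [CommRing R] (s : Rˣ) (k : ZMod 4) :
    rotClass s k (around₃ Complex.I) * rotClass s k (aroundOpp (-1)) -
      rotClass s k (aroundOpp (-1)) * rotClass s k (around₃ Complex.I) =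
    (((s ^ 2 : Rˣ) : R) - (((s ^ 2)⁻¹ : Rˣ) : R)) •
      ((((s ^ 2)⁻¹ : Rˣ) : R) • (rotClass s k (around₂ Complex.I) * rotClass s k (around₃ 1)) -
        ((s ^ 2 : Rˣ) : R) • (rotClass s k (around₂ 1) * rotClass s k (around₃ (-1))) +
        ((s ^ 2 : Rˣ) : R) • (rotClass s k (around₁ (-Complex.I)) * rotClass s k (around₂ (-1))) -
        (((s ^ 2)⁻¹ : Rˣ) : R) •
          (rotClass s k (around₁ Complex.I) * rotClass s k (around₂ (-Complex.I)))) +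
      (((s ^ 2 : Rˣ) : R) - (((s ^ 2)⁻¹ : Rˣ) : R)) ^ 2 •
        (rotClass s k (around₁ 1) * rotClass s k around₄ +
          (((s ^ 2 : Rˣ) : R) + (((s ^ 2)⁻¹ : Rˣ) : R)) • rotClass s k (around₃ (-Complex.I))) := by
  obtain ⟨V, h, h'⟩ := mul_134_24 s k
  rw [triple_commutator (Units.mul_inv (s ^ 2)) h h' (mul_14_234 s k).1 (mul_124_34 s k).2,
    mul_comm_23_1]
  module

end Skein

open Skein in
theorem mainTheorem3 {R : Type*} [CommRing R] (s : Rˣ) (k : ZMod 4) :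
    let q : R := ((s ^ 2 : Rˣ) : R)
    let q' : R := (((s ^ 2)⁻¹ : Rˣ) : R)
    let α : R := q + q'
    let t1 : SkeinAlgebra Sigma05 s := (loop₁ (1 + k)).toSkein s
    let t2 : SkeinAlgebra Sigma05 s := (loop₁ (2 + k)).toSkein s
    let t3 : SkeinAlgebra Sigma05 s := (loop₁ (3 + k)).toSkein s
    let t4 : SkeinAlgebra Sigma05 s := (loop₁ (4 + k)).toSkein s
    let t12 : SkeinAlgebra Sigma05 s := (loop₂ (1 + k)).toSkein s
    let t23 : SkeinAlgebra Sigma05 s := (loop₂ (2 + k)).toSkein s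
    let t34 : SkeinAlgebra Sigma05 s := (loop₂ (3 + k)).toSkein s
    let t14 : SkeinAlgebra Sigma05 s := (loop₂ (4 + k)).toSkein s
    let t13 : SkeinAlgebra Sigma05 s := (loopOpp (1 + k)).toSkein s
    let t24 : SkeinAlgebra Sigma05 s := (loopOpp (2 + k)).toSkein s
    let t123 : SkeinAlgebra Sigma05 s := (loop₃ (1 + k)).toSkein s
    let t234 : SkeinAlgebra Sigma05 s := (loop₃ (2 + k)).toSkein s
    let t134 : SkeinAlgebra Sigma05 s := (loop₃ (3 + k)).toSkein s
    let t124 : SkeinAlgebra Sigma05 s := (loop₃ (4 + k)).toSkein s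
    let t0 : SkeinAlgebra Sigma05 s := loop₄.toSkein s
    (q • (t23 * t12) - q' • (t12 * t23) =
      (q ^ 2 - q' ^ 2) • t13 + (q - q') • (t1 * t3 + t2 * t123)) ∧
    (t24 * t13 - t13 * t24 =
      (q' ^ 2 - q ^ 2) • (t12 * t34 - t14 * t23) +
        (q' - q) • (t3 * t4 * t12 - t1 * t4 * t23 + t1 * t2 * t34 - t2 * t3 * t14)) ∧
    (q' • (t234 * t14) - q • (t14 * t234) =
      (q' ^ 2 - q ^ 2) • t123 + (q' - q) • (t4 * t0 + t1 * t23)) ∧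
    (q • (t124 * t34) - q' • (t34 * t124) =
      (q ^ 2 - q' ^ 2) • t123 + (q - q') • (t4 * t0 + t3 * t12)) ∧
    (t134 * t24 - t24 * t134 =
      (q - q') • (q' • (t34 * t124) - q • (t14 * t234) + q • (t1 * t23) - q' • (t3 * t12)) +
        (q - q') ^ 2 • (t4 * t0 + α • t123)) := by
  simp only [show (4 : ZMod 4) = 0 from rfl, toSkein_loop₁, toSkein_loop₂, toSkein_loopOpp,
    toSkein_loop₃, toSkein_loop₄ s k, puncture_zero, puncture_one, puncture_two, puncture_three]
  have hq : ((s ^ 2 : Rˣ) : R) * (((s ^ 2)⁻¹ : Rˣ) : R) = 1 := Units.mul_inv _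
  obtain ⟨b, b'⟩ := mul_14_234 s k
  obtain ⟨c, c'⟩ := mul_124_34 s k
  have hc := commutator_of_products c c'
  have hd : ∀ k : ZMod 4, _ := fun k => triple_relation s k
  obtain ⟨a, a'⟩ := mul_14_34 s (k + 2)
  have he := commutator_of_products (mul_14_24 s (k + 2)).1 (mul_14_24 s (k + 2)).2
  have hf := commutator_of_products (mul_24_34 s (k + 2)).1 (mul_24_34 s (k + 2)).2
  have hc₂ := commutator_of_products (mul_124_34 s (k + 2)).1 (mul_124_34 s (k + 2)).2
  have hd₂ := hd (k + 2)
  have hT := flip_mul_comm s (k + 2)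
  simp only [rotClass_around₁, rotClass_around₂, rotClass_around₃, rotClass_aroundOpp,
    rotClass_around₄, neg_neg] at a a' he hf hc₂ hd₂ hT
  refine ⟨commutator_of_products a a', ?_, ?_, ?_, hd k⟩
  · exact opposite_commutator hq a hT (mul_comm_1_24 s k) (mul_comm_3_24 s k) (mul_comm_2_24 s k)
      he hf (hc₂.trans (by rw [add_comm (_ * _)])) hd₂ (mul_comm_23_14 s k) (mul_comm_34_12 s k)
      (mul_comm_3_4 s k) (mul_comm_2_1 s k) (mul_comm_23_1 s k) (mul_comm_23_4 s k)
      (mul_comm_23_2 s k)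
  · have hb := commutator_of_products b b'
    rw [mul_comm_23_1] at hb
    linear_combination (norm := module) -hb
  · rw [hc, add_comm (_ * _)]
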